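/- All manifolds, maps and forms are smooth. An exterior differential system (EDS) $(M,\mathcal I)$ is a manifold $M$ with a homogeneous ideal $\mathcal I\subset\Omega^*(M)$ closed under $d$. $\langle\cdots\rangle_{\rm alg}$ denotes the algebraic ideal generated by the enclosed forms, $[\![\cdots]\!]$ the span of $1$-forms, and $I^1$ the bundle spanned by the $1$-forms in $\mathcal I$. **Bäcklund transformations.** A rank-$r$ integrable extension $\pi:(N,\mathcal B)\to(M,\mathcal I)$ is a submersion with $r$-dimensional fibres such that every point of $N$ has an open neighbourhood $U$ with a rank-$r$ subbundle $\Theta\subset T^*U$ satisfying $\mathcal B|_U=\langle\pi^*\mathcal I,\Gamma(U,\Theta)\rangle_{\rm alg}$ and $\Theta^\perp\cap\ker\pi_*=0$. A rank-$r$ Bäcklund transformation $(N,\mathcal B;\pi,\bar\pi)$ relating $(M,\mathcal I)$ and $(\bar M,\bar{\mathcal I})$ consists of two rank-$r$ integrable extensions $\pi:(N,\mathcal B)\to(M,\mathcal I)$ and $\bar\pi:(N,\mathcal B)\to(\bar M,\bar{\mathcal I})$. A hyperbolic Monge–Ampère system is an EDS on a $5$-manifold locally equal to $\langle\theta,d\theta,\Phi\rangle_{\rm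 alg}$ with $\theta$ a contact form and $\Phi$ a $2$-form such that, at each point, $(\lambda\,d\theta+\mu\Phi)^2\equiv0 \bmod\theta$ holds for exactly two points $[\lambda:\mu]\in\mathbb{RP}^1$. **Type $\mathscr A$.** A rank-$2$ Bäcklund transformation $(N,\mathcal B;\pi,\bar\pi)$ relating hyperbolic Monge–Ampère systems (so $\dim N=7$) is of Type $\mathscr A$ if $\pi^*I^1\cap\bar\pi^*\bar I^1=0$ and if, for (local) nonvanishing $1$-forms $\theta\in\mathcal I$, $\bar\theta\in\bar{\mathcal I}$, one has $\lambda\,d(\pi^*\theta)+\mu\,d(\bar\pi^*\bar\theta)\equiv0$ modulo $B^1$ at a point only when $\lambda=\mu=0$. Let $(\chi_{10},\chi_{01})$ be an ordering of the characteristic systems of $(N,\mathcal B)$: near each point there is a coframing $(\beta^1,\beta^2,\beta^3,\alpha^1,\dots,\alpha^4)$ with $\mathcal B=\langle\beta^1,\beta^2,\beta^3,\alpha^1\wedge\alpha^2,\alpha^3\wedge\alpha^4\rangle_{\rm alg}$, $\chi_{10}=[\![\beta^1,\beta^2,\beta^3,\alpha^1,\alpha^2]\!]$, $\chi_{01}=[\![\beta^1,\beta^2,\beta^3,\alpha^3,\alpha^4]\!]$.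 A coframing $(\omega^0,\bar\omega^0,\gamma,\omega^1,\dots,\omega^4)$ on an open $W\subset N$ is $0$-adapted if $$[\![\omega^0]\!]=\pi^*I^1,\quad[\![\bar\omega^0]\!]=\bar\pi^*\bar I^1,\quad[\![\omega^0,\bar\omega^0,\gamma]\!]=B^1,$$ $$\chi_{10}=[\![\omega^0,\bar\omega^0,\gamma,\omega^1,\omega^2]\!],\quad \chi_{01}=[\![\omega^0,\bar\omega^0,\gamma,\omega^3,\omega^4]\!],$$ and, for some constant $\epsilon=\pm1$ and smooth functions $A,B_i,C_0,C_i,D_i$ on $W$ ($i=1,\dots,4$) with $A>0$, $A^2\neq\epsilon$, $$d\omega^0\equiv A\,\omega^1\wedge\omega^2+\omega^3\wedge\omega^4+(B_3\omega^3+B_4\omega^4)\wedge\gamma \mod\omega^0,$$ $$d\bar\omega^0\equiv \omega^1\wedge\omega^2+\epsilon A\,\omega^3\wedge\omega^4+(B_1\omega^1+B_2\omega^2)\wedge\gamma \mod\bar\omega^0,$$ $$d\gamma\equiv C_0\,\omega^0\wedge\bar\omega^0+\sum_i C_i\,\omega^i\wedge\omega^0+\sum_i D_i\,\omega^i\wedge\bar\omega^0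 \mod\gamma.$$ **One-parameter families.** A smooth $1$-parameter family of rank-$1$ Bäcklund transformations relating $(M,\mathcal I)$ and $(\bar M,\bar{\mathcal I})$ consists of a $6$-manifold $P$, EDSs $\mathcal B_\lambda$ ($\lambda\in\mathbb R$) on $P$ and submersions $\pi:P\times\mathbb R\to M$, $\bar\pi:P\times\mathbb R\to\bar M$ such that, with $\pi_\lambda=\pi(\cdot,\lambda)$ and $\bar\pi_\lambda=\bar\pi(\cdot,\lambda)$, each $(P,\mathcal B_\lambda;\pi_\lambda,\bar\pi_\lambda)$ is a rank-$1$ Bäcklund transformation, and near each point of $P$ there are nonvanishing $1$-forms $\theta_\lambda,\bar\theta_\lambda$, smooth in $\lambda$, with $\mathcal B_\lambda=\langle\pi_\lambda^*\mathcal I,\theta_\lambda\rangle_{\rm alg}=\langle\bar\pi_\lambda^*\bar{\mathcal I},\bar\theta_\lambda\rangle_{\rm alg}$. It yields $(P\times\mathbb R,\hat{\mathcal B};\pi,\bar\pi)$, where $\hat{\mathcal B}$ at $(p,\mu)$ is generated algebraically by $\rho^*\mathcal B_\mu$ and $d\lambda$, $\rho:P\times\mathbb R\to P$ being the projection. A rank-$2$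 Bäcklund transformation arises from such a family on an open set $U\subset N$ if a diffeomorphism $P\times\mathbb R\cong U$ identifies $(U,\mathcal B|_U;\pi|_U,\bar\pi|_U)$ with some $(P\times\mathbb R,\hat{\mathcal B};\pi,\bar\pi)$ of this form. **Lemma 4.4.** Let $(N,\mathcal B;\pi,\bar\pi)$ be a Type $\mathscr A$ rank-$2$ Bäcklund transformation relating two hyperbolic Monge–Ampère systems, with an ordered pair $(\chi_{10},\chi_{01})$ of characteristic systems, and let $p\in N$. Then the transformation arises from a $1$-parameter family of rank-$1$ Bäcklund transformations on some open neighbourhood of $p$ if and only if, for every $0$-adapted coframing $(\omega^0,\bar\omega^0,\gamma,\omega^1,\dots,\omega^4)$ on an open neighbourhood of $p$, the form $\gamma$ is integrable near $p$, i.e. $\gamma=f\,d\lambda$ near $p$ for smooth functions $f,\lambda$ with $f$ nonvanishing. -/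

import Mathlib

open scoped Manifold ContDiff

noncomputable section

namespace BacklundEDS

/-! ### Multilinear algebra: wedge product and ideals of alternating forms -/

section Algebra

variable {V : Type*} [AddCommGroup V] [Module ℝ V] [TopologicalSpace V]

/-- The multilinear form `(v₀, …, v_{k+l-1}) ↦ α (v₀, …, v_{k-1}) * β (v_k, …, v_{k+l-1})`. -/
def tensorForm {k l : ℕ} (α : V [⋀^Fin k]→L[ℝ] ℝ) (β : V [⋀^Fin l]→L[ℝ] ℝ) :
    ContinuousMultilinearMap ℝ (fun _ : Fin (k + l) => V) ℝ where
  toFun v := α (fun i => v (Fin.castAdd l i)) * β (fun j => v (Fin.natAdd k j))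
  map_update_add' := by
    intro inst v m x y
    obtain rfl : inst = instDecidableEqFin (k + l) := Subsingleton.elim _ _
    refine Fin.addCases (fun a => ?_) (fun b => ?_) m
    · have h1 : ∀ z : V, (fun i => Function.update v (Fin.castAdd l a) z (Fin.castAdd l i)) =
          Function.update (fun i => v (Fin.castAdd l i)) a z := by
        intro z; ext1 i
        by_cases h : i = a
        · subst h; simp
        · simp [h]
      have h2 : ∀ z : V, (fun j => Function.update v (Fin.castAdd l a) z (Fin.natAdd k j)) =
          fun j => v (Fin.natAdd k j) := by
        intro z; ext1 j
        refine Function.update_of_ne ?_ _ _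
        intro h
        have := congrArg Fin.val h
        simp at this
        omega
      simp only [h1, h2, ContinuousAlternatingMap.map_update_add, add_mul]
    · have h1 : ∀ z : V, (fun i => Function.update v (Fin.natAdd k b) z (Fin.natAdd k i)) =
          Function.update (fun i => v (Fin.natAdd k i)) b z := by
        intro z; ext1 i
        by_cases h : i = b
        · subst h; simp
        · simp [h]
      have h2 : ∀ z : V, (fun j => Function.update v (Fin.natAdd k b) z (Fin.castAdd l j)) =
          fun j => v (Fin.castAdd l j) := by
        intro z; ext1 j
        refine Function.update_of_ne ?_ _ _
        intro h
        have := congrArg Fin.val h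
        simp at this
        omega
      simp only [h1, h2, ContinuousAlternatingMap.map_update_add, mul_add]
  map_update_smul' := by
    intro inst v m c x
    obtain rfl : inst = instDecidableEqFin (k + l) := Subsingleton.elim _ _
    refine Fin.addCases (fun a => ?_) (fun b => ?_) m
    · have h1 : ∀ z : V, (fun i => Function.update v (Fin.castAdd l a) z (Fin.castAdd l i)) =
          Function.update (fun i => v (Fin.castAdd l i)) a z := by
        intro z; ext1 i
        by_cases h : i = a
        · subst h; simp
        · simp [h]
      have h2 : ∀ z : V, (fun j => Function.update v (Fin.castAdd l a) z (Fin.natAdd k j)) =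
          fun j => v (Fin.natAdd k j) := by
        intro z; ext1 j
        refine Function.update_of_ne ?_ _ _
        intro h
        have := congrArg Fin.val h
        simp at this
        omega
      simp only [h1, h2, ContinuousAlternatingMap.map_update_smul, smul_eq_mul, mul_assoc]
    · have h1 : ∀ z : V, (fun i => Function.update v (Fin.natAdd k b) z (Fin.natAdd k i)) =
          Function.update (fun i => v (Fin.natAdd k i)) b z := by
        intro z; ext1 i
        by_cases h : i = b
        · subst h; simp
        · simp [h]
      have h2 : ∀ z : V, (fun j => Function.update v (Fin.natAdd k b) z (Fin.castAdd l j)) =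
          fun j => v (Fin.castAdd l j) := by
        intro z; ext1 j
        refine Function.update_of_ne ?_ _ _
        intro h
        have := congrArg Fin.val h
        simp at this
        omega
      simp only [h1, h2, ContinuousAlternatingMap.map_update_smul, smul_eq_mul, mul_left_comm]
  cont := by
    refine Continuous.mul ?_ ?_
    · exact α.cont.comp (continuous_pi fun i => continuous_apply _)
    · exact β.cont.comp (continuous_pi fun i => continuous_apply _)

/-- The wedge product of alternating forms, with the convention
`(α ∧ β)(v, w) = α(v) β(w) - α(w) β(v)` for covectors. -/
def wedge {k l : ℕ} (α : V [⋀^Fin k]→L[ℝ] ℝ) (β : V [⋀^Fin l]→L[ℝ] ℝ) :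
    V [⋀^Fin (k + l)]→L[ℝ] ℝ :=
  ((k.factorial * l.factorial : ℝ)⁻¹) •
    ContinuousMultilinearMap.alternatization (tensorForm α β)

/-- `PtIdeal S k α` : the `k`-form `α` on `V` lies in the (homogeneous, two-sided) ideal of the
exterior algebra of `V` generated by the set `S` of forms. Since the wedge product is graded
commutative, it suffices to multiply on one side. -/
inductive PtIdeal (S : Set (Σ k : ℕ, V [⋀^Fin k]→L[ℝ] ℝ)) :
    (k : ℕ) → (V [⋀^Fin k]→L[ℝ] ℝ) → Prop
  | gen {k : ℕ} {α : V [⋀^Fin k]→L[ℝ] ℝ} (h : (⟨k, α⟩ : Σ k : ℕ, V [⋀^Fin k]→L[ℝ] ℝ) ∈ S) :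
      PtIdeal S k α
  | zero {k : ℕ} : PtIdeal S k 0
  | add {k : ℕ} {α β : V [⋀^Fin k]→L[ℝ] ℝ} (hα : PtIdeal S k α) (hβ : PtIdeal S k β) :
      PtIdeal S k (α + β)
  | mul {k l : ℕ} {α : V [⋀^Fin k]→L[ℝ] ℝ} (hα : PtIdeal S k α) (β : V [⋀^Fin l]→L[ℝ] ℝ) :
      PtIdeal S (k + l) (wedge α β)

/-- `α ≡ β` modulo the ideal generated by a set `T` of covectors. -/
def CongMod {k : ℕ} (T : Set (V [⋀^Fin 1]→L[ℝ] ℝ)) [IsTopologicalAddGroup V]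
    (α β : V [⋀^Fin k]→L[ℝ] ℝ) : Prop :=
  PtIdeal ((fun τ => (⟨1, τ⟩ : Σ k : ℕ, V [⋀^Fin k]→L[ℝ] ℝ)) '' T) k (α - β)

end Algebra

/-! ### Differential forms on manifolds -/

section Forms

variable {E : Type*} [NormedAddCommGroup E] [NormedSpace ℝ E] {H : Type*} [TopologicalSpace H]
  (I : ModelWithCorners ℝ E H) (M : Type*) [TopologicalSpace M] [ChartedSpace H M]
  {E' : Type*} [NormedAddCommGroup E'] [NormedSpace ℝ E'] {H' : Type*} [TopologicalSpace H']
  {J : ModelWithCorners ℝ E' H'} {M' : Type*} [TopologicalSpace M'] [ChartedSpace H' M']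

/-- (Not necessarily smooth) differential `k`-forms on `M`. -/
abbrev DForm (k : ℕ) : Type _ := (x : M) → TangentSpace I x [⋀^Fin k]→L[ℝ] ℝ

/-- A differential form together with its degree. -/
abbrev GForm : Type _ := Σ k : ℕ, DForm I M k

variable {I M}

/-- The pullback `f^* φ`. -/
def pullback {k : ℕ} (f : M' → M) (φ : DForm I M k) : DForm J M' k :=
  fun x => (φ (f x)).compContinuousLinearMap (mfderiv J I f x)

/-- The wedge product of differential forms. -/
def wedgeF {k l : ℕ} (α : DForm I M k) (β : DForm I M l) : DForm I M (k + l) :=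
  fun x => wedge (α x) (β x)

/-- Local representative of `φ` in the preferred chart at `x₀`. -/
def rep {k : ℕ} (x₀ : M) (φ : DForm I M k) : E → E [⋀^Fin k]→L[ℝ] ℝ :=
  pullback (J := 𝓘(ℝ, E)) (extChartAt I x₀).symm φ

/-- `φ` is smooth at `x`: its coefficients in a chart around `x` are smooth at `x`. -/
def SmoothAt {k : ℕ} (φ : DForm I M k) (x : M) : Prop :=
  ContDiffAt ℝ ∞ (rep x φ) (extChartAt I x x)

/-- `φ` is smooth on (the open set) `U`. -/
def SmoothOn {k : ℕ} (φ : DForm I M k) (U : Set M) : Prop := ∀ x ∈ U, SmoothAt φ x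

/-- The exterior derivative, computed in a chart. -/
def extd {k : ℕ} (φ : DForm I M k) : DForm I M (k + 1) :=
  fun x => (extDeriv (rep x φ) (extChartAt I x x)).compContinuousLinearMap
    (mfderiv I 𝓘(ℝ, E) (extChartAt I x) x)

/-- The differential `df` of a real function, as a `1`-form. -/
def dfun (f : M → ℝ) : DForm I M 1 :=
  fun x => ContinuousAlternatingMap.ofSubsingleton ℝ (TangentSpace I x) ℝ (0 : Fin 1)
    (mfderiv I 𝓘(ℝ, ℝ) f x : TangentSpace I x →L[ℝ] ℝ)

/-- The pullback of a set of forms. -/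
def pullbackSet (f : M' → M) (S : Set (GForm I M)) : Set (GForm J M') :=
  {s | ∃ t ∈ S, s = ⟨t.1, pullback f t.2⟩}

/-- `AlgIdeal U S k φ` : restricted to the open set `U`, the `k`-form `φ` belongs to the algebraic
ideal of `Ω^*(U)` generated by the restrictions to `U` of the forms in `S`. -/
inductive AlgIdeal (U : Set M) (S : Set (GForm I M)) : (k : ℕ) → DForm I M k → Prop
  | gen {k : ℕ} {φ : DForm I M k} (h : (⟨k, φ⟩ : GForm I M) ∈ S) : AlgIdeal U S k φ
  | zero {k : ℕ} : AlgIdeal U S k 0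
  | add {k : ℕ} {φ η : DForm I M k} (hφ : AlgIdeal U S k φ) (hη : AlgIdeal U S k η) :
      AlgIdeal U S k (φ + η)
  | mul {k l : ℕ} {φ : DForm I M k} (hφ : AlgIdeal U S k φ) (α : DForm I M l)
      (hα : SmoothOn α U) : AlgIdeal U S (k + l) (wedgeF φ α)
  | congr {k : ℕ} {φ η : DForm I M k} (hφ : AlgIdeal U S k φ) (h : ∀ x ∈ U, φ x = η x) :
      AlgIdeal U S k η

/-- The algebraic ideals of `Ω^*(U)` generated by `S` and by `T` coincide. -/
def SameIdeal (U : Set M) (S T : Set (GForm I M)) : Prop :=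
  ∀ (k : ℕ) (φ : DForm I M k), AlgIdeal U S k φ ↔ AlgIdeal U T k φ

/-- A finite family of `1`-forms that is smooth and pointwise linearly independent on `U`. -/
def IsFrameOn {ι : Type*} (θ : ι → DForm I M 1) (U : Set M) : Prop :=
  (∀ i, SmoothOn (θ i) U) ∧ ∀ x ∈ U, LinearIndependent ℝ (fun i => θ i x)

/-- `γ` is integrable near `p`: `γ = f dλ` near `p` with `f`, `λ` smooth and `f` nonvanishing. -/
def IntegrableNear (γ : DForm I M 1) (p : M) : Prop :=
  ∃ V : Set M, IsOpen V ∧ p ∈ V ∧ ∃ f lam : M → ℝ,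
    ContMDiffOn I 𝓘(ℝ, ℝ) ∞ f V ∧ ContMDiffOn I 𝓘(ℝ, ℝ) ∞ lam V ∧
      ∀ x ∈ V, f x ≠ 0 ∧ γ x = f x • dfun lam x

variable (I M)

/-- An exterior differential system on `M`: a (homogeneous) ideal of the algebra of smooth
differential forms on `M` that is closed under exterior differentiation. -/
structure EDS where
  carrier : Set (GForm I M)
  smooth : ∀ {k : ℕ} {φ : DForm I M k}, (⟨k, φ⟩ : GForm I M) ∈ carrier → SmoothOn φ Set.univ
  zero_mem : ∀ k : ℕ, (⟨k, 0⟩ : GForm I M) ∈ carrier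
  add_mem : ∀ {k : ℕ} {φ η : DForm I M k}, (⟨k, φ⟩ : GForm I M) ∈ carrier →
    (⟨k, η⟩ : GForm I M) ∈ carrier → (⟨k, φ + η⟩ : GForm I M) ∈ carrier
  mul_mem : ∀ {k l : ℕ} {φ : DForm I M k} (α : DForm I M l), (⟨k, φ⟩ : GForm I M) ∈ carrier →
    SmoothOn α Set.univ → (⟨k + l, wedgeF φ α⟩ : GForm I M) ∈ carrier
  d_mem : ∀ {k : ℕ} {φ : DForm I M k}, (⟨k, φ⟩ : GForm I M) ∈ carrier →
    (⟨k + 1, extd φ⟩ : GForm I M) ∈ carrier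

variable {I M}

/-- The space of covectors at `x` spanned by the values of the `1`-forms in a set of forms
(the fibre at `x` of the bundle generated by the degree-one part). -/
def degOne (S : Set (GForm I M)) (x : M) : Submodule ℝ (TangentSpace I x [⋀^Fin 1]→L[ℝ] ℝ) :=
  Submodule.span ℝ {α | ∃ φ : DForm I M 1, (⟨1, φ⟩ : GForm I M) ∈ S ∧ α = φ x}

/-- `f` is a smooth submersion (of finite-dimensional manifolds). -/
def IsSubmersion (J : ModelWithCorners ℝ E' H') (I : ModelWithCorners ℝ E H)
    (f : M' → M) : Prop :=
  ContMDiff J I ∞ f ∧ ∀ x, Function.Surjective (mfderiv J I f x)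

/-- `π : (N, 𝒥) → (M, 𝓘)` is an integrable extension of rank `r`: a submersion with fibres of
dimension `r` such that near each point there is a rank-`r` subbundle of the cotangent bundle,
given by a local frame `Θ`, which is transversal to `π` and which together with `π^* 𝓘`
generates `𝒥` algebraically. -/
def IsIntegrableExtension (r : ℕ) (𝒥 : EDS J M') (𝓘₀ : EDS I M) (π : M' → M) : Prop :=
  IsSubmersion J I π ∧
  (∀ x, Module.finrank ℝ (LinearMap.ker (mfderiv J I π x).toLinearMap) = r) ∧
  ∀ p : M', ∃ U : Set M', IsOpen U ∧ p ∈ U ∧ ∃ Θ : Fin r → DForm J M' 1,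
    IsFrameOn Θ U ∧
    SameIdeal U 𝒥.carrier
      (pullbackSet π 𝓘₀.carrier ∪ Set.range (fun i => (⟨1, Θ i⟩ : GForm J M'))) ∧
    ∀ x ∈ U, ∀ v : TangentSpace J x, (∀ i, Θ i x (fun _ => v) = 0) →
      mfderiv J I π x v = 0 → v = 0

end Forms

/-! ### Bäcklund transformations of hyperbolic Monge–Ampère systems -/

section Systems

variable {M : Type*} [TopologicalSpace M] [ChartedSpace (EuclideanSpace ℝ (Fin 5)) M]
  {M' : Type*} [TopologicalSpace M'] [ChartedSpace (EuclideanSpace ℝ (Fin 5)) M']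
  {E : Type*} [NormedAddCommGroup E] [NormedSpace ℝ E] {H : Type*} [TopologicalSpace H]
  {I : ModelWithCorners ℝ E H} {N : Type*} [TopologicalSpace N] [ChartedSpace H N]

/-- Hyperbolic Monge–Ampère systems on a `5`-manifold: locally generated by a contact form `θ`,
its exterior derivative and a `2`-form `Φ` such that at each point exactly two points `[a : b]` of
the real projective line satisfy `(a dθ + b Φ)² ≡ 0 mod θ`. -/
def IsHyperbolicMongeAmpere (𝓘₀ : EDS (𝓡 5) M) : Prop :=
  ∀ p : M, ∃ U : Set M, IsOpen U ∧ p ∈ U ∧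
    ∃ (θ : DForm (𝓡 5) M 1) (Φ : DForm (𝓡 5) M 2), SmoothOn θ U ∧ SmoothOn Φ U ∧
      (∀ x ∈ U, wedge (θ x) (wedge (extd θ x) (extd θ x)) ≠ 0) ∧
      SameIdeal U 𝓘₀.carrier {⟨1, θ⟩, ⟨2, extd θ⟩, ⟨2, Φ⟩} ∧
      ∀ x ∈ U, Set.ncard {P : Projectivization ℝ (Fin 2 → ℝ) |
        CongMod {θ x}
          (wedge (P.rep 0 • extd θ x + P.rep 1 • Φ x) (P.rep 0 • extd θ x + P.rep 1 • Φ x)) 0} = 2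

/-- `(N, 𝓑; π, π')` is a rank-`r` Bäcklund transformation relating `(M, 𝓘)` and `(M', 𝓘')`. -/
def IsBacklund (r : ℕ) (𝓘₀ : EDS (𝓡 5) M) (𝓘₁ : EDS (𝓡 5) M') (𝓑 : EDS I N)
    (π : N → M) (π' : N → M') : Prop :=
  IsIntegrableExtension r 𝓑 𝓘₀ π ∧ IsIntegrableExtension r 𝓑 𝓘₁ π'

/-- First genericity condition: `π^* I¹ ∩ π'^* I'¹ = 0`. -/
def FirstGenericity (𝓘₀ : EDS (𝓡 5) M) (𝓘₁ : EDS (𝓡 5) M') (π : N → M) (π' : N → M') : Prop :=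
  ∀ p : N, degOne (pullbackSet (J := I) π 𝓘₀.carrier) p ⊓
    degOne (pullbackSet (J := I) π' 𝓘₁.carrier) p = ⊥

/-- Second genericity condition: for `1`-forms `θ`, `θ'` in the two ideals that do not vanish at
the points under consideration, `a dθ + b dθ' ≡ 0` modulo `B¹` only for `a = b = 0`. -/
def SecondGenericity (𝓘₀ : EDS (𝓡 5) M) (𝓘₁ : EDS (𝓡 5) M') (𝓑 : EDS I N)
    (π : N → M) (π' : N → M') : Prop :=
  ∀ (p : N) (θ : DForm (𝓡 5) M 1) (θ' : DForm (𝓡 5) M' 1),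
    (⟨1, θ⟩ : GForm (𝓡 5) M) ∈ 𝓘₀.carrier → (⟨1, θ'⟩ : GForm (𝓡 5) M') ∈ 𝓘₁.carrier →
    θ (π p) ≠ 0 → θ' (π' p) ≠ 0 →
    ∀ a b : ℝ, CongMod (degOne 𝓑.carrier p : Set (TangentSpace I p [⋀^Fin 1]→L[ℝ] ℝ))
      (a • extd (pullback (J := I) π θ) p + b • extd (pullback (J := I) π' θ') p) 0 →
      a = 0 ∧ b = 0

/-- Type `𝒜` rank-`2` Bäcklund transformations relating two hyperbolic Monge–Ampère systems. -/
structure IsTypeA (𝓘₀ : EDS (𝓡 5) M) (𝓘₁ : EDS (𝓡 5) M') (𝓑 : EDS I N)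
    (π : N → M) (π' : N → M') : Prop where
  left_ma : IsHyperbolicMongeAmpere 𝓘₀
  right_ma : IsHyperbolicMongeAmpere 𝓘₁
  backlund : IsBacklund 2 𝓘₀ 𝓘₁ 𝓑 π π'
  first : FirstGenericity (I := I) 𝓘₀ 𝓘₁ π π'
  second : SecondGenericity 𝓘₀ 𝓘₁ 𝓑 π π'

/-- `(χ₁₀, χ₀₁)` is an ordered pair of characteristic systems of the hyperbolic system `(N, 𝓑)`
of class `3`: locally there is a coframing `(β, α)`, `β` consisting of three and `α` of four
`1`-forms, with `𝓑 = ⟨β, α₀ ∧ α₁, α₂ ∧ α₃⟩_alg`, `χ₁₀ = [β, α₀, α₁]` and `χ₀₁ = [β, α₂, α₃]`. -/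
def IsCharacteristicPair (𝓑 : EDS I N)
    (χ₁₀ χ₀₁ : (x : N) → Submodule ℝ (TangentSpace I x [⋀^Fin 1]→L[ℝ] ℝ)) : Prop :=
  ∀ p : N, ∃ U : Set N, IsOpen U ∧ p ∈ U ∧
    ∃ (β : Fin 3 → DForm I N 1) (α : Fin 4 → DForm I N 1),
      IsFrameOn (Sum.elim β α) U ∧
      SameIdeal U 𝓑.carrier (Set.range (fun i => (⟨1, β i⟩ : GForm I N)) ∪
        {⟨2, wedgeF (α 0) (α 1)⟩, ⟨2, wedgeF (α 2) (α 3)⟩}) ∧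
      ∀ x ∈ U,
        χ₁₀ x = Submodule.span ℝ {β 0 x, β 1 x, β 2 x, α 0 x, α 1 x} ∧
        χ₀₁ x = Submodule.span ℝ {β 0 x, β 1 x, β 2 x, α 2 x, α 3 x}

/-- `(ω⁰, ω̄⁰, γ, ω¹, …, ω⁴)` is a `0`-adapted coframing on the open set `U ⊂ N`. Here `w0 = ω⁰`,
`w0' = ω̄⁰`, and `w i = ω^{i+1}`, `B i = B_{i+1}`, `C i = C_{i+1}`, `D i = D_{i+1}` for
`i = 0, …, 3`, while `C0` is the remaining coefficient `C_0`. -/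
def IsZeroAdapted (𝓘₀ : EDS (𝓡 5) M) (𝓘₁ : EDS (𝓡 5) M') (𝓑 : EDS I N)
    (π : N → M) (π' : N → M')
    (χ₁₀ χ₀₁ : (x : N) → Submodule ℝ (TangentSpace I x [⋀^Fin 1]→L[ℝ] ℝ))
    (U : Set N) (w0 w0' γ : DForm I N 1) (w : Fin 4 → DForm I N 1) : Prop :=
  IsFrameOn (Sum.elim ![w0, w0', γ] w) U ∧
  (∀ x ∈ U,
    Submodule.span ℝ {w0 x} = degOne (pullbackSet π 𝓘₀.carrier) x ∧
    Submodule.span ℝ {w0' x} = degOne (pullbackSet π' 𝓘₁.carrier) x ∧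
    Submodule.span ℝ {w0 x, w0' x, γ x} = degOne 𝓑.carrier x ∧
    χ₁₀ x = Submodule.span ℝ {w0 x, w0' x, γ x, w 0 x, w 1 x} ∧
    χ₀₁ x = Submodule.span ℝ {w0 x, w0' x, γ x, w 2 x, w 3 x}) ∧
  ∃ (ε : ℝ) (A C0 : N → ℝ) (B C D : Fin 4 → N → ℝ),
    (ε = 1 ∨ ε = -1) ∧
    ContMDiffOn I 𝓘(ℝ, ℝ) ∞ A U ∧ ContMDiffOn I 𝓘(ℝ, ℝ) ∞ C0 U ∧
    (∀ i, ContMDiffOn I 𝓘(ℝ, ℝ) ∞ (B i) U ∧ ContMDiffOn I 𝓘(ℝ, ℝ) ∞ (C i) U ∧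
      ContMDiffOn I 𝓘(ℝ, ℝ) ∞ (D i) U) ∧
    ∀ x ∈ U, 0 < A x ∧ A x ^ 2 ≠ ε ∧
      CongMod {w0 x} (extd w0 x)
        (A x • wedge (w 0 x) (w 1 x) + wedge (w 2 x) (w 3 x)
          + wedge (B 2 x • w 2 x + B 3 x • w 3 x) (γ x)) ∧
      CongMod {w0' x} (extd w0' x)
        (wedge (w 0 x) (w 1 x) + (ε * A x) • wedge (w 2 x) (w 3 x)
          + wedge (B 0 x • w 0 x + B 1 x • w 1 x) (γ x)) ∧
      CongMod {γ x} (extd γ x)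
        (C0 x • wedge (w0 x) (w0' x) + ∑ i, C i x • wedge (w i x) (w0 x)
          + ∑ i, D i x • wedge (w i x) (w0' x))

end Systems

/-! ### One-parameter families of rank-1 Bäcklund transformations -/

section Families

variable {M : Type*} [TopologicalSpace M] [ChartedSpace (EuclideanSpace ℝ (Fin 5)) M]
  {M' : Type*} [TopologicalSpace M'] [ChartedSpace (EuclideanSpace ℝ (Fin 5)) M']
  {P : Type*} [TopologicalSpace P] [ChartedSpace (EuclideanSpace ℝ (Fin 6)) P]
  {E : Type*} [NormedAddCommGroup E] [NormedSpace ℝ E] {H : Type*} [TopologicalSpace H]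
  {I : ModelWithCorners ℝ E H} {N : Type*} [TopologicalSpace N] [ChartedSpace H N]

/-- The form on `P × ℝ` whose value at `(p, μ)` is that of `ρ^* θ_μ`, with `ρ : P × ℝ → P` the
projection. -/
def familyForm {k : ℕ} (θ : ℝ → DForm (𝓡 6) P k) : DForm ((𝓡 6).prod 𝓘(ℝ, ℝ)) (P × ℝ) k :=
  fun q => pullback (J := (𝓡 6).prod 𝓘(ℝ, ℝ)) (Prod.fst : P × ℝ → P) (θ q.2) q

/-- A smooth family `(P, 𝓑_λ; π_λ, π'_λ)`, `λ ∈ ℝ`, of rank-`1` Bäcklund transformations relating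
two fixed systems, where `π_λ = π(·, λ)` and `π'_λ = π'(·, λ)`. -/
structure IsSmoothFamily (𝓘₀ : EDS (𝓡 5) M) (𝓘₁ : EDS (𝓡 5) M') (𝓑 : ℝ → EDS (𝓡 6) P)
    (π : P × ℝ → M) (π' : P × ℝ → M') : Prop where
  backlund : ∀ μ : ℝ, IsBacklund 1 𝓘₀ 𝓘₁ (𝓑 μ) (fun p => π (p, μ)) (fun p => π' (p, μ))
  submersion : IsSubmersion ((𝓡 6).prod 𝓘(ℝ, ℝ)) (𝓡 5) π
  submersion' : IsSubmersion ((𝓡 6).prod 𝓘(ℝ, ℝ)) (𝓡 5) π'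
  generators : ∀ p : P, ∃ U : Set P, IsOpen U ∧ p ∈ U ∧
    ∃ θ θ' : ℝ → DForm (𝓡 6) P 1,
      SmoothOn (familyForm θ) (U ×ˢ Set.univ) ∧ SmoothOn (familyForm θ') (U ×ˢ Set.univ) ∧
      (∀ μ, ∀ x ∈ U, θ μ x ≠ 0 ∧ θ' μ x ≠ 0) ∧
      ∀ μ, SameIdeal U (𝓑 μ).carrier
          (pullbackSet (fun p => π (p, μ)) 𝓘₀.carrier ∪ {⟨1, θ μ⟩}) ∧
        SameIdeal U (𝓑 μ).carrier
          (pullbackSet (fun p => π' (p, μ)) 𝓘₁.carrier ∪ {⟨1, θ' μ⟩})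

/-- The ideal on `P × ℝ` of the rank-`2` Bäcklund transformation constructed from a family: at
each `(p, μ)` it is the ideal generated by `ρ^* 𝓑_μ` and `dλ`. -/
def familyIdeal (𝓑 : ℝ → EDS (𝓡 6) P) : Set (GForm ((𝓡 6).prod 𝓘(ℝ, ℝ)) (P × ℝ)) :=
  {s | SmoothOn s.2 Set.univ ∧ ∀ q : P × ℝ,
    PtIdeal
      ({t | ∃ β ∈ (𝓑 q.2).carrier,
          t = ⟨β.1, pullback (J := (𝓡 6).prod 𝓘(ℝ, ℝ)) (Prod.fst : P × ℝ → P) β.2 q⟩} ∪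
        {⟨1, dfun (I := (𝓡 6).prod 𝓘(ℝ, ℝ)) (Prod.snd : P × ℝ → ℝ) q⟩})
      s.1 (s.2 q)}

/-- The restriction of `(N, 𝓑; π, π')` to the open set `U` arises from a `1`-parameter family of
rank-`1` Bäcklund transformations: some diffeomorphism `F` from `P × ℝ` onto `U` identifies it with
the rank-`2` Bäcklund transformation constructed from a smooth family on a `6`-manifold `P`. -/
def ArisesFromFamilyOn (𝓘₀ : EDS (𝓡 5) M) (𝓘₁ : EDS (𝓡 5) M') (𝓑 : EDS I N)
    (π : N → M) (π' : N → M') (U : Set N) : Prop :=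
  ∃ (P : Type) (_ : TopologicalSpace P) (_ : T2Space P) (_ : SecondCountableTopology P)
    (_ : ChartedSpace (EuclideanSpace ℝ (Fin 6)) P) (_ : IsManifold (𝓡 6) ∞ P)
    (𝓑₁ : ℝ → EDS (𝓡 6) P) (F : P × ℝ → N),
    IsSmoothFamily 𝓘₀ 𝓘₁ 𝓑₁ (π ∘ F) (π' ∘ F) ∧
    IsLocalDiffeomorph ((𝓡 6).prod 𝓘(ℝ, ℝ)) I ∞ F ∧ Function.Injective F ∧ Set.range F = U ∧
    SameIdeal Set.univ (pullbackSet F 𝓑.carrier) (familyIdeal 𝓑₁)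

end Families

end BacklundEDS

end

open scoped Manifold ContDiff

noncomputable section

namespace BacklundEDS

section Exterior

variable {V : Type*} [AddCommGroup V] [Module ℝ V] [TopologicalSpace V]
  {V' : Type*} [AddCommGroup V'] [Module ℝ V'] [TopologicalSpace V']

theorem wedge_apply {k l : ℕ} (α : V [⋀^Fin k]→L[ℝ] ℝ) (β : V [⋀^Fin l]→L[ℝ] ℝ)
    (v : Fin (k + l) → V) :
    wedge α β v = ((k.factorial * l.factorial : ℝ)⁻¹) * ∑ σ : Equiv.Perm (Fin (k + l)),
      Equiv.Perm.sign σ • (α (fun i => v (σ (Fin.castAdd l i))) *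
        β (fun j => v (σ (Fin.natAdd k j)))) := by
  rw [wedge, ContinuousAlternatingMap.smul_apply,
    ContinuousMultilinearMap.alternatization_apply_apply, smul_eq_mul]
  rfl

theorem wedge_compContinuousLinearMap {k l : ℕ} (α : V [⋀^Fin k]→L[ℝ] ℝ)
    (β : V [⋀^Fin l]→L[ℝ] ℝ) (f : V' →L[ℝ] V) :
    (wedge α β).compContinuousLinearMap f =
      wedge (α.compContinuousLinearMap f) (β.compContinuousLinearMap f) := by
  ext v
  simp only [ContinuousAlternatingMap.compContinuousLinearMap_apply, wedge_apply]
  rfl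

theorem wedge_add_left {k l : ℕ} (α α' : V [⋀^Fin k]→L[ℝ] ℝ) (β : V [⋀^Fin l]→L[ℝ] ℝ) :
    wedge (α + α') β = wedge α β + wedge α' β := by
  ext v
  simp only [ContinuousAlternatingMap.add_apply, wedge_apply, add_mul, smul_add,
    Finset.sum_add_distrib, mul_add]

theorem wedge_smul_left {k l : ℕ} (c : ℝ) (α : V [⋀^Fin k]→L[ℝ] ℝ) (β : V [⋀^Fin l]→L[ℝ] ℝ) :
    wedge (c • α) β = c • wedge α β := by
  ext v
  simp only [ContinuousAlternatingMap.smul_apply, wedge_apply, smul_eq_mul, Finset.mul_sum]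
  refine Finset.sum_congr rfl fun σ _ => ?_
  simp only [Units.smul_def, zsmul_eq_mul]
  ring

theorem wedge_zero_left {k l : ℕ} (β : V [⋀^Fin l]→L[ℝ] ℝ) :
    wedge (0 : V [⋀^Fin k]→L[ℝ] ℝ) β = 0 := by
  simpa using wedge_smul_left 0 (0 : V [⋀^Fin k]→L[ℝ] ℝ) β

theorem wedge_sum_left {k l : ℕ} {ι : Type*} (s : Finset ι) (α : ι → V [⋀^Fin k]→L[ℝ] ℝ)
    (β : V [⋀^Fin l]→L[ℝ] ℝ) : wedge (∑ i ∈ s, α i) β = ∑ i ∈ s, wedge (α i) β := by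
  classical
  induction s using Finset.induction_on with
  | empty => simp [wedge_zero_left]
  | insert a s ha ih => simp [Finset.sum_insert ha, wedge_add_left, ih]

theorem wedge_zero_form {k : ℕ} (α : V [⋀^Fin k]→L[ℝ] ℝ) (f : V [⋀^Fin 0]→L[ℝ] ℝ) :
    wedge α f = f ![] • α := by
  ext v
  rw [wedge_apply, ContinuousAlternatingMap.smul_apply]
  have h : ∀ σ : Equiv.Perm (Fin (k + 0)), Equiv.Perm.sign σ •
      (α (fun i => v (σ (Fin.castAdd 0 i))) * f (fun j => v (σ (Fin.natAdd k j)))) =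
      α v * f ![] := by
    intro σ
    have h1 : (fun i => v (σ (Fin.castAdd 0 i))) = v ∘ σ := rfl
    have h2 : (fun j => v (σ (Fin.natAdd k j))) = ![] := Subsingleton.elim _ _
    rw [h1, h2, show α (v ∘ σ) = Equiv.Perm.sign σ • α v from α.toAlternatingMap.map_perm v σ,
      smul_mul_assoc, smul_smul]
    simp
  rw [Finset.sum_congr rfl fun σ _ => h σ]
  rw [Finset.sum_const, Finset.card_univ, Fintype.card_perm, Fintype.card_fin]
  have : (k.factorial : ℝ) ≠ 0 := by positivity
  simp only [add_zero, Nat.factorial_zero, nsmul_eq_mul, smul_eq_mul, Nat.cast_one, mul_one]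
  field_simp

theorem wedge_covectors_apply (α β : V [⋀^Fin 1]→L[ℝ] ℝ) (v : Fin (1 + 1) → V) :
    wedge α β v = α (fun _ => v 0) * β (fun _ => v 1) - α (fun _ => v 1) * β (fun _ => v 0) := by
  have h1 : (fun i : Fin 1 => v (Fin.castAdd 1 i)) = fun _ => v 0 := by
    ext i; fin_cases i; rfl
  have h2 : (fun i : Fin 1 => v (Fin.natAdd 1 i)) = fun _ => v 1 := by
    ext i; fin_cases i; rfl
  have h3 : (fun i : Fin 1 => v (Equiv.swap 0 1 (Fin.castAdd 1 i))) = fun _ => v 1 := by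
    ext i; fin_cases i; rfl
  have h4 : (fun i : Fin 1 => v (Equiv.swap 0 1 (Fin.natAdd 1 i))) = fun _ => v 0 := by
    ext i; fin_cases i; rfl
  rw [wedge_apply]
  have hu : (Finset.univ : Finset (Equiv.Perm (Fin (1 + 1)))) = {1, Equiv.swap 0 1} := by decide
  rw [hu, Finset.sum_pair (by decide)]
  simp only [Equiv.Perm.coe_one, id, h1, h2, h3, h4]
  rw [Equiv.Perm.sign_swap (by decide)]
  simp [sub_eq_add_neg]

theorem wedge_covectors_swap (α β : V [⋀^Fin 1]→L[ℝ] ℝ) : wedge α β = -wedge β α := by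
  ext v
  rw [ContinuousAlternatingMap.neg_apply, wedge_covectors_apply, wedge_covectors_apply]
  ring

theorem wedge_covectors_self (α : V [⋀^Fin 1]→L[ℝ] ℝ) : wedge α α = 0 := by
  ext v
  rw [wedge_covectors_apply]
  simp [mul_comm]

theorem wedge_three_apply (α β γ : V [⋀^Fin 1]→L[ℝ] ℝ) (v : Fin (1 + 1 + 1) → V) :
    wedge (wedge α β) γ v = ∑ σ : Equiv.Perm (Fin 3), Equiv.Perm.sign σ •
      (α (fun _ => v (σ 0)) * β (fun _ => v (σ 1)) * γ (fun _ => v (σ 2))) := by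
  rw [wedge_apply]
  have h : ∀ σ : Equiv.Perm (Fin (1 + 1 + 1)), Equiv.Perm.sign σ •
      (wedge α β (fun i => v (σ (Fin.castAdd 1 i))) * γ (fun j => v (σ (Fin.natAdd (1 + 1) j)))) =
      Equiv.Perm.sign σ •
      (α (fun _ => v (σ 0)) * β (fun _ => v (σ 1)) * γ (fun _ => v (σ 2))) +
      Equiv.Perm.sign (σ * Equiv.swap 0 1 : Equiv.Perm (Fin (1 + 1 + 1))) • (α (fun _ => v ((σ * Equiv.swap 0 1 : Equiv.Perm (Fin (1 + 1 + 1))) 0)) *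
        β (fun _ => v ((σ * Equiv.swap 0 1 : Equiv.Perm (Fin (1 + 1 + 1))) 1)) * γ (fun _ => v ((σ * Equiv.swap 0 1 : Equiv.Perm (Fin (1 + 1 + 1))) 2))) := by
    intro σ
    have h2 : (fun j : Fin 1 => v (σ (Fin.natAdd (1 + 1) j))) = fun _ => v (σ 2) := by
      ext j; fin_cases j; rfl
    have e1 : (Equiv.swap 0 1 : Equiv.Perm (Fin (1 + 1 + 1))) 0 = 1 := by decide
    have e2 : (Equiv.swap 0 1 : Equiv.Perm (Fin (1 + 1 + 1))) 1 = 0 := by decide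
    have e3 : (Equiv.swap 0 1 : Equiv.Perm (Fin (1 + 1 + 1))) 2 = 2 := by decide
    rw [wedge_covectors_apply, h2, Equiv.Perm.sign_mul, Equiv.Perm.sign_swap (by decide)]
    simp only [Equiv.Perm.mul_apply, e1, e2, e3]
    have e4 : Fin.castAdd 1 (0 : Fin (1 + 1)) = (0 : Fin (1 + 1 + 1)) := rfl
    have e5 : Fin.castAdd 1 (1 : Fin (1 + 1)) = (1 : Fin (1 + 1 + 1)) := rfl
    rw [e4, e5, mul_neg, mul_one, sub_mul]
    simp only [Units.smul_def, Units.val_neg, zsmul_eq_mul, Int.cast_neg]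
    ring
  rw [Finset.sum_congr rfl fun σ _ => h σ, Finset.sum_add_distrib]
  have h' := Equiv.sum_comp (Equiv.mulRight (Equiv.swap (0 : Fin (1 + 1 + 1)) 1))
    (fun σ => Equiv.Perm.sign σ •
      (α (fun _ => v (σ 0)) * β (fun _ => v (σ 1)) * γ (fun _ => v (σ 2))))
  simp only [Equiv.coe_mulRight] at h'
  have h2 : ∀ X : ℝ, (((1 + 1).factorial * Nat.factorial 1 : ℝ))⁻¹ * (X + X) = X := by
    intro X
    norm_num [Nat.factorial]
    ring
  rw [h']
  exact h2 _

theorem wedge_three_rotate (α β γ : V [⋀^Fin 1]→L[ℝ] ℝ) :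
    wedge (wedge α β) γ = wedge (wedge β γ) α := by
  ext v
  rw [wedge_three_apply, wedge_three_apply]
  conv_rhs => rw [← Equiv.sum_comp (Equiv.mulRight (finRotate 3))]
  refine Finset.sum_congr rfl fun σ _ => ?_
  have e0 : (finRotate 3) 0 = 1 := by decide
  have e1 : (finRotate 3) 1 = 2 := by decide
  have e2 : (finRotate 3) 2 = 0 := by decide
  have e3 : Equiv.Perm.sign (finRotate 3) = 1 := by decide
  simp only [Equiv.coe_mulRight, Equiv.Perm.mul_apply, Equiv.Perm.sign_mul, e0, e1, e2, e3, mul_one]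
  congr 1
  exact (mul_rotate _ _ _).symm.symm.trans rfl

/-- A property of tuples that is inherited by subtuples and on which the generators of an ideal
vanish is one on which the whole ideal vanishes. -/
theorem wedge_eq_zero_of_left {k l : ℕ} {F : ∀ k : ℕ, Set (Fin k → V)}
    (hF : ∀ {k m : ℕ} (v : Fin k → V), v ∈ F k → ∀ f : Fin m → Fin k, Function.Injective f →
      v ∘ f ∈ F m) {α : V [⋀^Fin k]→L[ℝ] ℝ} (hα : ∀ v ∈ F k, α v = 0)
    (β : V [⋀^Fin l]→L[ℝ] ℝ) : ∀ v ∈ F (k + l), wedge α β v = 0 := by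
  intro v hv
  rw [wedge_apply, Finset.sum_eq_zero, mul_zero]
  intro σ _
  have := hα (v ∘ (σ ∘ Fin.castAdd l)) (hF v hv _ (σ.injective.comp (Fin.castAdd_injective k l)))
  rw [show (fun i => v (σ (Fin.castAdd l i))) = v ∘ (σ ∘ Fin.castAdd l) from rfl, this]
  simp

theorem PtIdeal.vanish {S : Set (Σ k : ℕ, V [⋀^Fin k]→L[ℝ] ℝ)} {F : ∀ k : ℕ, Set (Fin k → V)}
    (hF : ∀ {k m : ℕ} (v : Fin k → V), v ∈ F k → ∀ f : Fin m → Fin k, Function.Injective f →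
      v ∘ f ∈ F m)
    (hS : ∀ s ∈ S, ∀ v ∈ F s.1, s.2 v = 0) {k : ℕ} {α : V [⋀^Fin k]→L[ℝ] ℝ}
    (h : PtIdeal S k α) : ∀ v ∈ F k, α v = 0 := by
  induction h with
  | gen h => exact hS _ h
  | zero => intro v _; rfl
  | add _ _ h1 h2 =>
    intro v hv
    rw [ContinuousAlternatingMap.add_apply, h1 v hv, h2 v hv, add_zero]
  | mul _ β h => exact wedge_eq_zero_of_left hF h β

theorem PtIdeal.smul {S : Set (Σ k : ℕ, V [⋀^Fin k]→L[ℝ] ℝ)} {k : ℕ}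
    {α : V [⋀^Fin k]→L[ℝ] ℝ} (h : PtIdeal S k α) (c : ℝ) : PtIdeal S k (c • α) := by
  have := PtIdeal.mul h (ContinuousAlternatingMap.constOfIsEmpty ℝ V (Fin 0) c)
  rwa [wedge_zero_form] at this

theorem CongMod.eq_of_vanish [IsTopologicalAddGroup V] {T : Set (V [⋀^Fin 1]→L[ℝ] ℝ)} {k : ℕ}
    {α β : V [⋀^Fin k]→L[ℝ] ℝ} (h : CongMod T α β) (v : Fin k → V)
    (hv : ∀ a, ∀ τ ∈ T, τ (fun _ => v a) = 0) : α v = β v := by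
  rw [← sub_eq_zero, ← ContinuousAlternatingMap.sub_apply]
  refine PtIdeal.vanish (F := fun k => {v : Fin k → V | ∀ a, ∀ τ ∈ T, τ (fun _ => v a) = 0})
    (fun v hv f _ a => hv (f a)) ?_ h v hv
  rintro _ ⟨τ, hτ, rfl⟩ w hw
  have := hw 0 τ hτ
  rw [show w = fun _ => w 0 from funext fun i => by rw [Subsingleton.elim i 0]]
  exact this

/-- Contraction of an alternating form with a vector in the last slot. -/
def contractLast {k : ℕ} (φ : V [⋀^Fin (k + 1)]→L[ℝ] ℝ) (e : V) : V [⋀^Fin k]→L[ℝ] ℝ where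
  toFun v := φ (Fin.snoc v e : Fin (k + 1) → V)
  map_update_add' := by
    intro inst v m x y
    obtain rfl : inst = instDecidableEqFin k := Subsingleton.elim _ _
    simp only [Fin.snoc_update, ContinuousAlternatingMap.map_update_add]
  map_update_smul' := by
    intro inst v m c x
    obtain rfl : inst = instDecidableEqFin k := Subsingleton.elim _ _
    simp only [Fin.snoc_update, ContinuousAlternatingMap.map_update_smul]
  cont := by
    refine φ.cont.comp (continuous_pi fun i => ?_)
    refine Fin.lastCases ?_ (fun j => ?_) i
    · simpa using continuous_const
    · simpa using continuous_apply j
  map_eq_zero_of_eq' := by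
    intro v i j hv hij
    exact φ.map_eq_zero_of_eq (Fin.snoc v e : Fin (k + 1) → V) (i := i.castSucc) (j := j.castSucc)
      (by simpa using hv) (by simpa using hij)

theorem contractLast_apply {k : ℕ} (φ : V [⋀^Fin (k + 1)]→L[ℝ] ℝ) (e : V) (v : Fin k → V) :
    contractLast φ e v = φ (Fin.snoc v e : Fin (k + 1) → V) := rfl

/-- A covector as a linear functional. -/
def covec (α : V [⋀^Fin 1]→L[ℝ] ℝ) : V →L[ℝ] ℝ :=
  (ContinuousAlternatingMap.ofSubsingleton ℝ V ℝ (0 : Fin 1)).symm α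

@[simp]
theorem covec_apply (α : V [⋀^Fin 1]→L[ℝ] ℝ) (v : V) : covec α v = α (fun _ => v) := rfl

theorem covector_ext {α β : V [⋀^Fin 1]→L[ℝ] ℝ} (h : ∀ v, α (fun _ => v) = β (fun _ => v)) :
    α = β := by
  ext v
  have : v = fun _ => v 0 := by ext i; fin_cases i; rfl
  rw [this]
  exact h _

section Expansion

variable {ι : Type*} [Fintype ι] {c : ι → V [⋀^Fin 1]→L[ℝ] ℝ} {e : ι → V}

theorem apply_snoc_expand (he : ∀ v, v = ∑ i, c i (fun _ => v) • e i) {k : ℕ}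
    (φ : V [⋀^Fin (k + 1)]→L[ℝ] ℝ) (u : Fin k → V) (w : V) :
    φ (Fin.snoc u w : Fin (k + 1) → V) =
      ∑ i, φ (Fin.snoc u (e i) : Fin (k + 1) → V) * c i (fun _ => w) := by
  have h : ∀ z : V, (Fin.snoc u z : Fin (k + 1) → V) =
      Function.update (Fin.snoc u 0 : Fin (k + 1) → V) (Fin.last k) z := by
    intro z; rw [Fin.update_snoc_last]
  let L : V →ₗ[ℝ] ℝ := φ.toMultilinearMap.toLinearMap (Fin.snoc u 0) (Fin.last k)
  have hL : ∀ z, φ (Fin.snoc u z : Fin (k + 1) → V) = L z := by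
    intro z; rw [h z]; rfl
  rw [hL]
  conv_lhs => rw [he w]
  rw [map_sum]
  refine Finset.sum_congr rfl fun i _ => ?_
  rw [map_smul, hL, smul_eq_mul, mul_comm]

theorem sum_wedge_contractLast (he : ∀ v, v = ∑ i, c i (fun _ => v) • e i) {k : ℕ}
    (φ : V [⋀^Fin (k + 1)]→L[ℝ] ℝ) :
    ∑ i, wedge (contractLast φ (e i)) (c i) = ((k : ℝ) + 1) • φ := by
  ext v
  rw [ContinuousAlternatingMap.sum_apply, ContinuousAlternatingMap.smul_apply]
  simp only [wedge_apply]
  rw [← Finset.mul_sum, Finset.sum_comm]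
  have h : ∀ σ : Equiv.Perm (Fin (k + 1)), ∑ i, Equiv.Perm.sign σ •
      (contractLast φ (e i) (fun j => v (σ (Fin.castAdd 1 j))) *
        c i (fun j => v (σ (Fin.natAdd k j)))) = φ v := by
    intro σ
    rw [← Finset.smul_sum]
    have h1 : ∀ i, c i (fun j => v (σ (Fin.natAdd k j))) = c i (fun _ => v (σ (Fin.last k))) := by
      intro i
      congr 1
      ext j
      fin_cases j
      rfl
    simp only [h1, contractLast_apply]
    rw [← apply_snoc_expand he]
    have h2 : (Fin.snoc (fun j => v (σ (Fin.castAdd 1 j))) (v (σ (Fin.last k))) :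
        Fin (k + 1) → V) = v ∘ σ := by
      ext j
      refine Fin.lastCases ?_ (fun j => ?_) j
      · simp
      · rw [Fin.snoc_castSucc]; rfl
    rw [h2, show φ (v ∘ σ) = Equiv.Perm.sign σ • φ v from φ.toAlternatingMap.map_perm v σ, smul_smul]
    simp
  rw [Finset.sum_congr rfl fun σ _ => h σ, Finset.sum_const, Finset.card_univ, Fintype.card_perm,
    Fintype.card_fin, Nat.factorial_succ k]
  have : (k.factorial : ℝ) ≠ 0 := by positivity
  simp only [nsmul_eq_mul, smul_eq_mul]
  push_cast
  field_simp
  simp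

theorem covector_expand (he : ∀ v, v = ∑ i, c i (fun _ => v) • e i) (φ : V [⋀^Fin 1]→L[ℝ] ℝ) :
    φ = ∑ i, φ (fun _ => e i) • c i := by
  refine covector_ext fun v => ?_
  rw [ContinuousAlternatingMap.sum_apply, ← covec_apply]
  conv_lhs => rw [he v]
  rw [map_sum]
  refine Finset.sum_congr rfl fun i _ => ?_
  rw [map_smul, covec_apply, ContinuousAlternatingMap.smul_apply, smul_eq_mul, smul_eq_mul,
    mul_comm]

theorem two_smul_expand (he : ∀ v, v = ∑ i, c i (fun _ => v) • e i)
    (φ : V [⋀^Fin (1 + 1)]→L[ℝ] ℝ) :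
    (2 : ℝ) • φ = ∑ i, ∑ j, φ ![e j, e i] • wedge (c j) (c i) := by
  have h := sum_wedge_contractLast (k := 1) he φ
  rw [show ((1 : ℕ) : ℝ) + 1 = 2 by norm_num] at h
  rw [← h]
  refine Finset.sum_congr rfl fun i _ => ?_
  rw [covector_expand he (contractLast φ (e i)), wedge_sum_left]
  refine Finset.sum_congr rfl fun j _ => ?_
  rw [wedge_smul_left, contractLast_apply]
  congr 2
  ext a
  fin_cases a <;> rfl

theorem six_smul_expand (he : ∀ v, v = ∑ i, c i (fun _ => v) • e i)
    (φ : V [⋀^Fin (1 + 1 + 1)]→L[ℝ] ℝ) :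
    (6 : ℝ) • φ = ∑ i, ∑ j, ∑ l, φ ![e l, e j, e i] • wedge (wedge (c l) (c j)) (c i) := by
  have h := sum_wedge_contractLast (k := 1 + 1) he φ
  rw [show ((1 + 1 : ℕ) : ℝ) + 1 = 3 by norm_num] at h
  rw [show (6 : ℝ) = 2 * 3 by norm_num, mul_smul, ← h, Finset.smul_sum]
  refine Finset.sum_congr rfl fun i _ => ?_
  rw [← wedge_smul_left, two_smul_expand he, wedge_sum_left]
  refine Finset.sum_congr rfl fun j _ => ?_
  rw [wedge_sum_left]
  refine Finset.sum_congr rfl fun l _ => ?_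
  rw [wedge_smul_left, contractLast_apply]
  congr 2
  ext a
  fin_cases a <;> rfl

/-- A `2`-form vanishes modulo a set of covectors when its coefficients with respect to the
remaining members of a coframe vanish. -/
theorem congMod_zero_of_coeff [IsTopologicalAddGroup V]
    (he : ∀ v, v = ∑ i, c i (fun _ => v) • e i)
    {T : Set (V [⋀^Fin 1]→L[ℝ] ℝ)} {Z : Set ι} (hZ : ∀ i ∈ Z, c i ∈ T)
    {η : V [⋀^Fin (1 + 1)]→L[ℝ] ℝ} (h : ∀ i ∉ Z, ∀ j ∉ Z, η ![e j, e i] = 0) :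
    PtIdeal ((fun τ => (⟨1, τ⟩ : Σ k : ℕ, V [⋀^Fin k]→L[ℝ] ℝ)) '' T) 2 η := by
  have hs : ∀ (s : Finset ι) (f : ι → V [⋀^Fin (1 + 1)]→L[ℝ] ℝ),
      (∀ i, PtIdeal ((fun τ => (⟨1, τ⟩ : Σ k : ℕ, V [⋀^Fin k]→L[ℝ] ℝ)) '' T) (1 + 1) (f i)) →
      PtIdeal ((fun τ => (⟨1, τ⟩ : Σ k : ℕ, V [⋀^Fin k]→L[ℝ] ℝ)) '' T) (1 + 1)
        (∑ i ∈ s, f i) := by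
    classical
    intro s f hf
    induction s using Finset.induction_on with
    | empty => rw [Finset.sum_empty]; exact .zero
    | insert a s ha ih => rw [Finset.sum_insert ha]; exact .add (hf a) ih
  have h2 : η = (2 : ℝ)⁻¹ • ((2 : ℝ) • η) := by rw [smul_smul]; norm_num
  rw [h2, two_smul_expand he]
  refine PtIdeal.smul (hs _ _ fun i => hs _ _ fun j => ?_) _
  by_cases hj : j ∈ Z
  · exact (PtIdeal.mul (k := 1) (.gen (Set.mem_image_of_mem _ (hZ j hj))) (c i)).smul _
  by_cases hi : i ∈ Z
  · rw [wedge_covectors_swap, ← neg_one_smul ℝ (wedge (c i) (c j))]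
    exact ((PtIdeal.mul (k := 1) (.gen (Set.mem_image_of_mem _ (hZ i hi))) (c j)).smul _).smul _
  · rw [h i hi j hj, zero_smul]
    exact .zero

end Expansion

end Exterior

section Characteristic

variable {V : Type*} [AddCommGroup V] [Module ℝ V] [TopologicalSpace V]
  {V' : Type*} [AddCommGroup V'] [Module ℝ V'] [TopologicalSpace V'] {ι : Type*}

/-- Given covectors `c i` sorted by `g` into those generating an ideal (`none`) and those of two
further groups, the vectors annihilated by all covectors outside the group `s`. -/
def charSpace (c : ι → V [⋀^Fin 1]→L[ℝ] ℝ) (g : ι → Option Bool) (s : Bool) : Set V :=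
  {v | ∀ i, g i ≠ some s → c i (fun _ => v) = 0}

/-- The tuples of vectors taken from different characteristic spaces. -/
def charTuples (c : ι → V [⋀^Fin 1]→L[ℝ] ℝ) (g : ι → Option Bool) (k : ℕ) : Set (Fin k → V) :=
  {v | ∃ s : Fin k → Bool, Function.Injective s ∧ ∀ a, v a ∈ charSpace c g (s a)}

/-- Forms that vanish on all tuples taken from different characteristic spaces. These are the
elements of the ideal generated by the `c i` with `g i = none` and the `c i ∧ c j` with
`g i = g j`. -/
def IsCharForm (c : ι → V [⋀^Fin 1]→L[ℝ] ℝ) (g : ι → Option Bool) {k : ℕ}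
    (φ : V [⋀^Fin k]→L[ℝ] ℝ) : Prop :=
  ∀ v ∈ charTuples c g k, φ v = 0

variable {c : ι → V [⋀^Fin 1]→L[ℝ] ℝ} {g : ι → Option Bool}

theorem charTuples_comp {k m : ℕ} (v : Fin k → V) (hv : v ∈ charTuples c g k)
    (f : Fin m → Fin k) (hf : Function.Injective f) : v ∘ f ∈ charTuples c g m := by
  obtain ⟨s, hs, h⟩ := hv
  exact ⟨s ∘ f, hs.comp hf, fun a => h (f a)⟩

theorem IsCharForm.of_ptIdeal {S : Set (Σ k : ℕ, V [⋀^Fin k]→L[ℝ] ℝ)}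
    (hS : ∀ s ∈ S, IsCharForm c g s.2) {k : ℕ} {φ : V [⋀^Fin k]→L[ℝ] ℝ} (h : PtIdeal S k φ) :
    IsCharForm c g φ :=
  PtIdeal.vanish charTuples_comp hS h

theorem IsCharForm.wedge {k l : ℕ} {φ : V [⋀^Fin k]→L[ℝ] ℝ} (h : IsCharForm c g φ)
    (ψ : V [⋀^Fin l]→L[ℝ] ℝ) : IsCharForm c g (BacklundEDS.wedge φ ψ) :=
  wedge_eq_zero_of_left charTuples_comp h ψ

theorem IsCharForm.zero {k : ℕ} : IsCharForm c g (0 : V [⋀^Fin k]→L[ℝ] ℝ) := fun _ _ => rfl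

theorem IsCharForm.add {k : ℕ} {φ ψ : V [⋀^Fin k]→L[ℝ] ℝ} (h : IsCharForm c g φ)
    (h' : IsCharForm c g ψ) : IsCharForm c g (φ + ψ) := fun v hv => by
  rw [ContinuousAlternatingMap.add_apply, h v hv, h' v hv, add_zero]

theorem IsCharForm.of_two_lt {k : ℕ} (hk : 2 < k) (φ : V [⋀^Fin k]→L[ℝ] ℝ) :
    IsCharForm c g φ := by
  rintro v ⟨s, hs, -⟩
  have := Fintype.card_le_of_injective s hs
  simp at this
  omega

theorem isCharForm_zero_iff {φ : V [⋀^Fin 0]→L[ℝ] ℝ} : IsCharForm c g φ ↔ φ = 0 := by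
  refine ⟨fun h => ?_, fun h => h ▸ .zero⟩
  ext v
  exact h v ⟨fun a => a.elim0, fun a => a.elim0, fun a => a.elim0⟩

theorem isCharForm_one_iff {φ : V [⋀^Fin 1]→L[ℝ] ℝ} :
    IsCharForm c g φ ↔ ∀ s, ∀ v ∈ charSpace c g s, φ (fun _ => v) = 0 := by
  constructor
  · intro h s v hv
    exact h _ ⟨fun _ => s, fun a b _ => Subsingleton.elim a b, fun _ => hv⟩
  · rintro h v ⟨s, -, hv⟩
    rw [show v = fun _ => v 0 from funext fun i => by rw [Subsingleton.elim i 0]]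
    exact h (s 0) _ (hv 0)

theorem isCharForm_two_iff {φ : V [⋀^Fin (1 + 1)]→L[ℝ] ℝ} :
    IsCharForm c g φ ↔
      ∀ v ∈ charSpace c g false, ∀ w ∈ charSpace c g true, φ ![v, w] = 0 := by
  constructor
  · intro h v hv w hw
    refine h _ ⟨![false, true], by decide, fun a => ?_⟩
    fin_cases a
    · exact hv
    · exact hw
  · rintro h v ⟨s, hs, hv⟩
    have hne : s 0 ≠ s 1 := fun h => by simpa using hs h
    have hv' : v = ![v 0, v 1] := by ext a; fin_cases a <;> rfl
    cases h0 : s 0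
    · have h1 : s 1 = true := by
        cases h1 : s 1
        · exact absurd (h0.trans h1.symm) hne
        · rfl
      rw [hv']
      exact h _ (h0 ▸ hv 0) _ (h1 ▸ hv 1)
    · have h1 : s 1 = false := by
        cases h1 : s 1
        · rfl
        · exact absurd (h0.trans h1.symm) hne
      have := φ.map_swap v (i := 0) (j := 1) (by decide)
      have h3 : v ∘ Equiv.swap (0 : Fin (1 + 1)) 1 = ![v 1, v 0] := by
        ext a; fin_cases a <;> rfl
      rw [h3] at this
      rw [← neg_eq_zero]
      refine Eq.trans this.symm ?_
      exact h _ (h1 ▸ hv 1) _ (h0 ▸ hv 0)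

theorem isCharForm_covector {i : ι} (hi : g i = none) : IsCharForm c g (c i) := by
  rw [isCharForm_one_iff]
  intro s v hv
  exact hv i (by simp [hi])

theorem isCharForm_wedge {i j : ι} (hij : g i = g j) :
    IsCharForm c g (BacklundEDS.wedge (c i) (c j)) := by
  rw [isCharForm_two_iff]
  intro v hv w hw
  rw [wedge_covectors_apply]
  simp only [Matrix.cons_val_zero, Matrix.cons_val_one]
  by_cases h : g i = some false
  · rw [hw i (by simp [h]), hw j (by simp [← hij, h])]
    simp
  · rw [hv i h, hv j (hij ▸ h)]
    simp

theorem IsCharForm.compContinuousLinearMap {ι' : Type*} {c' : ι' → V' [⋀^Fin 1]→L[ℝ] ℝ}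
    {g' : ι' → Option Bool} {f : V' →L[ℝ] V}
    (hf : ∀ s, ∀ v ∈ charSpace c' g' s, f v ∈ charSpace c g s) {k : ℕ}
    {φ : V [⋀^Fin k]→L[ℝ] ℝ} (h : IsCharForm c g φ) :
    IsCharForm c' g' (φ.compContinuousLinearMap f) := by
  rintro v ⟨s, hs, hv⟩
  exact h _ ⟨s, hs, fun a => hf _ _ (hv a)⟩

theorem IsCharForm.mono {ι' : Type*} {c' : ι' → V [⋀^Fin 1]→L[ℝ] ℝ}
    {g' : ι' → Option Bool} (hf : ∀ s, charSpace c' g' s ⊆ charSpace c g s) {k : ℕ}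
    {φ : V [⋀^Fin k]→L[ℝ] ℝ} (h : IsCharForm c g φ) : IsCharForm c' g' φ := by
  rintro v ⟨s, hs, hv⟩
  exact h _ ⟨s, hs, fun a => hf _ (hv a)⟩

end Characteristic

section Generation

variable {X : Type*} {E : X → Type*} [∀ x, AddCommGroup (E x)] [∀ x, Module ℝ (E x)]
  [∀ x, TopologicalSpace (E x)]
  {ι : Type*} [Fintype ι]

/-- A family of forms that is closed under the operations of an ideal, and contains the generators
`c i` (`g i = none`) and `c i ∧ c j` (`g i = g j`), contains all forms (of a class `Sm`) that
vanish on tuples of frame vectors from different groups. -/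
theorem mem_of_isCharForm {U : Set X} {c : ι → ∀ x, E x [⋀^Fin 1]→L[ℝ] ℝ} {e : ι → ∀ x, E x}
    (he : ∀ x ∈ U, ∀ v, v = ∑ i, c i x (fun _ => v) • e i x)
    (hd : ∀ x ∈ U, ∀ i j, i ≠ j → c i x (fun _ => e j x) = 0)
    {g : ι → Option Bool}
    {Sm J : ∀ k : ℕ, (∀ x, E x [⋀^Fin k]→L[ℝ] ℝ) → Prop}
    (hadd : ∀ k φ ψ, J k φ → J k ψ → J k (fun x => φ x + ψ x))
    (hzero : ∀ k, J k (fun _ => 0))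
    (hwedge : ∀ k φ i, J k φ → J (k + 1) (fun x => wedge (φ x) (c i x)))
    (hsmul : ∀ k φ m ψ (I : Fin m → ι), J k φ → Sm m ψ →
      J k (fun x => ψ x (fun a => e (I a) x) • φ x))
    (hconst : ∀ k φ (r : ℝ), J k φ → J k (fun x => r • φ x))
    (hcongr : ∀ k φ ψ, J k φ → (∀ x ∈ U, φ x = ψ x) → J k ψ)
    (hcontr : ∀ k φ i, Sm (k + 1) φ → Sm k (fun x => contractLast (φ x) (e i x)))
    (h1 : ∀ i, g i = none → J 1 (c i))
    (h2 : ∀ i j, g i = g j → J (1 + 1) (fun x => wedge (c i x) (c j x)))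
    (k : ℕ) (φ : ∀ x, E x [⋀^Fin k]→L[ℝ] ℝ) (hφ : Sm k φ)
    (hc : ∀ x ∈ U, IsCharForm (fun i => c i x) g (φ x)) : J k φ := by
  have hsum : ∀ (k : ℕ) (s : Finset ι) (f : ι → ∀ x, E x [⋀^Fin k]→L[ℝ] ℝ),
      (∀ i, J k (f i)) → J k (fun x => ∑ i ∈ s, f i x) := by
    classical
    intro k s f hf
    induction s using Finset.induction_on with
    | empty => simpa using hzero k
    | insert a s ha ih => simp only [Finset.sum_insert ha]; exact hadd _ _ _ (hf a) ih
  have hespace : ∀ x ∈ U, ∀ i s, g i = some s → e i x ∈ charSpace (fun i => c i x) g s := by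
    intro x hx i s hi j hj
    refine hd x hx j i fun h => hj ?_
    rw [h, hi]
  have hpair : ∀ i j, (g i = none ∨ g j = none ∨ g i = g j) →
      J (1 + 1) (fun x => wedge (c i x) (c j x)) := by
    intro i j h
    by_cases hi : g i = none
    · exact hwedge 1 _ _ (h1 i hi)
    by_cases hj : g j = none
    · refine hcongr _ _ _ (hconst _ _ (-1) (hwedge 1 _ i (h1 j hj))) fun x _ => ?_
      exact (neg_one_smul ℝ _).trans (wedge_covectors_swap (c i x) _).symm
    · simp only [hi, hj, false_or] at h
      exact h2 i j h
  match k, φ, hφ, hc with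
  | 0, φ, hφ, hc =>
    exact hcongr _ _ _ (hzero 0) fun x hx => (isCharForm_zero_iff.1 (hc x hx)).symm
  | 1, φ, hφ, hc =>
    refine hcongr _ _ _ (hsum 1 Finset.univ (fun i x => φ x (fun _ => e i x) • c i x)
      fun i => ?_) fun x hx => (covector_expand (he x hx) (φ x)).symm
    cases hi : g i with
    | none => exact hsmul 1 _ 1 φ (fun _ => i) (h1 i hi) hφ
    | some s =>
      refine hcongr _ _ _ (hzero 1) fun x hx => ?_
      rw [isCharForm_one_iff.1 (hc x hx) s _ (hespace x hx i s hi), zero_smul]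
  | 2, φ, hφ, hc =>
    refine hcongr _ _ _ (hconst _ _ (2 : ℝ)⁻¹ (hsum 2 Finset.univ _ fun i =>
      hsum 2 Finset.univ (fun j x => φ x ![e j x, e i x] • wedge (c j x) (c i x)) fun j => ?_))
      fun x hx => ?_
    · by_cases hp : g j = none ∨ g i = none ∨ g j = g i
      · have := hsmul 2 _ 2 φ ![j, i] (hpair j i hp) hφ
        refine hcongr _ _ _ this fun x _ => ?_
        congr 2
        ext a
        fin_cases a <;> rfl
      · push Not at hp
        obtain ⟨hj, hi, hne⟩ := hp
        obtain ⟨s, hs⟩ := Option.ne_none_iff_exists'.1 hj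
        obtain ⟨t, ht⟩ := Option.ne_none_iff_exists'.1 hi
        refine hcongr _ _ _ (hzero 2) fun x hx => ?_
        rw [hc x hx ![e j x, e i x] ⟨![s, t], ?_, ?_⟩, zero_smul]
        · intro a b hab
          have : s ≠ t := fun h => hne (by rw [hs, ht, h])
          fin_cases a <;> fin_cases b <;>
            first | rfl | exact absurd hab this | exact absurd hab.symm this
        · intro a
          fin_cases a
          · exact hespace x hx j s hs
          · exact hespace x hx i t ht
    · have := two_smul_expand (he x hx) (φ x)
      change _ = φ x
      rw [← this, smul_smul]
      norm_num
  | 3, φ, hφ, hc =>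
    refine hcongr _ _ _ (hconst _ _ (6 : ℝ)⁻¹ (hsum 3 Finset.univ _ fun i =>
      hsum 3 Finset.univ _ fun j => hsum 3 Finset.univ
        (fun l x => φ x ![e l x, e j x, e i x] • wedge (wedge (c l x) (c j x)) (c i x))
        fun l => ?_))
      fun x hx => ?_
    · have hT : J 3 (fun x => wedge (wedge (c l x) (c j x)) (c i x)) := by
        by_cases h12 : g l = none ∨ g j = none ∨ g l = g j
        · exact hwedge 2 _ _ (hpair l j h12)
        by_cases h23 : g j = none ∨ g i = none ∨ g j = g i
        · refine hcongr _ _ _ (hwedge 2 _ l (hpair j i h23)) fun x _ => ?_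
          exact (wedge_three_rotate _ _ _).symm
        · have h31 : g i = g l := by
            push Not at h12 h23
            obtain ⟨s, hs⟩ := Option.ne_none_iff_exists'.1 h12.1
            obtain ⟨t, ht⟩ := Option.ne_none_iff_exists'.1 h23.1
            obtain ⟨r, hr⟩ := Option.ne_none_iff_exists'.1 h23.2.1
            have a1 := h12.2.2
            have a2 := h23.2.2
            rw [hs, ht] at a1
            rw [ht, hr] at a2
            rw [hr, hs]
            revert a1 a2
            cases s <;> cases t <;> cases r <;> simp
          refine hcongr _ _ _ (hwedge 2 _ j (hpair i l (Or.inr (Or.inr h31)))) fun x _ => ?_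
          exact wedge_three_rotate _ _ _
      have := hsmul 3 _ 3 φ ![l, j, i] hT hφ
      refine hcongr _ _ _ this fun x _ => ?_
      congr 2
      ext a
      fin_cases a <;> rfl
    · have := six_smul_expand (he x hx) (φ x)
      change _ = φ x
      rw [← this, smul_smul]
      norm_num
  | k + 4, φ, hφ, hc =>
    refine hcongr _ _ _ (hconst _ _ (((k + 3 : ℕ) : ℝ) + 1)⁻¹ (hsum (k + 4) Finset.univ _
      fun i => hwedge (k + 3) _ i (mem_of_isCharForm he hd hadd hzero hwedge hsmul hconst hcongr
        hcontr h1 h2 (k + 3) _ (hcontr (k + 3) φ i hφ) fun x _ => .of_two_lt (by omega) _)))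
      fun x hx => ?_
    have := sum_wedge_contractLast (he x hx) (φ x)
    change _ • (∑ i, wedge (contractLast (φ x) (e i x)) (c i x)) = φ x
    rw [this, smul_smul, inv_mul_cancel₀ (by positivity), one_smul]

end Generation

section SmoothFamilies

variable {E E' : Type*} [NormedAddCommGroup E] [NormedSpace ℝ E]
  [NormedAddCommGroup E'] [NormedSpace ℝ E']

theorem contDiffAt_of_injective {W J : Type*} [NormedAddCommGroup W] [NormedSpace ℝ W] [Fintype J]
    {n : WithTop ℕ∞} (L : W →ₗ[ℝ] (J → ℝ)) (hL : Function.Injective L) {f : E' → W} {u : E'}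
    (h : ∀ j, ContDiffAt ℝ n (fun y => L (f y) j) u) : ContDiffAt ℝ n f u := by
  obtain ⟨g, hg⟩ := L.exists_leftInverse_of_injective (LinearMap.ker_eq_bot.2 hL)
  have h1 : f = fun y => g.toContinuousLinearMap (fun j => L (f y) j) := by
    ext y
    exact (LinearMap.congr_fun hg (f y)).symm
  rw [h1]
  exact g.toContinuousLinearMap.contDiff.contDiffAt.comp u (contDiffAt_pi.2 h)

theorem contDiffAt_alternating [FiniteDimensional ℝ E] {k : ℕ} {n : WithTop ℕ∞}
    {f : E' → E [⋀^Fin k]→L[ℝ] ℝ} {u : E'}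
    (h : ∀ v, ContDiffAt ℝ n (fun y => f y v) u) : ContDiffAt ℝ n f u := by
  let b := Module.finBasis ℝ E
  let L : (E [⋀^Fin k]→L[ℝ] ℝ) →ₗ[ℝ] ((Fin k → Fin (Module.finrank ℝ E)) → ℝ) :=
    { toFun := fun φ J => φ (fun a => b (J a))
      map_add' := fun _ _ => rfl
      map_smul' := fun _ _ => rfl }
  refine contDiffAt_of_injective L ?_ fun J => h _
  intro φ ψ hφ
  apply ContinuousAlternatingMap.toAlternatingMap_injective
  refine Module.Basis.ext_alternating b fun J _ => ?_
  exact congrFun hφ J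

theorem contDiffAt_alternating_apply [FiniteDimensional ℝ E] {k : ℕ} {n : WithTop ℕ∞}
    {f : E' → E [⋀^Fin k]→L[ℝ] ℝ} {w : Fin k → E' → E} {u : E'} (hf : ContDiffAt ℝ n f u)
    (hw : ∀ a, ContDiffAt ℝ n (w a) u) : ContDiffAt ℝ n (fun y => f y (fun a => w a y)) u := by
  let b := Module.finBasis ℝ E
  have h1 : ∀ y, f y (fun a => w a y) = ∑ J : Fin k → Fin (Module.finrank ℝ E),
      (∏ a, b.repr (w a y) (J a)) * f y (fun a => b (J a)) := by
    intro y
    have : (fun a => w a y) = fun a => ∑ j, b.repr (w a y) j • b j := by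
      ext a; exact (b.sum_repr _).symm
    rw [this, ContinuousAlternatingMap.map_sum]
    refine Finset.sum_congr rfl fun J _ => ?_
    rw [ContinuousAlternatingMap.map_smul_univ, smul_eq_mul]
  simp only [h1]
  refine ContDiffAt.sum fun J _ => ContDiffAt.mul (contDiffAt_prod fun a _ => ?_) ?_
  · exact ((b.coord (J a)).toContinuousLinearMap.contDiff.contDiffAt).comp u (hw a)
  · exact ((ContinuousAlternatingMap.apply ℝ E ℝ (fun a => b (J a))).contDiff.contDiffAt).comp u hf

theorem contDiffAt_covec {n : WithTop ℕ∞}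
    {f : E' → E [⋀^Fin 1]→L[ℝ] ℝ} {u : E'} (hf : ContDiffAt ℝ n f u) :
    ContDiffAt ℝ n (fun y => covec (f y)) u :=
  ContDiffAt.comp (g := (ContinuousAlternatingMap.ofSubsingletonLIE (𝕜 := ℝ) (E := E) (F := ℝ)
    (0 : Fin 1)).symm) u (LinearIsometryEquiv.contDiff _).contDiffAt hf

end SmoothFamilies

section DualFrames

variable {V : Type*} [AddCommGroup V] [Module ℝ V] [TopologicalSpace V]

theorem apply_expand {ι : Type*} [Fintype ι] {c : ι → V [⋀^Fin 1]→L[ℝ] ℝ} {e : ι → V} {k : ℕ} (he : ∀ v, v = ∑ i, c i (fun _ => v) • e i)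
    (φ : V [⋀^Fin k]→L[ℝ] ℝ) (v : Fin k → V) :
    φ v = ∑ I : Fin k → ι, (∏ a, c (I a) (fun _ => v a)) * φ (fun a => e (I a)) := by
  conv_lhs => rw [show v = fun a => ∑ i, c i (fun _ => v a) • e i from funext fun a => he (v a)]
  rw [ContinuousAlternatingMap.map_sum]
  refine Finset.sum_congr rfl fun J _ => ?_
  rw [ContinuousAlternatingMap.map_smul_univ, smul_eq_mul]

variable {ι : Type*} [DecidableEq ι] {c : ι → V [⋀^Fin 1]→L[ℝ] ℝ} {e : ι → V}

/-- `e` is dual to `c`. -/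
def IsDual (c : ι → V [⋀^Fin 1]→L[ℝ] ℝ) (e : ι → V) : Prop :=
  ∀ i j, c i (fun _ => e j) = if i = j then 1 else 0

variable [Fintype ι]

theorem IsDual.linearIndependent (h : IsDual c e) : LinearIndependent ℝ c := by
  rw [Fintype.linearIndependent_iff]
  intro r hr j
  have := congrArg (fun φ => φ (fun _ => e j)) hr
  simpa [ContinuousAlternatingMap.sum_apply, h _ j] using this

theorem IsDual.linearIndependent_frame (h : IsDual c e) : LinearIndependent ℝ e := by
  rw [Fintype.linearIndependent_iff]
  intro r hr j
  have := congrArg (covec (c j)) hr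
  rw [map_zero, map_sum] at this
  simpa [h j] using this

theorem IsDual.expand [FiniteDimensional ℝ V] (hcard : Fintype.card ι = Module.finrank ℝ V)
    (h : IsDual c e) (v : V) : v = ∑ i, c i (fun _ => v) • e i := by
  let b := basisOfLinearIndependentOfCardEqFinrank' e h.linearIndependent_frame hcard
  have hb : ∀ i, b i = e i := fun i => by simp [b]
  have h1 := b.sum_repr v
  conv_lhs => rw [← h1]
  refine Finset.sum_congr rfl fun i _ => ?_
  have h2 := congrArg (covec (c i)) h1
  simp only [map_sum, map_smul, hb, covec_apply, h i, smul_eq_mul, mul_ite, mul_one, mul_zero,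
    Finset.sum_ite_eq, Finset.mem_univ, if_true] at h2
  rw [hb, h2]

theorem exists_isDual [FiniteDimensional ℝ V] [IsTopologicalAddGroup V] [ContinuousSMul ℝ V]
    [T2Space V]
    (hcard : Fintype.card ι = Module.finrank ℝ V) (hc : LinearIndependent ℝ c) :
    ∃ e, IsDual c e := by
  let L : V →ₗ[ℝ] (ι → ℝ) := LinearMap.pi fun i => (covec (c i)).toLinearMap
  have hind : LinearIndependent ℝ (fun i => ((covec (c i)).toLinearMap : Module.Dual ℝ V)) := by
    rw [Fintype.linearIndependent_iff] at hc ⊢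
    intro r hr
    refine hc r (covector_ext fun v => ?_)
    have := LinearMap.congr_fun hr v
    simpa [ContinuousAlternatingMap.sum_apply] using this
  have hinj : Function.Injective L := by
    rw [← LinearMap.ker_eq_bot, LinearMap.ker_eq_bot']
    intro v hv
    rw [← Module.forall_dual_apply_eq_zero_iff ℝ]
    intro f
    have hspan := hind.span_eq_top_of_card_eq_finrank' (by rw [hcard, Subspace.dual_finrank_eq])
    have hf : f ∈ Submodule.span ℝ
        (Set.range fun i => ((covec (c i)).toLinearMap : Module.Dual ℝ V)) := hspan ▸ trivial
    induction hf using Submodule.span_induction with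
    | mem x hx =>
      obtain ⟨i, rfl⟩ := hx
      exact congrFun hv i
    | zero => rfl
    | add x y _ _ hx hy => rw [LinearMap.add_apply, hx, hy, add_zero]
    | smul a x _ hx => rw [LinearMap.smul_apply, hx, smul_zero]
  have hsurj : Function.Surjective L :=
    (LinearMap.injective_iff_surjective_of_finrank_eq_finrank (by simp [hcard])).1 hinj
  choose e he using fun j => hsurj (Pi.single j 1)
  refine ⟨e, fun i j => ?_⟩
  have := congrFun (he j) i
  simpa [L, Pi.single_apply] using this

end DualFrames

section ManifoldForms

variable {E : Type*} [NormedAddCommGroup E] [NormedSpace ℝ E]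
  {H : Type*} [TopologicalSpace H] {I : ModelWithCorners ℝ E H}
  {M : Type*} [TopologicalSpace M] [ChartedSpace H M]

theorem rep_add {k : ℕ} (x : M) (φ ψ : DForm I M k) : rep x (φ + ψ) = rep x φ + rep x ψ := rfl

theorem rep_apply {k : ℕ} (x : M) (φ : DForm I M k) (u : E) (v : Fin k → E) :
    rep x φ u v = φ ((extChartAt I x).symm u)
      (fun a => mfderiv 𝓘(ℝ, E) I (extChartAt I x).symm u (v a)) := rfl

theorem SmoothAt.add {k : ℕ} {x : M} {φ ψ : DForm I M k} (h : SmoothAt φ x) (h' : SmoothAt ψ x) :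
    SmoothAt (φ + ψ) x := ContDiffAt.add h h'

theorem smoothAt_zero {k : ℕ} {x : M} : SmoothAt (0 : DForm I M k) x :=
  contDiffAt_const (c := (0 : E [⋀^Fin k]→L[ℝ] ℝ))

theorem rep_eventuallyEq {k : ℕ} {x : M} {φ ψ : DForm I M k}
    (h : ∀ᶠ y in nhds x, φ y = ψ y) : rep x φ =ᶠ[nhds (extChartAt I x x)] rep x ψ := by
  have h1 : Filter.Tendsto (extChartAt I x).symm (nhds (extChartAt I x x)) (nhds x) := by
    have := continuousAt_extChartAt_symm (I := I) x
    rwa [ContinuousAt, extChartAt_to_inv] at this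
  filter_upwards [h1.eventually h] with u hu
  ext v
  rw [rep_apply, rep_apply, hu]

theorem SmoothAt.congr {k : ℕ} {x : M} {φ ψ : DForm I M k} (h : SmoothAt φ x)
    (h' : ∀ᶠ y in nhds x, φ y = ψ y) : SmoothAt ψ x :=
  ContDiffAt.congr_of_eventuallyEq h (rep_eventuallyEq (h'.mono fun _ h => h.symm))

theorem contMDiffAt_comp_extChartAt_symm [I.Boundaryless] [IsManifold I ∞ M] {f : M → ℝ} {x : M}
    (hf : ContMDiffAt I 𝓘(ℝ, ℝ) ∞ f x) :
    ContDiffAt ℝ ∞ (f ∘ (extChartAt I x).symm) (extChartAt I x x) := by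
  have h1 := contMDiffOn_extChartAt_symm (I := I) (n := ∞) x
  have h2 : ContMDiffAt 𝓘(ℝ, E) I ∞ (extChartAt I x).symm (extChartAt I x x) :=
    h1.contMDiffAt ((isOpen_extChartAt_target x).mem_nhds (mem_extChartAt_target x))
  rw [← contMDiffAt_iff_contDiffAt]
  refine ContMDiffAt.comp _ ?_ h2
  rwa [extChartAt_to_inv]

theorem ContMDiffAt.of_comp_extChartAt [IsManifold I ∞ M] {f : M → ℝ} {h : E → ℝ} {x : M}
    (hh : ContDiffAt ℝ ∞ h (extChartAt I x x)) (hf : ∀ᶠ y in nhds x, f y = h (extChartAt I x y)) :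
    ContMDiffAt I 𝓘(ℝ, ℝ) ∞ f x := by
  have h1 : ContMDiffAt I 𝓘(ℝ, ℝ) ∞ (h ∘ extChartAt I x) x :=
    (contMDiffAt_iff_contDiffAt.2 hh).comp x contMDiffAt_extChartAt
  exact h1.congr_of_eventuallyEq hf

theorem SmoothAt.smul [I.Boundaryless] [IsManifold I ∞ M] {k : ℕ} {x : M} {φ : DForm I M k}
    (h : SmoothAt φ x) {f : M → ℝ} (hf : ContMDiffAt I 𝓘(ℝ, ℝ) ∞ f x) :
    SmoothAt (fun y => f y • φ y) x :=
  ContDiffAt.smul (contMDiffAt_comp_extChartAt_symm hf) h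

theorem SmoothAt.sum {k : ℕ} {x : M} {ι : Type*} (s : Finset ι) {φ : ι → DForm I M k}
    (h : ∀ i ∈ s, SmoothAt (φ i) x) : SmoothAt (fun y => ∑ i ∈ s, φ i y) x := by
  classical
  induction s using Finset.induction_on with
  | empty => exact smoothAt_zero
  | insert a s ha ih =>
    simp only [Finset.sum_insert ha]
    exact (h a (Finset.mem_insert_self a s)).add
      (ih fun i hi => h i (Finset.mem_insert_of_mem hi))

theorem mfderiv_extChartAt_symm_apply [I.Boundaryless] [IsManifold I ∞ M] (x : M) {y : M}
    (hy : y ∈ (extChartAt I x).source) (v : TangentSpace I y) :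
    mfderiv 𝓘(ℝ, E) I (extChartAt I x).symm (extChartAt I x y)
      (mfderiv I 𝓘(ℝ, E) (extChartAt I x) y v) = v := by
  have := IsManifold.of_le (I := I) (M := M) (m := 1) (n := ∞) (by simp)
  have h := mfderivWithin_extChartAt_symm_comp_mfderiv_extChartAt' (I := I) (x := x) hy
  rw [I.range_eq_univ, mfderivWithin_univ] at h
  exact DFunLike.congr_fun h v

theorem mfderiv_extChartAt_apply [I.Boundaryless] [IsManifold I ∞ M] (x : M) {u : E}
    (hu : u ∈ (extChartAt I x).target) (v : E) :
    mfderiv I 𝓘(ℝ, E) (extChartAt I x) ((extChartAt I x).symm u)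
      (mfderiv 𝓘(ℝ, E) I (extChartAt I x).symm u v) = v := by
  have := IsManifold.of_le (I := I) (M := M) (m := 1) (n := ∞) (by simp)
  have h := mfderiv_extChartAt_comp_mfderivWithin_extChartAt_symm (I := I) (x := x) hu
  rw [I.range_eq_univ, mfderivWithin_univ] at h
  exact DFunLike.congr_fun h v

theorem rep_apply_extChartAt [I.Boundaryless] [IsManifold I ∞ M] {k : ℕ} (x : M) (φ : DForm I M k)
    {y : M} (hy : y ∈ (extChartAt I x).source) (v : Fin k → TangentSpace I y) :
    rep x φ (extChartAt I x y) (fun a => mfderiv I 𝓘(ℝ, E) (extChartAt I x) y (v a)) = φ y v := by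
  have h := (extChartAt I x).left_inv hy
  have key : ∀ z (hz : z = y), φ z (fun a => mfderiv 𝓘(ℝ, E) I (extChartAt I x).symm
      (extChartAt I x y) (mfderiv I 𝓘(ℝ, E) (extChartAt I x) y (v a))) = φ y v := by
    rintro z rfl
    congr 1
    ext a
    exact mfderiv_extChartAt_symm_apply x hy (v a)
  exact key _ h

section Coframes

variable [I.Boundaryless] [IsManifold I ∞ M] {ι : Type*} [DecidableEq ι]

theorem rep_isDual {x : M} {c : ι → DForm I M 1} {e : ι → ∀ y : M, TangentSpace I y}
    {y : M} (hy : y ∈ (extChartAt I x).source) (h : IsDual (fun i => c i y) (fun i => e i y)) :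
    IsDual (V := E) (fun i => rep x (c i) (extChartAt I x y))
      (fun i => mfderiv I 𝓘(ℝ, E) (extChartAt I x) y (e i y)) := by
  intro i j
  refine Eq.trans ?_ (h i j)
  exact rep_apply_extChartAt x (c i) hy fun _ => e j y

variable [FiniteDimensional ℝ E] [Fintype ι]

/-- The coefficients of a smooth form with respect to the frame dual to a smooth coframe. -/
theorem SmoothAt.coeff (hcard : Fintype.card ι = Module.finrank ℝ E) {x : M}
    {c : ι → DForm I M 1} (hc : ∀ i, SmoothAt (c i) x) {e : ι → ∀ y : M, TangentSpace I y}
    (he : ∀ᶠ y in nhds x, IsDual (fun i => c i y) (fun i => e i y)) {k : ℕ} {φ : DForm I M k}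
    (hφ : SmoothAt φ x) (J : Fin k → ι) :
    ContMDiffAt I 𝓘(ℝ, ℝ) ∞ (fun y => φ y (fun a => e (J a) y)) x := by
  let L : E → E →L[ℝ] (ι → ℝ) := fun u => ContinuousLinearMap.pi fun i => covec (rep x (c i) u)
  have hL : ContDiffAt ℝ ∞ L (extChartAt I x x) := by
    have h1 : L = fun u => ∑ i, (covec (rep x (c i) u)).smulRight (Pi.single i (1 : ℝ)) := by
      ext u v i
      simp [L, Finset.sum_apply, Pi.single_apply]
    rw [h1]
    refine ContDiffAt.sum fun i _ => ?_
    exact (contDiffAt_covec (hc i)).smulRight contDiffAt_const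
  have hinv : ∀ y ∈ (extChartAt I x).source, IsDual (fun i => c i y) (fun i => e i y) →
      ∃ A : E ≃L[ℝ] (ι → ℝ), (A : E →L[ℝ] (ι → ℝ)) = L (extChartAt I x y) ∧
        ∀ j, A (mfderiv I 𝓘(ℝ, E) (extChartAt I x) y (e j y)) = Pi.single j 1 := by
    intro y hy h
    have hd := rep_isDual hy h
    have h1 : ∀ j, L (extChartAt I x y) (mfderiv I 𝓘(ℝ, E) (extChartAt I x) y (e j y)) =
        Pi.single j 1 := by
      intro j
      ext i
      rw [Pi.single_apply]
      exact hd i j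
    have hinj : Function.Injective (L (extChartAt I x y)).toLinearMap := by
      rw [← LinearMap.ker_eq_bot, LinearMap.ker_eq_bot']
      intro v hv
      rw [hd.expand hcard v]
      refine Finset.sum_eq_zero fun i _ => ?_
      have : rep x (c i) (extChartAt I x y) (fun _ => v) = 0 := congrFun hv i
      exact (congrArg (fun r : ℝ => r • (_ : E)) this).trans (zero_smul ℝ _)
    let A := LinearEquiv.ofInjectiveOfFinrankEq (L (extChartAt I x y)).toLinearMap hinj
      (by simp [hcard])
    refine ⟨A.toContinuousLinearEquiv, ?_, fun j => h1 j⟩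
    ext v : 1
    rfl
  have hsrc : ∀ᶠ y in nhds x, y ∈ (extChartAt I x).source := extChartAt_source_mem_nhds x
  obtain ⟨A, hA, -⟩ := hinv x (mem_extChartAt_source x) he.self_of_nhds
  let w : ι → E → E := fun i u => ContinuousLinearMap.inverse (L u) (Pi.single i 1)
  have hw : ∀ i, ContDiffAt ℝ ∞ (w i) (extChartAt I x x) := by
    intro i
    have h1 : ContDiffAt ℝ ∞ (fun u => ContinuousLinearMap.inverse (L u)) (extChartAt I x x) := by
      refine ContDiffAt.comp (g := ContinuousLinearMap.inverse) _ ?_ hL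
      rw [← hA]
      exact contDiffAt_map_inverse A
    exact h1.clm_apply contDiffAt_const
  refine ContMDiffAt.of_comp_extChartAt (h := fun u => rep x φ u (fun a => w (J a) u))
    (contDiffAt_alternating_apply hφ fun a => hw (J a)) ?_
  filter_upwards [hsrc, he] with y hy hd
  obtain ⟨B, hB, hB'⟩ := hinv y hy hd
  have h2 : ∀ i, w i (extChartAt I x y) = mfderiv I 𝓘(ℝ, E) (extChartAt I x) y (e i y) := by
    intro i
    simp only [w]
    rw [← hB, ContinuousLinearMap.inverse_equiv, ← hB' i]
    exact B.symm_apply_apply _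
  simp only [h2]
  exact (rep_apply_extChartAt x φ hy fun a => e (J a) y).symm

/-- A form is smooth if its coefficients with respect to a smooth coframe are smooth. -/
theorem SmoothAt.of_coeff (hcard : Fintype.card ι = Module.finrank ℝ E) {x : M}
    {c : ι → DForm I M 1} (hc : ∀ i, SmoothAt (c i) x) {e : ι → ∀ y : M, TangentSpace I y}
    (he : ∀ᶠ y in nhds x, IsDual (fun i => c i y) (fun i => e i y)) {k : ℕ} {φ : DForm I M k}
    (hφ : ∀ J : Fin k → ι, ContMDiffAt I 𝓘(ℝ, ℝ) ∞ (fun y => φ y (fun a => e (J a) y)) x) :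
    SmoothAt φ x := by
  refine contDiffAt_alternating fun v => ?_
  have h1 : (fun u => rep x φ u v) =ᶠ[nhds (extChartAt I x x)] fun u => ∑ J : Fin k → ι,
      (∏ a, rep x (c (J a)) u (fun _ => v a)) *
        ((fun y => φ y (fun a => e (J a) y)) ∘ (extChartAt I x).symm) u := by
    have h2 : Filter.Tendsto (extChartAt I x).symm (nhds (extChartAt I x x)) (nhds x) := by
      have := continuousAt_extChartAt_symm (I := I) x
      rwa [ContinuousAt, extChartAt_to_inv] at this
    filter_upwards [h2.eventually he] with u hu
    have h3 : ∀ z, z = ∑ i, c i ((extChartAt I x).symm u) (fun _ => z) •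
        e i ((extChartAt I x).symm u) :=
      IsDual.expand (V := E) hcard hu
    exact apply_expand h3 (φ ((extChartAt I x).symm u))
      (fun a => mfderiv 𝓘(ℝ, E) I (extChartAt I x).symm u (v a))
  refine ContDiffAt.congr_of_eventuallyEq ?_ h1
  refine ContDiffAt.sum fun J _ => ContDiffAt.mul (contDiffAt_prod fun a _ => ?_)
    (contMDiffAt_comp_extChartAt_symm (hφ J))
  exact ((ContinuousAlternatingMap.apply ℝ E ℝ _).contDiff.contDiffAt).comp _ (hc (J a))

end Coframes

variable [FiniteDimensional ℝ E]

theorem SmoothAt.wedgeF {k l : ℕ} {x : M} {φ : DForm I M k} {ψ : DForm I M l}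
    (h : SmoothAt φ x) (h' : SmoothAt ψ x) : SmoothAt (BacklundEDS.wedgeF φ ψ) x := by
  refine contDiffAt_alternating fun v => ?_
  have h1 : ∀ u, rep x (BacklundEDS.wedgeF φ ψ) u v = wedge (rep x φ u) (rep x ψ u) v := by
    intro u
    rw [rep_apply, wedge_apply]
    exact wedge_apply _ _ _
  simp only [h1, wedge_apply]
  refine ContDiffAt.mul contDiffAt_const (ContDiffAt.sum fun σ _ => ?_)
  simp only [Units.smul_def, zsmul_eq_mul]
  refine ContDiffAt.mul contDiffAt_const (ContDiffAt.mul ?_ ?_)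
  · exact ((ContinuousAlternatingMap.apply ℝ E ℝ _).contDiff.contDiffAt).comp _ h
  · exact ((ContinuousAlternatingMap.apply ℝ E ℝ _).contDiff.contDiffAt).comp _ h'

end ManifoldForms

section Pullback

variable {E : Type*} [NormedAddCommGroup E] [NormedSpace ℝ E]
  {H : Type*} [TopologicalSpace H] {I : ModelWithCorners ℝ E H}
  {M : Type*} [TopologicalSpace M] [ChartedSpace H M]
  {E' : Type*} [NormedAddCommGroup E'] [NormedSpace ℝ E']
  {H' : Type*} [TopologicalSpace H'] {J : ModelWithCorners ℝ E' H'}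
  {M' : Type*} [TopologicalSpace M'] [ChartedSpace H' M']
  {E'' : Type*} [NormedAddCommGroup E''] [NormedSpace ℝ E'']
  {H'' : Type*} [TopologicalSpace H''] {K : ModelWithCorners ℝ E'' H''}
  {M'' : Type*} [TopologicalSpace M''] [ChartedSpace H'' M'']

theorem pullback_wedgeF {k l : ℕ} (f : M' → M) (φ : DForm I M k) (ψ : DForm I M l) :
    pullback (J := J) f (wedgeF φ ψ) = wedgeF (pullback f φ) (pullback f ψ) := by
  funext x
  exact wedge_compContinuousLinearMap _ _ _

theorem pullback_comp {k : ℕ} {f : M' → M} {h : M'' → M'} {x : M''}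
    (hf : MDifferentiableAt J I f (h x)) (hh : MDifferentiableAt K J h x) (φ : DForm I M k) :
    pullback (J := K) (f ∘ h) φ x = pullback h (pullback (J := J) f φ) x := by
  ext v
  simp only [pullback, ContinuousAlternatingMap.compContinuousLinearMap_apply]
  rw [mfderiv_comp x hf hh]
  rfl

theorem contDiffAt_writtenInExtChartAt [J.Boundaryless] {f : M' → M} {x : M'} (hf : ContMDiffAt J I ∞ f x) :
    ContDiffAt ℝ ∞ (writtenInExtChartAt J I x f) (extChartAt J x x) := by
  have h := (contMDiffAt_iff.1 hf).2
  rwa [J.range_eq_univ, contDiffWithinAt_univ] at h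

theorem writtenInExtChartAt_self (f : M' → M) (x : M') :
    writtenInExtChartAt J I x f (extChartAt J x x) = extChartAt I (f x) (f x) := by
  simp [writtenInExtChartAt]

variable [I.Boundaryless] [IsManifold I ∞ M] [J.Boundaryless] [IsManifold J ∞ M']

theorem mdifferentiableAt_extChartAt_symm (x : M) {u : E} (hu : u ∈ (extChartAt I x).target) :
    MDifferentiableAt 𝓘(ℝ, E) I (extChartAt I x).symm u := by
  have h1 := contMDiffOn_extChartAt_symm (I := I) (n := ∞) x
  exact (h1.contMDiffAt ((isOpen_extChartAt_target x).mem_nhds hu)).mdifferentiableAt (by simp)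

theorem fderiv_writtenInExtChartAt_apply {f : M' → M} {x y : M'}
    (hy : y ∈ (extChartAt J x).source) (hfy : f y ∈ (extChartAt I (f x)).source)
    (hf : MDifferentiableAt J I f y) (v : TangentSpace J y) :
    fderiv ℝ (writtenInExtChartAt J I x f) (extChartAt J x y)
      (mfderiv J 𝓘(ℝ, E') (extChartAt J x) y v) =
    mfderiv I 𝓘(ℝ, E) (extChartAt I (f x)) (f y) (mfderiv J I f y v) := by
  have := IsManifold.of_le (I := I) (M := M) (m := 1) (n := ∞) (by simp)
  have := IsManifold.of_le (I := J) (M := M') (m := 1) (n := ∞) (by simp)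
  have hinv := (extChartAt J x).left_inv hy
  have hsymm := mdifferentiableAt_extChartAt_symm x ((extChartAt J x).map_source hy)
  have h1 : MDifferentiableAt I 𝓘(ℝ, E) (extChartAt I (f x)) (f y) :=
    mdifferentiableAt_extChartAt (by rwa [← extChartAt_source (I := I)])
  have h2 : MDifferentiableAt J 𝓘(ℝ, E') (extChartAt J x) y :=
    mdifferentiableAt_extChartAt (by rwa [← extChartAt_source (I := J)])
  have h3 : MDifferentiableAt 𝓘(ℝ, E') 𝓘(ℝ, E) (writtenInExtChartAt J I x f)
      (extChartAt J x y) := by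
    refine MDifferentiableAt.comp_of_eq (I' := I) (f := f ∘ (extChartAt J x).symm) _ h1 ?_ ?_
    · exact MDifferentiableAt.comp_of_eq _ hf hsymm hinv
    · exact congrArg f hinv
  have h4 := mfderiv_comp_apply y h3 h2 v
  have h5 := mfderiv_comp_apply y h1 hf v
  have h6 : (writtenInExtChartAt J I x f) ∘ (extChartAt J x) =ᶠ[nhds y]
      (extChartAt I (f x)) ∘ f := by
    filter_upwards [(isOpen_extChartAt_source x).mem_nhds hy] with z hz
    simp only [writtenInExtChartAt, Function.comp_apply, (extChartAt J x).left_inv hz]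
  rw [h6.mfderiv_eq] at h4
  rw [mfderiv_eq_fderiv] at h4
  exact h4.symm.trans h5

theorem rep_pullback {k : ℕ} {f : M' → M} {x : M'} (hf : ContMDiffAt J I ∞ f x)
    (φ : DForm I M k) :
    rep x (pullback (J := J) f φ) =ᶠ[nhds (extChartAt J x x)] fun u =>
      (rep (f x) φ (writtenInExtChartAt J I x f u)).compContinuousLinearMap
        (fderiv ℝ (writtenInExtChartAt J I x f) u) := by
  have := IsManifold.of_le (I := I) (M := M) (m := 1) (n := ∞) (by simp)
  have := IsManifold.of_le (I := J) (M := M') (m := 1) (n := ∞) (by simp)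
  have h1 : ∀ᶠ y in nhds x, MDifferentiableAt J I f y := by
    have h2 := (contMDiffAt_iff_contMDiffAt_nhds (n := 1) (by simp)).1 (hf.of_le (by simp))
    exact h2.mono fun y hy => hy.mdifferentiableAt (by simp)
  have h2 : ∀ᶠ y in nhds x, f y ∈ (extChartAt I (f x)).source :=
    hf.continuousAt.eventually (extChartAt_source_mem_nhds (f x))
  have h3 : Filter.Tendsto (extChartAt J x).symm (nhds (extChartAt J x x)) (nhds x) := by
    have := continuousAt_extChartAt_symm (I := J) x
    rwa [ContinuousAt, extChartAt_to_inv] at this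
  filter_upwards [h3.eventually h1, h3.eventually h2, extChartAt_target_mem_nhds x] with u hu1 hu2 hu
  ext v
  have hy := (extChartAt J x).map_target hu
  have h4 := rep_apply_extChartAt (f x) φ hu2 (fun a => mfderiv J I f ((extChartAt J x).symm u)
    (mfderiv 𝓘(ℝ, E') J (extChartAt J x).symm u (v a)))
  refine h4.symm.trans ?_
  refine congrArg (rep (f x) φ (writtenInExtChartAt J I x f u)) (funext fun a => ?_)
  have h5 := fderiv_writtenInExtChartAt_apply hy hu2 hu1
    (mfderiv 𝓘(ℝ, E') J (extChartAt J x).symm u (v a))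
  rw [(extChartAt J x).right_inv hu] at h5
  refine h5.symm.trans ?_
  exact congrArg _ (mfderiv_extChartAt_apply x hu (v a))

theorem SmoothAt.pullback [FiniteDimensional ℝ E] [FiniteDimensional ℝ E'] {k : ℕ} {f : M' → M}
    {x : M'} (hf : ContMDiffAt J I ∞ f x) {φ : DForm I M k} (hφ : SmoothAt φ (f x)) :
    SmoothAt (BacklundEDS.pullback (J := J) f φ) x := by
  have hF := contDiffAt_writtenInExtChartAt hf
  refine ContDiffAt.congr_of_eventuallyEq ?_ (rep_pullback hf φ)
  refine contDiffAt_alternating fun v => ?_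
  refine contDiffAt_alternating_apply
    (f := fun u => rep (f x) φ (writtenInExtChartAt J I x f u))
    (w := fun a u => fderiv ℝ (writtenInExtChartAt J I x f) u (v a)) ?_ fun a => ?_
  · refine ContDiffAt.comp (g := rep (f x) φ) _ ?_ hF
    rw [writtenInExtChartAt_self]
    exact hφ
  · exact (hF.fderiv_right (m := ∞) (by simp)).clm_apply contDiffAt_const

theorem extd_pullback {k : ℕ} {f : M' → M} {x : M'} (hf : ContMDiffAt J I ∞ f x) {φ : DForm I M k}
    (hφ : SmoothAt φ (f x)) :
    extd (pullback (J := J) f φ) x = pullback (J := J) f (extd φ) x := by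
  have hF := contDiffAt_writtenInExtChartAt hf
  have h1 := (rep_pullback hf φ).extDeriv_eq
  have h2 : DifferentiableAt ℝ (rep (f x) φ)
      (writtenInExtChartAt J I x f (extChartAt J x x)) := by
    rw [writtenInExtChartAt_self]
    exact hφ.differentiableAt (by simp)
  rw [extDeriv_pullback h2 hF (by
    rw [minSmoothness_of_isRCLikeNormedField]; exact WithTop.coe_le_coe.2 (le_top : (2 : ℕ∞) ≤ ⊤)),
    writtenInExtChartAt_self] at h1
  ext v
  refine (congrArg (fun ψ : E' [⋀^Fin (k + 1)]→L[ℝ] ℝ => ψ (fun a =>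
    mfderiv J 𝓘(ℝ, E') (extChartAt J x) x (v a))) h1).trans ?_
  refine congrArg (extDeriv (rep (f x) φ) (extChartAt I (f x) (f x))) (funext fun a => ?_)
  exact fderiv_writtenInExtChartAt_apply (mem_extChartAt_source x) (mem_extChartAt_source (f x))
    (hf.mdifferentiableAt (by simp)) (v a)

end Pullback

section ModelSpace

variable {E : Type*} [NormedAddCommGroup E] [NormedSpace ℝ E]

theorem rep_model_space {k : ℕ} (u : E) (φ : DForm 𝓘(ℝ, E) E k) :
    rep u φ = fun y => (φ y : E [⋀^Fin k]→L[ℝ] ℝ) := by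
  funext y
  ext v
  have key : ∀ f : E → E, f = id → φ (f y) (fun a => mfderiv 𝓘(ℝ, E) 𝓘(ℝ, E) f y (v a)) =
      φ y v := by
    rintro _ rfl
    refine congrArg (φ y) (funext fun a => ?_)
    exact DFunLike.congr_fun (mfderiv_id (I := 𝓘(ℝ, E)) (x := y)) (v a)
  exact key _ (by rw [extChartAt_model_space_eq_id]; rfl)

theorem extd_model_space {k : ℕ} (φ : DForm 𝓘(ℝ, E) E k) (u : E) :
    extd φ u = extDeriv (fun y => (φ y : E [⋀^Fin k]→L[ℝ] ℝ)) u := by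
  ext v
  have key : ∀ f : E → E, f = id → ∀ ψ : E → E [⋀^Fin k]→L[ℝ] ℝ, extDeriv ψ (f u)
      (fun a => mfderiv 𝓘(ℝ, E) 𝓘(ℝ, E) f u (v a)) = extDeriv ψ u v := by
    rintro _ rfl ψ
    refine congrArg (extDeriv ψ u) (funext fun a => ?_)
    exact DFunLike.congr_fun (mfderiv_id (I := 𝓘(ℝ, E)) (x := u)) (v a)
  refine (key (extChartAt 𝓘(ℝ, E) u) (by rw [extChartAt_model_space_eq_id]; rfl)
    (rep u φ)).trans ?_
  rw [rep_model_space]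
  rfl

theorem extDeriv_covector_apply (η : E → E [⋀^Fin 1]→L[ℝ] ℝ) (u v w : E) :
    extDeriv η u ![v, w] = fderiv ℝ η u v (fun _ => w) - fderiv ℝ η u w (fun _ => v) := by
  rw [extDeriv, ContinuousAlternatingMap.alternatizeUncurryFin_apply, Fin.sum_univ_two]
  have h0 : Fin.removeNth 0 ![v, w] = fun _ : Fin 1 => w := by
    ext i; fin_cases i; rfl
  have h1 : Fin.removeNth 1 ![v, w] = fun _ : Fin 1 => v := by
    ext i; fin_cases i; rfl
  rw [h0, h1]
  simp [sub_eq_add_neg]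

theorem extDeriv_smul_covector_apply {h : E → ℝ} {η : E → E [⋀^Fin 1]→L[ℝ] ℝ} {u : E}
    (hh : DifferentiableAt ℝ h u) (hη : DifferentiableAt ℝ η u) (v w : E) :
    extDeriv (fun y => h y • η y) u ![v, w] = h u * extDeriv η u ![v, w] +
      (fderiv ℝ h u v * η u (fun _ => w) - fderiv ℝ h u w * η u (fun _ => v)) := by
  rw [extDeriv_covector_apply, extDeriv_covector_apply, fderiv_fun_smul hh hη]
  simp only [add_apply, smul_apply,
    ContinuousLinearMap.smulRight_apply, ContinuousAlternatingMap.add_apply,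
    ContinuousAlternatingMap.smul_apply, smul_eq_mul]
  ring

/-- The coordinate `1`-form on the real line. -/
def lineForm : DForm 𝓘(ℝ, ℝ) ℝ 1 := fun _ =>
  ContinuousAlternatingMap.ofSubsingleton ℝ ℝ ℝ (0 : Fin 1) (ContinuousLinearMap.id ℝ ℝ)

theorem smoothAt_lineForm (t : ℝ) : SmoothAt lineForm t := by
  unfold SmoothAt
  rw [rep_model_space]
  exact contDiffAt_const

theorem extd_lineForm (t : ℝ) : extd lineForm t = 0 := by
  rw [extd_model_space]
  have h : extDeriv (fun y : ℝ => (lineForm y : ℝ [⋀^Fin 1]→L[ℝ] ℝ)) t = 0 := by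
    let L : ℝ → ℝ [⋀^Fin 1]→L[ℝ] ℝ := fun _ =>
      ContinuousAlternatingMap.ofSubsingleton ℝ ℝ ℝ (0 : Fin 1) (ContinuousLinearMap.id ℝ ℝ)
    have h1 : fderiv ℝ L t = 0 := fderiv_const_apply _
    refine ContinuousAlternatingMap.ext fun v => ?_
    have hv : v = ![v 0, v 1] := by ext i; fin_cases i <;> rfl
    have h2 := extDeriv_covector_apply L t (v 0) (v 1)
    rw [← hv] at h2
    refine h2.trans ?_
    have h3 := fun a b : ℝ => DFunLike.congr_fun (DFunLike.congr_fun h1 a) (fun _ => b)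
    exact (congrArg₂ (· - ·) (h3 _ _) (h3 _ _)).trans (sub_zero 0)
  exact h

end ModelSpace

section ExteriorDerivative

variable {E : Type*} [NormedAddCommGroup E] [NormedSpace ℝ E]
  {H : Type*} [TopologicalSpace H] {I : ModelWithCorners ℝ E H}
  {M : Type*} [TopologicalSpace M] [ChartedSpace H M]

theorem extd_apply {k : ℕ} (φ : DForm I M k) (x : M) (v : Fin (k + 1) → TangentSpace I x) :
    extd φ x v = extDeriv (rep x φ) (extChartAt I x x)
      (fun a => mfderiv I 𝓘(ℝ, E) (extChartAt I x) x (v a)) := rfl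

theorem extd_congr {k : ℕ} {φ ψ : DForm I M k} {x : M} (h : ∀ᶠ y in nhds x, φ y = ψ y) :
    extd φ x = extd ψ x := by
  ext v
  rw [extd_apply, extd_apply, (rep_eventuallyEq h).extDeriv_eq]

theorem extd_add {k : ℕ} {φ ψ : DForm I M k} {x : M} (hφ : SmoothAt φ x) (hψ : SmoothAt ψ x) :
    extd (φ + ψ) x = extd φ x + extd ψ x := by
  ext v
  rw [ContinuousAlternatingMap.add_apply, extd_apply, extd_apply, extd_apply, rep_add,
    extDeriv_add (hφ.differentiableAt (by simp)) (hψ.differentiableAt (by simp))]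
  rfl

theorem extd_zero {k : ℕ} (x : M) : extd (0 : DForm I M k) x = 0 := by
  have h := extd_add (smoothAt_zero (I := I) (k := k) (x := x)) smoothAt_zero
  rw [add_zero] at h
  simpa using h

theorem dfun_eq_pullback (f : M → ℝ) : dfun (I := I) f = pullback (J := I) f lineForm := by
  funext x
  ext v
  rfl

variable [I.Boundaryless] [IsManifold I ∞ M]

theorem extd_smul_apply {φ : DForm I M 1} {f : M → ℝ} {x : M}
    (hf : ContMDiffAt I 𝓘(ℝ, ℝ) ∞ f x) (hφ : SmoothAt φ x) :
    ∃ D : TangentSpace I x → ℝ, ∀ v w, extd (fun y => f y • φ y) x ![v, w] =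
      f x * extd φ x ![v, w] + (D v * φ x (fun _ => w) - D w * φ x (fun _ => v)) := by
  let h := f ∘ (extChartAt I x).symm
  let d := mfderiv I 𝓘(ℝ, E) (extChartAt I x) x
  refine ⟨fun v => fderiv ℝ h (extChartAt I x x) (d v), fun v w => ?_⟩
  have h1 := extDeriv_smul_covector_apply (h := h) (η := rep x φ) (u := extChartAt I x x)
    ((contMDiffAt_comp_extChartAt_symm hf).differentiableAt (by simp))
    (hφ.differentiableAt (by simp)) (d v) (d w)
  have h2 : ∀ a b : TangentSpace I x, (fun i => d (![a, b] i)) = ![d a, d b] := by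
    intro a b; ext i; fin_cases i <;> rfl
  have h3 : h (extChartAt I x x) = f x := by simp [h]
  have h4 : ∀ a : TangentSpace I x, rep x φ (extChartAt I x x) (fun _ => d a) = φ x fun _ => a :=
    fun a => rep_apply_extChartAt x φ (mem_extChartAt_source x) fun _ => a
  rw [extd_apply, extd_apply, ← h4, ← h4, ← h3]
  refine (congrArg _ (h2 v w)).trans (h1.trans ?_)
  exact congrArg (fun z => h (extChartAt I x x) * extDeriv (rep x φ) (extChartAt I x x) z + _)
    (h2 v w).symm

/-- If a smooth `1`-form is pointwise a multiple of a nonvanishing one, then it is a smooth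
multiple of it. -/
theorem exists_smooth_ratio {φ η : DForm I M 1} {x : M} (hφ : SmoothAt φ x) (hη : SmoothAt η x)
    (hx : η x ≠ 0) (h : ∀ᶠ y in nhds x, ∃ r : ℝ, φ y = r • η y) :
    ∃ f : M → ℝ, ContMDiffAt I 𝓘(ℝ, ℝ) ∞ f x ∧ ∀ᶠ y in nhds x, φ y = f y • η y := by
  obtain ⟨b, hb⟩ : ∃ b : E, rep x η (extChartAt I x x) (fun _ => b) ≠ 0 := by
    by_contra hcon
    push Not at hcon
    refine hx (covector_ext fun v => ?_)
    rw [← rep_apply_extChartAt x η (mem_extChartAt_source x) fun _ => v]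
    exact hcon _
  have happ : ∀ {ψ : DForm I M 1}, SmoothAt ψ x →
      ContDiffAt ℝ ∞ (fun u => rep x ψ u (fun _ => b)) (extChartAt I x x) := fun {ψ} hψ =>
    ContDiffAt.comp (g := ContinuousAlternatingMap.apply ℝ E ℝ fun _ => b) _
      (ContinuousLinearMap.contDiff _).contDiffAt hψ
  have hne : ∀ᶠ u in nhds (extChartAt I x x), rep x η u (fun _ => b) ≠ 0 :=
    (happ hη).continuousAt.eventually_ne hb
  refine ⟨fun y => rep x φ (extChartAt I x y) (fun _ => b) /
    rep x η (extChartAt I x y) (fun _ => b), ?_, ?_⟩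
  · exact ContMDiffAt.of_comp_extChartAt (h := fun u => rep x φ u (fun _ => b) /
      rep x η u (fun _ => b)) ((happ hφ).div (happ hη) hb) (Filter.Eventually.of_forall fun _ => rfl)
  · filter_upwards [h, extChartAt_source_mem_nhds (I := I) x,
      (continuousAt_extChartAt (I := I) x).eventually hne] with y hy hsrc hy0
    obtain ⟨r, hr⟩ := hy
    have h1 : ∀ z, z = y → φ z = r • η z := by rintro z rfl; exact hr
    have h2 : rep x φ (extChartAt I x y) (fun _ => b) =
        r * rep x η (extChartAt I x y) (fun _ => b) := by
      rw [rep_apply, rep_apply, h1 _ ((extChartAt I x).left_inv hsrc)]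
      rfl
    rw [h2, mul_div_assoc, div_self hy0, mul_one, hr]

theorem smoothAt_extd {k : ℕ} {φ : DForm I M k} {x : M} (h : ∀ᶠ y in nhds x, SmoothAt φ y) :
    SmoothAt (extd φ) x := by
  have h1 : Filter.Tendsto (extChartAt I x).symm (nhds (extChartAt I x x)) (nhds x) := by
    have := continuousAt_extChartAt_symm (I := I) x
    rwa [ContinuousAt, extChartAt_to_inv] at this
  have h2 : rep x (extd φ) =ᶠ[nhds (extChartAt I x x)] extDeriv (rep x φ) := by
    filter_upwards [h1.eventually h, extChartAt_target_mem_nhds x] with u hu hu'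
    have h3 : ContMDiffAt 𝓘(ℝ, E) I ∞ (extChartAt I x).symm u :=
      (contMDiffOn_extChartAt_symm x).contMDiffAt ((isOpen_extChartAt_target x).mem_nhds hu')
    have h4 := extd_pullback (J := 𝓘(ℝ, E)) h3 hu
    rw [extd_model_space] at h4
    exact h4.symm
  refine ContDiffAt.congr_of_eventuallyEq ?_ h2
  have h5 : ContDiffAt ℝ ∞ (fderiv ℝ (rep x φ)) (extChartAt I x x) :=
    ContDiffAt.fderiv_right (h.self_of_nhds : ContDiffAt ℝ ∞ (rep x φ) _) (m := ∞) (by simp)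
  exact ((ContinuousAlternatingMap.alternatizeUncurryFinCLM ℝ E ℝ).contDiff.contDiffAt).comp _ h5

theorem SmoothOn.extd {k : ℕ} {φ : DForm I M k} {U : Set M} (hU : IsOpen U) (h : SmoothOn φ U) :
    SmoothOn (BacklundEDS.extd φ) U := fun _ hx =>
  smoothAt_extd (Filter.mem_of_superset (hU.mem_nhds hx) h)

theorem smoothAt_dfun [FiniteDimensional ℝ E] {f : M → ℝ} {x : M} (hf : ContMDiffAt I 𝓘(ℝ, ℝ) ∞ f x) :
    SmoothAt (dfun (I := I) f) x := by
  rw [dfun_eq_pullback]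
  exact SmoothAt.pullback hf (smoothAt_lineForm _)

theorem extd_dfun {f : M → ℝ} {x : M} (hf : ContMDiffAt I 𝓘(ℝ, ℝ) ∞ f x) :
    extd (dfun (I := I) f) x = 0 := by
  rw [dfun_eq_pullback, extd_pullback hf (smoothAt_lineForm _)]
  ext v
  have := extd_lineForm (f x)
  simp only [pullback, this]
  rfl

end ExteriorDerivative

section PointIdeals

variable {V : Type*} [AddCommGroup V] [Module ℝ V] [TopologicalSpace V]
  {ι : Type*} [Fintype ι] {c : ι → V [⋀^Fin 1]→L[ℝ] ℝ} {e : ι → V} {g : ι → Option Bool}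

theorem ptIdeal_of_isCharForm [DecidableEq ι] [FiniteDimensional ℝ V]
    (hcard : Fintype.card ι = Module.finrank ℝ V) (h : IsDual c e)
    {S : Set (Σ k : ℕ, V [⋀^Fin k]→L[ℝ] ℝ)} (h1 : ∀ i, g i = none → PtIdeal S 1 (c i))
    (h2 : ∀ i j, g i = g j → PtIdeal S 2 (wedge (c i) (c j))) {k : ℕ} {φ : V [⋀^Fin k]→L[ℝ] ℝ}
    (hφ : IsCharForm c g φ) : PtIdeal S k φ := by
  refine mem_of_isCharForm (X := Unit) (E := fun _ => V) (U := Set.univ) (c := fun i _ => c i)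
    (e := fun i _ => e i) (g := g) (Sm := fun _ _ => True)
    (J := fun k φ => PtIdeal S k (φ ()))
    (fun _ _ => h.expand hcard) (fun _ _ i j hij => (h i j).trans (if_neg hij))
    (fun _ _ _ => .add) (fun _ => .zero) (fun _ _ i hφ => .mul hφ _)
    (fun _ _ _ _ _ hφ _ => hφ.smul _) (fun _ _ r hφ => hφ.smul r) ?_ (fun _ _ _ _ => trivial) h1 h2
    k (φ := fun _ : Unit => φ) trivial (fun _ _ => hφ :
      ∀ x ∈ Set.univ, IsCharForm (fun i => (fun i _ => c i) i x) g ((fun _ : Unit => φ) x))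
  intro k φ ψ hφ hψ
  rw [← hψ () trivial]
  exact hφ

end PointIdeals

section AlgebraicIdeals

variable {E : Type*} [NormedAddCommGroup E] [NormedSpace ℝ E]
  {H : Type*} [TopologicalSpace H] {I : ModelWithCorners ℝ E H}
  {M : Type*} [TopologicalSpace M] [ChartedSpace H M]
  {E' : Type*} [NormedAddCommGroup E'] [NormedSpace ℝ E']
  {H' : Type*} [TopologicalSpace H'] {J : ModelWithCorners ℝ E' H'}
  {M' : Type*} [TopologicalSpace M'] [ChartedSpace H' M']
  {E'' : Type*} [NormedAddCommGroup E''] [NormedSpace ℝ E'']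
  {H'' : Type*} [TopologicalSpace H''] {K : ModelWithCorners ℝ E'' H''}
  {M'' : Type*} [TopologicalSpace M''] [ChartedSpace H'' M'']
  {U U' : Set M} {S T : Set (GForm I M)} {k : ℕ} {φ : DForm I M k}

theorem AlgIdeal.mono (hU : U' ⊆ U) (h : AlgIdeal U S k φ) : AlgIdeal U' S k φ := by
  induction h with
  | gen h => exact .gen h
  | zero => exact .zero
  | add _ _ h1 h2 => exact .add h1 h2
  | mul _ α hα h => exact .mul h α fun x hx => hα x (hU hx)
  | congr _ h1 h => exact .congr h fun x hx => h1 x (hU hx)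

theorem AlgIdeal.trans (hST : ∀ s ∈ S, AlgIdeal U T s.1 s.2) (h : AlgIdeal U S k φ) :
    AlgIdeal U T k φ := by
  induction h with
  | gen h => exact hST _ h
  | zero => exact .zero
  | add _ _ h1 h2 => exact .add h1 h2
  | mul _ α hα h => exact .mul h α hα
  | congr _ h1 h => exact .congr h h1

theorem AlgIdeal.ptIdeal (h : AlgIdeal U S k φ) {x : M} (hx : x ∈ U) :
    PtIdeal ((fun s : GForm I M => (⟨s.1, s.2 x⟩ : Σ k : ℕ, TangentSpace I x [⋀^Fin k]→L[ℝ] ℝ)) '' S)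
      k (φ x) := by
  induction h with
  | gen h => exact .gen ⟨_, h, rfl⟩
  | zero => exact .zero
  | add _ _ h1 h2 => exact .add h1 h2
  | mul _ α hα h => exact .mul h _
  | congr _ h1 h => rw [← h1 x hx]; exact h

theorem AlgIdeal.vanish (h : AlgIdeal U S k φ) {x : M} (hx : x ∈ U)
    {F : ∀ k : ℕ, Set (Fin k → TangentSpace I x)}
    (hF : ∀ {k m : ℕ} (v : Fin k → TangentSpace I x), v ∈ F k → ∀ f : Fin m → Fin k,
      Function.Injective f → v ∘ f ∈ F m)
    (hS : ∀ s ∈ S, ∀ v ∈ F s.1, s.2 x v = 0) : ∀ v ∈ F k, φ x v = 0 :=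
  (h.ptIdeal hx).vanish hF (by rintro _ ⟨s, hs, rfl⟩; exact hS s hs)

theorem AlgIdeal.isCharForm (h : AlgIdeal U S k φ) {x : M} (hx : x ∈ U) {ι : Type*}
    {c : ι → TangentSpace I x [⋀^Fin 1]→L[ℝ] ℝ} {g : ι → Option Bool}
    (hS : ∀ s ∈ S, IsCharForm c g (s.2 x)) : IsCharForm c g (φ x) :=
  h.vanish hx charTuples_comp hS

/-- A function as a `0`-form. -/
def funForm (f : M → ℝ) : DForm I M 0 := fun x =>
  ContinuousAlternatingMap.constOfIsEmpty ℝ (TangentSpace I x) (Fin 0) (f x)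

theorem wedgeF_funForm (φ : DForm I M k) (f : M → ℝ) :
    wedgeF φ (funForm (I := I) f) = fun x => f x • φ x := by
  funext x
  exact wedge_zero_form (φ x) (funForm (I := I) f x)

theorem pullbackSet_comp {f : M' → M} {h : M'' → M'} (hf : MDifferentiable J I f)
    (hh : MDifferentiable K J h) (S : Set (GForm I M)) :
    pullbackSet (J := K) (f ∘ h) S = pullbackSet h (pullbackSet (J := J) f S) := by
  have key : ∀ (k : ℕ) (φ : DForm I M k), pullback (J := K) (f ∘ h) φ =
      pullback h (pullback (J := J) f φ) := fun k φ =>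
    funext fun x => pullback_comp (hf _) (hh _) φ
  ext s
  constructor
  · rintro ⟨t, ht, rfl⟩
    exact ⟨⟨t.1, pullback f t.2⟩, ⟨t, ht, rfl⟩, by rw [key]⟩
  · rintro ⟨_, ⟨t, ht, rfl⟩, rfl⟩
    exact ⟨t, ht, by rw [key]⟩

theorem pullback_union (f : M' → M) (S T : Set (GForm I M)) :
    pullbackSet (J := J) f (S ∪ T) = pullbackSet f S ∪ pullbackSet f T := by
  ext s
  constructor
  · rintro ⟨t, ht | ht, rfl⟩
    · exact Or.inl ⟨t, ht, rfl⟩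
    · exact Or.inr ⟨t, ht, rfl⟩
  · rintro (⟨t, ht, rfl⟩ | ⟨t, ht, rfl⟩)
    · exact ⟨t, Or.inl ht, rfl⟩
    · exact ⟨t, Or.inr ht, rfl⟩

variable [FiniteDimensional ℝ E] [I.Boundaryless] [IsManifold I ∞ M]

theorem smoothAt_funForm {f : M → ℝ} {x : M} (hf : ContMDiffAt I 𝓘(ℝ, ℝ) ∞ f x) :
    SmoothAt (funForm (I := I) f) x :=
  contDiffAt_alternating fun _ =>
    (contMDiffAt_comp_extChartAt_symm hf : ContDiffAt ℝ ∞ (f ∘ (extChartAt I x).symm) _)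

theorem AlgIdeal.smul (h : AlgIdeal U S k φ) {f : M → ℝ}
    (hf : ∀ x ∈ U, ContMDiffAt I 𝓘(ℝ, ℝ) ∞ f x) : AlgIdeal U S k (fun x => f x • φ x) := by
  have := AlgIdeal.mul h (funForm f) fun x hx => smoothAt_funForm (hf x hx)
  rwa [wedgeF_funForm] at this

theorem AlgIdeal.sum {ι : Type*} (s : Finset ι) {φ : ι → DForm I M k}
    (h : ∀ i ∈ s, AlgIdeal U S k (φ i)) : AlgIdeal U S k (fun x => ∑ i ∈ s, φ i x) := by
  classical
  induction s using Finset.induction_on with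
  | empty => exact .zero
  | insert a s ha ih =>
    simp only [Finset.sum_insert ha]
    exact .add (h a (Finset.mem_insert_self a s))
      (ih fun i hi => h i (Finset.mem_insert_of_mem hi))

theorem AlgIdeal.smoothOn (hU : IsOpen U) (hS : ∀ s ∈ S, SmoothOn s.2 U) (h : AlgIdeal U S k φ) :
    SmoothOn φ U := by
  induction h with
  | gen h => exact hS _ h
  | zero => exact fun x _ => smoothAt_zero
  | add _ _ h1 h2 => exact fun x hx => (h1 x hx).add (h2 x hx)
  | mul _ α hα h => exact fun x hx => (h x hx).wedgeF (hα x hx)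
  | congr _ h1 h =>
    exact fun x hx => (h x hx).congr (Filter.mem_of_superset (hU.mem_nhds hx) h1)

variable [FiniteDimensional ℝ E'] [J.Boundaryless] [IsManifold J ∞ M']

theorem AlgIdeal.pullback {f : M' → M} {W : Set M'} (hf : ∀ x ∈ W, ContMDiffAt J I ∞ f x)
    (hW : ∀ x ∈ W, f x ∈ U) (h : AlgIdeal U S k φ) :
    AlgIdeal W (pullbackSet (J := J) f S) k (BacklundEDS.pullback f φ) := by
  induction h with
  | gen h => exact .gen ⟨_, h, rfl⟩
  | zero => exact .zero
  | add _ _ h1 h2 => exact .add h1 h2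
  | mul _ α hα h =>
    rw [pullback_wedgeF]
    exact .mul h _ fun x hx => SmoothAt.pullback (hf x hx) (hα _ (hW x hx))
  | congr _ h1 h =>
    refine .congr h fun x hx => ?_
    simp only [BacklundEDS.pullback]
    rw [h1 _ (hW x hx)]

section Frames

variable {ι : Type*} [Fintype ι] [DecidableEq ι] {c : ι → DForm I M 1}

theorem IsFrameOn.exists_isDual (hcard : Fintype.card ι = Module.finrank ℝ E)
    (hc : IsFrameOn c U) : ∃ e : ι → ∀ x : M, TangentSpace I x,
      ∀ x ∈ U, IsDual (fun i => c i x) (fun i => e i x) := by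
  have h : ∀ x : M, ∃ e : ι → TangentSpace I x, x ∈ U → IsDual (fun i => c i x) e := by
    intro x
    by_cases hx : x ∈ U
    · have key : ∀ c' : ι → E [⋀^Fin 1]→L[ℝ] ℝ, LinearIndependent ℝ c' →
          ∃ e : ι → E, IsDual c' e := fun c' h => BacklundEDS.exists_isDual hcard h
      obtain ⟨e, he⟩ := key (fun i => c i x) (hc.2 x hx)
      exact ⟨e, fun _ => he⟩
    · exact ⟨fun _ => 0, fun h => absurd h hx⟩
  choose e he using h
  exact ⟨fun i x => e x i, he⟩

variable {e : ι → ∀ x : M, TangentSpace I x}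

theorem SmoothOn.coeff (hU : IsOpen U) (hcard : Fintype.card ι = Module.finrank ℝ E)
    (hc : ∀ i, SmoothOn (c i) U) (he : ∀ x ∈ U, IsDual (fun i => c i x) (fun i => e i x))
    (hφ : SmoothOn φ U) (A : Fin k → ι) :
    ∀ x ∈ U, ContMDiffAt I 𝓘(ℝ, ℝ) ∞ (fun y => φ y (fun a => e (A a) y)) x := fun x hx =>
  SmoothAt.coeff hcard (fun i => hc i x hx) (Filter.mem_of_superset (hU.mem_nhds hx) he)
    (hφ x hx) A

theorem SmoothOn.of_coeff (hU : IsOpen U) (hcard : Fintype.card ι = Module.finrank ℝ E)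
    (hc : ∀ i, SmoothOn (c i) U) (he : ∀ x ∈ U, IsDual (fun i => c i x) (fun i => e i x))
    (hφ : ∀ A : Fin k → ι, ∀ x ∈ U,
      ContMDiffAt I 𝓘(ℝ, ℝ) ∞ (fun y => φ y (fun a => e (A a) y)) x) : SmoothOn φ U := fun x hx =>
  SmoothAt.of_coeff hcard (fun i => hc i x hx) (Filter.mem_of_superset (hU.mem_nhds hx) he)
    fun A => hφ A x hx

/-- A smooth form with values in the ideal generated by the `c i` with `g i = none` and the
`c i ∧ c j` with `g i = g j` lies in every algebraic ideal containing these generators. -/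
theorem algIdeal_of_isCharForm (hU : IsOpen U) (hcard : Fintype.card ι = Module.finrank ℝ E)
    (hc : IsFrameOn c U) {g : ι → Option Bool} (h1 : ∀ i, g i = none → AlgIdeal U S 1 (c i))
    (h2 : ∀ i j, g i = g j → AlgIdeal U S 2 (wedgeF (c i) (c j))) (hφ : SmoothOn φ U)
    (hg : ∀ x ∈ U, IsCharForm (fun i => c i x) g (φ x)) : AlgIdeal U S k φ := by
  obtain ⟨e, he⟩ := hc.exists_isDual hcard
  have hexp : ∀ x ∈ U, ∀ v : TangentSpace I x, v = ∑ i, c i x (fun _ => v) • e i x :=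
    fun x hx => IsDual.expand (V := E) hcard (he x hx)
  refine mem_of_isCharForm (X := M) (E := fun x => TangentSpace I x) (U := U) (c := c) (e := e) (g := g)
    (Sm := fun k φ => SmoothOn (I := I) (M := M) φ U)
    (J := fun k φ => AlgIdeal (I := I) (M := M) U S k φ)
    hexp (fun x hx i j hij => (he x hx i j).trans (if_neg hij))
    (fun _ _ _ => .add) (fun _ => .zero) (fun _ _ i hφ => .mul hφ _ (hc.1 i)) ?_
    (fun _ _ r hφ => AlgIdeal.smul (I := I) (M := M) hφ fun x _ => contMDiffAt_const)
    (fun _ _ _ => .congr) ?_ h1 h2 k (φ := φ) hφ hg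
  · intro k φ m ψ A hφ hψ
    exact AlgIdeal.smul (I := I) (M := M) hφ (SmoothOn.coeff hU hcard hc.1 he hψ A)
  · intro k φ i hφ
    refine SmoothOn.of_coeff (I := I) (M := M) hU hcard hc.1 he fun A x hx => ?_
    refine (SmoothOn.coeff hU hcard hc.1 he hφ (Fin.snoc A i : Fin (k + 1) → ι) x hx).congr_of_eventuallyEq
      (Filter.Eventually.of_forall fun y => ?_)
    refine congrArg (φ y) (funext fun a => ?_)
    refine Fin.lastCases ?_ (fun a => ?_) a <;> simp

end Frames

end AlgebraicIdeals

section SpanOfCovectors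

variable {V : Type*} [AddCommGroup V] [Module ℝ V] [TopologicalSpace V] [FiniteDimensional ℝ V]

/-- A covector that vanishes wherever all members of a set of covectors do lies in its span. -/
theorem mem_span_of_vanish [IsTopologicalAddGroup V] {T : Set (V [⋀^Fin 1]→L[ℝ] ℝ)}
    {φ : V [⋀^Fin 1]→L[ℝ] ℝ}
    (h : ∀ v, (∀ τ ∈ T, τ (fun _ => v) = 0) → φ (fun _ => v) = 0) : φ ∈ Submodule.span ℝ T := by
  let D : V [⋀^Fin 1]→L[ℝ] ℝ →ₗ[ℝ] Module.Dual ℝ V :=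
    { toFun := fun τ => (covec τ).toLinearMap
      map_add' := fun _ _ => rfl
      map_smul' := fun _ _ => rfl }
  have hD : Function.Injective D := fun α β hαβ =>
    covector_ext fun v => LinearMap.congr_fun hαβ v
  have h1 : D φ ∈ (((Submodule.span ℝ T).map D).dualCoannihilator).dualAnnihilator := by
    rw [Submodule.mem_dualAnnihilator]
    intro v hv
    rw [Submodule.mem_dualCoannihilator] at hv
    exact h v fun τ hτ => hv (D τ) (Submodule.mem_map_of_mem (Submodule.subset_span hτ))
  rw [Subspace.dualCoannihilator_dualAnnihilator_eq] at h1
  obtain ⟨ψ, hψ, h2⟩ := h1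
  rwa [← hD h2]

end SpanOfCovectors

theorem vanish_of_mem_span {V : Type*} [AddCommGroup V] [Module ℝ V] [TopologicalSpace V]
    [IsTopologicalAddGroup V]
    {T : Set (V [⋀^Fin 1]→L[ℝ] ℝ)} {φ : V [⋀^Fin 1]→L[ℝ] ℝ} (hφ : φ ∈ Submodule.span ℝ T) {v : V}
    (hv : ∀ τ ∈ T, τ (fun _ => v) = 0) : φ (fun _ => v) = 0 := by
  induction hφ using Submodule.span_induction with
  | mem x hx => exact hv x hx
  | zero => rfl
  | add x y _ _ hx hy => rw [ContinuousAlternatingMap.add_apply, hx, hy, add_zero]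
  | smul a x _ hx => rw [ContinuousAlternatingMap.smul_apply, hx, smul_zero]

section Contact

variable {W : Type*} [AddCommGroup W] [Module ℝ W] [TopologicalSpace W]
  {θ : W [⋀^Fin 1]→L[ℝ] ℝ} {Ω : W [⋀^Fin (1 + 1)]→L[ℝ] ℝ}

/-- `Ω` is nondegenerate on the kernel of `θ`. -/
def Nondegenerate (θ : W [⋀^Fin 1]→L[ℝ] ℝ) (Ω : W [⋀^Fin (1 + 1)]→L[ℝ] ℝ) : Prop :=
  ∀ v, θ (fun _ => v) = 0 → (∀ w, θ (fun _ => w) = 0 → Ω ![v, w] = 0) → v = 0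

theorem two_form_swap (Ω : W [⋀^Fin (1 + 1)]→L[ℝ] ℝ) (v w : W) : Ω ![v, w] = -Ω ![w, v] := by
  have := Ω.map_swap ![w, v] (i := 0) (j := 1) (by decide)
  refine (congrArg Ω ?_).trans this
  ext a; fin_cases a <;> rfl

theorem two_form_self (Ω : W [⋀^Fin (1 + 1)]→L[ℝ] ℝ) (v : W) : Ω ![v, v] = 0 := by
  have := two_form_swap Ω v v
  linarith

theorem two_form_vecCons (Ω : W [⋀^Fin (1 + 1)]→L[ℝ] ℝ) (u : Fin (1 + 1) → W) :
    Ω u = Ω ![u 0, u 1] := by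
  congr 1
  ext a; fin_cases a <;> rfl

theorem finrank_ker_covec_ge [FiniteDimensional ℝ W] (θ : W [⋀^Fin 1]→L[ℝ] ℝ) {n : ℕ}
    (hW : Module.finrank ℝ W = n + 1) :
    n ≤ Module.finrank ℝ (LinearMap.ker (covec θ).toLinearMap) := by
  have h1 := (covec θ).toLinearMap.finrank_range_add_finrank_ker
  have h2 : Module.finrank ℝ (LinearMap.range (covec θ).toLinearMap) ≤ 1 := by
    simpa using Submodule.finrank_le (LinearMap.range (covec θ).toLinearMap)
  omega

theorem finrank_ker_covec [FiniteDimensional ℝ W] {θ : W [⋀^Fin 1]→L[ℝ] ℝ} (hθ : θ ≠ 0) {n : ℕ}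
    (hW : Module.finrank ℝ W = n + 1) :
    Module.finrank ℝ (LinearMap.ker (covec θ).toLinearMap) = n := by
  have h1 := (covec θ).toLinearMap.finrank_range_add_finrank_ker
  have h3 : LinearMap.range (covec θ).toLinearMap = ⊤ := by
    refine LinearMap.range_eq_top.2 (LinearMap.surjective fun h => hθ (covector_ext fun v => ?_))
    exact LinearMap.congr_fun h v
  rw [h3, finrank_top, Module.finrank_self] at h1
  omega

theorem nondegenerate_of_wedge_ne_zero [FiniteDimensional ℝ W] (hW : Module.finrank ℝ W = 5)
    (h : wedge θ (wedge Ω Ω) ≠ 0) : Nondegenerate θ Ω := by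
  intro v hv hΩ
  by_contra hne
  refine h ?_
  have hpair : ∀ u : Fin (1 + 1) → W, (∀ a, θ (fun _ => u a) = 0) → ∀ a, u a = v → Ω u = 0 := by
    intro u hu a ha
    rw [two_form_vecCons]
    fin_cases a
    · rw [show u 0 = v from ha]
      exact hΩ _ (hu 1)
    · rw [show u 1 = v from ha, two_form_swap, hΩ _ (hu 0), neg_zero]
  have hquad : ∀ u : Fin (1 + 1 + (1 + 1)) → W, (∀ a, θ (fun _ => u a) = 0) → ∀ a, u a = v →
      wedge Ω Ω u = 0 := by
    intro u hu a ha
    rw [wedge_apply]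
    refine mul_eq_zero_of_right _ (Finset.sum_eq_zero fun σ _ => ?_)
    obtain ⟨b, rfl⟩ := σ.surjective a
    refine smul_eq_zero_of_right _ ?_
    revert ha
    refine Fin.addCases (fun i hi => ?_) (fun i hi => ?_) b
    · have := hpair (fun i => u (σ (Fin.castAdd (1 + 1) i))) (fun _ => hu _) i hi
      rw [this, zero_mul]
    · have := hpair (fun i => u (σ (Fin.natAdd (1 + 1) i))) (fun _ => hu _) i hi
      rw [this, mul_zero]
  have hquint : ∀ u : Fin (1 + (1 + 1 + (1 + 1))) → W, ∀ i, (∀ a, a ≠ i → θ (fun _ => u a) = 0) →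
      ∀ a, u a = v → wedge θ (wedge Ω Ω) u = 0 := by
    intro u i hu a ha
    rw [wedge_apply]
    refine mul_eq_zero_of_right _ (Finset.sum_eq_zero fun σ _ => smul_eq_zero_of_right _ ?_)
    by_cases h0 : θ (fun j => u (σ (Fin.castAdd _ j))) = 0
    · exact mul_eq_zero_of_left h0 _
    have h0' : θ (fun _ => u (σ (Fin.castAdd _ 0))) ≠ 0 := by
      intro heq
      refine h0 ((congrArg θ (funext fun j => ?_)).trans heq)
      rw [Subsingleton.elim j 0]
    have h1 : σ (Fin.castAdd _ 0) = i := by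
      by_contra hcon
      exact h0' (hu _ hcon)
    obtain ⟨b, rfl⟩ := σ.surjective a
    have h2 : ∃ j, b = Fin.natAdd 1 j := by
      revert ha
      refine Fin.addCases (fun j hj => ?_) (fun j _ => ⟨j, rfl⟩) b
      rw [Subsingleton.elim j 0] at hj
      exact absurd (by rw [hj]; exact hv) h0'
    obtain ⟨j, rfl⟩ := h2
    refine mul_eq_zero_of_right _ (hquad _ (fun l => hu _ fun hl => ?_) j ha)
    have := σ.injective (hl.trans h1.symm)
    have := congrArg Fin.val this
    simp at this
  let K := LinearMap.ker (covec θ).toLinearMap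
  have hK : 4 ≤ Module.finrank ℝ K := finrank_ker_covec_ge θ hW
  have hl1 : LinearIndependent ℝ (fun _ : Fin 1 => (⟨v, hv⟩ : K)) :=
    linearIndependent_unique_iff.2 fun h0 => hne (congrArg Subtype.val h0)
  obtain ⟨x2, hl2⟩ := exists_linearIndependent_cons_of_lt_finrank hl1 (by omega)
  obtain ⟨x3, hl3⟩ := exists_linearIndependent_cons_of_lt_finrank hl2 (by omega)
  obtain ⟨x4, hl4⟩ := exists_linearIndependent_cons_of_lt_finrank hl3 (by omega)
  have hl4' := hl4.map' K.subtype K.ker_subtype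
  obtain ⟨x5, hl5⟩ := exists_linearIndependent_cons_of_lt_finrank hl4' (by omega)
  obtain ⟨x, hx⟩ : ∃ x : Fin 5 → W, x = Fin.cons x5 (K.subtype ∘ Fin.cons x4 (Fin.cons x3
    (Fin.cons x2 fun _ : Fin 1 => (⟨v, hv⟩ : K)))) := ⟨_, rfl⟩
  have hlx : LinearIndependent ℝ x := hx ▸ hl5
  have hx0 : ∀ j, j ≠ 0 → θ (fun _ => x j) = 0 := by
    intro j hj
    obtain ⟨i, rfl⟩ := Fin.exists_succ_eq.2 hj
    rw [hx, Fin.cons_succ]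
    exact LinearMap.mem_ker.1 ((Fin.cons x4 (Fin.cons x3 (Fin.cons x2 fun _ => ⟨v, hv⟩)) :
      Fin 4 → K) i).2
  have hx4 : x 4 = v := by rw [hx]; rfl
  obtain ⟨b, hb⟩ : ∃ b : Module.Basis (Fin 5) ℝ W, ∀ j, b j = x j :=
    ⟨basisOfLinearIndependentOfCardEqFinrank' x hlx (by simp [hW]), fun j => by simp⟩
  refine ContinuousAlternatingMap.toAlternatingMap_injective
    (Module.Basis.ext_alternating (f := (wedge θ (wedge Ω Ω)).toAlternatingMap) (g := 0) b
      fun s hs => ?_)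
  simp only [hb]
  have hsurj : Function.Surjective s :=
    ((Fintype.bijective_iff_injective_and_card s).2 ⟨hs, by simp⟩).2
  obtain ⟨i, hi⟩ := hsurj 0
  obtain ⟨a, ha⟩ := hsurj 4
  have hi' : ∀ j, j ≠ i → s j ≠ 0 := fun j hj h0 => hj (hs (h0.trans hi.symm))
  have ha' : x (s a) = v := by rw [ha, hx4]
  exact hquint (fun j => x (s j)) i (fun j hj => hx0 _ (hi' j hj)) a ha'

theorem Nondegenerate.eq_zero_of_frame [FiniteDimensional ℝ W] (hW : Module.finrank ℝ W = 5)
    (h : Nondegenerate θ Ω) (hθ : θ ≠ 0) {f : Fin 4 → W} (hf : LinearIndependent ℝ f)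
    (hfθ : ∀ i, θ (fun _ => f i) = 0) {v : W} (hv : θ (fun _ => v) = 0)
    (hΩ : ∀ i, Ω ![v, f i] = 0) : v = 0 := by
  refine h v hv fun w hw => ?_
  have h1 : LinearIndependent ℝ (fun i => (⟨f i, hfθ i⟩ : LinearMap.ker (covec θ).toLinearMap)) :=
    LinearIndependent.of_comp (LinearMap.ker (covec θ).toLinearMap).subtype hf
  have h2 := h1.span_eq_top_of_card_eq_finrank' (by rw [finrank_ker_covec hθ hW]; simp)
  have h3 : (⟨w, hw⟩ : LinearMap.ker (covec θ).toLinearMap) ∈ Submodule.span ℝ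
      (Set.range fun i => (⟨f i, hfθ i⟩ : LinearMap.ker (covec θ).toLinearMap)) := h2 ▸ trivial
  obtain ⟨r, hr⟩ := (Submodule.mem_span_range_iff_exists_fun ℝ).1 h3
  have h4 : w = ∑ i, r i • f i := by
    have := congrArg Subtype.val hr
    simpa using this.symm
  have h5 : ∀ u, Ω ![v, u] = (covec (contractLast (-Ω) v)) u := by
    intro u
    rw [covec_apply, contractLast_apply, ContinuousAlternatingMap.neg_apply, two_form_swap]
    refine congrArg (fun z => -Ω z) ?_
    ext a; fin_cases a <;> rfl
  rw [h5, h4, map_sum]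
  refine Finset.sum_eq_zero fun i _ => ?_
  rw [map_smul, ← h5, hΩ, smul_zero]

end Contact

section Dimensions

/-- A linear map from dimension `n + 1` to dimension `n` whose kernel is detected by one linear
functional has one-dimensional kernel and is onto. -/
theorem finrank_ker_eq_one_of_functional {V W : Type*} [AddCommGroup V] [Module ℝ V]
    [FiniteDimensional ℝ V] [AddCommGroup W] [Module ℝ W] [FiniteDimensional ℝ W] {n : ℕ}
    (hV : Module.finrank ℝ V = n + 1) (hW : Module.finrank ℝ W = n) (f : V →ₗ[ℝ] W)
    (l : V →ₗ[ℝ] ℝ) (h : ∀ v, f v = 0 → l v = 0 → v = 0) :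
    Module.finrank ℝ (LinearMap.ker f) = 1 ∧ Function.Surjective f := by
  have h1 := f.finrank_range_add_finrank_ker
  have h2 : Module.finrank ℝ (LinearMap.range f) ≤ n := hW ▸ Submodule.finrank_le _
  have h3 : Module.finrank ℝ (LinearMap.ker f) ≤ 1 := by
    have := LinearMap.finrank_le_finrank_of_injective (f := l ∘ₗ (LinearMap.ker f).subtype) ?_
    · simpa using this
    · rw [← LinearMap.ker_eq_bot, LinearMap.ker_eq_bot']
      intro v hv
      exact Subtype.ext (h v v.2 hv)
  have h4 : Module.finrank ℝ (LinearMap.ker f) = 1 := by omega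
  refine ⟨h4, LinearMap.range_eq_top.1 (Submodule.eq_top_of_finrank_eq ?_)⟩
  omega

end Dimensions

section Replacement

variable {V : Type*} [AddCommGroup V] [Module ℝ V] [TopologicalSpace V] [IsTopologicalAddGroup V]
  {ι κ : Type*} [Fintype ι] {β b : ι → V [⋀^Fin 1]→L[ℝ] ℝ} {α : κ → V [⋀^Fin 1]→L[ℝ] ℝ}

theorem span_range_eq_of_linearIndependent [FiniteDimensional ℝ V] (hb : LinearIndependent ℝ b)
    (hβ : LinearIndependent ℝ β) (h : ∀ i, b i ∈ Submodule.span ℝ (Set.range β)) :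
    Submodule.span ℝ (Set.range b) = Submodule.span ℝ (Set.range β) := by
  have h1 : Submodule.span ℝ (Set.range b) ≤ Submodule.span ℝ (Set.range β) := by
    rw [Submodule.span_le]
    rintro _ ⟨i, rfl⟩
    exact h i
  have : FiniteDimensional ℝ (Submodule.span ℝ (Set.range β)) :=
    FiniteDimensional.span_of_finite ℝ (Set.finite_range β)
  exact Submodule.eq_of_le_of_finrank_eq h1 (by
    rw [finrank_span_eq_card hb, finrank_span_eq_card hβ])

theorem linearIndependent_sum_elim_replace (hb : LinearIndependent ℝ b)
    (hc : LinearIndependent ℝ (Sum.elim β α)) (h : ∀ i, b i ∈ Submodule.span ℝ (Set.range β)) :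
    LinearIndependent ℝ (Sum.elim b α) := by
  have h1 : Submodule.span ℝ (Set.range b) ≤ Submodule.span ℝ (Set.range β) := by
    rw [Submodule.span_le]
    rintro _ ⟨i, rfl⟩
    exact h i
  rw [linearIndependent_sum] at hc ⊢
  exact ⟨hb, hc.2.1, hc.2.2.mono_left h1⟩

end Replacement

/-- The sorting of a coframe whose second part consists of two pairs. -/
def pairSort (ι : Type*) : ι ⊕ Fin 4 → Option Bool :=
  Sum.elim (fun _ => none) ![some false, some false, some true, some true]

section PairSort

variable {V : Type*} [AddCommGroup V] [Module ℝ V] [TopologicalSpace V]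
  {ι ι' : Type*} {c : ι ⊕ Fin 4 → V [⋀^Fin 1]→L[ℝ] ℝ} {c' : ι' ⊕ Fin 4 → V [⋀^Fin 1]→L[ℝ] ℝ}

theorem mem_charSpace_pairSort_false {v : V} : v ∈ charSpace c (pairSort ι) false ↔
    (∀ i, c (Sum.inl i) (fun _ => v) = 0) ∧ c (Sum.inr 2) (fun _ => v) = 0 ∧
      c (Sum.inr 3) (fun _ => v) = 0 := by
  constructor
  · intro h
    exact ⟨fun i => h _ (by simp [pairSort]), h _ (by simp [pairSort]), h _ (by simp [pairSort])⟩
  · rintro ⟨h, h2, h3⟩ (i | i) hi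
    · exact h i
    · fin_cases i
      · exact absurd rfl hi
      · exact absurd rfl hi
      · exact h2
      · exact h3

theorem mem_charSpace_pairSort_true {v : V} : v ∈ charSpace c (pairSort ι) true ↔
    (∀ i, c (Sum.inl i) (fun _ => v) = 0) ∧ c (Sum.inr 0) (fun _ => v) = 0 ∧
      c (Sum.inr 1) (fun _ => v) = 0 := by
  constructor
  · intro h
    exact ⟨fun i => h _ (by simp [pairSort]), h _ (by simp [pairSort]), h _ (by simp [pairSort])⟩
  · rintro ⟨h, h2, h3⟩ (i | i) hi
    · exact h i
    · fin_cases i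
      · exact h2
      · exact h3
      · exact absurd rfl hi
      · exact absurd rfl hi

/-- The characteristic spaces only depend on the common kernel of the first part and on the
second part of the coframe. -/
theorem charSpace_pairSort_subset (h : ∀ v, (∀ i, c' (Sum.inl i) (fun _ => v) = 0) →
      (∀ i, c (Sum.inl i) (fun _ => v) = 0) ∧
        ∀ i, c' (Sum.inr i) (fun _ => v) = 0 → c (Sum.inr i) (fun _ => v) = 0) (s : Bool) :
    charSpace c' (pairSort ι') s ⊆ charSpace c (pairSort ι) s := by
  intro v hv
  cases s
  · rw [mem_charSpace_pairSort_false] at hv ⊢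
    obtain ⟨h1, h2⟩ := h v hv.1
    exact ⟨h1, h2 _ hv.2.1, h2 _ hv.2.2⟩
  · rw [mem_charSpace_pairSort_true] at hv ⊢
    obtain ⟨h1, h2⟩ := h v hv.1
    exact ⟨h1, h2 _ hv.2.1, h2 _ hv.2.2⟩

end PairSort

section Slots

variable {V : Type*} [AddCommGroup V] [Module ℝ V] [TopologicalSpace V]

/-- A `2`-form with its second argument fixed. -/
def leftSlot (Ω : V [⋀^Fin (1 + 1)]→L[ℝ] ℝ) (w : V) : V →L[ℝ] ℝ := covec (contractLast Ω w)

theorem leftSlot_apply (Ω : V [⋀^Fin (1 + 1)]→L[ℝ] ℝ) (w v : V) : leftSlot Ω w v = Ω ![v, w] := by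
  rw [leftSlot, covec_apply, contractLast_apply]
  congr 1
  ext a; fin_cases a <;> rfl

end Slots

section Congruences

variable {V : Type*} [AddCommGroup V] [Module ℝ V] [TopologicalSpace V] [IsTopologicalAddGroup V]
  [FiniteDimensional ℝ V] {c : Fin 3 ⊕ Fin 4 → V [⋀^Fin 1]→L[ℝ] ℝ} {e : Fin 3 ⊕ Fin 4 → V}
  {Ω : V [⋀^Fin (1 + 1)]→L[ℝ] ℝ}

theorem congMod_singleton_of_coeff (hV : Module.finrank ℝ V = 7) (h : IsDual c e)
    {i₀ : Fin 3 ⊕ Fin 4} {α β : V [⋀^Fin (1 + 1)]→L[ℝ] ℝ}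
    (hαβ : ∀ i, i ≠ i₀ → ∀ j, j ≠ i₀ → α ![e j, e i] = β ![e j, e i]) :
    CongMod {c i₀} α β := by
  refine congMod_zero_of_coeff (h.expand (by simp [hV])) (Z := {i₀}) (by simp) ?_
  intro i hi j hj
  rw [ContinuousAlternatingMap.sub_apply, sub_eq_zero]
  exact hαβ i hi j hj

theorem congMod_first (hV : Module.finrank ℝ V = 7) (h : IsDual c e)
    (h1 : ∀ i, Ω ![e (Sum.inl 1), e (Sum.inr i)] = 0)
    (h2 : Ω ![e (Sum.inl 1), e (Sum.inl 2)] = 0)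
    (h3 : Ω ![e (Sum.inl 2), e (Sum.inr 0)] = 0) (h4 : Ω ![e (Sum.inl 2), e (Sum.inr 1)] = 0)
    (h02 : Ω ![e (Sum.inr 0), e (Sum.inr 2)] = 0) (h03 : Ω ![e (Sum.inr 0), e (Sum.inr 3)] = 0)
    (h12 : Ω ![e (Sum.inr 1), e (Sum.inr 2)] = 0) (h13 : Ω ![e (Sum.inr 1), e (Sum.inr 3)] = 0)
    {A : ℝ} (h01 : Ω ![e (Sum.inr 0), e (Sum.inr 1)] = A)
    (h23 : Ω ![e (Sum.inr 2), e (Sum.inr 3)] = 1) :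
    CongMod {c (Sum.inl 0)} Ω
      (A • wedge (c (Sum.inr 0)) (c (Sum.inr 1)) + wedge (c (Sum.inr 2)) (c (Sum.inr 3))
        + wedge (Ω ![e (Sum.inr 2), e (Sum.inl 2)] • c (Sum.inr 2) +
          Ω ![e (Sum.inr 3), e (Sum.inl 2)] • c (Sum.inr 3)) (c (Sum.inl 2))) := by
  refine congMod_singleton_of_coeff hV h fun i hi j hj => ?_
  simp only [ContinuousAlternatingMap.add_apply, ContinuousAlternatingMap.smul_apply,
    wedge_covectors_apply, Matrix.cons_val_zero, Matrix.cons_val_one, h _ _, smul_eq_mul]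
  have s1 : ∀ i, Ω ![e (Sum.inr i), e (Sum.inl 1)] = 0 := fun i => by
    rw [two_form_swap, h1, neg_zero]
  have s2 : Ω ![e (Sum.inl 2), e (Sum.inl 1)] = 0 := by rw [two_form_swap, h2, neg_zero]
  have s3 : Ω ![e (Sum.inr 0), e (Sum.inl 2)] = 0 := by rw [two_form_swap, h3, neg_zero]
  have s4 : Ω ![e (Sum.inr 1), e (Sum.inl 2)] = 0 := by rw [two_form_swap, h4, neg_zero]
  have s02 : Ω ![e (Sum.inr 2), e (Sum.inr 0)] = 0 := by rw [two_form_swap, h02, neg_zero]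
  have s03 : Ω ![e (Sum.inr 3), e (Sum.inr 0)] = 0 := by rw [two_form_swap, h03, neg_zero]
  have s12 : Ω ![e (Sum.inr 2), e (Sum.inr 1)] = 0 := by rw [two_form_swap, h12, neg_zero]
  have s13 : Ω ![e (Sum.inr 3), e (Sum.inr 1)] = 0 := by rw [two_form_swap, h13, neg_zero]
  have s01 : Ω ![e (Sum.inr 1), e (Sum.inr 0)] = -A := by rw [two_form_swap, h01]
  have s23 : Ω ![e (Sum.inr 3), e (Sum.inr 2)] = -1 := by rw [two_form_swap, h23]
  have s5 := two_form_swap Ω (e (Sum.inl 2)) (e (Sum.inr 2))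
  have s6 := two_form_swap Ω (e (Sum.inl 2)) (e (Sum.inr 3))
  rcases i with i | i <;> rcases j with j | j <;> fin_cases i <;> fin_cases j <;>
    first | exact absurd rfl hi | exact absurd rfl hj | skip
  all_goals simp [two_form_self, h1, h2, h3, h4, h02, h03, h12, h13, h01, h23, s1, s2, s3, s4, s02,
    s03, s12, s13, s01, s23, s5, s6]

theorem congMod_second (hV : Module.finrank ℝ V = 7) (h : IsDual c e)
    (h1 : ∀ i, Ω ![e (Sum.inl 0), e (Sum.inr i)] = 0)
    (h2 : Ω ![e (Sum.inl 0), e (Sum.inl 2)] = 0)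
    (h3 : Ω ![e (Sum.inl 2), e (Sum.inr 2)] = 0) (h4 : Ω ![e (Sum.inl 2), e (Sum.inr 3)] = 0)
    (h02 : Ω ![e (Sum.inr 0), e (Sum.inr 2)] = 0) (h03 : Ω ![e (Sum.inr 0), e (Sum.inr 3)] = 0)
    (h12 : Ω ![e (Sum.inr 1), e (Sum.inr 2)] = 0) (h13 : Ω ![e (Sum.inr 1), e (Sum.inr 3)] = 0)
    {A : ℝ} (h01 : Ω ![e (Sum.inr 0), e (Sum.inr 1)] = 1)
    (h23 : Ω ![e (Sum.inr 2), e (Sum.inr 3)] = A) :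
    CongMod {c (Sum.inl 1)} Ω
      (wedge (c (Sum.inr 0)) (c (Sum.inr 1)) + A • wedge (c (Sum.inr 2)) (c (Sum.inr 3))
        + wedge (Ω ![e (Sum.inr 0), e (Sum.inl 2)] • c (Sum.inr 0) +
          Ω ![e (Sum.inr 1), e (Sum.inl 2)] • c (Sum.inr 1)) (c (Sum.inl 2))) := by
  refine congMod_singleton_of_coeff hV h fun i hi j hj => ?_
  simp only [ContinuousAlternatingMap.add_apply, ContinuousAlternatingMap.smul_apply,
    wedge_covectors_apply, Matrix.cons_val_zero, Matrix.cons_val_one, h _ _, smul_eq_mul]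
  have s1 : ∀ i, Ω ![e (Sum.inr i), e (Sum.inl 0)] = 0 := fun i => by
    rw [two_form_swap, h1, neg_zero]
  have s2 : Ω ![e (Sum.inl 2), e (Sum.inl 0)] = 0 := by rw [two_form_swap, h2, neg_zero]
  have s3 : Ω ![e (Sum.inr 2), e (Sum.inl 2)] = 0 := by rw [two_form_swap, h3, neg_zero]
  have s4 : Ω ![e (Sum.inr 3), e (Sum.inl 2)] = 0 := by rw [two_form_swap, h4, neg_zero]
  have s02 : Ω ![e (Sum.inr 2), e (Sum.inr 0)] = 0 := by rw [two_form_swap, h02, neg_zero]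
  have s03 : Ω ![e (Sum.inr 3), e (Sum.inr 0)] = 0 := by rw [two_form_swap, h03, neg_zero]
  have s12 : Ω ![e (Sum.inr 2), e (Sum.inr 1)] = 0 := by rw [two_form_swap, h12, neg_zero]
  have s13 : Ω ![e (Sum.inr 3), e (Sum.inr 1)] = 0 := by rw [two_form_swap, h13, neg_zero]
  have s01 : Ω ![e (Sum.inr 1), e (Sum.inr 0)] = -1 := by rw [two_form_swap, h01]
  have s23 : Ω ![e (Sum.inr 3), e (Sum.inr 2)] = -A := by rw [two_form_swap, h23]
  have s5 := two_form_swap Ω (e (Sum.inl 2)) (e (Sum.inr 0))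
  have s6 := two_form_swap Ω (e (Sum.inl 2)) (e (Sum.inr 1))
  rcases i with i | i <;> rcases j with j | j <;> fin_cases i <;> fin_cases j <;>
    first | exact absurd rfl hi | exact absurd rfl hj | skip
  all_goals simp [two_form_self, h1, h2, h3, h4, h02, h03, h12, h13, h01, h23, s1, s2, s3, s4, s02,
    s03, s12, s13, s01, s23, s5, s6]

theorem congMod_third (hV : Module.finrank ℝ V = 7) (h : IsDual c e)
    (h1 : ∀ i j, Ω ![e (Sum.inr i), e (Sum.inr j)] = 0) :
    CongMod {c (Sum.inl 2)} Ω
      (Ω ![e (Sum.inl 0), e (Sum.inl 1)] • wedge (c (Sum.inl 0)) (c (Sum.inl 1))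
        + ∑ i, Ω ![e (Sum.inr i), e (Sum.inl 0)] • wedge (c (Sum.inr i)) (c (Sum.inl 0))
        + ∑ i, Ω ![e (Sum.inr i), e (Sum.inl 1)] • wedge (c (Sum.inr i)) (c (Sum.inl 1))) := by
  refine congMod_singleton_of_coeff hV h fun i hi j hj => ?_
  simp only [ContinuousAlternatingMap.add_apply, ContinuousAlternatingMap.smul_apply,
    ContinuousAlternatingMap.sum_apply,
    wedge_covectors_apply, Matrix.cons_val_zero, Matrix.cons_val_one, h _ _, smul_eq_mul]
  have s0 := two_form_swap Ω (e (Sum.inl 1)) (e (Sum.inl 0))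
  have s1 := fun i => two_form_swap Ω (e (Sum.inl 0)) (e (Sum.inr i))
  have s2 := fun i => two_form_swap Ω (e (Sum.inl 1)) (e (Sum.inr i))
  rcases i with i | i <;> rcases j with j | j
  · fin_cases i <;> fin_cases j <;>
      first | exact absurd rfl hi | exact absurd rfl hj | simp [two_form_self, s0]
  · fin_cases i
    · simp
    · simp
    · exact absurd rfl hi
  · fin_cases j
    · simp [s1]
    · simp [s2]
    · exact absurd rfl hj
  · simp [h1]

end Congruences

section Shift

variable {V : Type*} [AddCommGroup V] [Module ℝ V] [TopologicalSpace V] [IsTopologicalAddGroup V]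
  {c : Fin 3 ⊕ Fin 4 → V [⋀^Fin 1]→L[ℝ] ℝ} {e : Fin 3 ⊕ Fin 4 → V}

/-- The coframe obtained by adding multiples of the first part to the second part. -/
def shiftCoframe (c : Fin 3 ⊕ Fin 4 → V [⋀^Fin 1]→L[ℝ] ℝ) (X : Fin 3 → Fin 4 → ℝ) :
    Fin 3 ⊕ Fin 4 → V [⋀^Fin 1]→L[ℝ] ℝ :=
  Sum.elim (fun a => c (Sum.inl a)) fun i => c (Sum.inr i) + ∑ a, X a i • c (Sum.inl a)

/-- The frame dual to `shiftCoframe`. -/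
def shiftFrame (e : Fin 3 ⊕ Fin 4 → V) (X : Fin 3 → Fin 4 → ℝ) : Fin 3 ⊕ Fin 4 → V :=
  Sum.elim (fun a => e (Sum.inl a) - ∑ i, X a i • e (Sum.inr i)) fun i => e (Sum.inr i)

theorem IsDual.shift (h : IsDual c e) (X : Fin 3 → Fin 4 → ℝ) :
    IsDual (shiftCoframe c X) (shiftFrame e X) := by
  have h' : ∀ i j, covec (c i) (e j) = if i = j then 1 else 0 := h
  have hadd : ∀ i v, covec (c (Sum.inr i) + ∑ a, X a i • c (Sum.inl a)) v =
      covec (c (Sum.inr i)) v + ∑ a, X a i * covec (c (Sum.inl a)) v := by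
    intro i v
    simp [ContinuousAlternatingMap.sum_apply]
  intro i j
  rw [← covec_apply]
  rcases i with i | i <;> rcases j with j | j
  · simp only [shiftCoframe, shiftFrame, Sum.elim_inl, map_sub, map_sum, map_smul, h']
    simp
  · simp only [shiftCoframe, shiftFrame, Sum.elim_inl, Sum.elim_inr, h']
  · simp only [shiftCoframe, shiftFrame, Sum.elim_inl, Sum.elim_inr, hadd, map_sub, map_sum,
      map_smul, h']
    simp
  · simp only [shiftCoframe, shiftFrame, Sum.elim_inr, hadd, h']
    simp

theorem two_form_shift {Ψ : V [⋀^Fin (1 + 1)]→L[ℝ] ℝ} {f : Fin 4 → V} (u w : V) (x : Fin 4 → ℝ) :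
    Ψ ![u - ∑ i, x i • f i, w] = Ψ ![u, w] - ∑ i, x i * Ψ ![f i, w] := by
  simp only [← leftSlot_apply, map_sub, map_sum, map_smul, smul_eq_mul]

end Shift

section Rescale

variable {V : Type*} [AddCommGroup V] [Module ℝ V] [TopologicalSpace V] [IsTopologicalAddGroup V]
  {c : Fin 3 ⊕ Fin 4 → V [⋀^Fin 1]→L[ℝ] ℝ} {e : Fin 3 ⊕ Fin 4 → V}

/-- Rescaling of a coframe, combined with a change of its third member. -/
def rescaleCoframe (c : Fin 3 ⊕ Fin 4 → V [⋀^Fin 1]→L[ℝ] ℝ) (s a b k m : ℝ) :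
    Fin 3 ⊕ Fin 4 → V [⋀^Fin 1]→L[ℝ] ℝ :=
  Sum.elim ![s • c (Sum.inl 0), c (Sum.inl 1),
      c (Sum.inl 2) + a • (s • c (Sum.inl 0)) + b • c (Sum.inl 1)]
    ![k • c (Sum.inr 0), c (Sum.inr 1), m • c (Sum.inr 2), c (Sum.inr 3)]

/-- The frame dual to `rescaleCoframe`. -/
def rescaleFrame (e : Fin 3 ⊕ Fin 4 → V) (s a b k m : ℝ) : Fin 3 ⊕ Fin 4 → V :=
  Sum.elim ![s⁻¹ • e (Sum.inl 0) - a • e (Sum.inl 2), e (Sum.inl 1) - b • e (Sum.inl 2),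
      e (Sum.inl 2)]
    ![k⁻¹ • e (Sum.inr 0), e (Sum.inr 1), m⁻¹ • e (Sum.inr 2), e (Sum.inr 3)]

theorem IsDual.rescale (h : IsDual c e) {s k m : ℝ} (a b : ℝ) (hs : s ≠ 0) (hk : k ≠ 0)
    (hm : m ≠ 0) : IsDual (rescaleCoframe c s a b k m) (rescaleFrame e s a b k m) := by
  have h' : ∀ i j, covec (c i) (e j) = if i = j then 1 else 0 := h
  have hadd : ∀ (α β : V [⋀^Fin 1]→L[ℝ] ℝ), covec (α + β) = covec α + covec β := fun _ _ => rfl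
  have hsmul : ∀ (r : ℝ) (α : V [⋀^Fin 1]→L[ℝ] ℝ), covec (r • α) = r • covec α := fun _ _ => rfl
  intro i j
  rw [← covec_apply]
  rcases i with i | i <;> rcases j with j | j <;> fin_cases i <;> fin_cases j <;>
    simp [-covec_apply, rescaleCoframe, rescaleFrame, hadd, hsmul, h', hs, hk, hm]

end Rescale

section Adapt

variable {V : Type*} [AddCommGroup V] [Module ℝ V] [TopologicalSpace V] [IsTopologicalAddGroup V]
  [FiniteDimensional ℝ V] {c : Fin 3 ⊕ Fin 4 → V [⋀^Fin 1]→L[ℝ] ℝ} {e : Fin 3 ⊕ Fin 4 → V}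
  {Ω Ω' Γ : V [⋀^Fin (1 + 1)]→L[ℝ] ℝ} {A K : ℝ}

/-- The multiples of the first part of a coframe to be added to the second part so that the
structure equations become adapted. -/
def adaptShift (Ω Ω' : V [⋀^Fin (1 + 1)]→L[ℝ] ℝ) (e : Fin 3 ⊕ Fin 4 → V) (A K : ℝ) :
    Fin 3 → Fin 4 → ℝ :=
  ![![-Ω' ![e (Sum.inr 1), e (Sum.inl 0)], Ω' ![e (Sum.inr 0), e (Sum.inl 0)],
      -Ω' ![e (Sum.inr 3), e (Sum.inl 0)] / K, Ω' ![e (Sum.inr 2), e (Sum.inl 0)] / K],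
    ![-Ω ![e (Sum.inr 1), e (Sum.inl 1)] / A, Ω ![e (Sum.inr 0), e (Sum.inl 1)] / A,
      -Ω ![e (Sum.inr 3), e (Sum.inl 1)], Ω ![e (Sum.inr 2), e (Sum.inl 1)]],
    ![-Ω ![e (Sum.inr 1), e (Sum.inl 2)] / A, Ω ![e (Sum.inr 0), e (Sum.inl 2)] / A,
      -Ω' ![e (Sum.inr 3), e (Sum.inl 2)] / K, Ω' ![e (Sum.inr 2), e (Sum.inl 2)] / K]]

/-- The frame vectors `e (inr i)` fall into two pairs that are orthogonal with respect to `Ω`. -/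
def IsBlock (Ω : V [⋀^Fin (1 + 1)]→L[ℝ] ℝ) (e : Fin 3 ⊕ Fin 4 → V) (P Q : ℝ) : Prop :=
  Ω ![e (Sum.inr 0), e (Sum.inr 1)] = P ∧ Ω ![e (Sum.inr 2), e (Sum.inr 3)] = Q ∧
    Ω ![e (Sum.inr 0), e (Sum.inr 2)] = 0 ∧ Ω ![e (Sum.inr 0), e (Sum.inr 3)] = 0 ∧
    Ω ![e (Sum.inr 1), e (Sum.inr 2)] = 0 ∧ Ω ![e (Sum.inr 1), e (Sum.inr 3)] = 0

theorem IsBlock.shift_apply {Ω : V [⋀^Fin (1 + 1)]→L[ℝ] ℝ} {P Q : ℝ} (h : IsBlock Ω e P Q) (u : V)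
    (x : Fin 4 → ℝ) :
    Ω ![u - ∑ i, x i • e (Sum.inr i), e (Sum.inr 0)] = -Ω ![e (Sum.inr 0), u] + x 1 * P ∧
    Ω ![u - ∑ i, x i • e (Sum.inr i), e (Sum.inr 1)] = -Ω ![e (Sum.inr 1), u] - x 0 * P ∧
    Ω ![u - ∑ i, x i • e (Sum.inr i), e (Sum.inr 2)] = -Ω ![e (Sum.inr 2), u] + x 3 * Q ∧
    Ω ![u - ∑ i, x i • e (Sum.inr i), e (Sum.inr 3)] = -Ω ![e (Sum.inr 3), u] - x 2 * Q := by
  obtain ⟨h01, h23, h02, h03, h12, h13⟩ := h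
  have s02 : Ω ![e (Sum.inr 2), e (Sum.inr 0)] = 0 := by rw [two_form_swap, h02, neg_zero]
  have s03 : Ω ![e (Sum.inr 3), e (Sum.inr 0)] = 0 := by rw [two_form_swap, h03, neg_zero]
  have s12 : Ω ![e (Sum.inr 2), e (Sum.inr 1)] = 0 := by rw [two_form_swap, h12, neg_zero]
  have s13 : Ω ![e (Sum.inr 3), e (Sum.inr 1)] = 0 := by rw [two_form_swap, h13, neg_zero]
  have s01 : Ω ![e (Sum.inr 1), e (Sum.inr 0)] = -P := by rw [two_form_swap, h01]
  have s23 : Ω ![e (Sum.inr 3), e (Sum.inr 2)] = -Q := by rw [two_form_swap, h23]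
  simp only [two_form_shift]
  simp only [two_form_swap Ω u, Fin.sum_univ_four, two_form_self, h01, h23, h02,
    h03, h12, h13, s01, s23, s02, s03, s12, s13]
  refine ⟨?_, ?_, ?_, ?_⟩ <;> ring

theorem IsBlock.adapt (hV : Module.finrank ℝ V = 7) (h : IsDual c e)
    (hΩ : IsBlock Ω e A 1) (hΩ' : IsBlock Ω' e 1 K) (hA : A ≠ 0) (hK : K ≠ 0)
    (hΓ : ∀ i j, Γ ![e (Sum.inr i), e (Sum.inr j)] = 0)
    (hN : ∀ v, c (Sum.inl 0) (fun _ => v) = 0 → (∀ i, Ω ![v, e (Sum.inr i)] = 0) →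
      ∀ w, c (Sum.inl 0) (fun _ => w) = 0 → Ω ![v, w] = 0)
    (hN' : ∀ v, c (Sum.inl 1) (fun _ => v) = 0 → (∀ i, Ω' ![v, e (Sum.inr i)] = 0) →
      ∀ w, c (Sum.inl 1) (fun _ => w) = 0 → Ω' ![v, w] = 0)
    {c' : Fin 3 ⊕ Fin 4 → V [⋀^Fin 1]→L[ℝ] ℝ} {e' : Fin 3 ⊕ Fin 4 → V}
    (hc' : c' = shiftCoframe c (adaptShift Ω Ω' e A K))
    (he' : e' = shiftFrame e (adaptShift Ω Ω' e A K)) :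
    CongMod {c' (Sum.inl 0)} Ω
      (A • wedge (c' (Sum.inr 0)) (c' (Sum.inr 1)) + wedge (c' (Sum.inr 2)) (c' (Sum.inr 3))
        + wedge (Ω ![e' (Sum.inr 2), e' (Sum.inl 2)] • c' (Sum.inr 2) +
          Ω ![e' (Sum.inr 3), e' (Sum.inl 2)] • c' (Sum.inr 3)) (c' (Sum.inl 2))) ∧
    CongMod {c' (Sum.inl 1)} Ω'
      (wedge (c' (Sum.inr 0)) (c' (Sum.inr 1)) + K • wedge (c' (Sum.inr 2)) (c' (Sum.inr 3))
        + wedge (Ω' ![e' (Sum.inr 0), e' (Sum.inl 2)] • c' (Sum.inr 0) +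
          Ω' ![e' (Sum.inr 1), e' (Sum.inl 2)] • c' (Sum.inr 1)) (c' (Sum.inl 2))) ∧
    CongMod {c' (Sum.inl 2)} Γ
      (Γ ![e' (Sum.inl 0), e' (Sum.inl 1)] • wedge (c' (Sum.inl 0)) (c' (Sum.inl 1))
        + ∑ i, Γ ![e' (Sum.inr i), e' (Sum.inl 0)] • wedge (c' (Sum.inr i)) (c' (Sum.inl 0))
        + ∑ i, Γ ![e' (Sum.inr i), e' (Sum.inl 1)] •
          wedge (c' (Sum.inr i)) (c' (Sum.inl 1))) := by
  have hd : IsDual c' e' := hc' ▸ he' ▸ h.shift _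
  subst hc' he'
  set e' := shiftFrame e (adaptShift Ω Ω' e A K)
  obtain ⟨y0, y1, y2, y3⟩ := hΩ.shift_apply (e (Sum.inl 1)) (adaptShift Ω Ω' e A K 1)
  obtain ⟨x0, x1, x2, x3⟩ := hΩ'.shift_apply (e (Sum.inl 0)) (adaptShift Ω Ω' e A K 0)
  obtain ⟨z0, z1, -, -⟩ := hΩ.shift_apply (e (Sum.inl 2)) (adaptShift Ω Ω' e A K 2)
  obtain ⟨-, -, z2, z3⟩ := hΩ'.shift_apply (e (Sum.inl 2)) (adaptShift Ω Ω' e A K 2)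
  have hy : ∀ i, Ω ![e' (Sum.inl 1), e' (Sum.inr i)] = 0 := by
    intro i
    fin_cases i
    · refine y0.trans ?_
      simp [adaptShift, hA]
    · refine y1.trans ?_
      simp [adaptShift, hA]
    · refine y2.trans ?_
      simp [adaptShift]
    · refine y3.trans ?_
      simp [adaptShift]
  have hx : ∀ i, Ω' ![e' (Sum.inl 0), e' (Sum.inr i)] = 0 := by
    intro i
    fin_cases i
    · refine x0.trans ?_
      simp [adaptShift]
    · refine x1.trans ?_
      simp [adaptShift]
    · refine x2.trans ?_
      simp [adaptShift, hK]
    · refine x3.trans ?_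
      simp [adaptShift, hK]
  have hc0 : ∀ j, j ≠ Sum.inl 0 → c (Sum.inl 0) (fun _ => e' j) = 0 := fun j hj =>
    (hd (Sum.inl 0) j).trans (if_neg hj.symm)
  have hc1 : ∀ j, j ≠ Sum.inl 1 → c (Sum.inl 1) (fun _ => e' j) = 0 := fun j hj =>
    (hd (Sum.inl 1) j).trans (if_neg hj.symm)
  obtain ⟨a1, a2, a3, a4, a5, a6⟩ := hΩ
  obtain ⟨b1, b2, b3, b4, b5, b6⟩ := hΩ'
  refine ⟨congMod_first hV hd hy ?_ ?_ ?_ a3 a4 a5 a6 a1 a2,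
    congMod_second hV hd hx ?_ ?_ ?_ b3 b4 b5 b6 b1 b2, congMod_third hV hd hΓ⟩
  · exact hN _ (hc0 _ (by decide)) hy _ (hc0 _ (by decide))
  · refine z0.trans ?_
    simp [adaptShift, hA]
  · refine z1.trans ?_
    simp [adaptShift, hA]
  · exact hN' _ (hc1 _ (by decide)) hx _ (hc1 _ (by decide))
  · refine z2.trans ?_
    simp [adaptShift, hK]
  · refine z3.trans ?_
    simp [adaptShift, hK]

end Adapt

section Degree

variable {E : Type*} [NormedAddCommGroup E] [NormedSpace ℝ E]
  {H : Type*} [TopologicalSpace H] {I : ModelWithCorners ℝ E H}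
  {M : Type*} [TopologicalSpace M] [ChartedSpace H M]
  {U : Set M} {S : Set (GForm I M)} {k : ℕ} {φ : DForm I M k}

theorem AlgIdeal.vanish_of_degree_le (h : AlgIdeal U S k φ) {x : M} (hx : x ∈ U)
    {Z : Set (TangentSpace I x)} {n : ℕ} (hk : k ≤ n)
    (hS : ∀ s ∈ S, s.1 ≤ n → ∀ v : Fin s.1 → TangentSpace I x, (∀ a, v a ∈ Z) → s.2 x v = 0)
    (v : Fin k → TangentSpace I x) (hv : ∀ a, v a ∈ Z) : φ x v = 0 := by
  refine h.vanish hx (F := fun k => {v | k ≤ n ∧ ∀ a, v a ∈ Z}) ?_ ?_ v ⟨hk, hv⟩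
  · rintro k m v ⟨hk, hv⟩ f hf
    have := Fintype.card_le_of_injective f hf
    simp only [Fintype.card_fin] at this
    exact ⟨this.trans hk, fun a => hv (f a)⟩
  · rintro s hs v ⟨hk, hv⟩
    exact hS s hs hk v hv

instance [FiniteDimensional ℝ E] (x : M) : FiniteDimensional ℝ (TangentSpace I x) :=
  inferInstanceAs (FiniteDimensional ℝ E)

theorem zero_form_apply_eq_zero {V : Type*} [AddCommGroup V] [Module ℝ V] [TopologicalSpace V]
    {φ : V [⋀^Fin 0]→L[ℝ] ℝ} (h : φ ![] = 0) : φ = 0 := by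
  ext v
  rw [Subsingleton.elim v ![], h]
  rfl

theorem AlgIdeal.mem_degOne [FiniteDimensional ℝ E] {φ : DForm I M 1} (h : AlgIdeal U S 1 φ)
    {x : M} (hx : x ∈ U) (h0 : ∀ ψ : DForm I M 0, (⟨0, ψ⟩ : GForm I M) ∈ S → ψ x = 0) :
    φ x ∈ degOne S x := by
  refine mem_span_of_vanish fun v hv => ?_
  refine h.vanish_of_degree_le hx (Z := {v}) le_rfl ?_ _ fun _ => rfl
  rintro ⟨k, ψ⟩ hs hk w hw
  interval_cases k
  · dsimp only
    rw [h0 ψ hs]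
    rfl
  · have : w = fun _ => v := funext hw
    rw [this]
    exact hv _ ⟨ψ, hs, rfl⟩

end Degree

section MongeAmpere

variable {M : Type*} [TopologicalSpace M] [ChartedSpace (EuclideanSpace ℝ (Fin 5)) M]
  [IsManifold (𝓡 5) ∞ M]

/-- The `1`-forms in a hyperbolic Monge–Ampère system are near each point the multiples of a
global member that is a contact form there. -/
theorem IsHyperbolicMongeAmpere.exists_contact {𝓘₀ : EDS (𝓡 5) M}
    (h : IsHyperbolicMongeAmpere 𝓘₀) (q : M) :
    ∃ θ : DForm (𝓡 5) M 1, (⟨1, θ⟩ : GForm (𝓡 5) M) ∈ 𝓘₀.carrier ∧ ∃ U, IsOpen U ∧ q ∈ U ∧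
      ∀ y ∈ U, θ y ≠ 0 ∧ Nondegenerate (θ y) (extd θ y) ∧
        (∀ φ : DForm (𝓡 5) M 1, (⟨1, φ⟩ : GForm (𝓡 5) M) ∈ 𝓘₀.carrier → ∃ r : ℝ, φ y = r • θ y) ∧
        ∀ φ : DForm (𝓡 5) M 0, (⟨0, φ⟩ : GForm (𝓡 5) M) ∈ 𝓘₀.carrier → φ y = 0 := by
  obtain ⟨U, hU, hq, η, Φ, hη, -, hcontact, hsame, -⟩ := h q
  have hη0 : ∀ y ∈ U, η y ≠ 0 := by
    intro y hy h0
    refine hcontact y hy ?_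
    rw [h0, wedge_zero_left]
  have h0 : ∀ y ∈ U, ∀ φ : DForm (𝓡 5) M 0, (⟨0, φ⟩ : GForm (𝓡 5) M) ∈ 𝓘₀.carrier →
      φ y = 0 := by
    intro y hy φ hφ
    refine zero_form_apply_eq_zero ?_
    refine ((hsame 0 φ).1 (.gen hφ)).vanish_of_degree_le hy (Z := Set.univ) le_rfl ?_ _
      fun _ => trivial
    rintro s (rfl | rfl | rfl) hs <;> simp at hs
  have h1 : ∀ y ∈ U, ∀ φ : DForm (𝓡 5) M 1, (⟨1, φ⟩ : GForm (𝓡 5) M) ∈ 𝓘₀.carrier →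
      ∃ r : ℝ, φ y = r • η y := by
    intro y hy φ hφ
    have : φ y ∈ Submodule.span ℝ {η y} := by
      refine mem_span_of_vanish fun v hv => ?_
      refine ((hsame 1 φ).1 (.gen hφ)).vanish_of_degree_le hy (Z := {v}) le_rfl ?_ _ fun _ => rfl
      rintro s (rfl | rfl | rfl) hs w hw
      · have : w = fun _ => v := funext hw
        rw [this]
        exact hv _ rfl
      · simp at hs
      · simp at hs
    obtain ⟨r, hr⟩ := Submodule.mem_span_singleton.1 this
    exact ⟨r, hr.symm⟩
  obtain ⟨θ, hθ, hθq⟩ : ∃ θ : DForm (𝓡 5) M 1, (⟨1, θ⟩ : GForm (𝓡 5) M) ∈ 𝓘₀.carrier ∧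
      θ q ≠ 0 := by
    by_contra hcon
    push Not at hcon
    have h2 : η q ∈ degOne 𝓘₀.carrier q :=
      ((hsame 1 η).2 (.gen (Or.inl rfl))).mem_degOne hq (h0 q hq)
    refine hη0 q hq ?_
    have h3 : degOne 𝓘₀.carrier q = ⊥ := by
      refine Submodule.span_eq_bot.2 ?_
      rintro _ ⟨φ, hφ, rfl⟩
      exact hcon φ hφ
    rwa [h3] at h2
  have hratio : ∀ y ∈ U, ∃ f : M → ℝ, ContMDiffAt (𝓡 5) 𝓘(ℝ, ℝ) ∞ f y ∧
      ∀ᶠ z in nhds y, θ z = f z • η z := fun y hy =>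
    exists_smooth_ratio (𝓘₀.smooth hθ y trivial) (hη y hy) (hη0 y hy)
      (Filter.mem_of_superset (hU.mem_nhds hy) fun z hz => h1 z hz θ hθ)
  have hne : ∀ᶠ y in nhds q, θ y ≠ 0 := by
    obtain ⟨f, hf, hfθ⟩ := hratio q hq
    have hfq : f q ≠ 0 := fun h => hθq (by rw [hfθ.self_of_nhds, h, zero_smul])
    filter_upwards [hfθ, hf.continuousAt.eventually_ne hfq, hU.mem_nhds hq] with y h2 h3 h4
    rw [h2]
    exact smul_ne_zero h3 (hη0 y h4)
  obtain ⟨U', hU'sub, hU', hqU'⟩ := mem_nhds_iff.1 (Filter.inter_mem hne (hU.mem_nhds hq))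
  refine ⟨θ, hθ, U', hU', hqU', fun y hy => ?_⟩
  have hyU := (hU'sub hy).2
  have hy0 : θ y ≠ 0 := (hU'sub hy).1
  obtain ⟨f, hf, hfθ⟩ := hratio y hyU
  have hfy : f y ≠ 0 := fun h => hy0 (by rw [hfθ.self_of_nhds, h, zero_smul])
  have hker : ∀ v, θ y (fun _ => v) = 0 ↔ η y (fun _ => v) = 0 := by
    intro v
    rw [hfθ.self_of_nhds, ContinuousAlternatingMap.smul_apply, smul_eq_mul, mul_eq_zero,
      or_iff_right hfy]
  refine ⟨hy0, ?_, fun φ hφ => ?_, fun φ hφ => h0 y hyU φ hφ⟩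
  · have hnd : Nondegenerate (η y) (extd η y) :=
      nondegenerate_of_wedge_ne_zero (W := TangentSpace (𝓡 5) y)
        (finrank_euclideanSpace_fin (𝕜 := ℝ) (n := 5)) (hcontact y hyU)
    obtain ⟨D, hD⟩ := extd_smul_apply hf (hη y hyU)
    intro v hv hvw
    refine hnd v ((hker v).1 hv) fun w hw => ?_
    have h2 := hvw w ((hker w).2 hw)
    rw [extd_congr hfθ, hD, hw, (hker v).1 hv] at h2
    simpa [hfy] using h2
  · obtain ⟨r, hr⟩ := h1 y hyU φ hφ
    exact ⟨r / f y, by rw [hr, hfθ.self_of_nhds, smul_smul, div_mul_cancel₀ _ hfy]⟩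

end MongeAmpere

section Generation

variable {E : Type*} [NormedAddCommGroup E] [NormedSpace ℝ E]
  {H : Type*} [TopologicalSpace H] {I : ModelWithCorners ℝ E H}
  {M : Type*} [TopologicalSpace M] [ChartedSpace H M] {ι : Type*}

/-- `S` generates over `U` the algebraic ideal described by the coframe `c` sorted by `g`. -/
structure Generates (U : Set M) (c : ι → DForm I M 1) (g : ι → Option Bool)
    (S : Set (GForm I M)) : Prop where
  smooth : ∀ s ∈ S, SmoothOn s.2 U
  char : ∀ s ∈ S, ∀ x ∈ U, IsCharForm (fun i => c i x) g (s.2 x)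
  one : ∀ i, g i = none → AlgIdeal U S 1 (c i)
  two : ∀ i j, g i = g j → AlgIdeal U S 2 (wedgeF (c i) (c j))

variable {U U' : Set M} {c : ι → DForm I M 1} {g : ι → Option Bool} {S T : Set (GForm I M)}

theorem Generates.mono (h : Generates U c g S) (hU : U' ⊆ U) : Generates U' c g S :=
  ⟨fun s hs x hx => h.smooth s hs x (hU hx), fun s hs x hx => h.char s hs x (hU hx),
    fun i hi => (h.one i hi).mono hU, fun i j hij => (h.two i j hij).mono hU⟩

variable [FiniteDimensional ℝ E] [I.Boundaryless] [IsManifold I ∞ M]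

theorem Generates.of_sameIdeal (h : Generates U c g S) (hU : IsOpen U) (hUU' : U ⊆ U')
    (hST : SameIdeal U' S T) : Generates U c g T := by
  have h1 : ∀ t ∈ T, AlgIdeal U S t.1 t.2 := fun t ht => ((hST _ _).2 (.gen ht)).mono hUU'
  have h2 : ∀ s ∈ S, AlgIdeal U T s.1 s.2 := fun t ht => ((hST _ _).1 (.gen ht)).mono hUU'
  exact ⟨fun t ht => (h1 t ht).smoothOn hU h.smooth,
    fun t ht x hx => (h1 t ht).isCharForm hx fun s hs => h.char s hs x hx,
    fun i hi => (h.one i hi).trans h2, fun i j hij => (h.two i j hij).trans h2⟩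

variable [Fintype ι] [DecidableEq ι]

theorem Generates.algIdeal_iff (h : Generates U c g S) (hU : IsOpen U)
    (hcard : Fintype.card ι = Module.finrank ℝ E) (hc : IsFrameOn c U) {k : ℕ}
    {φ : DForm I M k} : AlgIdeal U S k φ ↔
      SmoothOn φ U ∧ ∀ x ∈ U, IsCharForm (fun i => c i x) g (φ x) :=
  ⟨fun hφ => ⟨hφ.smoothOn hU h.smooth, fun x hx => hφ.isCharForm hx fun s hs => h.char s hs x hx⟩,
    fun hφ => algIdeal_of_isCharForm hU hcard hc h.one h.two hφ.1 hφ.2⟩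

theorem Generates.sameIdeal (h : Generates U c g S) (h' : Generates U c g T) (hU : IsOpen U)
    (hcard : Fintype.card ι = Module.finrank ℝ E) (hc : IsFrameOn c U) : SameIdeal U S T :=
  fun k φ => (h.algIdeal_iff hU hcard hc (φ := φ)).trans (h'.algIdeal_iff hU hcard hc).symm

theorem algIdeal_one_of_isCharForm (hU : IsOpen U) (hcard : Fintype.card ι = Module.finrank ℝ E)
    (hc : IsFrameOn c U) (h1 : ∀ i, g i = none → AlgIdeal U S 1 (c i)) {φ : DForm I M 1}
    (hφ : SmoothOn φ U) (hg : ∀ x ∈ U, IsCharForm (fun i => c i x) g (φ x)) :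
    AlgIdeal U S 1 φ := by
  obtain ⟨e, he⟩ := hc.exists_isDual hcard
  have hco : ∀ i, ∀ x ∈ U, ContMDiffAt I 𝓘(ℝ, ℝ) ∞ (fun y => φ y (fun _ => e i y)) x := fun i =>
    SmoothOn.coeff hU hcard hc.1 he hφ fun _ => i
  refine .congr (AlgIdeal.sum Finset.univ (φ := fun i x => φ x (fun _ => e i x) • c i x)
    fun i _ => ?_) fun x hx => (covector_expand ((he x hx).expand hcard) (φ x)).symm
  cases hi : g i with
  | none => exact (h1 i hi).smul (hco i)
  | some s =>
    refine .congr .zero fun x hx => ?_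
    rw [isCharForm_one_iff.1 (hg x hx) s (e i x) fun j hj => ?_, zero_smul]
    · rfl
    · refine (he x hx j i).trans (if_neg fun hji => hj ?_)
      rw [hji, hi]

/-- If the exterior derivatives of the generating `1`-forms lie in the ideal, then so do those of
all `1`-forms in the ideal. -/
theorem isCharForm_extd_one (hU : IsOpen U) (hcard : Fintype.card ι = Module.finrank ℝ E)
    (hc : IsFrameOn c U)
    (hd : ∀ i, g i = none → ∀ x ∈ U, IsCharForm (fun i => c i x) g (extd (c i) x))
    {φ : DForm I M 1} (hφ : SmoothOn φ U) (hg : ∀ x ∈ U, IsCharForm (fun i => c i x) g (φ x)) :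
    ∀ x ∈ U, IsCharForm (fun i => c i x) g (extd φ x) := by
  obtain ⟨e, he⟩ := hc.exists_isDual hcard
  have hco : ∀ i, ∀ x ∈ U, ContMDiffAt I 𝓘(ℝ, ℝ) ∞ (fun y => φ y (fun _ => e i y)) x := fun i =>
    SmoothOn.coeff hU hcard hc.1 he hφ fun _ => i
  have hsm : ∀ i, SmoothOn (fun x => φ x (fun _ => e i x) • c i x) U := fun i x hx =>
    (hc.1 i x hx).smul (hco i x hx)
  have key : ∀ s : Finset ι, ∀ x ∈ U, IsCharForm (fun i => c i x) g
      (extd (fun x => ∑ i ∈ s, φ x (fun _ => e i x) • c i x) x) := by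
    intro s
    induction s using Finset.induction_on with
    | empty =>
      intro x hx
      simp only [Finset.sum_empty]
      have := extd_zero (I := I) (M := M) (k := 1) x
      exact this ▸ .zero
    | insert a s ha ih =>
      intro x hx
      simp only [Finset.sum_insert ha]
      have h1 := extd_add (hsm a x hx) (SmoothAt.sum s fun i _ => hsm i x hx)
      refine h1 ▸ IsCharForm.add ?_ (ih x hx)
      cases hi : g a with
      | none =>
        obtain ⟨D, hD⟩ := extd_smul_apply (hco a x hx) (hc.1 a x hx)
        rw [isCharForm_two_iff]
        intro v hv w hw
        rw [hD, isCharForm_two_iff.1 (hd a hi x hx) v hv w hw, hv a (by simp [hi]),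
          hw a (by simp [hi])]
        simp
      | some t =>
        have h2 : ∀ᶠ y in nhds x, φ y (fun _ => e a y) • c a y = (0 : DForm I M 1) y := by
          filter_upwards [hU.mem_nhds hx] with y hy
          rw [isCharForm_one_iff.1 (hg y hy) t (e a y) fun j hj => ?_, zero_smul]
          · rfl
          · refine (he y hy j a).trans (if_neg fun hji => hj ?_)
            rw [hji, hi]
        rw [extd_congr h2, extd_zero]
        exact .zero
  intro x hx
  have h3 : ∀ᶠ y in nhds x, φ y = (fun x => ∑ i, φ x (fun _ => e i x) • c i x) y := by
    filter_upwards [hU.mem_nhds hx] with y hy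
    exact covector_expand ((he y hy).expand hcard) (φ y)
  rw [extd_congr h3]
  exact key _ x hx

/-- The exterior differential system of all smooth forms with values in the ideal described by a
global coframe. -/
def charEDS (c : ι → DForm I M 1) (g : ι → Option Bool)
    (hcard : Fintype.card ι = Module.finrank ℝ E) (hc : IsFrameOn c Set.univ)
    (hd : ∀ i, g i = none → ∀ x, IsCharForm (fun i => c i x) g (extd (c i) x)) : EDS I M where
  carrier := {s | SmoothOn s.2 Set.univ ∧ ∀ x, IsCharForm (fun i => c i x) g (s.2 x)}
  smooth h := h.1
  zero_mem _ := ⟨fun _ _ => smoothAt_zero, fun _ => .zero⟩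
  add_mem h h' := ⟨fun x hx => (h.1 x hx).add (h'.1 x hx), fun x => (h.2 x).add (h'.2 x)⟩
  mul_mem α h hα := ⟨fun x hx => (h.1 x hx).wedgeF (hα x hx), fun x => (h.2 x).wedge _⟩
  d_mem := by
    intro k φ h
    refine ⟨SmoothOn.extd isOpen_univ h.1, fun x => ?_⟩
    match k, φ, h with
    | 0, φ, h =>
      have : φ = 0 := funext fun y => isCharForm_zero_iff.1 (h.2 y)
      dsimp only
      rw [this, extd_zero]
      exact .zero
    | 1, φ, h =>
      exact isCharForm_extd_one isOpen_univ hcard hc (fun i hi x _ => hd i hi x) h.1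
        (fun x _ => h.2 x) x trivial
    | k + 2, φ, h => exact IsCharForm.of_two_lt (k := k + 2 + 1) (by omega) _

theorem generates_charEDS (hcard : Fintype.card ι = Module.finrank ℝ E)
    (hc : IsFrameOn c Set.univ)
    (hd : ∀ i, g i = none → ∀ x, IsCharForm (fun i => c i x) g (extd (c i) x)) :
    Generates Set.univ c g (charEDS c g hcard hc hd).carrier where
  smooth _ hs := hs.1
  char _ hs x _ := hs.2 x
  one i hi := .gen ⟨hc.1 i, fun _ => isCharForm_covector hi⟩
  two i j hij := .gen ⟨fun x hx => (hc.1 i x hx).wedgeF (hc.1 j x hx), fun _ => isCharForm_wedge hij⟩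

end Generation

section GenerationPullback

variable {E : Type*} [NormedAddCommGroup E] [NormedSpace ℝ E] [FiniteDimensional ℝ E]
  {H : Type*} [TopologicalSpace H] {I : ModelWithCorners ℝ E H} [I.Boundaryless]
  {M : Type*} [TopologicalSpace M] [ChartedSpace H M] [IsManifold I ∞ M]
  {E' : Type*} [NormedAddCommGroup E'] [NormedSpace ℝ E'] [FiniteDimensional ℝ E']
  {H' : Type*} [TopologicalSpace H'] {J : ModelWithCorners ℝ E' H'} [J.Boundaryless]
  {M' : Type*} [TopologicalSpace M'] [ChartedSpace H' M'] [IsManifold J ∞ M']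
  {ι ι' : Type*} {U : Set M} {c : ι → DForm I M 1} {g : ι → Option Bool}
  {S : Set (GForm I M)}

theorem Generates.pullback (h : Generates U c g S) {f : M' → M} {W : Set M'}
    (hf : ∀ x ∈ W, ContMDiffAt J I ∞ f x) (hW : ∀ x ∈ W, f x ∈ U) (κ : ι' → ι)
    (hκ : ∀ i, (∃ j, κ j = i) ∨ ∀ x ∈ W, pullback (J := J) f (c i) x = 0) :
    Generates W (fun j => BacklundEDS.pullback f (c (κ j))) (g ∘ κ) (pullbackSet (J := J) f S) where
  smooth := by
    rintro _ ⟨s, hs, rfl⟩ x hx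
    exact SmoothAt.pullback (hf x hx) (h.smooth s hs _ (hW x hx))
  char := by
    rintro _ ⟨s, hs, rfl⟩ x hx
    refine (h.char s hs _ (hW x hx)).compContinuousLinearMap (f := mfderiv J I f x)
      fun t v hv i hi => ?_
    rcases hκ i with ⟨j, rfl⟩ | h0
    · exact hv j hi
    · exact DFunLike.congr_fun (h0 x hx) fun _ => v
  one i hi := (h.one _ hi).pullback hf hW
  two i j hij := by
    rw [← pullback_wedgeF]
    exact (h.two _ _ hij).pullback hf hW

end GenerationPullback

section PointwiseSpans

variable {V : Type*} [AddCommGroup V] [Module ℝ V] [TopologicalSpace V] [IsTopologicalAddGroup V]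
  [FiniteDimensional ℝ V]

/-- A covector that vanishes on the characteristic spaces lies in the span of the first part of
the coframe. -/
theorem IsCharForm.mem_span {ι : Type*} [Fintype ι] [DecidableEq ι]
    {c : ι ⊕ Fin 4 → V [⋀^Fin 1]→L[ℝ] ℝ} {e : ι ⊕ Fin 4 → V}
    (hcard : Fintype.card (ι ⊕ Fin 4) = Module.finrank ℝ V) (he : IsDual c e)
    {φ : V [⋀^Fin 1]→L[ℝ] ℝ} (h : IsCharForm c (pairSort ι) φ) :
    φ ∈ Submodule.span ℝ (Set.range fun a => c (Sum.inl a)) := by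
  rw [isCharForm_one_iff] at h
  have h0 : ∀ i, φ (fun _ => e (Sum.inr i)) = 0 := by
    intro i
    obtain ⟨s, hs⟩ : ∃ s, pairSort ι (Sum.inr i) = some s := by
      fin_cases i <;> exact ⟨_, rfl⟩
    refine h s _ fun j hj => (he j _).trans (if_neg fun hji => hj ?_)
    rw [hji, hs]
  rw [covector_expand (he.expand hcard) φ, Fintype.sum_sum_type]
  refine add_mem (sum_mem fun a _ => Submodule.smul_mem _ _ (Submodule.subset_span ⟨a, rfl⟩))
    (sum_mem fun i _ => ?_)
  rw [h0, zero_smul]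
  exact zero_mem _

theorem isCharForm_of_mem_span {ι : Type*} {c : ι ⊕ Fin 4 → V [⋀^Fin 1]→L[ℝ] ℝ}
    {φ : V [⋀^Fin 1]→L[ℝ] ℝ} (h : φ ∈ Submodule.span ℝ (Set.range fun a => c (Sum.inl a))) :
    IsCharForm c (pairSort ι) φ := by
  rw [isCharForm_one_iff]
  intro s v hv
  refine vanish_of_mem_span h ?_
  rintro _ ⟨a, rfl⟩
  exact hv _ (by simp [pairSort])

theorem linearIndependent_triple {a b c : V [⋀^Fin 1]→L[ℝ] ℝ}
    (hab : LinearIndependent ℝ ![a, b]) (hc : c ∉ Submodule.span ℝ {a, b}) :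
    LinearIndependent ℝ ![a, b, c] := by
  have h : (![a, b, c] : Fin 3 → _) = Fin.snoc ![a, b] c := by
    ext1 i; fin_cases i <;> rfl
  rw [h, linearIndependent_finSnoc]
  refine ⟨hab, ?_⟩
  rwa [Matrix.range_cons, Matrix.range_cons, Matrix.range_empty, Set.union_empty,
    Set.singleton_union]

end PointwiseSpans

section Openness

theorem linearIndependent_of_pullback {V W : Type*} [AddCommGroup V] [Module ℝ V]
    [TopologicalSpace V] [AddCommGroup W] [Module ℝ W] [TopologicalSpace W]
    [IsTopologicalAddGroup V] [IsTopologicalAddGroup W] {ι : Type*}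
    (L : V →L[ℝ] W) {c : ι → W [⋀^Fin 1]→L[ℝ] ℝ} {c' : ι → V [⋀^Fin 1]→L[ℝ] ℝ}
    (h : ∀ i v, c' i (fun _ => v) = c i (fun _ => L v)) (hc' : LinearIndependent ℝ c') :
    LinearIndependent ℝ c := by
  rw [linearIndependent_iff'] at hc' ⊢
  intro s r hr
  refine hc' s r (covector_ext fun v => ?_)
  have h1 := DFunLike.congr_fun hr fun _ => L v
  rw [ContinuousAlternatingMap.sum_apply] at h1 ⊢
  exact (Finset.sum_congr rfl fun i _ => congrArg (fun z => r i * z) (h i v)).trans h1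

variable {E : Type*} [NormedAddCommGroup E] [NormedSpace ℝ E] [FiniteDimensional ℝ E]
  {H : Type*} [TopologicalSpace H] {I : ModelWithCorners ℝ E H} [I.Boundaryless]
  {M : Type*} [TopologicalSpace M] [ChartedSpace H M] [IsManifold I ∞ M]

/-- Smooth `1`-forms that are linearly independent at a point are so near this point. -/
theorem eventually_linearIndependent {ι : Type*} [Finite ι] {c : ι → DForm I M 1} {x : M}
    (hc : ∀ i, SmoothAt (c i) x) (h : LinearIndependent ℝ fun i => c i x) :
    ∀ᶠ y in nhds x, LinearIndependent ℝ fun i => c i y := by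
  have h0 : LinearIndependent ℝ fun i => rep x (c i) (extChartAt I x x) :=
    linearIndependent_of_pullback (V := TangentSpace I x)
      (W := TangentSpace 𝓘(ℝ, E) (extChartAt I x x))
      (mfderiv I 𝓘(ℝ, E) (extChartAt I x) x)
      (fun i v => (rep_apply_extChartAt x (c i) (mem_extChartAt_source x) fun _ => v).symm) h
  have hcont : ContinuousAt (fun u i => rep x (c i) u) (extChartAt I x x) :=
    continuousAt_pi.2 fun i => (hc i).continuousAt
  have h2 := hcont.eventually (isOpen_setOfPred_linearIndependent.mem_nhds h0)
  filter_upwards [(continuousAt_extChartAt (I := I) x).eventually h2,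
    extChartAt_source_mem_nhds (I := I) x] with y hy hsrc
  have hyy : (extChartAt I x).symm (extChartAt I x y) = y := (extChartAt I x).left_inv hsrc
  have h3 : ∀ z, z = y → (LinearIndependent ℝ fun i => c i z) →
      LinearIndependent ℝ fun i => c i y := by rintro z rfl h; exact h
  exact h3 _ hyy (linearIndependent_of_pullback 
    (V := TangentSpace 𝓘(ℝ, E) (extChartAt I x y)) (W := TangentSpace I _)
    (mfderiv 𝓘(ℝ, E) I (extChartAt I x).symm (extChartAt I x y)) (fun i v => rfl) hy)

end Openness

section PairFrames

variable {E : Type*} [NormedAddCommGroup E] [NormedSpace ℝ E] [FiniteDimensional ℝ E]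
  {H : Type*} [TopologicalSpace H] {I : ModelWithCorners ℝ E H} [I.Boundaryless]
  {M : Type*} [TopologicalSpace M] [ChartedSpace H M] [IsManifold I ∞ M] {ι : Type*}
  {U U' : Set M} {b b' : ι → DForm I M 1} {α : Fin 4 → DForm I M 1} {S T : Set (GForm I M)}

theorem pairSort_induction {P : Fin 4 → Fin 4 → Prop} (hself : ∀ i, P i i)
    (hswap : ∀ i j, P i j → P j i) (h01 : P 0 1) (h23 : P 2 3) {i j : Fin 4}
    (hij : pairSort ι (Sum.inr i) = pairSort ι (Sum.inr j)) : P i j := by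
  fin_cases i <;> fin_cases j <;>
    first
    | exact hself _
    | exact h01
    | exact h23
    | exact hswap _ _ h01
    | exact hswap _ _ h23
    | simp [pairSort] at hij

theorem SameIdeal.symm (h : SameIdeal U S T) : SameIdeal U T S := fun k φ => (h k φ).symm

theorem Generates.of_pairs (hsmooth : ∀ s ∈ S, SmoothOn s.2 U)
    (hchar : ∀ s ∈ S, ∀ x ∈ U, IsCharForm (fun i => Sum.elim b α i x) (pairSort ι) (s.2 x))
    (hb : ∀ a, SmoothOn (b a) U) (h1 : ∀ a, AlgIdeal U S 1 (b a))
    (h01 : AlgIdeal U S 2 (wedgeF (α 0) (α 1))) (h23 : AlgIdeal U S 2 (wedgeF (α 2) (α 3))) :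
    Generates U (Sum.elim b α) (pairSort ι) S := by
  have hself : ∀ i, AlgIdeal U S 2 (wedgeF (α i) (α i)) := fun i =>
    .congr .zero fun x _ => (wedge_covectors_self (α i x)).symm
  have hswap : ∀ i j, AlgIdeal U S 2 (wedgeF (α i) (α j)) → AlgIdeal U S 2 (wedgeF (α j) (α i)) := by
    intro i j h
    refine .congr (h.smul (f := fun _ => -1) fun _ _ => contMDiffAt_const) fun x _ => ?_
    exact (neg_one_smul ℝ _).trans (wedge_covectors_swap (α j x) (α i x)).symm
  refine ⟨hsmooth, hchar, ?_, ?_⟩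
  · rintro (a | i) hi
    · exact h1 a
    · fin_cases i <;> simp [pairSort] at hi
  · rintro (a | i) (a' | j) hij
    · exact (h1 a).mul _ (hb a')
    · fin_cases j <;> simp [pairSort] at hij
    · fin_cases i <;> simp [pairSort] at hij
    · exact pairSort_induction (P := fun i j => AlgIdeal U S 2 (wedgeF (α i) (α j))) hself hswap
        h01 h23 hij

variable [Fintype ι] [DecidableEq ι]

theorem Generates.replace (h : Generates U (Sum.elim b α) (pairSort ι) S) (hU : IsOpen U)
    (hcard : Fintype.card (ι ⊕ Fin 4) = Module.finrank ℝ E) (hc : IsFrameOn (Sum.elim b α) U)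
    (hb' : ∀ a, SmoothOn (b' a) U)
    (hspan : ∀ x ∈ U, Submodule.span ℝ (Set.range fun a => b' a x) =
      Submodule.span ℝ (Set.range fun a => b a x)) :
    Generates U (Sum.elim b' α) (pairSort ι) S := by
  refine .of_pairs h.smooth (fun s hs x hx => IsCharForm.mono (fun t => ?_) (h.char s hs x hx))
    hb' (fun a => ?_) (h.two (Sum.inr 0) (Sum.inr 1) rfl) (h.two (Sum.inr 2) (Sum.inr 3) rfl)
  · refine charSpace_pairSort_subset (c := fun i => Sum.elim b α i x)
      (c' := fun i => Sum.elim b' α i x) (fun v hv => ⟨fun i => ?_, fun i hi => hi⟩) t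
    have h1 : b i x ∈ Submodule.span ℝ (Set.range fun a => b' a x) := by
      rw [hspan x hx]
      exact Submodule.subset_span ⟨i, rfl⟩
    refine vanish_of_mem_span h1 ?_
    rintro _ ⟨a, rfl⟩
    exact hv a
  · refine algIdeal_one_of_isCharForm hU hcard hc h.one (hb' a) fun x hx => ?_
    refine isCharForm_of_mem_span (V := TangentSpace I x) ?_
    have h1 : b' a x ∈ Submodule.span ℝ (Set.range fun a => b a x) := by
      rw [← hspan x hx]
      exact Submodule.subset_span ⟨a, rfl⟩
    exact h1

end PairFrames

section SplitFrames

variable {M : Type*} [TopologicalSpace M] [ChartedSpace (EuclideanSpace ℝ (Fin 5)) M]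
  {M' : Type*} [TopologicalSpace M'] [ChartedSpace (EuclideanSpace ℝ (Fin 5)) M']
  {N : Type*} [TopologicalSpace N] [ChartedSpace (EuclideanSpace ℝ (Fin 7)) N]

/-- A coframe `(b, α)` adapted to a rank-`2` Bäcklund transformation and its characteristic
systems. -/
structure SplitFrame (𝓘₀ : EDS (𝓡 5) M) (𝓘₁ : EDS (𝓡 5) M') (𝓑 : EDS (𝓡 7) N)
    (π : N → M) (π' : N → M')
    (χ₁₀ χ₀₁ : (x : N) → Submodule ℝ (TangentSpace (𝓡 7) x [⋀^Fin 1]→L[ℝ] ℝ))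
    (W : Set N) (b : Fin 3 → DForm (𝓡 7) N 1) (α : Fin 4 → DForm (𝓡 7) N 1) : Prop where
  isOpen : IsOpen W
  frame : IsFrameOn (Sum.elim b α) W
  gen : Generates W (Sum.elim b α) (pairSort (Fin 3)) 𝓑.carrier
  left : ∃ Θ : Fin 2 → DForm (𝓡 7) N 1, Generates W (Sum.elim b α) (pairSort (Fin 3))
    (pullbackSet π 𝓘₀.carrier ∪ Set.range fun i => (⟨1, Θ i⟩ : GForm (𝓡 7) N))
  right : ∃ Θ : Fin 2 → DForm (𝓡 7) N 1, Generates W (Sum.elim b α) (pairSort (Fin 3))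
    (pullbackSet π' 𝓘₁.carrier ∪ Set.range fun i => (⟨1, Θ i⟩ : GForm (𝓡 7) N))
  trans_left : ∀ x ∈ W, ∀ v : TangentSpace (𝓡 7) x, (∀ a, b a x (fun _ => v) = 0) →
    mfderiv (𝓡 7) (𝓡 5) π x v = 0 → v = 0
  trans_right : ∀ x ∈ W, ∀ v : TangentSpace (𝓡 7) x, (∀ a, b a x (fun _ => v) = 0) →
    mfderiv (𝓡 7) (𝓡 5) π' x v = 0 → v = 0
  char_left : ∀ x ∈ W, χ₁₀ x =
    Submodule.span ℝ (Set.range fun a => b a x) ⊔ Submodule.span ℝ {α 0 x, α 1 x}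
  char_right : ∀ x ∈ W, χ₀₁ x =
    Submodule.span ℝ (Set.range fun a => b a x) ⊔ Submodule.span ℝ {α 2 x, α 3 x}

variable {𝓘₀ : EDS (𝓡 5) M} {𝓘₁ : EDS (𝓡 5) M'} {𝓑 : EDS (𝓡 7) N} {π : N → M} {π' : N → M'}
  {χ₁₀ χ₀₁ : (x : N) → Submodule ℝ (TangentSpace (𝓡 7) x [⋀^Fin 1]→L[ℝ] ℝ)}
  {W W' : Set N} {b b' : Fin 3 → DForm (𝓡 7) N 1} {α : Fin 4 → DForm (𝓡 7) N 1}

theorem card_three_four : Fintype.card (Fin 3 ⊕ Fin 4) =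
    Module.finrank ℝ (EuclideanSpace ℝ (Fin 7)) := by simp

theorem card_three_four_tangent (x : N) : Fintype.card (Fin 3 ⊕ Fin 4) =
    Module.finrank ℝ (TangentSpace (𝓡 7) x) := card_three_four

variable [IsManifold (𝓡 7) ∞ N]

theorem SplitFrame.mono (h : SplitFrame 𝓘₀ 𝓘₁ 𝓑 π π' χ₁₀ χ₀₁ W b α) (hW' : IsOpen W')
    (hWW' : W' ⊆ W) : SplitFrame 𝓘₀ 𝓘₁ 𝓑 π π' χ₁₀ χ₀₁ W' b α where
  isOpen := hW'
  frame := ⟨fun i x hx => h.frame.1 i x (hWW' hx), fun x hx => h.frame.2 x (hWW' hx)⟩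
  gen := h.gen.mono hWW'
  left := h.left.imp fun _ hΘ => hΘ.mono hWW'
  right := h.right.imp fun _ hΘ => hΘ.mono hWW'
  trans_left x hx := h.trans_left x (hWW' hx)
  trans_right x hx := h.trans_right x (hWW' hx)
  char_left x hx := h.char_left x (hWW' hx)
  char_right x hx := h.char_right x (hWW' hx)

theorem SplitFrame.replace (h : SplitFrame 𝓘₀ 𝓘₁ 𝓑 π π' χ₁₀ χ₀₁ W b α)
    (hb' : ∀ a, SmoothOn (b' a) W) (hli : ∀ x ∈ W, LinearIndependent ℝ fun a => b' a x)
    (hmem : ∀ x ∈ W, ∀ a, b' a x ∈ Submodule.span ℝ (Set.range fun a => b a x)) :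
    SplitFrame 𝓘₀ 𝓘₁ 𝓑 π π' χ₁₀ χ₀₁ W b' α := by
  have hlib : ∀ x ∈ W, LinearIndependent ℝ fun a => b a x := fun x hx =>
    (h.frame.2 x hx).comp Sum.inl Sum.inl_injective
  have hspan : ∀ x ∈ W, Submodule.span ℝ (Set.range fun a => b' a x) =
      Submodule.span ℝ (Set.range fun a => b a x) := fun x hx =>
    span_range_eq_of_linearIndependent (V := TangentSpace (𝓡 7) x) (hli x hx) (hlib x hx)
      (hmem x hx)
  have hvan : ∀ x ∈ W, ∀ v : TangentSpace (𝓡 7) x, (∀ a, b' a x (fun _ => v) = 0) →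
      ∀ a, b a x (fun _ => v) = 0 := by
    intro x hx v hv a
    have h1 : b a x ∈ Submodule.span ℝ (Set.range fun a => b' a x) := by
      rw [hspan x hx]
      exact Submodule.subset_span ⟨a, rfl⟩
    refine vanish_of_mem_span h1 ?_
    rintro _ ⟨a, rfl⟩
    exact hv a
  refine ⟨h.isOpen, ⟨?_, fun x hx => ?_⟩, h.gen.replace h.isOpen card_three_four h.frame hb' hspan,
    h.left.imp fun _ hΘ => hΘ.replace h.isOpen card_three_four h.frame hb' hspan,
    h.right.imp fun _ hΘ => hΘ.replace h.isOpen card_three_four h.frame hb' hspan,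
    fun x hx v hv => h.trans_left x hx v (hvan x hx v hv),
    fun x hx v hv => h.trans_right x hx v (hvan x hx v hv), fun x hx => ?_, fun x hx => ?_⟩
  · rintro (a | i)
    · exact hb' a
    · exact h.frame.1 (Sum.inr i)
  · have h1 : LinearIndependent ℝ (Sum.elim (fun a => b a x) fun i => α i x) := by
      have := h.frame.2 x hx
      convert this using 1
      ext1 i; cases i <;> rfl
    have h2 := linearIndependent_sum_elim_replace (V := TangentSpace (𝓡 7) x) (hli x hx) h1
      (hmem x hx)
    convert h2 using 1
    ext1 i; cases i <;> rfl
  · rw [hspan x hx, h.char_left x hx]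
  · rw [hspan x hx, h.char_right x hx]

theorem span_five {V : Type*} [AddCommGroup V] [Module ℝ V] (b0 b1 b2 a0 a1 : V) :
    Submodule.span ℝ {b0, b1, b2, a0, a1} =
      Submodule.span ℝ (Set.range ![b0, b1, b2]) ⊔ Submodule.span ℝ {a0, a1} := by
  rw [← Submodule.span_union]
  congr 1
  ext z
  simp
  tauto

theorem exists_splitFrame (hB : IsBacklund 2 𝓘₀ 𝓘₁ 𝓑 π π')
    (hχ : IsCharacteristicPair 𝓑 χ₁₀ χ₀₁) (p : N) :
    ∃ W b α, p ∈ W ∧ SplitFrame 𝓘₀ 𝓘₁ 𝓑 π π' χ₁₀ χ₀₁ W b α := by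
  obtain ⟨U, hU, hp, β, α, hframe, hsame, hspan⟩ := hχ p
  obtain ⟨V, hV, hpV, Θ, -, hΘ, hΘt⟩ := hB.1.2.2 p
  obtain ⟨V', hV', hpV', Θ', -, hΘ', hΘt'⟩ := hB.2.2.2 p
  have hUW : IsOpen (U ∩ (V ∩ V')) := hU.inter (hV.inter hV')
  have h0 : Generates U (Sum.elim β α) (pairSort (Fin 3))
      (Set.range (fun i => (⟨1, β i⟩ : GForm (𝓡 7) N)) ∪
        {⟨2, wedgeF (α 0) (α 1)⟩, ⟨2, wedgeF (α 2) (α 3)⟩}) := by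
    refine .of_pairs ?_ ?_ (fun a => hframe.1 (Sum.inl a)) (fun a => .gen (Or.inl ⟨a, rfl⟩))
      (.gen (Or.inr (Or.inl rfl))) (.gen (Or.inr (Or.inr rfl)))
    · rintro _ (⟨a, rfl⟩ | rfl | rfl) x hx
      · exact hframe.1 (Sum.inl a) x hx
      · exact (hframe.1 (Sum.inr 0) x hx).wedgeF (hframe.1 (Sum.inr 1) x hx)
      · exact (hframe.1 (Sum.inr 2) x hx).wedgeF (hframe.1 (Sum.inr 3) x hx)
    · rintro _ (⟨a, rfl⟩ | rfl | rfl) x hx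
      · exact isCharForm_covector (c := fun i => Sum.elim β α i x) (i := Sum.inl a) rfl
      · exact isCharForm_wedge (c := fun i => Sum.elim β α i x) (i := Sum.inr 0)
          (j := Sum.inr 1) rfl
      · exact isCharForm_wedge (c := fun i => Sum.elim β α i x) (i := Sum.inr 2)
          (j := Sum.inr 3) rfl
  have h1 : Generates U (Sum.elim β α) (pairSort (Fin 3)) 𝓑.carrier :=
    h0.of_sameIdeal hU subset_rfl hsame.symm
  have h2 := (h1.mono (U' := U ∩ (V ∩ V')) Set.inter_subset_left).of_sameIdeal hUW
    (fun x hx => hx.2.1) hΘ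
  have h3 := (h1.mono (U' := U ∩ (V ∩ V')) Set.inter_subset_left).of_sameIdeal hUW
    (fun x hx => hx.2.2) hΘ'
  obtain ⟨e, he⟩ := hframe.exists_isDual card_three_four
  have hvan : ∀ (S : Set (GForm (𝓡 7) N)) (Θ : Fin 2 → DForm (𝓡 7) N 1),
      Generates (U ∩ (V ∩ V')) (Sum.elim β α) (pairSort (Fin 3))
        (S ∪ Set.range fun i => (⟨1, Θ i⟩ : GForm (𝓡 7) N)) →
      ∀ x ∈ U ∩ (V ∩ V'), ∀ v : TangentSpace (𝓡 7) x, (∀ a, β a x (fun _ => v) = 0) →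
        ∀ i, Θ i x (fun _ => v) = 0 := by
    intro S Θ hS x hx v hv i
    have h4 := (hS.char ⟨1, Θ i⟩ (Or.inr ⟨i, rfl⟩) x hx).mem_span (V := TangentSpace (𝓡 7) x)
      (card_three_four_tangent x) (he x hx.1)
    refine vanish_of_mem_span h4 ?_
    rintro _ ⟨a, rfl⟩
    exact hv a
  refine ⟨U ∩ (V ∩ V'), β, α, ⟨hp, hpV, hpV'⟩, hUW,
    ⟨fun i x hx => hframe.1 i x hx.1, fun x hx => hframe.2 x hx.1⟩, h1.mono Set.inter_subset_left,
    ⟨Θ, h2⟩, ⟨Θ', h3⟩,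
    fun x hx v hv => hΘt x hx.2.1 v (hvan _ _ h2 x hx v hv),
    fun x hx v hv => hΘt' x hx.2.2 v (hvan _ _ h3 x hx v hv), fun x hx => ?_, fun x hx => ?_⟩
  · rw [(hspan x hx.1).1, span_five]
    congr 3
    ext1 a; fin_cases a <;> rfl
  · rw [(hspan x hx.1).2, span_five]
    congr 3
    ext1 a; fin_cases a <;> rfl

/-- The `1`-forms of the ideal span the first part of a split frame. -/
theorem SplitFrame.degOne_eq (h : SplitFrame 𝓘₀ 𝓘₁ 𝓑 π π' χ₁₀ χ₀₁ W b α) {x : N} (hx : x ∈ W) :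
    degOne 𝓑.carrier x = Submodule.span ℝ (Set.range fun a => b a x) := by
  obtain ⟨e, he⟩ := h.frame.exists_isDual card_three_four
  refine le_antisymm (Submodule.span_le.2 ?_) (Submodule.span_le.2 ?_)
  · rintro _ ⟨φ, hφ, rfl⟩
    exact (h.gen.char _ hφ x hx).mem_span (V := TangentSpace (𝓡 7) x)
      (card_three_four_tangent x) (he x hx)
  · rintro _ ⟨a, rfl⟩
    exact (h.gen.one (Sum.inl a) rfl).mem_degOne hx fun ψ hψ =>
      isCharForm_zero_iff.1 (h.gen.char _ hψ x hx)

theorem SplitFrame.zero_form (h : SplitFrame 𝓘₀ 𝓘₁ 𝓑 π π' χ₁₀ χ₀₁ W b α) {x : N} (hx : x ∈ W)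
    {ψ : DForm (𝓡 7) N 0} (hψ : (⟨0, ψ⟩ : GForm (𝓡 7) N) ∈ 𝓑.carrier) : ψ x = 0 :=
  isCharForm_zero_iff.1 (h.gen.char _ hψ x hx)

end SplitFrames

section Blocks

variable {V : Type*} [AddCommGroup V] [Module ℝ V] [TopologicalSpace V] [IsTopologicalAddGroup V]
  {c : Fin 3 ⊕ Fin 4 → V [⋀^Fin 1]→L[ℝ] ℝ} {e : Fin 3 ⊕ Fin 4 → V}
  {Ω Ω' : V [⋀^Fin (1 + 1)]→L[ℝ] ℝ}

theorem IsDual.mem_charSpace (he : IsDual c e) {j : Fin 3 ⊕ Fin 4} {s : Bool}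
    (hj : pairSort (Fin 3) j = some s) : e j ∈ charSpace c (pairSort (Fin 3)) s := fun i hi =>
  (he i j).trans (if_neg fun h => hi (by rw [h]; exact hj))

theorem IsCharForm.isBlock (he : IsDual c e) (h : IsCharForm c (pairSort (Fin 3)) Ω) :
    IsBlock Ω e (Ω ![e (Sum.inr 0), e (Sum.inr 1)]) (Ω ![e (Sum.inr 2), e (Sum.inr 3)]) := by
  rw [isCharForm_two_iff] at h
  exact ⟨rfl, rfl, h _ (he.mem_charSpace rfl) _ (he.mem_charSpace rfl),
    h _ (he.mem_charSpace rfl) _ (he.mem_charSpace rfl),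
    h _ (he.mem_charSpace rfl) _ (he.mem_charSpace rfl),
    h _ (he.mem_charSpace rfl) _ (he.mem_charSpace rfl)⟩

theorem IsBlock.eq_zero (h : IsBlock Ω e 0 0) (i j : Fin 4) :
    Ω ![e (Sum.inr i), e (Sum.inr j)] = 0 := by
  obtain ⟨h01, h23, h02, h03, h12, h13⟩ := h
  fin_cases i <;> fin_cases j <;>
    first
    | exact two_form_self _ _
    | assumption
    | (rw [two_form_swap, neg_eq_zero]; assumption)

theorem IsBlock.add_smul {P Q P' Q' : ℝ} (h : IsBlock Ω e P Q) (h' : IsBlock Ω' e P' Q')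
    (a b : ℝ) : IsBlock (a • Ω + b • Ω') e (a * P + b * P') (a * Q + b * Q') := by
  obtain ⟨h01, h23, h02, h03, h12, h13⟩ := h
  obtain ⟨k01, k23, k02, k03, k12, k13⟩ := h'
  refine ⟨?_, ?_, ?_, ?_, ?_, ?_⟩ <;>
    simp [ContinuousAlternatingMap.add_apply, ContinuousAlternatingMap.smul_apply, *]

theorem IsBlock.first_ne_zero {P Q : ℝ} (h : IsBlock Ω e P Q)
    (h0 : ¬ ∀ i, Ω ![e (Sum.inr 0), e (Sum.inr i)] = 0) : P ≠ 0 := by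
  rintro rfl
  obtain ⟨h01, h23, h02, h03, h12, h13⟩ := h
  refine h0 fun i => ?_
  fin_cases i
  · exact two_form_self _ _
  · exact h01
  · exact h02
  · exact h03

theorem IsBlock.second_ne_zero {P Q : ℝ} (h : IsBlock Ω e P Q)
    (h0 : ¬ ∀ i, Ω ![e (Sum.inr 2), e (Sum.inr i)] = 0) : Q ≠ 0 := by
  rintro rfl
  obtain ⟨h01, h23, h02, h03, h12, h13⟩ := h
  refine h0 fun i => ?_
  fin_cases i
  · rw [two_form_swap, neg_eq_zero]
    exact h02
  · rw [two_form_swap, neg_eq_zero]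
    exact h12
  · exact two_form_self _ _
  · exact h23

variable {W : Type*} [AddCommGroup W] [Module ℝ W] [TopologicalSpace W] [FiniteDimensional ℝ W]
  {θ : W [⋀^Fin 1]→L[ℝ] ℝ} {η : W [⋀^Fin (1 + 1)]→L[ℝ] ℝ} {L : V →L[ℝ] W}

theorem map_eq_zero_of_contact (hW : Module.finrank ℝ W = 5) (hθ : θ ≠ 0)
    (hη : Nondegenerate θ η) (he : IsDual c e)
    (hL : ∀ v, (∀ a, c (Sum.inl a) (fun _ => v) = 0) → L v = 0 → v = 0)
    (hθe : ∀ i, θ (fun _ => L (e (Sum.inr i))) = 0) {v : V} (hv : θ (fun _ => L v) = 0)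
    (hvη : ∀ i, η ![L v, L (e (Sum.inr i))] = 0) : L v = 0 := by
  refine hη.eq_zero_of_frame hW hθ (f := fun i => L (e (Sum.inr i))) ?_ hθe hv hvη
  rw [Fintype.linearIndependent_iff]
  intro r hr j
  have h1 : ∑ i, r i • e (Sum.inr i) = 0 := by
    refine hL _ (fun a => ?_) ?_
    · rw [← covec_apply, map_sum]
      refine Finset.sum_eq_zero fun i _ => ?_
      rw [map_smul, covec_apply, he, if_neg (by simp), smul_zero]
    · simpa only [map_sum, map_smul] using hr
  have h2 := congrArg (covec (c (Sum.inr j))) h1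
  simp only [map_sum, map_smul, covec_apply, he _ _, map_zero] at h2
  simpa using h2

theorem frame_map_ne_zero (he : IsDual c e)
    (hL : ∀ v, (∀ a, c (Sum.inl a) (fun _ => v) = 0) → L v = 0 → v = 0) (i : Fin 4) :
    L (e (Sum.inr i)) ≠ 0 := by
  intro h0
  have h1 := hL _ (fun a => (he _ _).trans (if_neg (by simp))) h0
  have h2 := he (Sum.inr i) (Sum.inr i)
  rw [h1, if_pos rfl, ← covec_apply, map_zero] at h2
  exact zero_ne_one h2

end Blocks

section ContactFrames

variable {M : Type*} [TopologicalSpace M] [ChartedSpace (EuclideanSpace ℝ (Fin 5)) M]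
  {M' : Type*} [TopologicalSpace M'] [ChartedSpace (EuclideanSpace ℝ (Fin 5)) M']
  {N : Type*} [TopologicalSpace N] [ChartedSpace (EuclideanSpace ℝ (Fin 7)) N]

/-- A split frame whose first two members are pulled back from contact forms. -/
structure ContactFrame (𝓘₀ : EDS (𝓡 5) M) (𝓘₁ : EDS (𝓡 5) M') (𝓑 : EDS (𝓡 7) N)
    (π : N → M) (π' : N → M')
    (χ₁₀ χ₀₁ : (x : N) → Submodule ℝ (TangentSpace (𝓡 7) x [⋀^Fin 1]→L[ℝ] ℝ))
    (W : Set N) (θ : DForm (𝓡 5) M 1) (θ' : DForm (𝓡 5) M' 1) (γ : DForm (𝓡 7) N 1)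
    (α : Fin 4 → DForm (𝓡 7) N 1) : Prop where
  split : SplitFrame 𝓘₀ 𝓘₁ 𝓑 π π' χ₁₀ χ₀₁ W ![pullback π θ, pullback π' θ', γ] α
  mem_left : (⟨1, θ⟩ : GForm (𝓡 5) M) ∈ 𝓘₀.carrier
  mem_right : (⟨1, θ'⟩ : GForm (𝓡 5) M') ∈ 𝓘₁.carrier
  contact_left : ∀ x ∈ W, θ (π x) ≠ 0 ∧ Nondegenerate (θ (π x)) (extd θ (π x)) ∧
    ∀ φ : DForm (𝓡 5) M 1, (⟨1, φ⟩ : GForm (𝓡 5) M) ∈ 𝓘₀.carrier → ∃ r : ℝ, φ (π x) = r • θ (π x)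
  contact_right : ∀ x ∈ W, θ' (π' x) ≠ 0 ∧ Nondegenerate (θ' (π' x)) (extd θ' (π' x)) ∧
    ∀ φ : DForm (𝓡 5) M' 1, (⟨1, φ⟩ : GForm (𝓡 5) M') ∈ 𝓘₁.carrier →
      ∃ r : ℝ, φ (π' x) = r • θ' (π' x)

variable [IsManifold (𝓡 5) ∞ M] [IsManifold (𝓡 5) ∞ M'] [IsManifold (𝓡 7) ∞ N]
  {𝓘₀ : EDS (𝓡 5) M} {𝓘₁ : EDS (𝓡 5) M'} {𝓑 : EDS (𝓡 7) N} {π : N → M} {π' : N → M'}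
  {χ₁₀ χ₀₁ : (x : N) → Submodule ℝ (TangentSpace (𝓡 7) x [⋀^Fin 1]→L[ℝ] ℝ)}
  {W : Set N} {b : Fin 3 → DForm (𝓡 7) N 1}
  {θ : DForm (𝓡 5) M 1} {θ' : DForm (𝓡 5) M' 1} {γ : DForm (𝓡 7) N 1}
  {α : Fin 4 → DForm (𝓡 7) N 1}

theorem pullback_ne_zero {x : N} (hπ : Function.Surjective (mfderiv (𝓡 7) (𝓡 5) π x))
    (h : θ (π x) ≠ 0) : pullback (J := 𝓡 7) π θ x ≠ 0 := by
  intro h0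
  refine h (covector_ext fun v => ?_)
  obtain ⟨u, rfl⟩ := hπ v
  exact DFunLike.congr_fun h0 fun _ => u

theorem SplitFrame.pullback_mem_left (h : SplitFrame 𝓘₀ 𝓘₁ 𝓑 π π' χ₁₀ χ₀₁ W b α)
    (hθ : (⟨1, θ⟩ : GForm (𝓡 5) M) ∈ 𝓘₀.carrier) {x : N} (hx : x ∈ W) :
    pullback (J := 𝓡 7) π θ x ∈ Submodule.span ℝ (Set.range fun a => b a x) := by
  obtain ⟨e, he⟩ := h.frame.exists_isDual card_three_four
  obtain ⟨Θ, hΘ⟩ := h.left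
  exact (hΘ.char ⟨1, pullback π θ⟩ (Or.inl ⟨_, hθ, rfl⟩) x hx).mem_span (V := TangentSpace (𝓡 7) x)
    (card_three_four_tangent x) (he x hx)

theorem SplitFrame.pullback_mem_right (h : SplitFrame 𝓘₀ 𝓘₁ 𝓑 π π' χ₁₀ χ₀₁ W b α)
    (hθ : (⟨1, θ'⟩ : GForm (𝓡 5) M') ∈ 𝓘₁.carrier) {x : N} (hx : x ∈ W) :
    pullback (J := 𝓡 7) π' θ' x ∈ Submodule.span ℝ (Set.range fun a => b a x) := by
  obtain ⟨e, he⟩ := h.frame.exists_isDual card_three_four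
  obtain ⟨Θ, hΘ⟩ := h.right
  exact (hΘ.char ⟨1, pullback π' θ'⟩ (Or.inl ⟨_, hθ, rfl⟩) x hx).mem_span
    (V := TangentSpace (𝓡 7) x) (card_three_four_tangent x) (he x hx)

theorem exists_contactFrame (hA : IsTypeA 𝓘₀ 𝓘₁ 𝓑 π π')
    (hχ : IsCharacteristicPair 𝓑 χ₁₀ χ₀₁) (p : N) :
    ∃ W θ θ' γ α, p ∈ W ∧ (⟨1, γ⟩ : GForm (𝓡 7) N) ∈ 𝓑.carrier ∧
      ContactFrame 𝓘₀ 𝓘₁ 𝓑 π π' χ₁₀ χ₀₁ W θ θ' γ α := by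
  obtain ⟨W, b, α, hp, hW⟩ := exists_splitFrame hA.backlund hχ p
  obtain ⟨θ, hθ, U, hU, hpU, hUθ⟩ := hA.left_ma.exists_contact (π p)
  obtain ⟨θ', hθ', U', hU', hpU', hUθ'⟩ := hA.right_ma.exists_contact (π' p)
  have hπ : ContMDiff (𝓡 7) (𝓡 5) ∞ π := hA.backlund.1.1.1
  have hπ' : ContMDiff (𝓡 7) (𝓡 5) ∞ π' := hA.backlund.2.1.1
  let w := pullback (J := 𝓡 7) π θ
  let w' := pullback (J := 𝓡 7) π' θ'
  have hpair : LinearIndependent ℝ ![w p, w' p] := by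
    rw [LinearIndependent.pair_iff]
    intro s t hst
    have hw : w p ≠ 0 := pullback_ne_zero (hA.backlund.1.1.2 p) (hUθ _ hpU).1
    have hw' : w' p ≠ 0 := pullback_ne_zero (hA.backlund.2.1.2 p) (hUθ' _ hpU').1
    have h1 : s • w p ∈ degOne (pullbackSet (J := 𝓡 7) π 𝓘₀.carrier) p ⊓
        degOne (pullbackSet (J := 𝓡 7) π' 𝓘₁.carrier) p := by
      refine ⟨Submodule.smul_mem _ _ (Submodule.subset_span ⟨w, ⟨_, hθ, rfl⟩, rfl⟩), ?_⟩
      rw [eq_neg_of_add_eq_zero_left hst]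
      exact neg_mem (Submodule.smul_mem _ _ (Submodule.subset_span ⟨w', ⟨_, hθ', rfl⟩, rfl⟩))
    rw [hA.first p, Submodule.mem_bot] at h1
    have hs : s = 0 := (smul_eq_zero.1 h1).resolve_right hw
    rw [h1, zero_add] at hst
    exact ⟨hs, (smul_eq_zero.1 hst).resolve_right hw'⟩
  obtain ⟨γ, hγ, hγp⟩ : ∃ γ : DForm (𝓡 7) N 1, (⟨1, γ⟩ : GForm (𝓡 7) N) ∈ 𝓑.carrier ∧
      γ p ∉ Submodule.span ℝ {w p, w' p} := by
    by_contra hcon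
    push Not at hcon
    have h1 : degOne 𝓑.carrier p ≤ Submodule.span ℝ (Set.range ![w p, w' p]) := by
      refine Submodule.span_le.2 ?_
      rintro _ ⟨φ, hφ, rfl⟩
      rw [Matrix.range_cons, Matrix.range_cons, Matrix.range_empty, Set.union_empty,
        Set.singleton_union]
      exact hcon φ hφ
    rw [hW.degOne_eq hp] at h1
    have : FiniteDimensional ℝ (Submodule.span ℝ (Set.range ![w p, w' p])) :=
      FiniteDimensional.span_of_finite ℝ (Set.finite_range _)
    have h2 := Submodule.finrank_mono h1
    have h3 : LinearIndependent ℝ fun a => b a p :=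
      (hW.frame.2 p hp).comp Sum.inl Sum.inl_injective
    rw [finrank_span_eq_card hpair, finrank_span_eq_card h3] at h2
    simp at h2
  have hli : LinearIndependent ℝ fun a => (![w, w', γ] : Fin 3 → DForm (𝓡 7) N 1) a p := by
    have := linearIndependent_triple (V := TangentSpace (𝓡 7) p) hpair hγp
    convert this using 1
    ext1 a; fin_cases a <;> rfl
  have hsmooth : ∀ a x, SmoothAt ((![w, w', γ] : Fin 3 → DForm (𝓡 7) N 1) a) x := by
    intro a x
    fin_cases a
    · exact SmoothAt.pullback (hπ x) (𝓘₀.smooth hθ _ trivial)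
    · exact SmoothAt.pullback (hπ' x) (𝓘₁.smooth hθ' _ trivial)
    · exact 𝓑.smooth hγ x trivial
  have hev := eventually_linearIndependent (fun a => hsmooth a p) hli
  have hnhds : (W ∩ (π ⁻¹' U ∩ π' ⁻¹' U')) ∩ {x | LinearIndependent ℝ fun a =>
      (![w, w', γ] : Fin 3 → DForm (𝓡 7) N 1) a x} ∈ nhds p :=
    Filter.inter_mem (Filter.inter_mem (hW.isOpen.mem_nhds hp)
      (Filter.inter_mem (hπ.continuous.continuousAt.preimage_mem_nhds (hU.mem_nhds hpU))
        (hπ'.continuous.continuousAt.preimage_mem_nhds (hU'.mem_nhds hpU')))) hev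
  obtain ⟨W', hsub, hW', hpW'⟩ := mem_nhds_iff.1 hnhds
  refine ⟨W', θ, θ', γ, α, hpW', hγ, ?_, hθ, hθ', fun x hx => ?_, fun x hx => ?_⟩
  · refine (hW.mono hW' fun x hx => (hsub hx).1.1).replace (fun a x _ => hsmooth a x)
      (fun x hx => (hsub hx).2) fun x hx a => ?_
    have hxW : x ∈ W := (hsub hx).1.1
    fin_cases a
    · exact hW.pullback_mem_left hθ hxW
    · exact hW.pullback_mem_right hθ' hxW
    · rw [← hW.degOne_eq hxW]
      exact Submodule.subset_span ⟨γ, hγ, rfl⟩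
  · obtain ⟨h1, h2, h3, -⟩ := hUθ _ (hsub hx).1.2.1
    exact ⟨h1, h2, h3⟩
  · obtain ⟨h1, h2, h3, -⟩ := hUθ' _ (hsub hx).1.2.2
    exact ⟨h1, h2, h3⟩

namespace ContactFrame

variable {e : Fin 3 ⊕ Fin 4 → ∀ x : N, TangentSpace (𝓡 7) x} {x : N}

theorem degOne_left (h : ContactFrame 𝓘₀ 𝓘₁ 𝓑 π π' χ₁₀ χ₀₁ W θ θ' γ α) (hx : x ∈ W) :
    degOne (pullbackSet (J := 𝓡 7) π 𝓘₀.carrier) x = Submodule.span ℝ {pullback π θ x} := by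
  refine le_antisymm (Submodule.span_le.2 ?_) (Submodule.span_le.2 ?_)
  · rintro _ ⟨φ, ⟨⟨k, ψ⟩, hψ, hφ⟩, rfl⟩
    obtain ⟨rfl, hφ'⟩ := Sigma.mk.inj hφ
    obtain rfl := eq_of_heq hφ'
    obtain ⟨r, hr⟩ := (h.contact_left x hx).2.2 ψ hψ
    refine Submodule.mem_span_singleton.2 ⟨r, covector_ext fun v => ?_⟩
    exact (DFunLike.congr_fun hr fun _ => mfderiv (𝓡 7) (𝓡 5) π x v).symm
  · rintro _ rfl
    exact Submodule.subset_span ⟨pullback π θ, ⟨_, h.mem_left, rfl⟩, rfl⟩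

theorem degOne_right (h : ContactFrame 𝓘₀ 𝓘₁ 𝓑 π π' χ₁₀ χ₀₁ W θ θ' γ α) (hx : x ∈ W) :
    degOne (pullbackSet (J := 𝓡 7) π' 𝓘₁.carrier) x = Submodule.span ℝ {pullback π' θ' x} := by
  refine le_antisymm (Submodule.span_le.2 ?_) (Submodule.span_le.2 ?_)
  · rintro _ ⟨φ, ⟨⟨k, ψ⟩, hψ, hφ⟩, rfl⟩
    obtain ⟨rfl, hφ'⟩ := Sigma.mk.inj hφ
    obtain rfl := eq_of_heq hφ'
    obtain ⟨r, hr⟩ := (h.contact_right x hx).2.2 ψ hψ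
    refine Submodule.mem_span_singleton.2 ⟨r, covector_ext fun v => ?_⟩
    exact (DFunLike.congr_fun hr fun _ => mfderiv (𝓡 7) (𝓡 5) π' x v).symm
  · rintro _ rfl
    exact Submodule.subset_span ⟨pullback π' θ', ⟨_, h.mem_right, rfl⟩, rfl⟩

theorem isCharForm_left (h : ContactFrame 𝓘₀ 𝓘₁ 𝓑 π π' χ₁₀ χ₀₁ W θ θ' γ α) (hx : x ∈ W)
    (hπ : ContMDiff (𝓡 7) (𝓡 5) ∞ π) :
    IsCharForm (fun i => Sum.elim ![pullback π θ, pullback π' θ', γ] α i x) (pairSort (Fin 3))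
      (extd (pullback (J := 𝓡 7) π θ) x) := by
  obtain ⟨Θ, hΘ⟩ := h.split.left
  rw [extd_pullback (hπ x) (𝓘₀.smooth h.mem_left _ trivial)]
  exact hΘ.char ⟨2, pullback π (extd θ)⟩ (Or.inl ⟨_, 𝓘₀.d_mem h.mem_left, rfl⟩) x hx

theorem isCharForm_right (h : ContactFrame 𝓘₀ 𝓘₁ 𝓑 π π' χ₁₀ χ₀₁ W θ θ' γ α) (hx : x ∈ W)
    (hπ' : ContMDiff (𝓡 7) (𝓡 5) ∞ π') :
    IsCharForm (fun i => Sum.elim ![pullback π θ, pullback π' θ', γ] α i x) (pairSort (Fin 3))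
      (extd (pullback (J := 𝓡 7) π' θ') x) := by
  obtain ⟨Θ, hΘ⟩ := h.split.right
  rw [extd_pullback (hπ' x) (𝓘₁.smooth h.mem_right _ trivial)]
  exact hΘ.char ⟨2, pullback π' (extd θ')⟩ (Or.inl ⟨_, 𝓘₁.d_mem h.mem_right, rfl⟩) x hx

theorem map_eq_zero_left (h : ContactFrame 𝓘₀ 𝓘₁ 𝓑 π π' χ₁₀ χ₀₁ W θ θ' γ α) (hx : x ∈ W)
    (hπ : ContMDiff (𝓡 7) (𝓡 5) ∞ π)
    (he : IsDual (fun i => Sum.elim ![pullback π θ, pullback π' θ', γ] α i x) fun i => e i x)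
    {v : TangentSpace (𝓡 7) x} (hv : pullback (J := 𝓡 7) π θ x (fun _ => v) = 0)
    (hvd : ∀ i, extd (pullback (J := 𝓡 7) π θ) x ![v, e (Sum.inr i) x] = 0) :
    mfderiv (𝓡 7) (𝓡 5) π x v = 0 := by
  obtain ⟨h1, h2, -⟩ := h.contact_left x hx
  have hdim : Module.finrank ℝ (TangentSpace (𝓡 5) (π x)) = 5 := finrank_euclideanSpace_fin
  refine map_eq_zero_of_contact (V := TangentSpace (𝓡 7) x) (W := TangentSpace (𝓡 5) (π x))
    hdim h1 h2 he (h.split.trans_left x hx)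
    (fun i => (he (Sum.inl 0) (Sum.inr i)).trans (if_neg (by simp))) hv fun i => ?_
  have h3 := hvd i
  rw [extd_pullback (hπ x) (𝓘₀.smooth h.mem_left _ trivial)] at h3
  refine Eq.trans (congrArg (extd θ (π x)) ?_) h3
  ext1 a; fin_cases a <;> rfl

theorem map_eq_zero_right (h : ContactFrame 𝓘₀ 𝓘₁ 𝓑 π π' χ₁₀ χ₀₁ W θ θ' γ α) (hx : x ∈ W)
    (hπ' : ContMDiff (𝓡 7) (𝓡 5) ∞ π')
    (he : IsDual (fun i => Sum.elim ![pullback π θ, pullback π' θ', γ] α i x) fun i => e i x)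
    {v : TangentSpace (𝓡 7) x} (hv : pullback (J := 𝓡 7) π' θ' x (fun _ => v) = 0)
    (hvd : ∀ i, extd (pullback (J := 𝓡 7) π' θ') x ![v, e (Sum.inr i) x] = 0) :
    mfderiv (𝓡 7) (𝓡 5) π' x v = 0 := by
  obtain ⟨h1, h2, -⟩ := h.contact_right x hx
  have hdim : Module.finrank ℝ (TangentSpace (𝓡 5) (π' x)) = 5 := finrank_euclideanSpace_fin
  refine map_eq_zero_of_contact (V := TangentSpace (𝓡 7) x) (W := TangentSpace (𝓡 5) (π' x))
    hdim h1 h2 he (h.split.trans_right x hx)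
    (fun i => (he (Sum.inl 1) (Sum.inr i)).trans (if_neg (by simp))) hv fun i => ?_
  have h3 := hvd i
  rw [extd_pullback (hπ' x) (𝓘₁.smooth h.mem_right _ trivial)] at h3
  refine Eq.trans (congrArg (extd θ' (π' x)) ?_) h3
  ext1 a; fin_cases a <;> rfl

theorem extd_apply_eq_zero_left (h : ContactFrame 𝓘₀ 𝓘₁ 𝓑 π π' χ₁₀ χ₀₁ W θ θ' γ α)
    (hπ : ContMDiff (𝓡 7) (𝓡 5) ∞ π) {v : TangentSpace (𝓡 7) x}
    (hv : mfderiv (𝓡 7) (𝓡 5) π x v = 0) (w : TangentSpace (𝓡 7) x) :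
    extd (pullback (J := 𝓡 7) π θ) x ![v, w] = 0 := by
  rw [extd_pullback (hπ x) (𝓘₀.smooth h.mem_left _ trivial)]
  exact (extd θ (π x)).map_coord_zero (0 : Fin 2) hv

theorem extd_apply_eq_zero_right (h : ContactFrame 𝓘₀ 𝓘₁ 𝓑 π π' χ₁₀ χ₀₁ W θ θ' γ α)
    (hπ' : ContMDiff (𝓡 7) (𝓡 5) ∞ π') {v : TangentSpace (𝓡 7) x}
    (hv : mfderiv (𝓡 7) (𝓡 5) π' x v = 0) (w : TangentSpace (𝓡 7) x) :
    extd (pullback (J := 𝓡 7) π' θ') x ![v, w] = 0 := by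
  rw [extd_pullback (hπ' x) (𝓘₁.smooth h.mem_right _ trivial)]
  exact (extd θ' (π' x)).map_coord_zero (0 : Fin 2) hv

/-- The exterior derivatives of the two contact forms restrict to the characteristic planes as
linearly independent diagonal forms without zero coefficients. -/
theorem blocks (h : ContactFrame 𝓘₀ 𝓘₁ 𝓑 π π' χ₁₀ χ₀₁ W θ θ' γ α) (hx : x ∈ W)
    (hA : IsTypeA 𝓘₀ 𝓘₁ 𝓑 π π')
    (he : IsDual (fun i => Sum.elim ![pullback π θ, pullback π' θ', γ] α i x) fun i => e i x)
    {P Q P' Q' : ℝ}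
    (hP : P = extd (pullback (J := 𝓡 7) π θ) x ![e (Sum.inr 0) x, e (Sum.inr 1) x])
    (hQ : Q = extd (pullback (J := 𝓡 7) π θ) x ![e (Sum.inr 2) x, e (Sum.inr 3) x])
    (hP' : P' = extd (pullback (J := 𝓡 7) π' θ') x ![e (Sum.inr 0) x, e (Sum.inr 1) x])
    (hQ' : Q' = extd (pullback (J := 𝓡 7) π' θ') x ![e (Sum.inr 2) x, e (Sum.inr 3) x]) :
    IsBlock (extd (pullback (J := 𝓡 7) π θ) x) (fun i => e i x) P Q ∧
    IsBlock (extd (pullback (J := 𝓡 7) π' θ') x) (fun i => e i x) P' Q' ∧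
    P ≠ 0 ∧ Q ≠ 0 ∧ P' ≠ 0 ∧ Q' ≠ 0 ∧ P * Q' ≠ Q * P' := by
  have hπ : ContMDiff (𝓡 7) (𝓡 5) ∞ π := hA.backlund.1.1.1
  have hπ' : ContMDiff (𝓡 7) (𝓡 5) ∞ π' := hA.backlund.2.1.1
  have b1 : IsBlock (extd (pullback (J := 𝓡 7) π θ) x) (fun i => e i x) P Q := by
    rw [hP, hQ]
    exact (h.isCharForm_left hx hπ).isBlock (V := TangentSpace (𝓡 7) x) he
  have b2 : IsBlock (extd (pullback (J := 𝓡 7) π' θ') x) (fun i => e i x) P' Q' := by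
    rw [hP', hQ']
    exact (h.isCharForm_right hx hπ').isBlock (V := TangentSpace (𝓡 7) x) he
  have n1 : ∀ j, ¬ ∀ i, extd (pullback (J := 𝓡 7) π θ) x ![e (Sum.inr j) x, e (Sum.inr i) x] = 0 :=
    fun j hj => frame_map_ne_zero (V := TangentSpace (𝓡 7) x) (W := TangentSpace (𝓡 5) (π x)) he
      (h.split.trans_left x hx) j (h.map_eq_zero_left hx hπ he
        ((he (Sum.inl 0) (Sum.inr j)).trans (if_neg (by simp))) hj)
  have n2 : ∀ j, ¬ ∀ i, extd (pullback (J := 𝓡 7) π' θ') x ![e (Sum.inr j) x, e (Sum.inr i) x] = 0 :=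
    fun j hj => frame_map_ne_zero (V := TangentSpace (𝓡 7) x) (W := TangentSpace (𝓡 5) (π' x)) he
      (h.split.trans_right x hx) j (h.map_eq_zero_right hx hπ' he
        ((he (Sum.inl 1) (Sum.inr j)).trans (if_neg (by simp))) hj)
  have hP'0 : P' ≠ 0 := b2.first_ne_zero (n2 0)
  refine ⟨b1, b2, b1.first_ne_zero (n1 0), b1.second_ne_zero (n1 2), hP'0,
    b2.second_ne_zero (n2 2), fun heq => hP'0 ?_⟩
  refine (hA.second x θ θ' h.mem_left h.mem_right (h.contact_left x hx).1 (h.contact_right x hx).1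
    P' (-P) ?_).1
  have b3 := b1.add_smul b2 P' (-P)
  rw [show P' * P + -P * P' = 0 by ring, show P' * Q + -P * Q' = 0 by linarith] at b3
  refine congMod_zero_of_coeff (V := TangentSpace (𝓡 7) x)
    (he.expand (card_three_four_tangent x)) (Z := Set.range Sum.inl) ?_ ?_
  · rintro _ ⟨a, rfl⟩
    rw [SetLike.mem_coe, h.split.degOne_eq hx]
    exact Submodule.subset_span ⟨a, rfl⟩
  · rintro (a | i) hi (a' | j) hj
    · exact absurd ⟨a, rfl⟩ hi
    · exact absurd ⟨a, rfl⟩ hi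
    · exact absurd ⟨a', rfl⟩ hj
    · rw [sub_zero]
      exact b3.eq_zero j i

end ContactFrame

end ContactFrames

section BlockRescaling

variable {V : Type*} [AddCommGroup V] [Module ℝ V] [TopologicalSpace V]
  {e : Fin 3 ⊕ Fin 4 → V} {Ω Ω' : V [⋀^Fin (1 + 1)]→L[ℝ] ℝ} {P Q : ℝ}

theorem IsBlock.congr_smul (h : IsBlock Ω e P Q) {s : ℝ}
    (hΩ : ∀ i j, Ω' ![e (Sum.inr i), e (Sum.inr j)] = s * Ω ![e (Sum.inr i), e (Sum.inr j)]) :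
    IsBlock Ω' e (s * P) (s * Q) := by
  obtain ⟨h01, h23, h02, h03, h12, h13⟩ := h
  refine ⟨?_, ?_, ?_, ?_, ?_, ?_⟩ <;> rw [hΩ] <;> simp [*]

theorem two_form_smul_left (Ω : V [⋀^Fin (1 + 1)]→L[ℝ] ℝ) (r : ℝ) (v w : V) :
    Ω ![r • v, w] = r * Ω ![v, w] := by
  rw [← leftSlot_apply, map_smul, leftSlot_apply, smul_eq_mul]

theorem two_form_smul_right (Ω : V [⋀^Fin (1 + 1)]→L[ℝ] ℝ) (r : ℝ) (v w : V) :
    Ω ![v, r • w] = r * Ω ![v, w] := by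
  rw [two_form_swap, two_form_smul_left, two_form_swap Ω v w, mul_neg]

theorem IsBlock.rescale (h : IsBlock Ω e P Q) (s a b k m : ℝ) :
    IsBlock Ω (rescaleFrame e s a b k m) (k⁻¹ * P) (m⁻¹ * Q) := by
  obtain ⟨h01, h23, h02, h03, h12, h13⟩ := h
  have e0 : rescaleFrame e s a b k m (Sum.inr 0) = k⁻¹ • e (Sum.inr 0) := rfl
  have e1 : rescaleFrame e s a b k m (Sum.inr 1) = e (Sum.inr 1) := rfl
  have e2 : rescaleFrame e s a b k m (Sum.inr 2) = m⁻¹ • e (Sum.inr 2) := rfl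
  have e3 : rescaleFrame e s a b k m (Sum.inr 3) = e (Sum.inr 3) := rfl
  refine ⟨?_, ?_, ?_, ?_, ?_, ?_⟩ <;>
    simp only [e0, e1, e2, e3, two_form_smul_left, two_form_smul_right, h01, h23, h02, h03, h12,
      h13, mul_zero]

theorem exists_rescaleFrame_inr {s a b k m : ℝ} (hk : k ≠ 0) (hm : m ≠ 0) (i : Fin 4) :
    ∃ t : ℝ, t ≠ 0 ∧ rescaleFrame e s a b k m (Sum.inr i) = t • e (Sum.inr i) := by
  fin_cases i
  · exact ⟨_, inv_ne_zero hk, rfl⟩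
  · exact ⟨1, one_ne_zero, (one_smul ℝ _).symm⟩
  · exact ⟨_, inv_ne_zero hm, rfl⟩
  · exact ⟨1, one_ne_zero, (one_smul ℝ _).symm⟩

theorem sup_span_pair_eq {V : Type*} [AddCommGroup V] [Module ℝ V] (S : Submodule ℝ V)
    {a b z z' : V} {k : ℝ} (hk : k ≠ 0) (hz : z ∈ S) (hz' : z' ∈ S) :
    S ⊔ Submodule.span ℝ {k • a + z, b + z'} = S ⊔ Submodule.span ℝ {a, b} := by
  have hl : ∀ T : Set V, S ≤ S ⊔ Submodule.span ℝ T := fun T => le_sup_left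
  have hr : ∀ T : Set V, ∀ v ∈ T, v ∈ S ⊔ Submodule.span ℝ T := fun T v hv =>
    le_sup_right (a := S) (Submodule.subset_span hv)
  refine le_antisymm (sup_le le_sup_left (Submodule.span_le.2 ?_))
    (sup_le le_sup_left (Submodule.span_le.2 ?_))
  · rintro _ (rfl | rfl)
    · exact add_mem (Submodule.smul_mem _ _ (hr _ _ (Or.inl rfl))) (hl _ hz)
    · exact add_mem (hr _ _ (Or.inr rfl)) (hl _ hz')
  · rintro _ (h | h)
    · have h1 : k⁻¹ • (k • a + z) - k⁻¹ • z = a := by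
        rw [smul_add, smul_smul, inv_mul_cancel₀ hk, one_smul, add_sub_cancel_right]
      have h2 := sub_mem (Submodule.smul_mem _ k⁻¹ (hr {k • a + z, b + z'} _ (Or.inl rfl)))
        (Submodule.smul_mem _ k⁻¹ (hl {k • a + z, b + z'} hz))
      rw [h]
      rwa [h1] at h2
    · have h2 := sub_mem (hr {k • a + z, b + z'} _ (Or.inr rfl)) (hl {k • a + z, b + z'} hz')
      rw [h]
      rwa [add_sub_cancel_right] at h2

end BlockRescaling

section Coefficients

variable {E : Type*} [NormedAddCommGroup E] [NormedSpace ℝ E] [FiniteDimensional ℝ E]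
  {H : Type*} [TopologicalSpace H] {I : ModelWithCorners ℝ E H} [I.Boundaryless]
  {M : Type*} [TopologicalSpace M] [ChartedSpace H M] [IsManifold I ∞ M]
  {ι : Type*} [Fintype ι] [DecidableEq ι] {U : Set M} {c : ι → DForm I M 1}
  {e : ι → ∀ x : M, TangentSpace I x}

theorem SmoothOn.coeff_pair {φ : DForm I M 2} (hφ : SmoothOn φ U) (hU : IsOpen U)
    (hcard : Fintype.card ι = Module.finrank ℝ E)
    (hc : ∀ i, SmoothOn (c i) U) (he : ∀ x ∈ U, IsDual (fun i => c i x) (fun i => e i x))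
    (i j : ι) : ∀ x ∈ U, ContMDiffAt I 𝓘(ℝ, ℝ) ∞ (fun y => φ y ![e i y, e j y]) x := by
  intro x hx
  refine (SmoothOn.coeff hU hcard hc he hφ ![i, j] x hx).congr_of_eventuallyEq
    (Filter.Eventually.of_forall fun y => congrArg (φ y) ?_)
  ext1 a; fin_cases a <;> rfl

theorem ContMDiffAt.real_mul {f g : M → ℝ} {x : M} (hf : ContMDiffAt I 𝓘(ℝ, ℝ) ∞ f x)
    (hg : ContMDiffAt I 𝓘(ℝ, ℝ) ∞ g x) : ContMDiffAt I 𝓘(ℝ, ℝ) ∞ (fun y => f y * g y) x := by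
  refine ContMDiffAt.of_comp_extChartAt (h := fun u => f ((extChartAt I x).symm u) *
    g ((extChartAt I x).symm u)) ((contMDiffAt_comp_extChartAt_symm hf).mul
      (contMDiffAt_comp_extChartAt_symm hg)) ?_
  filter_upwards [extChartAt_source_mem_nhds (I := I) x] with y hy
  show f y * g y = f ((extChartAt I x).symm (extChartAt I x y)) *
    g ((extChartAt I x).symm (extChartAt I x y))
  rw [(extChartAt I x).left_inv hy]

theorem ContMDiffAt.real_inv {f : M → ℝ} {x : M} (hf : ContMDiffAt I 𝓘(ℝ, ℝ) ∞ f x)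
    (h0 : f x ≠ 0) : ContMDiffAt I 𝓘(ℝ, ℝ) ∞ (fun y => (f y)⁻¹) x :=
  ContMDiffAt.comp x (contDiffAt_inv ℝ h0).contMDiffAt hf

theorem ContMDiffAt.real_div {f g : M → ℝ} {x : M} (hf : ContMDiffAt I 𝓘(ℝ, ℝ) ∞ f x)
    (hg : ContMDiffAt I 𝓘(ℝ, ℝ) ∞ g x) (h0 : g x ≠ 0) :
    ContMDiffAt I 𝓘(ℝ, ℝ) ∞ (fun y => f y / g y) x := by
  simp only [div_eq_mul_inv]
  exact ContMDiffAt.real_mul hf (ContMDiffAt.real_inv hg h0)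

theorem ContMDiffAt.real_sqrt {f : M → ℝ} {x : M} (hf : ContMDiffAt I 𝓘(ℝ, ℝ) ∞ f x)
    (h0 : f x ≠ 0) : ContMDiffAt I 𝓘(ℝ, ℝ) ∞ (fun y => Real.sqrt (f y)) x :=
  ContMDiffAt.comp x (Real.contDiffAt_sqrt h0).contMDiffAt hf

theorem ContMDiffAt.real_sub {f g : M → ℝ} {x : M} (hf : ContMDiffAt I 𝓘(ℝ, ℝ) ∞ f x)
    (hg : ContMDiffAt I 𝓘(ℝ, ℝ) ∞ g x) : ContMDiffAt I 𝓘(ℝ, ℝ) ∞ (fun y => f y - g y) x :=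
  hf.sub hg

end Coefficients

section Construction

variable {M : Type*} [TopologicalSpace M] [ChartedSpace (EuclideanSpace ℝ (Fin 5)) M]
  {M' : Type*} [TopologicalSpace M'] [ChartedSpace (EuclideanSpace ℝ (Fin 5)) M']
  {N : Type*} [TopologicalSpace N] [ChartedSpace (EuclideanSpace ℝ (Fin 7)) N]
  [IsManifold (𝓡 5) ∞ M] [IsManifold (𝓡 5) ∞ M'] [IsManifold (𝓡 7) ∞ N]
  {𝓘₀ : EDS (𝓡 5) M} {𝓘₁ : EDS (𝓡 5) M'} {𝓑 : EDS (𝓡 7) N} {π : N → M} {π' : N → M'}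
  {χ₁₀ χ₀₁ : (x : N) → Submodule ℝ (TangentSpace (𝓡 7) x [⋀^Fin 1]→L[ℝ] ℝ)}
  {W : Set N} {θ : DForm (𝓡 5) M 1} {θ' : DForm (𝓡 5) M' 1} {γ : DForm (𝓡 7) N 1}
  {α : Fin 4 → DForm (𝓡 7) N 1}

theorem ContactFrame.mono {W' : Set N} (h : ContactFrame 𝓘₀ 𝓘₁ 𝓑 π π' χ₁₀ χ₀₁ W θ θ' γ α)
    (hW' : IsOpen W') (hWW' : W' ⊆ W) : ContactFrame 𝓘₀ 𝓘₁ 𝓑 π π' χ₁₀ χ₀₁ W' θ θ' γ α where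
  split := h.split.mono hW' hWW'
  mem_left := h.mem_left
  mem_right := h.mem_right
  contact_left x hx := h.contact_left x (hWW' hx)
  contact_right x hx := h.contact_right x (hWW' hx)

/-- The coefficient functions used to rescale a contact frame; all identities needed for the
structure equations. -/
structure RescaleData (W : Set N) (P Q P' Q' R T : N → ℝ) (ε : ℝ) (A s a b m : N → ℝ) : Prop where
  sign : ε = 1 ∨ ε = -1
  smooth_A : ∀ x ∈ W, ContMDiffAt (𝓡 7) 𝓘(ℝ, ℝ) ∞ A x
  smooth_s : ∀ x ∈ W, ContMDiffAt (𝓡 7) 𝓘(ℝ, ℝ) ∞ s x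
  smooth_a : ∀ x ∈ W, ContMDiffAt (𝓡 7) 𝓘(ℝ, ℝ) ∞ a x
  smooth_b : ∀ x ∈ W, ContMDiffAt (𝓡 7) 𝓘(ℝ, ℝ) ∞ b x
  smooth_m : ∀ x ∈ W, ContMDiffAt (𝓡 7) 𝓘(ℝ, ℝ) ∞ m x
  pos : ∀ x ∈ W, 0 < A x
  sq_ne : ∀ x ∈ W, A x ^ 2 ≠ ε
  s_ne : ∀ x ∈ W, s x ≠ 0
  m_ne : ∀ x ∈ W, m x ≠ 0
  first : ∀ x ∈ W, (P' x)⁻¹ * (s x * P x) = A x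
  second : ∀ x ∈ W, (m x)⁻¹ * (s x * Q x) = 1
  third : ∀ x ∈ W, (m x)⁻¹ * Q' x = ε * A x
  fourth : ∀ x ∈ W, R x + a x * (s x * P x) + b x * P' x = 0
  fifth : ∀ x ∈ W, T x + a x * (s x * Q x) + b x * Q' x = 0

theorem exists_rescaleData {p : N} (hW : IsOpen W) (hp : p ∈ W) {P Q P' Q' R T : N → ℝ}
    (hP : ∀ x ∈ W, ContMDiffAt (𝓡 7) 𝓘(ℝ, ℝ) ∞ P x)
    (hQ : ∀ x ∈ W, ContMDiffAt (𝓡 7) 𝓘(ℝ, ℝ) ∞ Q x)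
    (hP' : ∀ x ∈ W, ContMDiffAt (𝓡 7) 𝓘(ℝ, ℝ) ∞ P' x)
    (hQ' : ∀ x ∈ W, ContMDiffAt (𝓡 7) 𝓘(ℝ, ℝ) ∞ Q' x)
    (hR : ∀ x ∈ W, ContMDiffAt (𝓡 7) 𝓘(ℝ, ℝ) ∞ R x)
    (hT : ∀ x ∈ W, ContMDiffAt (𝓡 7) 𝓘(ℝ, ℝ) ∞ T x)
    (h0 : ∀ x ∈ W, P x ≠ 0 ∧ Q x ≠ 0 ∧ P' x ≠ 0 ∧ Q' x ≠ 0 ∧ P x * Q' x ≠ Q x * P' x) :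
    ∃ W' ⊆ W, IsOpen W' ∧ p ∈ W' ∧ ∃ ε A s a b m, RescaleData W' P Q P' Q' R T ε A s a b m := by
  let r : N → ℝ := fun x => P x * Q' x / (Q x * P' x)
  have hr : ∀ x ∈ W, ContMDiffAt (𝓡 7) 𝓘(ℝ, ℝ) ∞ r x := fun x hx =>
    ContMDiffAt.real_div (ContMDiffAt.real_mul (hP x hx) (hQ' x hx))
      (ContMDiffAt.real_mul (hQ x hx) (hP' x hx)) (mul_ne_zero (h0 x hx).2.1 (h0 x hx).2.2.1)
  have hr0 : r p ≠ 0 := by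
    obtain ⟨h1, h2, h3, h4, -⟩ := h0 p hp
    exact div_ne_zero (mul_ne_zero h1 h4) (mul_ne_zero h2 h3)
  obtain ⟨ε, hε, hεr⟩ : ∃ ε : ℝ, (ε = 1 ∨ ε = -1) ∧ 0 < ε * r p := by
    rcases lt_or_gt_of_ne hr0 with h | h
    · exact ⟨-1, Or.inr rfl, by linarith⟩
    · exact ⟨1, Or.inl rfl, by linarith⟩
  have hεε : ε * ε = 1 := by rcases hε with rfl | rfl <;> norm_num
  have hev : ∀ᶠ x in nhds p, 0 < ε * r x :=
    ((hr p hp).continuousAt.const_mul ε).eventually (lt_mem_nhds hεr)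
  obtain ⟨W', hsub, hW', hpW'⟩ := mem_nhds_iff.1 (Filter.inter_mem hev (hW.mem_nhds hp))
  refine ⟨W', fun x hx => (hsub hx).2, hW', hpW', ε, ?_⟩
  let A : N → ℝ := fun x => Real.sqrt (ε * r x)
  let s : N → ℝ := fun x => A x * P' x / P x
  let m : N → ℝ := fun x => s x * Q x
  let D : N → ℝ := fun x => ε * A x * A x - 1
  let a : N → ℝ := fun x => (T x / m x - ε * A x * (R x / P' x)) / D x
  let b : N → ℝ := fun x => (R x / P' x - A x * (T x / m x)) / D x
  have hpos : ∀ x ∈ W', 0 < A x := fun x hx => Real.sqrt_pos.2 (hsub hx).1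
  have hAA : ∀ x ∈ W', A x * A x = ε * r x := fun x hx => Real.mul_self_sqrt (hsub hx).1.le
  have hAr : ∀ x ∈ W', r x = ε * (A x * A x) := fun x hx => by
    rw [hAA x hx, ← mul_assoc, hεε, one_mul]
  have hr1 : ∀ x ∈ W', r x ≠ 1 := by
    intro x hx h1
    obtain ⟨-, h2, h3, -, h5⟩ := h0 x (hsub hx).2
    exact h5 ((div_eq_one_iff_eq (mul_ne_zero h2 h3)).1 h1)
  have hD : ∀ x ∈ W', D x ≠ 0 := fun x hx h => hr1 x hx (by
    rw [hAr x hx]; simp only [D] at h; linarith)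
  have hs : ∀ x ∈ W', s x ≠ 0 := fun x hx => by
    obtain ⟨h1, h2, h3, h4, -⟩ := h0 x (hsub hx).2
    exact div_ne_zero (mul_ne_zero (hpos x hx).ne' h3) h1
  have hm : ∀ x ∈ W', m x ≠ 0 := fun x hx => mul_ne_zero (hs x hx) (h0 x (hsub hx).2).2.1
  have sA : ∀ x ∈ W', ContMDiffAt (𝓡 7) 𝓘(ℝ, ℝ) ∞ A x := fun x hx =>
    ContMDiffAt.real_sqrt (ContMDiffAt.real_mul contMDiffAt_const (hr x (hsub hx).2))
      (hsub hx).1.ne'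
  have ss : ∀ x ∈ W', ContMDiffAt (𝓡 7) 𝓘(ℝ, ℝ) ∞ s x := fun x hx =>
    ContMDiffAt.real_div (ContMDiffAt.real_mul (sA x hx) (hP' x (hsub hx).2)) (hP x (hsub hx).2)
      (h0 x (hsub hx).2).1
  have sm : ∀ x ∈ W', ContMDiffAt (𝓡 7) 𝓘(ℝ, ℝ) ∞ m x := fun x hx =>
    ContMDiffAt.real_mul (ss x hx) (hQ x (hsub hx).2)
  have sK : ∀ x ∈ W', ContMDiffAt (𝓡 7) 𝓘(ℝ, ℝ) ∞ (fun x => ε * A x) x := fun x hx =>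
    ContMDiffAt.real_mul contMDiffAt_const (sA x hx)
  have sD : ∀ x ∈ W', ContMDiffAt (𝓡 7) 𝓘(ℝ, ℝ) ∞ D x := fun x hx =>
    ContMDiffAt.real_sub (ContMDiffAt.real_mul (sK x hx) (sA x hx)) contMDiffAt_const
  have sR : ∀ x ∈ W', ContMDiffAt (𝓡 7) 𝓘(ℝ, ℝ) ∞ (fun x => R x / P' x) x := fun x hx =>
    ContMDiffAt.real_div (hR x (hsub hx).2) (hP' x (hsub hx).2) (h0 x (hsub hx).2).2.2.1
  have sT : ∀ x ∈ W', ContMDiffAt (𝓡 7) 𝓘(ℝ, ℝ) ∞ (fun x => T x / m x) x := fun x hx =>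
    ContMDiffAt.real_div (hT x (hsub hx).2) (sm x hx) (hm x hx)
  have hsP : ∀ x ∈ W', s x * P x = A x * P' x := fun x hx =>
    div_mul_cancel₀ _ (h0 x (hsub hx).2).1
  have hQ'm : ∀ x ∈ W', Q' x = ε * A x * m x := by
    intro x hx
    obtain ⟨h1, h2, h3, h4, -⟩ := h0 x (hsub hx).2
    have e1 : r x * (Q x * P' x) = P x * Q' x := div_mul_cancel₀ _ (mul_ne_zero h2 h3)
    have e2 := hsP x hx
    rw [hAr x hx] at e1
    have e3 : P x * Q' x = P x * (ε * A x * m x) := by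
      rw [← e1]
      simp only [m]
      linear_combination (-(ε * A x * Q x)) * e2
    exact mul_left_cancel₀ h1 e3
  refine ⟨A, s, a, b, m, hε, sA, ss, fun x hx => ?_, fun x hx => ?_, sm, hpos, ?_, hs, hm, ?_, ?_,
    ?_, ?_, ?_⟩
  · exact ContMDiffAt.real_div (ContMDiffAt.real_sub (sT x hx)
      (ContMDiffAt.real_mul (sK x hx) (sR x hx))) (sD x hx) (hD x hx)
  · exact ContMDiffAt.real_div (ContMDiffAt.real_sub (sR x hx)
      (ContMDiffAt.real_mul (sA x hx) (sT x hx))) (sD x hx) (hD x hx)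
  · intro x hx h
    refine hD x hx ?_
    simp only [D]
    rw [mul_assoc, ← sq, h, hεε, sub_self]
  · intro x hx
    rw [hsP x hx, mul_comm, mul_assoc, mul_inv_cancel₀ (h0 x (hsub hx).2).2.2.1, mul_one]
  · intro x hx
    exact inv_mul_cancel₀ (hm x hx)
  · intro x hx
    rw [hQ'm x hx, mul_comm, mul_assoc, mul_inv_cancel₀ (hm x hx), mul_one]
  · intro x hx
    have h3 := (h0 x (hsub hx).2).2.2.1
    have hd := hD x hx
    have hmx := hm x hx
    rw [hsP x hx]
    simp only [a, b]
    have hR' : R x = R x / P' x * P' x := (div_mul_cancel₀ _ h3).symm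
    generalize R x / P' x = u at *
    generalize T x / m x = t at *
    rw [hR']
    field_simp
    simp only [D]
    ring
  · intro x hx
    have hd := hD x hx
    have hmx := hm x hx
    have hT' : T x = T x / m x * m x := (div_mul_cancel₀ _ hmx).symm
    rw [hQ'm x hx, show s x * Q x = m x from rfl]
    simp only [a, b]
    generalize R x / P' x = u at *
    generalize T x / m x = t at *
    rw [hT']
    field_simp
    simp only [D]
    ring

end Construction

section Adaptation

variable {M : Type*} [TopologicalSpace M] [ChartedSpace (EuclideanSpace ℝ (Fin 5)) M]
  {M' : Type*} [TopologicalSpace M'] [ChartedSpace (EuclideanSpace ℝ (Fin 5)) M']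
  {N : Type*} [TopologicalSpace N] [ChartedSpace (EuclideanSpace ℝ (Fin 7)) N]
  [IsManifold (𝓡 7) ∞ N]
  {𝓘₀ : EDS (𝓡 5) M} {𝓘₁ : EDS (𝓡 5) M'} {𝓑 : EDS (𝓡 7) N} {π : N → M} {π' : N → M'}
  {χ₁₀ χ₀₁ : (x : N) → Submodule ℝ (TangentSpace (𝓡 7) x [⋀^Fin 1]→L[ℝ] ℝ)}
  {W : Set N}

/-- A coframe with block-diagonal structure equations becomes `0`-adapted after a change of its
last four members. -/
theorem exists_isZeroAdapted_of_isBlock {c : Fin 3 ⊕ Fin 4 → DForm (𝓡 7) N 1}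
    {e : Fin 3 ⊕ Fin 4 → ∀ x : N, TangentSpace (𝓡 7) x} {ε : ℝ} {A : N → ℝ} (hW : IsOpen W)
    (hc : ∀ i, SmoothOn (c i) W) (he : ∀ x ∈ W, IsDual (fun i => c i x) fun i => e i x)
    (hleft : ∀ x ∈ W, Submodule.span ℝ {c (Sum.inl 0) x} =
      degOne (pullbackSet (J := 𝓡 7) π 𝓘₀.carrier) x)
    (hright : ∀ x ∈ W, Submodule.span ℝ {c (Sum.inl 1) x} =
      degOne (pullbackSet (J := 𝓡 7) π' 𝓘₁.carrier) x)
    (hone : ∀ x ∈ W, Submodule.span ℝ (Set.range fun a => c (Sum.inl a) x) = degOne 𝓑.carrier x)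
    (h10 : ∀ x ∈ W, χ₁₀ x = Submodule.span ℝ (Set.range fun a => c (Sum.inl a) x) ⊔
      Submodule.span ℝ {c (Sum.inr 0) x, c (Sum.inr 1) x})
    (h01 : ∀ x ∈ W, χ₀₁ x = Submodule.span ℝ (Set.range fun a => c (Sum.inl a) x) ⊔
      Submodule.span ℝ {c (Sum.inr 2) x, c (Sum.inr 3) x})
    (hε : ε = 1 ∨ ε = -1) (hA : ∀ x ∈ W, ContMDiffAt (𝓡 7) 𝓘(ℝ, ℝ) ∞ A x)
    (hApos : ∀ x ∈ W, 0 < A x) (hAε : ∀ x ∈ W, A x ^ 2 ≠ ε)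
    (hΩ : ∀ x ∈ W, IsBlock (extd (c (Sum.inl 0)) x) (fun i => e i x) (A x) 1)
    (hΩ' : ∀ x ∈ W, IsBlock (extd (c (Sum.inl 1)) x) (fun i => e i x) 1 (ε * A x))
    (hΓ : ∀ x ∈ W, ∀ i j, extd (c (Sum.inl 2)) x ![e (Sum.inr i) x, e (Sum.inr j) x] = 0)
    (hN : ∀ x ∈ W, ∀ v : TangentSpace (𝓡 7) x, c (Sum.inl 0) x (fun _ => v) = 0 →
      (∀ i, extd (c (Sum.inl 0)) x ![v, e (Sum.inr i) x] = 0) →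
      ∀ w, c (Sum.inl 0) x (fun _ => w) = 0 → extd (c (Sum.inl 0)) x ![v, w] = 0)
    (hN' : ∀ x ∈ W, ∀ v : TangentSpace (𝓡 7) x, c (Sum.inl 1) x (fun _ => v) = 0 →
      (∀ i, extd (c (Sum.inl 1)) x ![v, e (Sum.inr i) x] = 0) →
      ∀ w, c (Sum.inl 1) x (fun _ => w) = 0 → extd (c (Sum.inl 1)) x ![v, w] = 0) :
    ∃ w, IsZeroAdapted 𝓘₀ 𝓘₁ 𝓑 π π' χ₁₀ χ₀₁ W (c (Sum.inl 0)) (c (Sum.inl 1))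
      (c (Sum.inl 2)) w := by
  have hε0 : ε ≠ 0 := by rcases hε with rfl | rfl <;> norm_num
  have hK : ∀ x ∈ W, ε * A x ≠ 0 := fun x hx => mul_ne_zero hε0 (hApos x hx).ne'
  let X : N → Fin 3 → Fin 4 → ℝ := fun x => adaptShift (extd (c (Sum.inl 0)) x)
    (extd (c (Sum.inl 1)) x) (fun i => e i x) (A x) (ε * A x)
  let c' : Fin 3 ⊕ Fin 4 → DForm (𝓡 7) N 1 := fun i x => shiftCoframe (fun j => c j x) (X x) i
  let e' : Fin 3 ⊕ Fin 4 → ∀ x : N, TangentSpace (𝓡 7) x :=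
    fun i x => shiftFrame (fun j => e j x) (X x) i
  have hd : ∀ a, SmoothOn (extd (c (Sum.inl a))) W := fun a => SmoothOn.extd hW (hc (Sum.inl a))
  have hco : ∀ a i j, ∀ x ∈ W, ContMDiffAt (𝓡 7) 𝓘(ℝ, ℝ) ∞
      (fun y => extd (c (Sum.inl a)) y ![e i y, e j y]) x := fun a =>
    SmoothOn.coeff_pair (hd a) hW card_three_four hc he
  have hKs : ∀ x ∈ W, ContMDiffAt (𝓡 7) 𝓘(ℝ, ℝ) ∞ (fun y => ε * A y) x := fun x hx =>
    ContMDiffAt.real_mul contMDiffAt_const (hA x hx)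
  have hX : ∀ a i, ∀ x ∈ W, ContMDiffAt (𝓡 7) 𝓘(ℝ, ℝ) ∞ (fun y => X y a i) x := by
    intro a i x hx
    have hA0 := (hApos x hx).ne'
    have hK0 := hK x hx
    fin_cases a <;> fin_cases i
    · exact (hco 1 _ _ x hx).neg
    · exact hco 1 _ _ x hx
    · exact ContMDiffAt.real_div (hco 1 _ _ x hx).neg (hKs x hx) hK0
    · exact ContMDiffAt.real_div (hco 1 _ _ x hx) (hKs x hx) hK0
    · exact ContMDiffAt.real_div (hco 0 _ _ x hx).neg (hA x hx) hA0
    · exact ContMDiffAt.real_div (hco 0 _ _ x hx) (hA x hx) hA0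
    · exact (hco 0 _ _ x hx).neg
    · exact hco 0 _ _ x hx
    · exact ContMDiffAt.real_div (hco 0 _ _ x hx).neg (hA x hx) hA0
    · exact ContMDiffAt.real_div (hco 0 _ _ x hx) (hA x hx) hA0
    · exact ContMDiffAt.real_div (hco 1 _ _ x hx).neg (hKs x hx) hK0
    · exact ContMDiffAt.real_div (hco 1 _ _ x hx) (hKs x hx) hK0
  have hc' : ∀ i, SmoothOn (c' i) W := by
    rintro (a | i) x hx
    · exact hc (Sum.inl a) x hx
    · exact (hc (Sum.inr i) x hx).add
        (SmoothAt.sum Finset.univ fun a _ => (hc (Sum.inl a) x hx).smul (hX a i x hx))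
  have he' : ∀ x ∈ W, IsDual (fun i => c' i x) fun i => e' i x := fun x hx =>
    (he x hx).shift (V := TangentSpace (𝓡 7) x) (X x)
  have hco' : ∀ a i j, ∀ x ∈ W, ContMDiffAt (𝓡 7) 𝓘(ℝ, ℝ) ∞
      (fun y => extd (c (Sum.inl a)) y ![e' i y, e' j y]) x := fun a =>
    SmoothOn.coeff_pair (hd a) hW card_three_four hc' he'
  have hsum : ∀ x i, c' (Sum.inr i) x =
      c (Sum.inr i) x + ∑ a, X x a i • c (Sum.inl a) x := fun _ _ => rfl
  have hrange : ∀ x, (Set.range fun a => c (Sum.inl a) x) =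
      Set.range ![c (Sum.inl 0) x, c (Sum.inl 1) x, c (Sum.inl 2) x] := by
    intro x
    congr 1
    ext1 a; fin_cases a <;> rfl
  have hpair : ∀ x i j, Submodule.span ℝ (Set.range fun a => c (Sum.inl a) x) ⊔
      Submodule.span ℝ {c' (Sum.inr i) x, c' (Sum.inr j) x} =
      Submodule.span ℝ (Set.range fun a => c (Sum.inl a) x) ⊔
      Submodule.span ℝ {c (Sum.inr i) x, c (Sum.inr j) x} := by
    intro x i j
    have hz : ∀ k, ∑ a, X x a k • c (Sum.inl a) x ∈
        Submodule.span ℝ (Set.range fun a => c (Sum.inl a) x) := fun k =>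
      sum_mem fun a _ => Submodule.smul_mem _ _ (Submodule.subset_span ⟨a, rfl⟩)
    have h := sup_span_pair_eq (a := c (Sum.inr i) x) (b := c (Sum.inr j) x) _
      (one_ne_zero (α := ℝ)) (hz i) (hz j)
    rwa [one_smul] at h
  refine ⟨fun i => c' (Sum.inr i), ⟨?_, fun x hx => ?_⟩, fun x hx => ⟨hleft x hx, hright x hx, ?_,
    ?_, ?_⟩, ε, A, fun x => extd (c (Sum.inl 2)) x ![e' (Sum.inl 0) x, e' (Sum.inl 1) x],
    ![fun x => extd (c (Sum.inl 1)) x ![e' (Sum.inr 0) x, e' (Sum.inl 2) x],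
      fun x => extd (c (Sum.inl 1)) x ![e' (Sum.inr 1) x, e' (Sum.inl 2) x],
      fun x => extd (c (Sum.inl 0)) x ![e' (Sum.inr 2) x, e' (Sum.inl 2) x],
      fun x => extd (c (Sum.inl 0)) x ![e' (Sum.inr 3) x, e' (Sum.inl 2) x]],
    fun i x => extd (c (Sum.inl 2)) x ![e' (Sum.inr i) x, e' (Sum.inl 0) x],
    fun i x => extd (c (Sum.inl 2)) x ![e' (Sum.inr i) x, e' (Sum.inl 1) x], hε,
    fun x hx => (hA x hx).contMDiffWithinAt, fun x hx => (hco' _ _ _ x hx).contMDiffWithinAt,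
    fun i => ⟨fun x hx => ?_, fun x hx => (hco' _ _ _ x hx).contMDiffWithinAt,
      fun x hx => (hco' _ _ _ x hx).contMDiffWithinAt⟩, fun x hx => ⟨hApos x hx, hAε x hx, ?_⟩⟩
  · rintro (a | i)
    · fin_cases a
      · exact hc (Sum.inl 0)
      · exact hc (Sum.inl 1)
      · exact hc (Sum.inl 2)
    · exact hc' (Sum.inr i)
  · have h := (he' x hx).linearIndependent (V := TangentSpace (𝓡 7) x)
    convert h using 1
    ext1 i
    rcases i with a | i
    · fin_cases a <;> rfl
    · rfl
  · rw [← hone x hx, hrange x, Matrix.range_cons, Matrix.range_cons, Matrix.range_cons,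
      Matrix.range_empty, Set.union_empty]
    rfl
  · rw [span_five, ← hrange x, hpair x, h10 x hx]
  · rw [span_five, ← hrange x, hpair x, h01 x hx]
  · fin_cases i <;> exact (hco' _ _ _ x hx).contMDiffWithinAt
  · obtain ⟨k1, k2, k3⟩ := IsBlock.adapt (V := TangentSpace (𝓡 7) x)
      (card_three_four_tangent x).symm (he x hx)
      (hΩ x hx) (hΩ' x hx) (hApos x hx).ne' (hK x hx) (hΓ x hx) (hN x hx) (hN' x hx)
      (c' := fun i => c' i x) (e' := fun i => e' i x) rfl rfl
    refine ⟨k1, k2, k3⟩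

end Adaptation

section Existence

variable {M : Type*} [TopologicalSpace M] [ChartedSpace (EuclideanSpace ℝ (Fin 5)) M]
  {M' : Type*} [TopologicalSpace M'] [ChartedSpace (EuclideanSpace ℝ (Fin 5)) M']
  {N : Type*} [TopologicalSpace N] [ChartedSpace (EuclideanSpace ℝ (Fin 7)) N]
  [IsManifold (𝓡 5) ∞ M] [IsManifold (𝓡 5) ∞ M'] [IsManifold (𝓡 7) ∞ N]
  {𝓘₀ : EDS (𝓡 5) M} {𝓘₁ : EDS (𝓡 5) M'} {𝓑 : EDS (𝓡 7) N} {π : N → M} {π' : N → M'}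
  {χ₁₀ χ₀₁ : (x : N) → Submodule ℝ (TangentSpace (𝓡 7) x [⋀^Fin 1]→L[ℝ] ℝ)}
  {W : Set N} {θ : DForm (𝓡 5) M 1} {θ' : DForm (𝓡 5) M' 1} {γ : DForm (𝓡 7) N 1}
  {α : Fin 4 → DForm (𝓡 7) N 1}

theorem ContactFrame.exists_isZeroAdapted (hA : IsTypeA 𝓘₀ 𝓘₁ 𝓑 π π')
    (h : ContactFrame 𝓘₀ 𝓘₁ 𝓑 π π' χ₁₀ χ₀₁ W θ θ' γ α)
    (hγ : (⟨1, γ⟩ : GForm (𝓡 7) N) ∈ 𝓑.carrier) {p : N} (hp : p ∈ W) :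
    ∃ W' ⊆ W, IsOpen W' ∧ p ∈ W' ∧ ∃ w0 w0' γ' w,
      IsZeroAdapted 𝓘₀ 𝓘₁ 𝓑 π π' χ₁₀ χ₀₁ W' w0 w0' γ' w := by
  have hπ : ContMDiff (𝓡 7) (𝓡 5) ∞ π := hA.backlund.1.1.1
  have hπ' : ContMDiff (𝓡 7) (𝓡 5) ∞ π' := hA.backlund.2.1.1
  let c : Fin 3 ⊕ Fin 4 → DForm (𝓡 7) N 1 := Sum.elim ![pullback π θ, pullback π' θ', γ] α
  have hcs : ∀ i, SmoothOn (c i) W := h.split.frame.1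
  obtain ⟨e, he⟩ := h.split.frame.exists_isDual card_three_four
  have he : ∀ x ∈ W, IsDual (fun i => c i x) fun i => e i x := he
  have hco : ∀ a i j, ∀ x ∈ W, ContMDiffAt (𝓡 7) 𝓘(ℝ, ℝ) ∞
      (fun y => extd (c a) y ![e i y, e j y]) x := fun a =>
    SmoothOn.coeff_pair (SmoothOn.extd h.split.isOpen (hcs a)) h.split.isOpen card_three_four hcs he
  let P : N → ℝ := fun y => extd (c (Sum.inl 0)) y ![e (Sum.inr 0) y, e (Sum.inr 1) y]
  let Q : N → ℝ := fun y => extd (c (Sum.inl 0)) y ![e (Sum.inr 2) y, e (Sum.inr 3) y]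
  let P' : N → ℝ := fun y => extd (c (Sum.inl 1)) y ![e (Sum.inr 0) y, e (Sum.inr 1) y]
  let Q' : N → ℝ := fun y => extd (c (Sum.inl 1)) y ![e (Sum.inr 2) y, e (Sum.inr 3) y]
  let R : N → ℝ := fun y => extd (c (Sum.inl 2)) y ![e (Sum.inr 0) y, e (Sum.inr 1) y]
  let T : N → ℝ := fun y => extd (c (Sum.inl 2)) y ![e (Sum.inr 2) y, e (Sum.inr 3) y]
  have hbl : ∀ x ∈ W, IsBlock (extd (c (Sum.inl 0)) x) (fun i => e i x) (P x) (Q x) ∧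
      IsBlock (extd (c (Sum.inl 1)) x) (fun i => e i x) (P' x) (Q' x) ∧
      P x ≠ 0 ∧ Q x ≠ 0 ∧ P' x ≠ 0 ∧ Q' x ≠ 0 ∧ P x * Q' x ≠ Q x * P' x := fun x hx =>
    h.blocks hx hA (he x hx) rfl rfl rfl rfl
  have hbl2 : ∀ x ∈ W, IsBlock (extd (c (Sum.inl 2)) x) (fun i => e i x) (R x) (T x) :=
    fun x hx => (h.split.gen.char ⟨2, extd γ⟩ (𝓑.d_mem hγ) x hx).isBlock
      (V := TangentSpace (𝓡 7) x) (he x hx)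
  obtain ⟨W', hWW', hW', hpW', ε, A, s, a, b, m, hr⟩ := exists_rescaleData h.split.isOpen hp
    (hco (Sum.inl 0) _ _ : ∀ x ∈ W, ContMDiffAt (𝓡 7) 𝓘(ℝ, ℝ) ∞ P x)
    (hco (Sum.inl 0) _ _ : ∀ x ∈ W, ContMDiffAt (𝓡 7) 𝓘(ℝ, ℝ) ∞ Q x)
    (hco (Sum.inl 1) _ _ : ∀ x ∈ W, ContMDiffAt (𝓡 7) 𝓘(ℝ, ℝ) ∞ P' x)
    (hco (Sum.inl 1) _ _ : ∀ x ∈ W, ContMDiffAt (𝓡 7) 𝓘(ℝ, ℝ) ∞ Q' x)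
    (hco (Sum.inl 2) _ _ : ∀ x ∈ W, ContMDiffAt (𝓡 7) 𝓘(ℝ, ℝ) ∞ R x)
    (hco (Sum.inl 2) _ _ : ∀ x ∈ W, ContMDiffAt (𝓡 7) 𝓘(ℝ, ℝ) ∞ T x)
    fun x hx => (hbl x hx).2.2
  refine ⟨W', hWW', hW', hpW', ?_⟩
  have hP' : ∀ x ∈ W', P' x ≠ 0 := fun x hx => (hbl x (hWW' hx)).2.2.2.2.1
  let c1 : Fin 3 ⊕ Fin 4 → DForm (𝓡 7) N 1 := fun i x =>
    rescaleCoframe (fun j => c j x) (s x) (a x) (b x) (P' x) (m x) i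
  let e1 : Fin 3 ⊕ Fin 4 → ∀ x : N, TangentSpace (𝓡 7) x := fun i x =>
    rescaleFrame (fun j => e j x) (s x) (a x) (b x) (P' x) (m x) i
  have he1 : ∀ x ∈ W', IsDual (fun i => c1 i x) fun i => e1 i x := fun x hx =>
    (he x (hWW' hx)).rescale (V := TangentSpace (𝓡 7) x) (a x) (b x) (hr.s_ne x hx) (hP' x hx)
      (hr.m_ne x hx)
  have hs0 : SmoothOn (c1 (Sum.inl 0)) W' := fun x hx =>
    (hcs (Sum.inl 0) x (hWW' hx)).smul (hr.smooth_s x hx)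
  have has0 : SmoothOn (fun x => a x • c1 (Sum.inl 0) x) W' := fun x hx =>
    (hs0 x hx).smul (hr.smooth_a x hx)
  have hbs1 : SmoothOn (fun x => b x • c (Sum.inl 1) x) W' := fun x hx =>
    (hcs (Sum.inl 1) x (hWW' hx)).smul (hr.smooth_b x hx)
  have hc1 : ∀ i, SmoothOn (c1 i) W' := by
    rintro (i | i) x hx
    · fin_cases i
      · exact hs0 x hx
      · exact hcs (Sum.inl 1) x (hWW' hx)
      · exact ((hcs (Sum.inl 2) x (hWW' hx)).add (has0 x hx)).add (hbs1 x hx)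
    · fin_cases i
      · exact (hcs (Sum.inr 0) x (hWW' hx)).smul (hco (Sum.inl 1) _ _ x (hWW' hx))
      · exact hcs (Sum.inr 1) x (hWW' hx)
      · exact (hcs (Sum.inr 2) x (hWW' hx)).smul (hr.smooth_m x hx)
      · exact hcs (Sum.inr 3) x (hWW' hx)
  have hcz : ∀ k, ∀ x ∈ W, ∀ i, c (Sum.inl k) x (fun _ => e (Sum.inr i) x) = 0 := fun k x hx i =>
    (he x hx (Sum.inl k) (Sum.inr i)).trans (if_neg (by simp))
  have hd0 : ∀ x ∈ W', ∀ v w : TangentSpace (𝓡 7) x, c (Sum.inl 0) x (fun _ => v) = 0 →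
      c (Sum.inl 0) x (fun _ => w) = 0 →
      extd (c1 (Sum.inl 0)) x ![v, w] = s x * extd (c (Sum.inl 0)) x ![v, w] := by
    intro x hx v w hv hw
    obtain ⟨D, hD⟩ := extd_smul_apply (hr.smooth_s x hx) (hcs (Sum.inl 0) x (hWW' hx))
    refine (hD v w).trans ?_
    rw [hv, hw, mul_zero, mul_zero, sub_zero, add_zero]
  have hB0 : ∀ x ∈ W', IsBlock (extd (c1 (Sum.inl 0)) x) (fun i => e i x) (s x * P x)
      (s x * Q x) := fun x hx => (hbl x (hWW' hx)).1.congr_smul (V := TangentSpace (𝓡 7) x)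
    fun i j => hd0 x hx _ _ (hcz 0 x (hWW' hx) i) (hcz 0 x (hWW' hx) j)
  have hB2 : ∀ x ∈ W', IsBlock (extd (c1 (Sum.inl 2)) x) (fun i => e i x) 0 0 := by
    intro x hx
    obtain ⟨D, hD⟩ := extd_smul_apply (hr.smooth_a x hx) (hs0 x hx)
    obtain ⟨D', hD'⟩ := extd_smul_apply (hr.smooth_b x hx) (hcs (Sum.inl 1) x (hWW' hx))
    have h1 : extd (c1 (Sum.inl 2)) x = extd (c (Sum.inl 2)) x +
        extd (fun x => a x • c1 (Sum.inl 0) x) x + extd (fun x => b x • c (Sum.inl 1) x) x :=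
      (extd_add ((hcs (Sum.inl 2) x (hWW' hx)).add (has0 x hx)) (hbs1 x hx)).trans
        (congrArg (· + _) (extd_add (hcs (Sum.inl 2) x (hWW' hx)) (has0 x hx)))
    have hz0 : ∀ i, c1 (Sum.inl 0) x (fun _ => e (Sum.inr i) x) = 0 := fun i =>
      (congrArg (s x * ·) (hcz 0 x (hWW' hx) i)).trans (mul_zero _)
    have h2 : IsBlock (extd (fun x => a x • c1 (Sum.inl 0) x) x) (fun i => e i x)
        (a x * (s x * P x)) (a x * (s x * Q x)) :=
      (hB0 x hx).congr_smul (V := TangentSpace (𝓡 7) x) fun i j => by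
        refine (hD _ _).trans ?_
        rw [hz0 i, hz0 j, mul_zero, mul_zero, sub_zero, add_zero]
    have h3 : IsBlock (extd (fun x => b x • c (Sum.inl 1) x) x) (fun i => e i x)
        (b x * P' x) (b x * Q' x) :=
      (hbl x (hWW' hx)).2.1.congr_smul (V := TangentSpace (𝓡 7) x) fun i j => by
        refine (hD' _ _).trans ?_
        rw [hcz 1 x (hWW' hx) i, hcz 1 x (hWW' hx) j, mul_zero, mul_zero, sub_zero, add_zero]
    have h4 := (((hbl2 x (hWW' hx)).add_smul h2 1 1).add_smul h3 1 1)
    simp only [one_mul, one_smul] at h4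
    rw [hr.fourth x hx, hr.fifth x hx] at h4
    rw [h1]
    exact h4
  have hinr : ∀ x ∈ W', ∀ i, ∃ t : ℝ, t ≠ 0 ∧ e1 (Sum.inr i) x = t • e (Sum.inr i) x :=
    fun x hx i => exists_rescaleFrame_inr (V := TangentSpace (𝓡 7) x) (hP' x hx) (hr.m_ne x hx) i
  have hscale : ∀ x ∈ W', ∀ {Ψ : TangentSpace (𝓡 7) x [⋀^Fin (1 + 1)]→L[ℝ] ℝ} {v i},
      Ψ ![v, e1 (Sum.inr i) x] = 0 → Ψ ![v, e (Sum.inr i) x] = 0 := by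
    intro x hx Ψ v i hΨ
    obtain ⟨t, ht, hte⟩ := hinr x hx i
    rw [hte] at hΨ
    have h1 := two_form_smul_right (V := TangentSpace (𝓡 7) x) Ψ t v (e (Sum.inr i) x)
    rw [hΨ] at h1
    exact (mul_eq_zero.1 h1.symm).resolve_left ht
  have hspan : ∀ x ∈ W', Submodule.span ℝ (Set.range fun k => c1 (Sum.inl k) x) =
      Submodule.span ℝ (Set.range fun k => c (Sum.inl k) x) := by
    intro x hx
    refine span_range_eq_of_linearIndependent (V := TangentSpace (𝓡 7) x)
      ((he1 x hx).linearIndependent (V := TangentSpace (𝓡 7) x) |>.comp Sum.inl Sum.inl_injective)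
      ((he x (hWW' hx)).linearIndependent (V := TangentSpace (𝓡 7) x) |>.comp Sum.inl
        Sum.inl_injective) fun k => ?_
    have hm : ∀ k, c (Sum.inl k) x ∈ Submodule.span ℝ (Set.range fun k => c (Sum.inl k) x) :=
      fun k => Submodule.subset_span ⟨k, rfl⟩
    have hm0 := Submodule.smul_mem _ (s x) (hm 0)
    fin_cases k
    · exact hm0
    · exact hm 1
    · exact add_mem (add_mem (hm 2) (Submodule.smul_mem _ (a x) hm0))
        (Submodule.smul_mem _ (b x) (hm 1))
  have hspan' : ∀ x, (Set.range fun k => c (Sum.inl k) x) =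
      Set.range fun k => (![pullback π θ, pullback π' θ', γ] : Fin 3 → DForm (𝓡 7) N 1) k x :=
    fun x => rfl
  have hpair : ∀ x ∈ W', ∀ (S : Submodule ℝ (TangentSpace (𝓡 7) x [⋀^Fin 1]→L[ℝ] ℝ)) (k : ℝ)
      (y z : TangentSpace (𝓡 7) x [⋀^Fin 1]→L[ℝ] ℝ), k ≠ 0 →
      S ⊔ Submodule.span ℝ {k • y, z} = S ⊔ Submodule.span ℝ {y, z} := by
    intro x hx S k y z hk
    have h1 := sup_span_pair_eq (a := y) (b := z) S hk S.zero_mem S.zero_mem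
    rwa [add_zero, add_zero] at h1
  refine ⟨c1 (Sum.inl 0), c1 (Sum.inl 1), c1 (Sum.inl 2), exists_isZeroAdapted_of_isBlock (𝓘₀ := 𝓘₀) (𝓘₁ := 𝓘₁) (𝓑 := 𝓑) (π := π)
    (π' := π') (χ₁₀ := χ₁₀) (χ₀₁ := χ₀₁) (c := c1) (e := e1) (ε := ε) (A := A) hW' hc1 he1
    (fun x hx => ?_) (fun x hx => (h.degOne_right (hWW' hx)).symm) (fun x hx => ?_)
    (fun x hx => ?_) (fun x hx => ?_) hr.sign hr.smooth_A hr.pos hr.sq_ne (fun x hx => ?_)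
    (fun x hx => ?_) (fun x hx i j => ?_) (fun x hx v hv hvd w hw => ?_)
    (fun x hx v hv hvd w hw => ?_)⟩
  · rw [h.degOne_left (hWW' hx)]
    exact Submodule.span_singleton_smul_eq (IsUnit.mk0 _ (hr.s_ne x hx)) _
  · rw [hspan x hx, hspan', h.split.degOne_eq (hWW' hx)]
  · rw [hspan x hx, hspan', h.split.char_left x (hWW' hx)]
    exact (hpair x hx _ _ _ _ (hP' x hx)).symm
  · rw [hspan x hx, hspan', h.split.char_right x (hWW' hx)]
    exact (hpair x hx _ _ _ _ (hr.m_ne x hx)).symm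
  · have h1 := (hB0 x hx).rescale (V := TangentSpace (𝓡 7) x) (s x) (a x) (b x) (P' x) (m x)
    rw [hr.first x hx, hr.second x hx] at h1
    exact h1
  · have h1 := (hbl x (hWW' hx)).2.1.rescale (V := TangentSpace (𝓡 7) x) (s x) (a x) (b x) (P' x)
      (m x)
    rw [inv_mul_cancel₀ (hP' x hx), hr.third x hx] at h1
    exact h1
  · have h1 := (hB2 x hx).rescale (V := TangentSpace (𝓡 7) x) (s x) (a x) (b x) (P' x) (m x)
    rw [mul_zero, mul_zero] at h1
    exact h1.eq_zero (V := TangentSpace (𝓡 7) x) i j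
  · have hv0 : c (Sum.inl 0) x (fun _ => v) = 0 := (mul_eq_zero.1 hv).resolve_left (hr.s_ne x hx)
    have hw0 : c (Sum.inl 0) x (fun _ => w) = 0 := (mul_eq_zero.1 hw).resolve_left (hr.s_ne x hx)
    rw [hd0 x hx v w hv0 hw0]
    refine mul_eq_zero_of_right _ (h.extd_apply_eq_zero_left hπ
      (h.map_eq_zero_left (hWW' hx) hπ (he x (hWW' hx)) hv0 fun i => ?_) w)
    have h1 := hscale x hx (hvd i)
    rw [hd0 x hx v _ hv0 (hcz 0 x (hWW' hx) i)] at h1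
    exact (mul_eq_zero.1 h1).resolve_left (hr.s_ne x hx)
  · exact h.extd_apply_eq_zero_right hπ'
      (h.map_eq_zero_right (hWW' hx) hπ' (he x (hWW' hx)) hv fun i => hscale x hx (hvd i)) w

end Existence

section LocalInverses

variable {E : Type*} [NormedAddCommGroup E] [NormedSpace ℝ E]
  {H : Type*} [TopologicalSpace H] {I : ModelWithCorners ℝ E H}
  {M : Type*} [TopologicalSpace M] [ChartedSpace H M]
  {E' : Type*} [NormedAddCommGroup E'] [NormedSpace ℝ E']
  {H' : Type*} [TopologicalSpace H'] {J : ModelWithCorners ℝ E' H'}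
  {M' : Type*} [TopologicalSpace M'] [ChartedSpace H' M']

theorem exists_localInverse {F : M' → M} (hF : IsLocalDiffeomorph J I ∞ F) (q : M') :
    ∃ (V : Set M) (G : M → M'), IsOpen V ∧ F q ∈ V ∧ (∀ y ∈ V, ContMDiffAt I J ∞ G y) ∧
      (∀ y ∈ V, F (G y) = y ∧ G (F (G y)) = G y) ∧
      ∀ y ∈ V, ∀ x, x = G y → (∀ u, mfderiv I J G (F x) (mfderiv J I F x u) = u) ∧
        ∀ v, mfderiv J I F x (mfderiv I J G (F x) v) = v := by
  have hq := hF q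
  refine ⟨hq.localInverse.source, hq.localInverse, hq.localInverse_open_source,
    hq.localInverse_mem_source, fun y hy => hq.localInverse_contMDiffOn.contMDiffAt
      (hq.localInverse_open_source.mem_nhds hy), fun y hy => ?_, fun y hy x h0 => ?_⟩
  · have h1 := hq.localInverse_right_inv hy
    exact ⟨h1, by rw [h1]⟩
  · subst h0
    have hx : hq.localInverse y ∈ hq.localInverse.target := hq.localInverse.map_source hy
    have hxy := hq.localInverse_right_inv hy
    have hyx : F (hq.localInverse y) ∈ hq.localInverse.source := hxy.symm ▸ hy
    have h1 : (hq.localInverse : M → M') ∘ F =ᶠ[nhds (hq.localInverse y)] id :=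
      Filter.eventuallyEq_of_mem (hq.localInverse.open_target.mem_nhds hx)
        hq.localInverse_eqOn_left
    have hG : MDifferentiableAt I J hq.localInverse (F (hq.localInverse y)) :=
      hq.localInverse.mdifferentiableAt (by simp) hyx
    have h2 : ∀ u, mfderiv I J hq.localInverse (F (hq.localInverse y))
        (mfderiv J I F (hq.localInverse y) u) = u := by
      intro u
      have h3 := mfderiv_comp (hq.localInverse y) hG ((hF _).mdifferentiableAt (by simp))
      rw [h1.mfderiv_eq, mfderiv_id] at h3
      exact (DFunLike.congr_fun h3 u).symm
    refine ⟨h2, fun v => ?_⟩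
    obtain ⟨u, rfl⟩ := ((hF (hq.localInverse y)).mfderivToContinuousLinearEquiv
      (by simp)).surjective v
    exact congrArg (mfderiv J I F (hq.localInverse y)) (h2 u)

end LocalInverses

section FamilyToIntegrable

variable {M : Type*} [TopologicalSpace M] [ChartedSpace (EuclideanSpace ℝ (Fin 5)) M]
  {M' : Type*} [TopologicalSpace M'] [ChartedSpace (EuclideanSpace ℝ (Fin 5)) M']
  {N : Type*} [TopologicalSpace N] [ChartedSpace (EuclideanSpace ℝ (Fin 7)) N]
  [IsManifold (𝓡 7) ∞ N]
  {𝓘₀ : EDS (𝓡 5) M} {𝓘₁ : EDS (𝓡 5) M'} {𝓑 : EDS (𝓡 7) N} {π : N → M} {π' : N → M'}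
  {χ₁₀ χ₀₁ : (x : N) → Submodule ℝ (TangentSpace (𝓡 7) x [⋀^Fin 1]→L[ℝ] ℝ)}

theorem dfun_snd_apply {P : Type*} [TopologicalSpace P] [ChartedSpace (EuclideanSpace ℝ (Fin 6)) P]
    (q : P × ℝ) (v : TangentSpace ((𝓡 6).prod 𝓘(ℝ, ℝ)) q) :
    dfun (I := (𝓡 6).prod 𝓘(ℝ, ℝ)) (Prod.snd : P × ℝ → ℝ) q (fun _ => v) =
      (v : EuclideanSpace ℝ (Fin 6) × ℝ).2 := by
  have h : mfderiv ((𝓡 6).prod 𝓘(ℝ, ℝ)) 𝓘(ℝ, ℝ) (Prod.snd : P × ℝ → ℝ) q v =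
      (v : EuclideanSpace ℝ (Fin 6) × ℝ).2 := by
    rw [mfderiv_snd]
    rfl
  exact h

/-- The parameter of a family is a function whose differential lies in the ideal. -/
theorem ArisesFromFamilyOn.exists_dfun_mem (hB : IsBacklund 2 𝓘₀ 𝓘₁ 𝓑 π π')
    (hχ : IsCharacteristicPair 𝓑 χ₁₀ χ₀₁) {U : Set N}
    (h : ArisesFromFamilyOn 𝓘₀ 𝓘₁ 𝓑 π π' U) {p : N} (hp : p ∈ U) :
    ∃ (V : Set N) (lam : N → ℝ), IsOpen V ∧ p ∈ V ∧
      (∀ y ∈ V, ContMDiffAt (𝓡 7) 𝓘(ℝ, ℝ) ∞ lam y) ∧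
      ∀ y ∈ V, dfun (I := 𝓡 7) lam y ≠ 0 ∧ dfun (I := 𝓡 7) lam y ∈ degOne 𝓑.carrier y := by
  obtain ⟨P, _, _, _, _, _, 𝓑₁, F, -, hF, -, hU, hsame⟩ := h
  obtain ⟨q, rfl⟩ : p ∈ Set.range F := hU ▸ hp
  obtain ⟨V, G, hV, hpV, hG, hFG, hd⟩ := exists_localInverse hF q
  have hsnd : ContMDiff ((𝓡 6).prod 𝓘(ℝ, ℝ)) 𝓘(ℝ, ℝ) ∞ (Prod.snd : P × ℝ → ℝ) := contMDiff_snd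
  let η := dfun (I := (𝓡 6).prod 𝓘(ℝ, ℝ)) (Prod.snd : P × ℝ → ℝ)
  have hη : AlgIdeal Set.univ (pullbackSet F 𝓑.carrier) 1 η :=
    (hsame 1 η).2 (.gen ⟨fun x _ => smoothAt_dfun (hsnd x), fun x => .gen (Or.inr rfl)⟩)
  refine ⟨V, fun y => (G y).2, hV, hpV, fun y hy => (hsnd (G y)).comp y (hG y hy), ?_⟩
  intro y hy
  obtain ⟨x, hxy, hx⟩ : ∃ x, F x = y ∧ x = G y := ⟨G y, (hFG y hy).1, rfl⟩
  have hdx := hd y hy x hx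
  have hGy := hG y hy
  subst hxy
  have hlam : ∀ v : TangentSpace (𝓡 7) (F x), dfun (I := 𝓡 7) (fun y => (G y).2) (F x) (fun _ => v) =
      η x (fun _ => mfderiv (𝓡 7) ((𝓡 6).prod 𝓘(ℝ, ℝ)) G (F x) v) := by
    intro v
    have h1 := pullback_comp (K := 𝓡 7) (J := (𝓡 6).prod 𝓘(ℝ, ℝ)) (x := F x)
      ((hsnd (G (F x))).mdifferentiableAt (by simp)) (hGy.mdifferentiableAt (by simp)) lineForm
    rw [← dfun_eq_pullback, ← dfun_eq_pullback] at h1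
    have h2 := DFunLike.congr_fun h1 fun _ => v
    refine h2.trans ?_
    show η (G (F x)) (fun _ => mfderiv (𝓡 7) ((𝓡 6).prod 𝓘(ℝ, ℝ)) G (F x) v) = _
    rw [← hx]
  refine ⟨fun h0 => ?_, ?_⟩
  · have h1 := hlam (mfderiv ((𝓡 6).prod 𝓘(ℝ, ℝ)) (𝓡 7) F x
      ((0, 1) : EuclideanSpace ℝ (Fin 6) × ℝ))
    rw [h0] at h1
    have h2 := h1.trans ((congrArg (fun u => η x fun _ => u)
      (hdx.1 ((0, 1) : EuclideanSpace ℝ (Fin 6) × ℝ))).trans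
        (dfun_snd_apply x ((0, 1) : EuclideanSpace ℝ (Fin 6) × ℝ)))
    exact zero_ne_one h2
  · obtain ⟨W, b, α, hpW, hW⟩ := exists_splitFrame hB hχ (F x)
    have h1 : η x ∈ degOne (pullbackSet F 𝓑.carrier) x := by
      refine hη.mem_degOne trivial ?_
      rintro ψ ⟨⟨k, φ⟩, hφ, hψ⟩
      obtain ⟨rfl, hψ'⟩ := Sigma.mk.inj hψ
      obtain rfl := eq_of_heq hψ'
      ext v
      exact DFunLike.congr_fun (hW.zero_form hpW hφ) _
    refine mem_span_of_vanish (V := TangentSpace (𝓡 7) (F x)) fun v hv => ?_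
    refine (hlam v).trans
      (vanish_of_mem_span (V := TangentSpace ((𝓡 6).prod 𝓘(ℝ, ℝ)) x) h1 ?_)
    rintro _ ⟨ψ, ⟨⟨k, φ⟩, hφ, hψ⟩, rfl⟩
    obtain ⟨rfl, hψ'⟩ := Sigma.mk.inj hψ
    obtain rfl := eq_of_heq hψ'
    refine Eq.trans ?_ (hv _ ⟨φ, hφ, rfl⟩)
    exact congrArg (fun u => φ (F x) fun _ => u) (hdx.2 v)

theorem IsZeroAdapted.integrableNear {W V : Set N} {w0 w0' γ : DForm (𝓡 7) N 1}
    {w : Fin 4 → DForm (𝓡 7) N 1} (hW : IsOpen W)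
    (h : IsZeroAdapted 𝓘₀ 𝓘₁ 𝓑 π π' χ₁₀ χ₀₁ W w0 w0' γ w) {p : N} (hp : p ∈ W)
    (hV : IsOpen V) (hpV : p ∈ V) {lam : N → ℝ}
    (hlam : ∀ y ∈ V, ContMDiffAt (𝓡 7) 𝓘(ℝ, ℝ) ∞ lam y)
    (hd : ∀ y ∈ V, dfun (I := 𝓡 7) lam y ≠ 0 ∧ dfun (I := 𝓡 7) lam y ∈ degOne 𝓑.carrier y) :
    IntegrableNear γ p := by
  obtain ⟨hframe, hspan, ε, A, C0, B, C, D, hε, -, -, -, hstr⟩ := h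
  obtain ⟨e, he⟩ := hframe.exists_isDual card_three_four
  let c : Fin 3 ⊕ Fin 4 → DForm (𝓡 7) N 1 := Sum.elim ![w0, w0', γ] w
  have he : ∀ x ∈ W, IsDual (fun i => c i x) fun i => e i x := he
  have hcs : ∀ i, SmoothOn (c i) W := hframe.1
  have hWV : IsOpen (W ∩ V) := hW.inter hV
  let f : Fin 3 → N → ℝ := fun a y => dfun (I := 𝓡 7) lam y (fun _ => e (Sum.inl a) y)
  have hf : ∀ a, ∀ x ∈ W ∩ V, ContMDiffAt (𝓡 7) 𝓘(ℝ, ℝ) ∞ (f a) x := fun a =>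
    SmoothOn.coeff hWV card_three_four (fun i x hx => hcs i x hx.1) (fun x hx => he x hx.1)
      (fun x hx => smoothAt_dfun (hlam x hx.2)) fun _ => Sum.inl a
  have hexp : ∀ x ∈ W ∩ V, dfun (I := 𝓡 7) lam x =
      f 0 x • w0 x + f 1 x • w0' x + f 2 x • γ x := by
    intro x hx
    have h1 := covector_expand ((he x hx.1).expand (V := TangentSpace (𝓡 7) x)
      (card_three_four_tangent x)) (dfun (I := 𝓡 7) lam x)
    have h2 : ∀ i, dfun (I := 𝓡 7) lam x (fun _ => e (Sum.inr i) x) = 0 := by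
      intro i
      have h3 := (hd x hx.2).2
      rw [← (hspan x hx.1).2.2.1] at h3
      refine vanish_of_mem_span (V := TangentSpace (𝓡 7) x) h3 ?_
      rintro _ (rfl | rfl | rfl)
      · exact (he x hx.1 (Sum.inl 0) (Sum.inr i)).trans (if_neg (by simp))
      · exact (he x hx.1 (Sum.inl 1) (Sum.inr i)).trans (if_neg (by simp))
      · exact (he x hx.1 (Sum.inl 2) (Sum.inr i)).trans (if_neg (by simp))
    refine h1.trans ?_
    rw [Fintype.sum_sum_type]
    simp only [h2, zero_smul, Finset.sum_const_zero, add_zero, Fin.sum_univ_three]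
    rfl
  have hzero : ∀ x ∈ W ∩ V, f 0 x = 0 ∧ f 1 x = 0 := by
    intro x hx
    obtain ⟨hApos, hAε, s1, s2, s3⟩ := hstr x hx.1
    obtain ⟨D0, hD0⟩ := extd_smul_apply (hf 0 x hx) (hcs (Sum.inl 0) x hx.1)
    obtain ⟨D1, hD1⟩ := extd_smul_apply (hf 1 x hx) (hcs (Sum.inl 1) x hx.1)
    obtain ⟨D2, hD2⟩ := extd_smul_apply (hf 2 x hx) (hcs (Sum.inl 2) x hx.1)
    have t0 := (hcs (Sum.inl 0) x hx.1).smul (hf 0 x hx)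
    have t1 := (hcs (Sum.inl 1) x hx.1).smul (hf 1 x hx)
    have t2 := (hcs (Sum.inl 2) x hx.1).smul (hf 2 x hx)
    have e1 : extd (dfun (I := 𝓡 7) lam) x = extd (fun y => f 0 y • w0 y) x +
        extd (fun y => f 1 y • w0' y) x + extd (fun y => f 2 y • γ y) x := by
      refine (extd_congr ?_).trans ((extd_add (t0.add t1) t2).trans
        (congrArg (· + _) (extd_add t0 t1)))
      filter_upwards [hWV.mem_nhds hx] with y hy
      exact hexp y hy
    rw [extd_dfun (hlam x hx.2)] at e1
    have hz : ∀ i j, c (Sum.inl i) x (fun _ => e (Sum.inr j) x) = 0 := fun i j =>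
      (he x hx.1 (Sum.inl i) (Sum.inr j)).trans (if_neg (by simp))
    have z0 : ∀ j, w0 x (fun _ => e (Sum.inr j) x) = 0 := hz 0
    have z1 : ∀ j, w0' x (fun _ => e (Sum.inr j) x) = 0 := hz 1
    have z2 : ∀ j, γ x (fun _ => e (Sum.inr j) x) = 0 := hz 2
    have zw : ∀ i j, w i x (fun _ => e (Sum.inr j) x) = if i = j then 1 else 0 := fun i j =>
      (he x hx.1 (Sum.inr i) (Sum.inr j)).trans (by simp)
    have key : ∀ i j, 0 = f 0 x * extd w0 x ![e (Sum.inr i) x, e (Sum.inr j) x] +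
        f 1 x * extd w0' x ![e (Sum.inr i) x, e (Sum.inr j) x] +
        f 2 x * extd γ x ![e (Sum.inr i) x, e (Sum.inr j) x] := by
      intro i j
      have h1 := DFunLike.congr_fun e1 ![e (Sum.inr i) x, e (Sum.inr j) x]
      refine h1.trans ?_
      have k0 := hD0 (e (Sum.inr i) x) (e (Sum.inr j) x)
      have k1 := hD1 (e (Sum.inr i) x) (e (Sum.inr j) x)
      have k2 := hD2 (e (Sum.inr i) x) (e (Sum.inr j) x)
      rw [hz, hz, mul_zero, mul_zero, sub_zero, add_zero] at k0 k1 k2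
      exact congrArg₂ (· + ·) (congrArg₂ (· + ·) k0 k1) k2
    have hv : ∀ (τ : TangentSpace (𝓡 7) x [⋀^Fin 1]→L[ℝ] ℝ) i j,
        (∀ j, τ (fun _ => e (Sum.inr j) x) = 0) → ∀ a : Fin 2, ∀ τ' ∈ ({τ} : Set _),
          τ' (fun _ => (![e (Sum.inr i) x, e (Sum.inr j) x] : Fin 2 → TangentSpace (𝓡 7) x) a)
            = 0 := by
      rintro τ i j hτ a _ rfl
      fin_cases a <;> exact hτ _
    have v0 : ∀ i j, _ := fun i j => s1.eq_of_vanish (V := TangentSpace (𝓡 7) x) _ (hv _ i j z0)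
    have v1 : ∀ i j, _ := fun i j => s2.eq_of_vanish (V := TangentSpace (𝓡 7) x) _ (hv _ i j z1)
    have v2 : ∀ i j, _ := fun i j => s3.eq_of_vanish (V := TangentSpace (𝓡 7) x) _ (hv _ i j z2)
    have k01 := key 0 1
    have k23 := key 2 3
    rw [v0, v1, v2] at k01 k23
    simp only [ContinuousAlternatingMap.add_apply, ContinuousAlternatingMap.smul_apply,
      ContinuousAlternatingMap.sum_apply, wedge_covectors_apply, Matrix.cons_val_zero,
      Matrix.cons_val_one, z0, z1, z2, zw, smul_eq_mul] at k01 k23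
    simp at k01 k23
    have hεε : ε * ε = 1 := by rcases hε with rfl | rfl <;> norm_num
    have h0 : f 0 x * (A x ^ 2 - ε) = 0 := by
      linear_combination (-A x) * k01 + ε * k23 + f 1 x * A x * hεε
    have h1 : f 0 x = 0 := (mul_eq_zero.1 h0).resolve_right (sub_ne_zero.2 hAε)
    rw [h1] at k01
    exact ⟨h1, by linarith⟩
  have hexp' : ∀ x ∈ W ∩ V, dfun (I := 𝓡 7) lam x = f 2 x • γ x := by
    intro x hx
    rw [hexp x hx, (hzero x hx).1, (hzero x hx).2, zero_smul, zero_smul, zero_add, zero_add]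
  have hf0 : ∀ x ∈ W ∩ V, f 2 x ≠ 0 := fun x hx h0 => (hd x hx.2).1 (by
    rw [hexp' x hx, h0, zero_smul])
  refine ⟨W ∩ V, hWV, ⟨hp, hpV⟩, fun x => (f 2 x)⁻¹, lam, fun x hx =>
    (ContMDiffAt.real_inv (hf 2 x hx) (hf0 x hx)).contMDiffWithinAt,
    fun x hx => (hlam x hx.2).contMDiffWithinAt, fun x hx => ⟨inv_ne_zero (hf0 x hx), ?_⟩⟩
  rw [hexp' x hx, smul_smul, inv_mul_cancel₀ (hf0 x hx), one_smul]

end FamilyToIntegrable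

section Straightening

variable {E : Type*} [NormedAddCommGroup E] [NormedSpace ℝ E] [FiniteDimensional ℝ E]
  {G : Type*} [NormedAddCommGroup G] [InnerProductSpace ℝ G] [FiniteDimensional ℝ G]

/-- A nonzero functional is the last coordinate of some linear coordinate system. -/
theorem exists_linear_coordinates (hdim : Module.finrank ℝ E = Module.finrank ℝ G + 1)
    {l : E →L[ℝ] ℝ} (hl : l ≠ 0) : ∃ L : E ≃L[ℝ] G × ℝ, ∀ v, (L v).2 = l v := by
  obtain ⟨v₁, hv₁⟩ : ∃ v, l v ≠ 0 := by
    by_contra hcon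
    push Not at hcon
    exact hl (ContinuousLinearMap.ext hcon)
  obtain ⟨v₀, hv₀⟩ : ∃ v, l v = 1 := ⟨(l v₁)⁻¹ • v₁, by simp [hv₁]⟩
  let K := LinearMap.ker l.toLinearMap
  have hsurj : Function.Surjective l.toLinearMap := fun t => ⟨t • v₀, by simp [hv₀]⟩
  have hK : Module.finrank ℝ K = Module.finrank ℝ G := by
    have h1 := LinearMap.finrank_range_add_finrank_ker l.toLinearMap
    rw [LinearMap.range_eq_top.2 hsurj, finrank_top, Module.finrank_self, hdim] at h1
    have h2 : Module.finrank ℝ K = Module.finrank ℝ (LinearMap.ker l.toLinearMap) := rfl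
    omega
  let κ : K ≃ₗ[ℝ] G := LinearEquiv.ofFinrankEq _ _ hK
  let pr : E →ₗ[ℝ] K := LinearMap.codRestrict K
    (LinearMap.id - l.toLinearMap.smulRight v₀) fun v => by
      simp [K, hv₀]
  let Λ : E →ₗ[ℝ] G × ℝ := (κ.toLinearMap.comp pr).prod l.toLinearMap
  have hinj : Function.Injective Λ := by
    rw [← LinearMap.ker_eq_bot, LinearMap.ker_eq_bot']
    intro v hv
    have h2 : l v = 0 := congrArg Prod.snd hv
    have h1 : κ (pr v) = 0 := congrArg Prod.fst hv
    rw [map_eq_zero_iff κ κ.injective] at h1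
    have h3 : v - l v • v₀ = 0 := congrArg Subtype.val h1
    rwa [h2, zero_smul, sub_zero] at h3
  have hfin : Module.finrank ℝ E = Module.finrank ℝ (G × ℝ) := by simp [hdim]
  exact ⟨(LinearEquiv.ofInjectiveOfFinrankEq Λ hinj hfin).toContinuousLinearEquiv, fun v => rfl⟩

/-- Near a point at which its derivative does not vanish, a smooth function depends in suitable
coordinates on the last one only; the domain of the coordinates can be taken to be the whole
space. -/
theorem exists_straightening (hdim : Module.finrank ℝ E = Module.finrank ℝ G + 1) {g : E → ℝ}
    {O : Set E} (hO : IsOpen O) {u₀ : E} (hu : u₀ ∈ O) (hg : ∀ u ∈ O, ContDiffAt ℝ ∞ g u)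
    (hd : fderiv ℝ g u₀ ≠ 0) :
    ∃ (Φ : OpenPartialHomeomorph (G × ℝ) E) (τ : ℝ → ℝ), Φ.source = Set.univ ∧ Φ.target ⊆ O ∧
      u₀ ∈ Φ.target ∧ ContDiff ℝ ∞ Φ ∧ (∀ u ∈ Φ.target, ContDiffAt ℝ ∞ Φ.symm u) ∧
      ContDiff ℝ ∞ τ ∧ ∀ q, g (Φ q) = τ q.2 := by
  obtain ⟨L, hL⟩ := exists_linear_coordinates (G := G) hdim hd
  let ψ : E → G × ℝ := fun u => ((L u).1, g u)
  have hψ : ∀ u ∈ O, ContDiffAt ℝ ∞ ψ u := fun u hu =>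
    ((contDiff_fst.comp L.contDiff).contDiffAt).prodMk (hg u hu)
  have hψ' : HasFDerivAt ψ (L : E →L[ℝ] G × ℝ) u₀ := by
    have h1 : HasFDerivAt (fun u => (L u).1) ((ContinuousLinearMap.fst ℝ G ℝ).comp
        (L : E →L[ℝ] G × ℝ)) u₀ := ((ContinuousLinearMap.fst ℝ G ℝ).comp
        (L : E →L[ℝ] G × ℝ)).hasFDerivAt
    have h2 : HasFDerivAt g (fderiv ℝ g u₀) u₀ :=
      ((hg u₀ hu).differentiableAt (by simp)).hasFDerivAt
    refine (h1.prodMk h2).congr_fderiv ?_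
    refine ContinuousLinearMap.ext fun v => Prod.ext rfl ?_
    exact (hL v).symm
  let Ψ := (hψ u₀ hu).toOpenPartialHomeomorph ψ hψ' (by simp)
  have hu₀ : u₀ ∈ Ψ.source :=
    (hψ u₀ hu).mem_toOpenPartialHomeomorph_source hψ' (by simp)
  have hinv : ∀ᶠ u in nhds u₀, ∃ L' : E ≃L[ℝ] G × ℝ, HasFDerivAt ψ (L' : E →L[ℝ] G × ℝ) u := by
    have hc : ContinuousAt (fderiv ℝ ψ) u₀ :=
      ((hψ u₀ hu).fderiv_right (m := 0) (by simp)).continuousAt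
    have h1 := hc.eventually (hψ'.fderiv.symm ▸ L.nhds)
    filter_upwards [h1, hO.mem_nhds hu] with u ⟨L', hL'⟩ huO
    refine ⟨L', ?_⟩
    rw [hL']
    exact ((hψ u huO).differentiableAt (by simp)).hasFDerivAt
  obtain ⟨O', hO'sub, hO', huO'⟩ := mem_nhds_iff.1 (Filter.inter_mem hinv (hO.mem_nhds hu))
  let Ψ' := Ψ.restrOpen O' hO'
  have hsrc : Ψ'.source = Ψ.source ∩ O' := rfl
  have hu' : u₀ ∈ Ψ'.source := ⟨hu₀, huO'⟩
  obtain ⟨r, hr, hball⟩ := Metric.isOpen_iff.1 Ψ'.open_target (ψ u₀) (Ψ'.map_source hu')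
  rw [← ball_prod_same] at hball
  let B : OpenPartialHomeomorph (G × ℝ) (G × ℝ) :=
    (OpenPartialHomeomorph.univBall (ψ u₀).1 r).prod (OpenPartialHomeomorph.univBall (ψ u₀).2 r)
  have hBs : B.source = Set.univ := by simp [B]
  have hBt : B.target = Metric.ball (ψ u₀).1 r ×ˢ Metric.ball (ψ u₀).2 r := by
    simp [B, OpenPartialHomeomorph.univBall_target _ hr]
  have hBmem : ∀ q, B q ∈ Ψ'.target := fun q =>
    hball (hBt ▸ B.map_source (hBs ▸ Set.mem_univ q))
  let Φ := B.trans Ψ'.symm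
  have hΦs : Φ.source = Set.univ := by
    refine Set.eq_univ_of_forall fun q => ?_
    rw [OpenPartialHomeomorph.trans_source, hBs, Set.univ_inter]
    exact hBmem q
  have hΦt : ∀ u ∈ Φ.target, u ∈ Ψ'.source ∧ ψ u ∈ B.target := by
    intro u hu
    rw [OpenPartialHomeomorph.trans_target] at hu
    exact hu
  have hsymm : ∀ y ∈ Ψ'.target, ContDiffAt ℝ ∞ Ψ'.symm y := by
    intro y hy
    have hmem := Ψ'.map_target hy
    obtain ⟨⟨L', hL'⟩, hyO⟩ := hO'sub hmem.2
    exact Ψ'.contDiffAt_symm hy hL' (hψ _ hyO)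
  refine ⟨Φ, OpenPartialHomeomorph.univBall (ψ u₀).2 r, hΦs, fun u hu => ?_, ?_, ?_, ?_,
    OpenPartialHomeomorph.contDiff_univBall, fun q => ?_⟩
  · exact (hO'sub (hΦt u hu).1.2).2
  · rw [OpenPartialHomeomorph.trans_target]
    refine ⟨hu', ?_⟩
    rw [hBt]
    exact ⟨Metric.mem_ball_self hr, Metric.mem_ball_self hr⟩
  · rw [contDiff_iff_contDiffAt]
    intro q
    refine (hsymm _ (hBmem q)).comp q (ContDiff.contDiffAt ?_)
    exact ((OpenPartialHomeomorph.contDiff_univBall.comp contDiff_fst).prodMk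
      (OpenPartialHomeomorph.contDiff_univBall.comp contDiff_snd))
  · intro u hu
    obtain ⟨h1, h2⟩ := hΦt u hu
    rw [hBt] at h2
    have h3 : ContDiffAt ℝ ∞ B.symm (ψ u) := by
      have ha := (OpenPartialHomeomorph.contDiffOn_univBall_symm (n := ⊤) (c := (ψ u₀).1)
        (r := r)).contDiffAt (Metric.isOpen_ball.mem_nhds h2.1)
      have hb := (OpenPartialHomeomorph.contDiffOn_univBall_symm (n := ⊤) (c := (ψ u₀).2)
        (r := r)).contDiffAt (Metric.isOpen_ball.mem_nhds h2.2)
      exact (ha.comp (ψ u) contDiffAt_fst).prodMk (hb.comp (ψ u) contDiffAt_snd)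
    exact h3.comp u (hψ u (hO'sub h1.2).2)
  · have h1 : ψ (Ψ'.symm (B q)) = B q := Ψ'.right_inv (hBmem q)
    exact congrArg Prod.snd h1

end Straightening

section FoliatedBox

variable {N : Type*} [TopologicalSpace N] [ChartedSpace (EuclideanSpace ℝ (Fin 7)) N]
  [IsManifold (𝓡 7) ∞ N]

/-- A product neighbourhood on which a given function with nonvanishing differential depends only
on the second factor. -/
theorem exists_foliatedBox {W : Set N} (hW : IsOpen W) {p : N} (hp : p ∈ W) {lam : N → ℝ}
    (hlam : ∀ y ∈ W, ContMDiffAt (𝓡 7) 𝓘(ℝ, ℝ) ∞ lam y)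
    (hd : ∀ y ∈ W, dfun (I := 𝓡 7) lam y ≠ 0) :
    ∃ F : EuclideanSpace ℝ (Fin 6) × ℝ → N,
      IsLocalDiffeomorph ((𝓡 6).prod 𝓘(ℝ, ℝ)) (𝓡 7) ∞ F ∧ Function.Injective F ∧
      p ∈ Set.range F ∧ (∀ q, F q ∈ W) ∧
      ∀ q, ∃ h : ℝ, h ≠ 0 ∧ ∀ v : TangentSpace ((𝓡 6).prod 𝓘(ℝ, ℝ)) q,
        pullback (J := (𝓡 6).prod 𝓘(ℝ, ℝ)) F (dfun (I := 𝓡 7) lam) q (fun _ => v) =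
          h * (v : EuclideanSpace ℝ (Fin 6) × ℝ).2 := by
  let χ := chartAt (EuclideanSpace ℝ (Fin 7)) p
  let g : EuclideanSpace ℝ (Fin 7) → ℝ := lam ∘ χ.symm
  let O : Set (EuclideanSpace ℝ (Fin 7)) := χ.target ∩ χ.symm ⁻¹' W
  have hO : IsOpen O := χ.isOpen_inter_preimage_symm hW
  have hps : p ∈ χ.source := mem_chart_source _ p
  have hu₀ : χ p ∈ O := ⟨χ.map_source hps, by
    rw [Set.mem_preimage, χ.left_inv hps]; exact hp⟩
  have hχs : ∀ u ∈ O, ContMDiffAt (𝓡 7) (𝓡 7) ∞ χ.symm u := fun u hu =>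
    (contMDiffOn_chart_symm (I := 𝓡 7) (x := p)).contMDiffAt (χ.open_target.mem_nhds hu.1)
  have hg : ∀ u ∈ O, ContDiffAt ℝ ∞ g u := fun u hu =>
    ((hlam _ hu.2).comp u (hχs u hu)).contDiffAt
  have hgd : fderiv ℝ g (χ p) ≠ 0 := by
    intro h0
    have hev : lam =ᶠ[nhds p] g ∘ χ := by
      filter_upwards [χ.open_source.mem_nhds hps] with y hy
      exact (congrArg lam (χ.left_inv hy)).symm
    refine hd p hp ?_
    have h1 : mfderiv (𝓡 7) 𝓘(ℝ, ℝ) lam p = 0 := by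
      rw [hev.mfderiv_eq, mfderiv_comp p ((hg _ hu₀).contMDiffAt.mdifferentiableAt (by simp))
        ((contMDiffAt_of_mem_maximalAtlas (IsManifold.chart_mem_maximalAtlas p) hps).mdifferentiableAt
          (n := ∞) (by simp)), mfderiv_eq_fderiv, h0]
      rfl
    refine covector_ext fun v => ?_
    exact DFunLike.congr_fun h1 v
  obtain ⟨Φ, τ, hΦs, hΦt, hΦp, hΦ, hΦ', hτ, hgΦ⟩ := exists_straightening
    (G := EuclideanSpace ℝ (Fin 6)) (by simp) hO hu₀ hg hgd
  have hΦO : ∀ q, Φ q ∈ O := fun q => hΦt (Φ.map_source (hΦs ▸ Set.mem_univ q))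
  let F : EuclideanSpace ℝ (Fin 6) × ℝ → N := fun q => χ.symm (Φ q)
  have hid : ContMDiff ((𝓡 6).prod 𝓘(ℝ, ℝ)) 𝓘(ℝ, EuclideanSpace ℝ (Fin 6) × ℝ) ∞
      (id : EuclideanSpace ℝ (Fin 6) × ℝ → EuclideanSpace ℝ (Fin 6) × ℝ) :=
    contMDiff_fst.prodMk_space contMDiff_snd
  have hid' : ContMDiff 𝓘(ℝ, EuclideanSpace ℝ (Fin 6) × ℝ) ((𝓡 6).prod 𝓘(ℝ, ℝ)) ∞
      (id : EuclideanSpace ℝ (Fin 6) × ℝ → EuclideanSpace ℝ (Fin 6) × ℝ) :=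
    (contDiff_fst.contMDiff).prodMk contDiff_snd.contMDiff
  have hF : ContMDiff ((𝓡 6).prod 𝓘(ℝ, ℝ)) (𝓡 7) ∞ F := fun q =>
    (hχs _ (hΦO q)).comp q ((hΦ.contMDiff.comp hid) q)
  let Φ₁ : PartialDiffeomorph ((𝓡 6).prod 𝓘(ℝ, ℝ)) (𝓡 7) (EuclideanSpace ℝ (Fin 6) × ℝ) N ∞ :=
    { toPartialEquiv := (Φ.trans χ.symm).toPartialEquiv
      open_source := (Φ.trans χ.symm).open_source
      open_target := (Φ.trans χ.symm).open_target
      contMDiffOn_toFun := hF.contMDiffOn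
      contMDiffOn_invFun := by
        intro y hy
        have h1 : y ∈ χ.source ∧ χ y ∈ Φ.target := by
          have : y ∈ (Φ.trans χ.symm).target := hy
          rwa [OpenPartialHomeomorph.trans_target] at this
        have h2 : ContMDiffAt (𝓡 7) (𝓡 7) ∞ χ y :=
          contMDiffAt_of_mem_maximalAtlas (IsManifold.chart_mem_maximalAtlas p) h1.1
        exact ((hid' _).comp y ((hΦ' _ h1.2).contMDiffAt.comp y h2)).contMDiffWithinAt }
  have hsrc : ∀ q, q ∈ Φ₁.source := by
    intro q
    show q ∈ (Φ.trans χ.symm).source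
    rw [OpenPartialHomeomorph.trans_source, hΦs, Set.univ_inter]
    exact (hΦO q).1
  have hFl : IsLocalDiffeomorph ((𝓡 6).prod 𝓘(ℝ, ℝ)) (𝓡 7) ∞ F := fun q =>
    ⟨Φ₁, hsrc q, fun _ _ => rfl⟩
  refine ⟨F, hFl, fun q q' hq => Φ₁.injOn (hsrc q) (hsrc q') hq, ⟨Φ.symm (χ p), ?_⟩,
    fun q => (hΦO q).2, fun q => ?_⟩
  · show χ.symm (Φ (Φ.symm (χ p))) = p
    rw [Φ.right_inv hΦp, χ.left_inv hps]
  · have h1 : lam ∘ F = τ ∘ Prod.snd := funext hgΦ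
    have hv : ∀ v : TangentSpace ((𝓡 6).prod 𝓘(ℝ, ℝ)) q,
        pullback (J := (𝓡 6).prod 𝓘(ℝ, ℝ)) F (dfun (I := 𝓡 7) lam) q (fun _ => v) =
          deriv τ q.2 * (v : EuclideanSpace ℝ (Fin 6) × ℝ).2 := by
      intro v
      have h2 := mfderiv_comp (I := (𝓡 6).prod 𝓘(ℝ, ℝ)) (I' := 𝓡 7) (I'' := 𝓘(ℝ, ℝ)) q
        ((hlam _ (hΦO q).2).mdifferentiableAt (by simp)) (hF.mdifferentiableAt (by simp))
      have h3 := mfderiv_comp (I := (𝓡 6).prod 𝓘(ℝ, ℝ)) (I' := 𝓘(ℝ, ℝ)) (I'' := 𝓘(ℝ, ℝ)) q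
        (hτ.contMDiff.mdifferentiableAt (x := q.2) (by simp))
        (mdifferentiableAt_snd (I := 𝓡 6) (I' := 𝓘(ℝ, ℝ)) (x := q))
      rw [← h1, h2, mfderiv_snd, mfderiv_eq_fderiv] at h3
      have h4 := DFunLike.congr_fun h3 v
      refine h4.trans ?_
      show fderiv ℝ τ q.2 (v : EuclideanSpace ℝ (Fin 6) × ℝ).2 = _
      have h5 := (fderiv ℝ τ q.2).map_smul (v : EuclideanSpace ℝ (Fin 6) × ℝ).2 1
      rw [smul_eq_mul, mul_one, smul_eq_mul] at h5
      rw [h5, fderiv_apply_one_eq_deriv, mul_comm]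
    refine ⟨deriv τ q.2, fun h0 => hd (F q) (hΦO q).2 (covector_ext fun w => ?_), hv⟩
    obtain ⟨v, rfl⟩ := ((hFl q).mfderivToContinuousLinearEquiv (by simp)).surjective w
    refine (hv v).trans ?_
    rw [h0, zero_mul]
    rfl

end FoliatedBox

section GenerationTransfer

variable {E : Type*} [NormedAddCommGroup E] [NormedSpace ℝ E]
  {H : Type*} [TopologicalSpace H] {I : ModelWithCorners ℝ E H}
  {M : Type*} [TopologicalSpace M] [ChartedSpace H M] {ι : Type*}
  {U : Set M} {c : ι → DForm I M 1} {g : ι → Option Bool} {S T : Set (GForm I M)}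

theorem Generates.of_algIdeal (h : Generates U c g S)
    (hT : ∀ t ∈ T, SmoothOn t.2 U ∧ ∀ x ∈ U, IsCharForm (fun i => c i x) g (t.2 x))
    (hST : ∀ s ∈ S, AlgIdeal U T s.1 s.2) : Generates U c g T where
  smooth t ht := (hT t ht).1
  char t ht := (hT t ht).2
  one i hi := (h.one i hi).trans hST
  two i j hij := (h.two i j hij).trans hST

variable [FiniteDimensional ℝ E] [I.Boundaryless] [IsManifold I ∞ M] [Fintype ι] [DecidableEq ι]

/-- Additional generating `1`-forms may be exchanged for others that also complete the given
forms to a generating set. -/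
theorem Generates.exchange {κ : Type*} {Θ : κ → DForm I M 1} (hU : IsOpen U)
    (hcard : Fintype.card ι = Module.finrank ℝ E) (hc : IsFrameOn c U)
    (h : Generates U c g (S ∪ Set.range fun i => (⟨1, Θ i⟩ : GForm I M)))
    (hT : ∀ t ∈ T, SmoothOn t.2 U ∧ ∀ x ∈ U, IsCharForm (fun i => c i x) g (t.2 x))
    (h1 : ∀ i, g i = none → AlgIdeal U (S ∪ T) 1 (c i)) : Generates U c g (S ∪ T) := by
  refine h.of_algIdeal ?_ ?_
  · rintro t (ht | ht)
    · exact ⟨h.smooth t (Or.inl ht), h.char t (Or.inl ht)⟩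
    · exact hT t ht
  · rintro s (hs | ⟨i, rfl⟩)
    · exact .gen (Or.inl hs)
    · exact algIdeal_one_of_isCharForm hU hcard hc h1 (h.smooth _ (Or.inr ⟨i, rfl⟩))
        (h.char _ (Or.inr ⟨i, rfl⟩))

end GenerationTransfer

section Slices

/-- The members of a frame that restrict to a frame on the slices of a foliated box. -/
def sliceIndex : Fin 2 ⊕ Fin 4 → Fin 3 ⊕ Fin 4 := Sum.map Fin.castSucc id

theorem sliceIndex_injective : Function.Injective sliceIndex :=
  Sum.map_injective.2 ⟨Fin.castSucc_injective 2, Function.injective_id⟩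

theorem sliceIndex_ne (j : Fin 2 ⊕ Fin 4) : sliceIndex j ≠ Sum.inl 2 := by
  rcases j with j | j
  · fin_cases j <;> decide
  · simp [sliceIndex]

theorem eq_inl_two_or_sliceIndex (i : Fin 3 ⊕ Fin 4) :
    i = Sum.inl 2 ∨ ∃ j, sliceIndex j = i := by
  rcases i with i | i
  · fin_cases i
    · exact Or.inr ⟨Sum.inl 0, rfl⟩
    · exact Or.inr ⟨Sum.inl 1, rfl⟩
    · exact Or.inl rfl
  · exact Or.inr ⟨Sum.inr i, rfl⟩

theorem pairSort_sliceIndex (j : Fin 2 ⊕ Fin 4) :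
    pairSort (Fin 3) (sliceIndex j) = pairSort (Fin 2) j := by
  rcases j with j | j <;> rfl

variable {N : Type*} [TopologicalSpace N] [ChartedSpace (EuclideanSpace ℝ (Fin 7)) N]

/-- The restriction of a map to a slice `t = μ`. -/
def slice (F : EuclideanSpace ℝ (Fin 6) × ℝ → N) (μ : ℝ) : EuclideanSpace ℝ (Fin 6) → N :=
  fun x => F (x, μ)

/-- The restriction of a frame to a slice. -/
def sliceFrame (c : Fin 3 ⊕ Fin 4 → DForm (𝓡 7) N 1) (F : EuclideanSpace ℝ (Fin 6) × ℝ → N)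
    (μ : ℝ) : Fin 2 ⊕ Fin 4 → DForm (𝓡 6) (EuclideanSpace ℝ (Fin 6)) 1 :=
  fun j => pullback (slice F μ) (c (sliceIndex j))

theorem contMDiff_slice {F : EuclideanSpace ℝ (Fin 6) × ℝ → N}
    (hF : ContMDiff ((𝓡 6).prod 𝓘(ℝ, ℝ)) (𝓡 7) ∞ F) (μ : ℝ) :
    ContMDiff (𝓡 6) (𝓡 7) ∞ (slice F μ) :=
  hF.comp (contMDiff_id.prodMk contMDiff_const)

theorem mfderiv_slice {F : EuclideanSpace ℝ (Fin 6) × ℝ → N}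
    (hF : ContMDiff ((𝓡 6).prod 𝓘(ℝ, ℝ)) (𝓡 7) ∞ F) (μ : ℝ) (x v : EuclideanSpace ℝ (Fin 6)) :
    mfderiv (𝓡 6) (𝓡 7) (slice F μ) x v =
      mfderiv ((𝓡 6).prod 𝓘(ℝ, ℝ)) (𝓡 7) F (x, μ)
        ((v, 0) : EuclideanSpace ℝ (Fin 6) × ℝ) := by
  have h1 : MDifferentiableAt (𝓡 6) ((𝓡 6).prod 𝓘(ℝ, ℝ))
      (fun x : EuclideanSpace ℝ (Fin 6) => (x, μ)) x :=
    (contMDiff_id.prodMk contMDiff_const : ContMDiff (𝓡 6) ((𝓡 6).prod 𝓘(ℝ, ℝ)) ∞ _).mdifferentiableAt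
      (by simp)
  have h2 := mfderiv_comp (I := 𝓡 6) (I' := (𝓡 6).prod 𝓘(ℝ, ℝ)) (I'' := 𝓡 7) x
    (g := F) (hF.mdifferentiableAt (x := (x, μ)) (by simp)) h1
  rw [mfderiv_prod_left] at h2
  exact DFunLike.congr_fun h2 v

/-- A frame on a manifold together with a product chart in which one of its members is a multiple
of the differential of the last coordinate. -/
structure FoliatedFrame (c : Fin 3 ⊕ Fin 4 → DForm (𝓡 7) N 1) (W : Set N)
    (F : EuclideanSpace ℝ (Fin 6) × ℝ → N) : Prop where
  frame : IsFrameOn c W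
  diffeo : IsLocalDiffeomorph ((𝓡 6).prod 𝓘(ℝ, ℝ)) (𝓡 7) ∞ F
  mem : ∀ q, F q ∈ W
  straight : ∀ q, ∃ h : ℝ, h ≠ 0 ∧ ∀ v : TangentSpace ((𝓡 6).prod 𝓘(ℝ, ℝ)) q,
    pullback (J := (𝓡 6).prod 𝓘(ℝ, ℝ)) F (c (Sum.inl 2)) q (fun _ => v) =
      h * (v : EuclideanSpace ℝ (Fin 6) × ℝ).2

namespace FoliatedFrame

variable [IsManifold (𝓡 7) ∞ N] {c : Fin 3 ⊕ Fin 4 → DForm (𝓡 7) N 1} {W : Set N}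
  {F : EuclideanSpace ℝ (Fin 6) × ℝ → N}

theorem surjective (h : FoliatedFrame c W F) (q : EuclideanSpace ℝ (Fin 6) × ℝ) :
    Function.Surjective (mfderiv ((𝓡 6).prod 𝓘(ℝ, ℝ)) (𝓡 7) F q) :=
  ((h.diffeo q).mfderivToContinuousLinearEquiv (by simp)).surjective

theorem injective (h : FoliatedFrame c W F) {q : EuclideanSpace ℝ (Fin 6) × ℝ}
    {v : TangentSpace ((𝓡 6).prod 𝓘(ℝ, ℝ)) q}
    (hv : mfderiv ((𝓡 6).prod 𝓘(ℝ, ℝ)) (𝓡 7) F q v = 0) : v = 0 := by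
  have h1 := ((h.diffeo q).mfderivToContinuousLinearEquiv (by simp)).injective
  exact h1 (hv.trans (map_zero _).symm)

theorem sliceFrame_apply (h : FoliatedFrame c W F) (μ : ℝ) (j : Fin 2 ⊕ Fin 4)
    (x v : EuclideanSpace ℝ (Fin 6)) :
    sliceFrame c F μ j x (fun _ => v) =
      pullback (J := (𝓡 6).prod 𝓘(ℝ, ℝ)) F (c (sliceIndex j)) (x, μ)
        (fun _ => ((v, 0) : EuclideanSpace ℝ (Fin 6) × ℝ)) :=
  congrArg (fun u => c (sliceIndex j) (F (x, μ)) fun _ => u) (mfderiv_slice h.diffeo.contMDiff μ x v)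

theorem pullback_slice_eq_zero (h : FoliatedFrame c W F) (μ : ℝ) (x : EuclideanSpace ℝ (Fin 6)) :
    pullback (J := 𝓡 6) (slice F μ) (c (Sum.inl 2)) x = 0 := by
  obtain ⟨k, -, hk⟩ := h.straight (x, μ)
  refine covector_ext fun v => ?_
  refine (congrArg (fun u => c (Sum.inl 2) (F (x, μ)) fun _ => u)
    (mfderiv_slice h.diffeo.contMDiff μ x v)).trans ((hk _).trans ?_)
  exact mul_zero k

/-- The frame restricted to the slices has a dual frame. -/
theorem exists_isDual_slice (h : FoliatedFrame c W F) (μ : ℝ) (x : EuclideanSpace ℝ (Fin 6)) :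
    ∃ e : Fin 2 ⊕ Fin 4 → EuclideanSpace ℝ (Fin 6),
      IsDual (V := TangentSpace (𝓡 6) x) (fun j => sliceFrame c F μ j x) e := by
  obtain ⟨e, he⟩ := h.frame.exists_isDual card_three_four
  have he := he _ (h.mem (x, μ))
  choose e' he' using fun i => h.surjective (x, μ) (e i (F (x, μ)))
  obtain ⟨k, hk0, hk⟩ := h.straight (x, μ)
  have h2 : ∀ j, (e' (sliceIndex j) : EuclideanSpace ℝ (Fin 6) × ℝ).2 = 0 := by
    intro j
    have h3 := hk (e' (sliceIndex j))
    have h4 : pullback (J := (𝓡 6).prod 𝓘(ℝ, ℝ)) F (c (Sum.inl 2)) (x, μ)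
        (fun _ => e' (sliceIndex j)) = 0 :=
      (congrArg (fun u => c (Sum.inl 2) (F (x, μ)) fun _ => u) (he' (sliceIndex j))).trans
        ((he _ _).trans (if_neg (sliceIndex_ne j).symm))
    rw [h4] at h3
    exact (mul_eq_zero.1 h3.symm).resolve_left hk0
  refine ⟨fun j => (e' (sliceIndex j) : EuclideanSpace ℝ (Fin 6) × ℝ).1, fun i j => ?_⟩
  refine (h.sliceFrame_apply μ i x _).trans ?_
  have h5 : (((e' (sliceIndex j) : EuclideanSpace ℝ (Fin 6) × ℝ).1, 0) :
      EuclideanSpace ℝ (Fin 6) × ℝ) = e' (sliceIndex j) := Prod.ext rfl (h2 j).symm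
  rw [h5]
  refine (congrArg (fun u => c (sliceIndex i) (F (x, μ)) fun _ => u) (he' (sliceIndex j))).trans
    ((he _ _).trans ?_)
  simp only [sliceIndex_injective.eq_iff]

theorem smoothOn_sliceFrame (h : FoliatedFrame c W F) (μ : ℝ) (j : Fin 2 ⊕ Fin 4) :
    SmoothOn (sliceFrame c F μ j) Set.univ := fun x _ =>
  SmoothAt.pullback (contMDiff_slice h.diffeo.contMDiff μ x) (h.frame.1 _ _ (h.mem (x, μ)))

theorem isFrameOn_sliceFrame (h : FoliatedFrame c W F) (μ : ℝ) :
    IsFrameOn (sliceFrame c F μ) Set.univ := by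
  refine ⟨h.smoothOn_sliceFrame μ, fun x _ => ?_⟩
  obtain ⟨e, he⟩ := h.exists_isDual_slice μ x
  exact he.linearIndependent (V := TangentSpace (𝓡 6) x)

theorem card_two_four : Fintype.card (Fin 2 ⊕ Fin 4) =
    Module.finrank ℝ (EuclideanSpace ℝ (Fin 6)) := by simp

/-- Restriction to a slice of a generating set. -/
theorem generates_slice (h : FoliatedFrame c W F) {S : Set (GForm (𝓡 7) N)}
    (hS : Generates W c (pairSort (Fin 3)) S) (μ : ℝ) :
    Generates Set.univ (sliceFrame c F μ) (pairSort (Fin 2)) (pullbackSet (slice F μ) S) := by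
  have h1 := hS.pullback (J := 𝓡 6) (f := slice F μ) (W := Set.univ)
    (fun x _ => contMDiff_slice h.diffeo.contMDiff μ x) (fun x _ => h.mem (x, μ)) sliceIndex
    fun i => by
      rcases eq_inl_two_or_sliceIndex i with rfl | hi
      · exact Or.inr fun x _ => h.pullback_slice_eq_zero μ x
      · exact Or.inl hi
  have h2 : pairSort (Fin 3) ∘ sliceIndex = pairSort (Fin 2) := funext pairSort_sliceIndex
  rw [h2] at h1
  exact h1

theorem isCharForm_slice (h : FoliatedFrame c W F) (μ : ℝ) (x : EuclideanSpace ℝ (Fin 6)) {k : ℕ}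
    {φ : DForm (𝓡 7) N k}
    (hφ : IsCharForm (fun i => c i (F (x, μ))) (pairSort (Fin 3)) (φ (F (x, μ)))) :
    IsCharForm (fun j => sliceFrame c F μ j x) (pairSort (Fin 2))
      (pullback (J := 𝓡 6) (slice F μ) φ x) := by
  refine hφ.compContinuousLinearMap (V := TangentSpace (𝓡 7) (F (x, μ)))
    (V' := TangentSpace (𝓡 6) x) (f := mfderiv (𝓡 6) (𝓡 7) (slice F μ) x) fun t v hv i hi => ?_
  rcases eq_inl_two_or_sliceIndex i with rfl | ⟨j, rfl⟩
  · exact DFunLike.congr_fun (h.pullback_slice_eq_zero μ x) fun _ => v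
  · exact hv j (by rwa [← pairSort_sliceIndex])

end FoliatedFrame

end Slices

namespace FoliatedFrame

variable {N : Type*} [TopologicalSpace N] [ChartedSpace (EuclideanSpace ℝ (Fin 7)) N]
  [IsManifold (𝓡 7) ∞ N] {c : Fin 3 ⊕ Fin 4 → DForm (𝓡 7) N 1} {W : Set N}
  {F : EuclideanSpace ℝ (Fin 6) × ℝ → N}

/-- The exterior differential system induced on a slice. -/
def sliceEDS (h : FoliatedFrame c W F) (hd : ∀ j, pairSort (Fin 2) j = none → ∀ x ∈ W,
      IsCharForm (fun i => c i x) (pairSort (Fin 3)) (extd (c (sliceIndex j)) x)) (μ : ℝ) :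
    EDS (𝓡 6) (EuclideanSpace ℝ (Fin 6)) :=
  charEDS (sliceFrame c F μ) (pairSort (Fin 2)) card_two_four (h.isFrameOn_sliceFrame μ)
    fun j hj x => by
      have h1 := extd_pullback (contMDiff_slice h.diffeo.contMDiff μ x)
        (h.frame.1 (sliceIndex j) _ (h.mem (x, μ)))
      exact h1 ▸ h.isCharForm_slice μ x (hd j hj _ (h.mem (x, μ)))

theorem generates_sliceEDS (h : FoliatedFrame c W F) (hd : ∀ j, pairSort (Fin 2) j = none →
      ∀ x ∈ W, IsCharForm (fun i => c i x) (pairSort (Fin 3)) (extd (c (sliceIndex j)) x)) (μ : ℝ) :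
    Generates Set.univ (sliceFrame c F μ) (pairSort (Fin 2)) (h.sliceEDS hd μ).carrier :=
  generates_charEDS _ _ _

theorem card_three_four_prod : Fintype.card (Fin 3 ⊕ Fin 4) =
    Module.finrank ℝ (EuclideanSpace ℝ (Fin 6) × ℝ) := by simp

theorem isFrameOn_pullback (h : FoliatedFrame c W F) :
    IsFrameOn (fun i => pullback (J := (𝓡 6).prod 𝓘(ℝ, ℝ)) F (c i)) Set.univ := by
  refine ⟨fun i q _ => SmoothAt.pullback (h.diffeo.contMDiff q) (h.frame.1 i _ (h.mem q)),
    fun q _ => ?_⟩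
  obtain ⟨e, he⟩ := h.frame.exists_isDual card_three_four
  choose e' he' using fun i => h.surjective q (e i (F q))
  refine IsDual.linearIndependent (V := TangentSpace ((𝓡 6).prod 𝓘(ℝ, ℝ)) q) (e := e')
    fun i j => ?_
  exact (congrArg (fun u => c i (F q) fun _ => u) (he' j)).trans (he _ (h.mem q) i j)

theorem generates_pullback (h : FoliatedFrame c W F) {S : Set (GForm (𝓡 7) N)}
    (hS : Generates W c (pairSort (Fin 3)) S) :
    Generates Set.univ (fun i => pullback (J := (𝓡 6).prod 𝓘(ℝ, ℝ)) F (c i)) (pairSort (Fin 3))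
      (pullbackSet F S) :=
  hS.pullback (κ := id) (fun q _ => h.diffeo.contMDiff q) (fun q _ => h.mem q)
    fun i => Or.inl ⟨i, rfl⟩

/-- The coframe of a product consisting of the frame of a slice and the differential of the last
coordinate. -/
def prodCoframe (c : Fin 3 ⊕ Fin 4 → DForm (𝓡 7) N 1) (F : EuclideanSpace ℝ (Fin 6) × ℝ → N)
    (μ : ℝ) : Fin 3 ⊕ Fin 4 →
      DForm ((𝓡 6).prod 𝓘(ℝ, ℝ)) (EuclideanSpace ℝ (Fin 6) × ℝ) 1 :=
  Sum.elim ![pullback Prod.fst (sliceFrame c F μ (Sum.inl 0)),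
      pullback Prod.fst (sliceFrame c F μ (Sum.inl 1)), dfun Prod.snd]
    fun i => pullback Prod.fst (sliceFrame c F μ (Sum.inr i))

theorem prodCoframe_sliceIndex (μ : ℝ) (j : Fin 2 ⊕ Fin 4) :
    prodCoframe c F μ (sliceIndex j) = pullback Prod.fst (sliceFrame c F μ j) := by
  rcases j with j | j
  · fin_cases j <;> rfl
  · rfl

theorem pullback_fst_apply {k : ℕ} (φ : DForm (𝓡 6) (EuclideanSpace ℝ (Fin 6)) k)
    (q : EuclideanSpace ℝ (Fin 6) × ℝ) (v : Fin k → EuclideanSpace ℝ (Fin 6) × ℝ) :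
    pullback (J := (𝓡 6).prod 𝓘(ℝ, ℝ)) (Prod.fst : EuclideanSpace ℝ (Fin 6) × ℝ → _) φ q v =
      φ q.1 fun a => (v a).1 := by
  show φ q.1 (fun a => mfderiv ((𝓡 6).prod 𝓘(ℝ, ℝ)) (𝓡 6) Prod.fst q (v a)) = _
  rw [mfderiv_fst]
  rfl

theorem exists_isDual_prod (h : FoliatedFrame c W F) (q : EuclideanSpace ℝ (Fin 6) × ℝ) :
    ∃ e : Fin 3 ⊕ Fin 4 → EuclideanSpace ℝ (Fin 6) × ℝ,
      IsDual (V := TangentSpace ((𝓡 6).prod 𝓘(ℝ, ℝ)) q) (fun i => prodCoframe c F q.2 i q) e := by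
  obtain ⟨e, he⟩ := h.exists_isDual_slice q.2 q.1
  let E : Fin 3 ⊕ Fin 4 → EuclideanSpace ℝ (Fin 6) × ℝ :=
    Sum.elim ![(e (Sum.inl 0), 0), (e (Sum.inl 1), 0), (0, 1)] fun i => (e (Sum.inr i), 0)
  have hE : ∀ j, E (sliceIndex j) = (e j, 0) := by
    rintro (j | j)
    · fin_cases j <;> rfl
    · rfl
  have hfst : ∀ i v, prodCoframe c F q.2 (sliceIndex i) q (fun _ => v) =
      sliceFrame c F q.2 i q.1 (fun _ => v.1) := by
    intro i v
    rw [prodCoframe_sliceIndex]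
    exact pullback_fst_apply _ q _
  have hsnd : ∀ v, prodCoframe c F q.2 (Sum.inl 2) q (fun _ => v) = v.2 := dfun_snd_apply q
  refine ⟨E, fun i j => ?_⟩
  rcases eq_inl_two_or_sliceIndex i with rfl | ⟨i, rfl⟩ <;>
    rcases eq_inl_two_or_sliceIndex j with rfl | ⟨j, rfl⟩
  · exact (hsnd _).trans (if_pos rfl).symm
  · refine (hsnd _).trans ?_
    rw [hE, if_neg (sliceIndex_ne j).symm]
  · refine (hfst _ _).trans ?_
    rw [if_neg (sliceIndex_ne i)]
    exact (covec (V := TangentSpace (𝓡 6) q.1) (sliceFrame c F q.2 i q.1)).map_zero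
  · refine (hfst _ _).trans ?_
    rw [hE]
    refine (he i j).trans ?_
    simp only [sliceIndex_injective.eq_iff]

theorem charSpace_prodCoframe (h : FoliatedFrame c W F) (q : EuclideanSpace ℝ (Fin 6) × ℝ)
    (s : Bool) :
    charSpace (V := TangentSpace ((𝓡 6).prod 𝓘(ℝ, ℝ)) q) (fun i => prodCoframe c F q.2 i q)
        (pairSort (Fin 3)) s =
      charSpace (fun i => pullback (J := (𝓡 6).prod 𝓘(ℝ, ℝ)) F (c i) q) (pairSort (Fin 3)) s := by
  obtain ⟨k, hk0, hk⟩ := h.straight q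
  have hsnd : ∀ v : EuclideanSpace ℝ (Fin 6) × ℝ,
      prodCoframe c F q.2 (Sum.inl 2) q (fun _ => v) = v.2 := dfun_snd_apply q
  have hfst : ∀ i (v : EuclideanSpace ℝ (Fin 6) × ℝ), v.2 = 0 →
      prodCoframe c F q.2 (sliceIndex i) q (fun _ => v) =
        pullback (J := (𝓡 6).prod 𝓘(ℝ, ℝ)) F (c (sliceIndex i)) q (fun _ => v) := by
    intro i v hv
    rw [prodCoframe_sliceIndex]
    refine (pullback_fst_apply _ q _).trans ((h.sliceFrame_apply q.2 i q.1 v.1).trans ?_)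
    rw [show ((v.1, 0) : EuclideanSpace ℝ (Fin 6) × ℝ) = v from Prod.ext rfl hv.symm]
  ext v
  constructor
  · intro hv i hi
    have h2 : (v : EuclideanSpace ℝ (Fin 6) × ℝ).2 = 0 :=
      (hsnd v).symm.trans (hv (Sum.inl 2) (by simp [pairSort]))
    rcases eq_inl_two_or_sliceIndex i with rfl | ⟨j, rfl⟩
    · exact (hk v).trans (mul_eq_zero_of_right _ h2)
    · exact (hfst j v h2).symm.trans (hv _ hi)
  · intro hv i hi
    have h2 : (v : EuclideanSpace ℝ (Fin 6) × ℝ).2 = 0 :=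
      (mul_eq_zero.1 ((hk v).symm.trans (hv (Sum.inl 2) (by simp [pairSort])))).resolve_left hk0
    rcases eq_inl_two_or_sliceIndex i with rfl | ⟨j, rfl⟩
    · exact (hsnd v).trans h2
    · exact (hfst j v h2).trans (hv _ hi)

theorem mem_familyIdeal (h : FoliatedFrame c W F) (hd : ∀ j, pairSort (Fin 2) j = none →
      ∀ x ∈ W, IsCharForm (fun i => c i x) (pairSort (Fin 3)) (extd (c (sliceIndex j)) x)) {k : ℕ}
    {φ : DForm ((𝓡 6).prod 𝓘(ℝ, ℝ)) (EuclideanSpace ℝ (Fin 6) × ℝ) k}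
    (hφ : SmoothOn φ Set.univ) (hchar : ∀ q, IsCharForm
      (fun i => pullback (J := (𝓡 6).prod 𝓘(ℝ, ℝ)) F (c i) q) (pairSort (Fin 3)) (φ q)) :
    (⟨k, φ⟩ : GForm ((𝓡 6).prod 𝓘(ℝ, ℝ)) (EuclideanSpace ℝ (Fin 6) × ℝ)) ∈
      familyIdeal (h.sliceEDS hd) := by
  refine ⟨hφ, fun q => ?_⟩
  obtain ⟨e, he⟩ := h.exists_isDual_prod q
  have hsame := h.generates_sliceEDS hd q.2
  have hslice : ∀ {m : ℕ} {ψ : DForm (𝓡 6) (EuclideanSpace ℝ (Fin 6)) m},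
      SmoothOn ψ Set.univ → (∀ x, IsCharForm (fun j => sliceFrame c F q.2 j x) (pairSort (Fin 2))
        (ψ x)) → (⟨m, ψ⟩ : GForm (𝓡 6) _) ∈ (h.sliceEDS hd q.2).carrier := fun h1 h2 => ⟨h1, h2⟩
  have hone : ∀ i, pairSort (Fin 3) i = none → PtIdeal
      ({t | ∃ β ∈ (h.sliceEDS hd q.2).carrier, t = ⟨β.1, pullback (J := (𝓡 6).prod 𝓘(ℝ, ℝ))
          (Prod.fst : EuclideanSpace ℝ (Fin 6) × ℝ → _) β.2 q⟩} ∪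
        {⟨1, dfun (I := (𝓡 6).prod 𝓘(ℝ, ℝ))
          (Prod.snd : EuclideanSpace ℝ (Fin 6) × ℝ → ℝ) q⟩}) 1 (prodCoframe c F q.2 i q) := by
    intro i hi
    rcases eq_inl_two_or_sliceIndex i with rfl | ⟨j, rfl⟩
    · exact .gen (Or.inr rfl)
    · rw [prodCoframe_sliceIndex]
      rw [pairSort_sliceIndex] at hi
      exact .gen (Or.inl ⟨⟨1, sliceFrame c F q.2 j⟩, hslice (h.smoothOn_sliceFrame q.2 j)
        fun x => isCharForm_covector (c := fun j => sliceFrame c F q.2 j x) hi, rfl⟩)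
  refine ptIdeal_of_isCharForm (V := TangentSpace ((𝓡 6).prod 𝓘(ℝ, ℝ)) q)
    (c := fun i => prodCoframe c F q.2 i q) (g := pairSort (Fin 3)) card_three_four_prod he hone
    (fun i i' hii' => ?_) ((hchar q).mono fun s => (h.charSpace_prodCoframe q s).subset)
  by_cases hi : pairSort (Fin 3) i = none
  · exact PtIdeal.mul (l := 1) (hone i hi) (prodCoframe c F q.2 i' q)
  rcases eq_inl_two_or_sliceIndex i with rfl | ⟨j, rfl⟩
  · exact absurd rfl hi
  rcases eq_inl_two_or_sliceIndex i' with rfl | ⟨j', rfl⟩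
  · exact absurd (hii'.trans rfl) hi
  rw [pairSort_sliceIndex, pairSort_sliceIndex] at hii'
  refine .gen (Or.inl ⟨⟨2, wedgeF (sliceFrame c F q.2 j) (sliceFrame c F q.2 j')⟩,
    hslice (fun x hx => (h.smoothOn_sliceFrame q.2 j x hx).wedgeF
      (h.smoothOn_sliceFrame q.2 j' x hx)) fun x =>
        isCharForm_wedge (c := fun j => sliceFrame c F q.2 j x) hii', ?_⟩)
  rw [prodCoframe_sliceIndex, prodCoframe_sliceIndex]
  dsimp only
  rw [pullback_wedgeF]
  rfl

theorem generates_familyIdeal (h : FoliatedFrame c W F) (hd : ∀ j, pairSort (Fin 2) j = none →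
      ∀ x ∈ W, IsCharForm (fun i => c i x) (pairSort (Fin 3)) (extd (c (sliceIndex j)) x)) :
    Generates Set.univ (fun i => pullback (J := (𝓡 6).prod 𝓘(ℝ, ℝ)) F (c i)) (pairSort (Fin 3))
      (familyIdeal (h.sliceEDS hd)) where
  smooth s hs := hs.1
  char s hs q _ := by
    refine .mono (fun t => (h.charSpace_prodCoframe q t).symm.subset) (.of_ptIdeal ?_ (hs.2 q))
    rintro _ (⟨β, hβ, rfl⟩ | rfl)
    · refine (hβ.2 q.1).compContinuousLinearMap (V := TangentSpace (𝓡 6) q.1)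
        (V' := TangentSpace ((𝓡 6).prod 𝓘(ℝ, ℝ)) q)
        (f := mfderiv ((𝓡 6).prod 𝓘(ℝ, ℝ)) (𝓡 6) Prod.fst q) fun t v hv j hj => ?_
      have h1 := hv (sliceIndex j) (by rwa [pairSort_sliceIndex])
      exact (DFunLike.congr_fun (congrFun (prodCoframe_sliceIndex (c := c) (F := F) q.2 j) q)
        fun _ => v).symm.trans h1
    · exact isCharForm_covector (c := fun i => prodCoframe c F q.2 i q) (i := Sum.inl 2) rfl
  one i hi := .gen (h.mem_familyIdeal hd (h.isFrameOn_pullback.1 i) fun q => isCharForm_covector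
    (c := fun i => pullback (J := (𝓡 6).prod 𝓘(ℝ, ℝ)) F (c i) q) hi)
  two i j hij := .gen (h.mem_familyIdeal hd (fun q hq => (h.isFrameOn_pullback.1 i q hq).wedgeF
    (h.isFrameOn_pullback.1 j q hq)) fun q => isCharForm_wedge
      (c := fun i => pullback (J := (𝓡 6).prod 𝓘(ℝ, ℝ)) F (c i) q) hij)

theorem sameIdeal_familyIdeal (h : FoliatedFrame c W F) {S : Set (GForm (𝓡 7) N)}
    (hS : Generates W c (pairSort (Fin 3)) S) (hd : ∀ j, pairSort (Fin 2) j = none →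
      ∀ x ∈ W, IsCharForm (fun i => c i x) (pairSort (Fin 3)) (extd (c (sliceIndex j)) x)) :
    SameIdeal Set.univ (pullbackSet F S) (familyIdeal (h.sliceEDS hd)) :=
  (h.generates_pullback hS).sameIdeal (h.generates_familyIdeal hd) isOpen_univ card_three_four_prod
    h.isFrameOn_pullback

end FoliatedFrame

section CoordinateForms

theorem exists_coordinate_coframe :
    ∃ c : Fin 6 ⊕ Unit → DForm ((𝓡 6).prod 𝓘(ℝ, ℝ)) (EuclideanSpace ℝ (Fin 6) × ℝ) 1,
      (∀ i, SmoothOn (c i) Set.univ) ∧ ∃ e : Fin 6 ⊕ Unit → EuclideanSpace ℝ (Fin 6) × ℝ,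
        e (Sum.inr ()) = (0, 1) ∧ ∀ q, IsDual (V := TangentSpace ((𝓡 6).prod 𝓘(ℝ, ℝ)) q)
          (fun i => c i q) e := by
  have hfun : ∀ i : Fin 6, ContMDiff (𝓡 6) 𝓘(ℝ, ℝ) ∞ fun x : EuclideanSpace ℝ (Fin 6) => x i :=
    fun i => (EuclideanSpace.proj i : EuclideanSpace ℝ (Fin 6) →L[ℝ] ℝ).contDiff.contMDiff
  have hval : ∀ (i : Fin 6) (x v : EuclideanSpace ℝ (Fin 6)),
      dfun (I := 𝓡 6) (fun x : EuclideanSpace ℝ (Fin 6) => x i) x (fun _ => v) = v i := by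
    intro i x v
    have h1 : HasMFDerivAt (𝓡 6) 𝓘(ℝ, ℝ) (fun x : EuclideanSpace ℝ (Fin 6) => x i) x
        (EuclideanSpace.proj i : EuclideanSpace ℝ (Fin 6) →L[ℝ] ℝ) :=
      (EuclideanSpace.proj i : EuclideanSpace ℝ (Fin 6) →L[ℝ] ℝ).hasFDerivAt.hasMFDerivAt
    show mfderiv (𝓡 6) 𝓘(ℝ, ℝ) (fun x : EuclideanSpace ℝ (Fin 6) => x i) x v = v i
    rw [h1.mfderiv]
    rfl
  refine ⟨Sum.elim (fun i => pullback Prod.fst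
    (dfun (I := 𝓡 6) fun x : EuclideanSpace ℝ (Fin 6) => x i)) fun _ => dfun Prod.snd, ?_,
    Sum.elim (fun i => (EuclideanSpace.single i 1, 0)) fun _ => (0, 1), rfl, fun q => ?_⟩
  · rintro (i | _) q -
    · exact SmoothAt.pullback contMDiff_fst.contMDiffAt (smoothAt_dfun (hfun i _))
    · exact smoothAt_dfun contMDiff_snd.contMDiffAt
  · rintro (i | _) (j | _)
    · refine (FoliatedFrame.pullback_fst_apply _ q _).trans ((hval i _ _).trans ?_)
      simp [PiLp.single_apply]
    · refine (FoliatedFrame.pullback_fst_apply _ q _).trans ((hval i _ _).trans ?_)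
      simp
    · refine (dfun_snd_apply q _).trans ?_
      simp
    · refine (dfun_snd_apply q _).trans ?_
      simp

/-- The value of a smooth `1`-form on the last coordinate field is smooth. -/
theorem contMDiff_apply_last {φ : DForm ((𝓡 6).prod 𝓘(ℝ, ℝ)) (EuclideanSpace ℝ (Fin 6) × ℝ) 1}
    (hφ : SmoothOn φ Set.univ) : ContMDiff ((𝓡 6).prod 𝓘(ℝ, ℝ)) 𝓘(ℝ, ℝ) ∞
      fun q => φ q fun _ => ((0, 1) : EuclideanSpace ℝ (Fin 6) × ℝ) := by
  obtain ⟨c, hc, e, he1, he⟩ := exists_coordinate_coframe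
  intro q
  have h1 := SmoothOn.coeff isOpen_univ (ι := Fin 6 ⊕ Unit) (by simp) hc (e := fun i _ => e i)
    (fun q _ => he q) hφ (fun _ => Sum.inr ()) q trivial
  rw [he1] at h1
  exact h1

end CoordinateForms

section Generation

variable {M : Type*} [TopologicalSpace M] [ChartedSpace (EuclideanSpace ℝ (Fin 5)) M]
  {M' : Type*} [TopologicalSpace M'] [ChartedSpace (EuclideanSpace ℝ (Fin 5)) M']
  {N : Type*} [TopologicalSpace N] [ChartedSpace (EuclideanSpace ℝ (Fin 7)) N]
  [IsManifold (𝓡 5) ∞ M] [IsManifold (𝓡 5) ∞ M'] [IsManifold (𝓡 7) ∞ N]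
  {𝓘₀ : EDS (𝓡 5) M} {𝓘₁ : EDS (𝓡 5) M'} {𝓑 : EDS (𝓡 7) N} {π : N → M} {π' : N → M'}
  {χ₁₀ χ₀₁ : (x : N) → Submodule ℝ (TangentSpace (𝓡 7) x [⋀^Fin 1]→L[ℝ] ℝ)}
  {W W' : Set N} {θ : DForm (𝓡 5) M 1} {θ' : DForm (𝓡 5) M' 1} {γ : DForm (𝓡 7) N 1}
  {α : Fin 4 → DForm (𝓡 7) N 1}

namespace ContactFrame

/-- The third member of a contact frame may be exchanged, as long as the spans are preserved. -/
theorem replace_third (h : ContactFrame 𝓘₀ 𝓘₁ 𝓑 π π' χ₁₀ χ₀₁ W θ θ' γ α)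
    {δ : DForm (𝓡 7) N 1} (hδ : SmoothOn δ W)
    (hspan : ∀ x ∈ W, Submodule.span ℝ (Set.range fun a =>
      (![pullback π θ, pullback π' θ', δ] : Fin 3 → DForm (𝓡 7) N 1) a x) = degOne 𝓑.carrier x) :
    ContactFrame 𝓘₀ 𝓘₁ 𝓑 π π' χ₁₀ χ₀₁ W θ θ' δ α := by
  refine ⟨h.split.replace ?_ (fun x hx => ?_) fun x hx a => ?_, h.mem_left, h.mem_right,
    h.contact_left, h.contact_right⟩
  · intro a
    fin_cases a
    · exact h.split.frame.1 (Sum.inl 0)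
    · exact h.split.frame.1 (Sum.inl 1)
    · exact hδ
  · have h1 : LinearIndependent ℝ fun a =>
        (![pullback π θ, pullback π' θ', γ] : Fin 3 → DForm (𝓡 7) N 1) a x :=
      (h.split.frame.2 x hx).comp Sum.inl Sum.inl_injective
    rw [linearIndependent_iff_card_eq_finrank_span, Set.finrank, hspan x hx, h.split.degOne_eq hx,
      finrank_span_eq_card h1]
  · rw [← h.split.degOne_eq hx, ← hspan x hx]
    exact Submodule.subset_span ⟨a, rfl⟩

theorem generates_left (h : ContactFrame 𝓘₀ 𝓘₁ 𝓑 π π' χ₁₀ χ₀₁ W θ θ' γ α) :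
    Generates W (Sum.elim ![pullback π θ, pullback π' θ', γ] α) (pairSort (Fin 3))
      (pullbackSet π 𝓘₀.carrier ∪ {⟨1, pullback π' θ'⟩, ⟨1, γ⟩}) := by
  obtain ⟨Θ, hΘ⟩ := h.split.left
  refine hΘ.exchange h.split.isOpen card_three_four h.split.frame ?_ ?_
  · rintro t (rfl | rfl)
    · exact ⟨h.split.frame.1 (Sum.inl 1), fun x _ => isCharForm_covector
        (c := fun i => Sum.elim ![pullback π θ, pullback π' θ', γ] α i x) (i := Sum.inl 1) rfl⟩
    · exact ⟨h.split.frame.1 (Sum.inl 2), fun x _ => isCharForm_covector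
        (c := fun i => Sum.elim ![pullback π θ, pullback π' θ', γ] α i x) (i := Sum.inl 2) rfl⟩
  · rintro (a | i) hi
    · fin_cases a
      · exact .gen (Or.inl ⟨_, h.mem_left, rfl⟩)
      · exact .gen (Or.inr (Or.inl rfl))
      · exact .gen (Or.inr (Or.inr rfl))
    · fin_cases i <;> simp [pairSort] at hi

theorem generates_right (h : ContactFrame 𝓘₀ 𝓘₁ 𝓑 π π' χ₁₀ χ₀₁ W θ θ' γ α) :
    Generates W (Sum.elim ![pullback π θ, pullback π' θ', γ] α) (pairSort (Fin 3))
      (pullbackSet π' 𝓘₁.carrier ∪ {⟨1, pullback π θ⟩, ⟨1, γ⟩}) := by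
  obtain ⟨Θ, hΘ⟩ := h.split.right
  refine hΘ.exchange h.split.isOpen card_three_four h.split.frame ?_ ?_
  · rintro t (rfl | rfl)
    · exact ⟨h.split.frame.1 (Sum.inl 0), fun x _ => isCharForm_covector
        (c := fun i => Sum.elim ![pullback π θ, pullback π' θ', γ] α i x) (i := Sum.inl 0) rfl⟩
    · exact ⟨h.split.frame.1 (Sum.inl 2), fun x _ => isCharForm_covector
        (c := fun i => Sum.elim ![pullback π θ, pullback π' θ', γ] α i x) (i := Sum.inl 2) rfl⟩
  · rintro (a | i) hi
    · fin_cases a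
      · exact .gen (Or.inr (Or.inl rfl))
      · exact .gen (Or.inl ⟨_, h.mem_right, rfl⟩)
      · exact .gen (Or.inr (Or.inr rfl))
    · fin_cases i <;> simp [pairSort] at hi

end ContactFrame

end Generation

section SliceExtension

variable {M : Type*} [TopologicalSpace M] [ChartedSpace (EuclideanSpace ℝ (Fin 5)) M]
  {N : Type*} [TopologicalSpace N] [ChartedSpace (EuclideanSpace ℝ (Fin 7)) N]
  [IsManifold (𝓡 5) ∞ M] [IsManifold (𝓡 7) ∞ N]
  {𝓘₀ : EDS (𝓡 5) M} {π : N → M} {c : Fin 3 ⊕ Fin 4 → DForm (𝓡 7) N 1} {W : Set N}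
  {F : EuclideanSpace ℝ (Fin 6) × ℝ → N}

namespace FoliatedFrame

theorem generates_slice_comp (h : FoliatedFrame c W F) (hπ : ContMDiff (𝓡 7) (𝓡 5) ∞ π)
    {S : Set (GForm (𝓡 5) M)} {j : Fin 2} (hgen : Generates W c (pairSort (Fin 3))
      (pullbackSet π S ∪ {⟨1, c (sliceIndex (Sum.inl j))⟩, ⟨1, c (Sum.inl 2)⟩})) (μ : ℝ) :
    Generates Set.univ (sliceFrame c F μ) (pairSort (Fin 2))
      (pullbackSet (π ∘ slice F μ) S ∪ {⟨1, sliceFrame c F μ (Sum.inl j)⟩}) := by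
  have h1 := h.generates_slice hgen μ
  rw [pullback_union, ← pullbackSet_comp (hπ.mdifferentiable (by simp))
    ((contMDiff_slice h.diffeo.contMDiff μ).mdifferentiable (by simp))] at h1
  refine h1.of_algIdeal ?_ ?_
  · rintro t (ht | rfl)
    · exact ⟨h1.smooth t (Or.inl ht), h1.char t (Or.inl ht)⟩
    · exact ⟨h.smoothOn_sliceFrame μ _, fun x _ => isCharForm_covector
        (c := fun i => sliceFrame c F μ i x) (i := Sum.inl j) rfl⟩
  · rintro s (hs | ⟨t, rfl | rfl, rfl⟩)
    · exact .gen (Or.inl hs)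
    · exact .gen (Or.inr rfl)
    · exact .congr .zero fun x _ => (h.pullback_slice_eq_zero μ x).symm

theorem mfderiv_comp_apply (h : FoliatedFrame c W F) (hπ : ContMDiff (𝓡 7) (𝓡 5) ∞ π)
    (q : EuclideanSpace ℝ (Fin 6) × ℝ) (v : TangentSpace ((𝓡 6).prod 𝓘(ℝ, ℝ)) q) :
    mfderiv ((𝓡 6).prod 𝓘(ℝ, ℝ)) (𝓡 5) (π ∘ F) q v =
      mfderiv (𝓡 7) (𝓡 5) π (F q) (mfderiv ((𝓡 6).prod 𝓘(ℝ, ℝ)) (𝓡 7) F q v) :=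
  DFunLike.congr_fun (mfderiv_comp (I := (𝓡 6).prod 𝓘(ℝ, ℝ)) (I' := 𝓡 7) (I'' := 𝓡 5) q
    (hπ.mdifferentiable (by simp) _) (h.diffeo.contMDiff.mdifferentiable (by simp) q)) v

theorem isSubmersion_comp (h : FoliatedFrame c W F) (hπ : IsSubmersion (𝓡 7) (𝓡 5) π) :
    IsSubmersion ((𝓡 6).prod 𝓘(ℝ, ℝ)) (𝓡 5) (π ∘ F) := by
  refine ⟨hπ.1.comp h.diffeo.contMDiff, fun q u => ?_⟩
  obtain ⟨v, rfl⟩ := hπ.2 (F q) u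
  obtain ⟨w, rfl⟩ := h.surjective q v
  exact ⟨w, h.mfderiv_comp_apply hπ.1 q w⟩

/-- The slices of a foliated box are integrable extensions of rank one. -/
theorem isIntegrableExtension_slice (h : FoliatedFrame c W F)
    (hd : ∀ j, pairSort (Fin 2) j = none → ∀ x ∈ W,
      IsCharForm (fun i => c i x) (pairSort (Fin 3)) (extd (c (sliceIndex j)) x))
    (hπ : ContMDiff (𝓡 7) (𝓡 5) ∞ π) {j : Fin 2} (hgen : Generates W c (pairSort (Fin 3))
      (pullbackSet π 𝓘₀.carrier ∪ {⟨1, c (sliceIndex (Sum.inl j))⟩, ⟨1, c (Sum.inl 2)⟩}))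
    (hker : ∀ x ∈ W, ∀ v : TangentSpace (𝓡 7) x, mfderiv (𝓡 7) (𝓡 5) π x v = 0 →
      c (sliceIndex (Sum.inl j)) x (fun _ => v) = 0 → c (Sum.inl 2) x (fun _ => v) = 0 → v = 0)
    (μ : ℝ) : IsIntegrableExtension 1 (h.sliceEDS hd μ) 𝓘₀ (π ∘ slice F μ) := by
  have hs := contMDiff_slice h.diffeo.contMDiff μ
  have hcomp : ∀ x v : EuclideanSpace ℝ (Fin 6),
      mfderiv (𝓡 6) (𝓡 5) (π ∘ slice F μ) x v =
        mfderiv (𝓡 7) (𝓡 5) π (slice F μ x) (mfderiv (𝓡 6) (𝓡 7) (slice F μ) x v) := fun x v =>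
    DFunLike.congr_fun (mfderiv_comp (I := 𝓡 6) (I' := 𝓡 7) (I'' := 𝓡 5) x
      (hπ.mdifferentiable (by simp) _) (hs.mdifferentiable (by simp) x)) v
  have hinj : ∀ x v : EuclideanSpace ℝ (Fin 6), mfderiv (𝓡 6) (𝓡 5) (π ∘ slice F μ) x v = 0 →
      sliceFrame c F μ (Sum.inl j) x (fun _ => v) = 0 → v = 0 := by
    intro x v hv hj
    have h1 := hker _ (h.mem (x, μ)) (mfderiv (𝓡 6) (𝓡 7) (slice F μ) x v)
      ((hcomp x v).symm.trans hv) hj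
      (DFunLike.congr_fun (h.pullback_slice_eq_zero μ x) fun _ => v)
    exact congrArg Prod.fst (h.injective ((mfderiv_slice h.diffeo.contMDiff μ x v).symm.trans h1))
  have hdim : ∀ x : EuclideanSpace ℝ (Fin 6),
      Module.finrank ℝ (LinearMap.ker (mfderiv (𝓡 6) (𝓡 5) (π ∘ slice F μ) x).toLinearMap) = 1 ∧
        Function.Surjective (mfderiv (𝓡 6) (𝓡 5) (π ∘ slice F μ) x) := fun x =>
    finrank_ker_eq_one_of_functional (V := EuclideanSpace ℝ (Fin 6))
      (W := EuclideanSpace ℝ (Fin 5)) (n := 5)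
      (finrank_euclideanSpace_fin (𝕜 := ℝ) (n := 6)) (finrank_euclideanSpace_fin (𝕜 := ℝ) (n := 5))
      (mfderiv (𝓡 6) (𝓡 5) (π ∘ slice F μ) x).toLinearMap
      (covec (V := TangentSpace (𝓡 6) x) (sliceFrame c F μ (Sum.inl j) x)).toLinearMap (hinj x)
  refine ⟨⟨hπ.comp hs, fun x => (hdim x).2⟩, fun x => (hdim x).1, fun x =>
    ⟨Set.univ, isOpen_univ, trivial, fun _ => sliceFrame c F μ (Sum.inl j), ⟨fun _ =>
      h.smoothOn_sliceFrame μ _, fun x _ => ?_⟩, ?_, fun x _ v hv hπv => hinj x v hπv (hv 0)⟩⟩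
  · exact linearIndependent_unique_iff.2 (((h.isFrameOn_sliceFrame μ).2 x trivial).ne_zero _)
  · rw [Set.range_const]
    exact (h.generates_sliceEDS hd μ).sameIdeal (h.generates_slice_comp hπ hgen μ) isOpen_univ
      card_two_four (h.isFrameOn_sliceFrame μ)

theorem smoothOn_familyForm (h : FoliatedFrame c W F) (j : Fin 2 ⊕ Fin 4) :
    SmoothOn (familyForm fun μ => sliceFrame c F μ j) Set.univ := by
  let φ := pullback (J := (𝓡 6).prod 𝓘(ℝ, ℝ)) F (c (sliceIndex j))
  have hφ : SmoothOn φ Set.univ := h.isFrameOn_pullback.1 (sliceIndex j)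
  intro q _
  have h1 : SmoothAt (fun q => φ q + (-φ q fun _ => ((0, 1) : EuclideanSpace ℝ (Fin 6) × ℝ)) •
      dfun (I := (𝓡 6).prod 𝓘(ℝ, ℝ)) (Prod.snd : EuclideanSpace ℝ (Fin 6) × ℝ → ℝ) q) q :=
    (hφ q trivial).add ((smoothAt_dfun contMDiff_snd.contMDiffAt).smul
      (contMDiff_apply_last hφ q).neg)
  refine h1.congr (Filter.Eventually.of_forall fun q => covector_ext fun v => ?_)
  have h2 := (pullback_fst_apply (sliceFrame c F q.2 j) q fun _ => v).trans
    (h.sliceFrame_apply q.2 j q.1 (v : EuclideanSpace ℝ (Fin 6) × ℝ).1)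
  refine Eq.trans ?_ h2.symm
  let l : EuclideanSpace ℝ (Fin 6) × ℝ →L[ℝ] ℝ :=
    covec (V := TangentSpace ((𝓡 6).prod 𝓘(ℝ, ℝ)) q) (φ q)
  obtain ⟨v1, v2⟩ : EuclideanSpace ℝ (Fin 6) × ℝ := v
  have h3 : ((v1, v2) : EuclideanSpace ℝ (Fin 6) × ℝ) = (v1, 0) + v2 • (0, 1) := by simp
  have h4 : l (v1, v2) + -l (0, 1) * v2 = l (v1, 0) := by
    rw [h3, map_add, map_smul, smul_eq_mul]
    ring
  refine Eq.trans ?_ h4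
  exact congrArg (fun r => l (v1, v2) + -l (0, 1) * r) (dfun_snd_apply q ((v1, v2) :
    EuclideanSpace ℝ (Fin 6) × ℝ))

end FoliatedFrame

end SliceExtension

section Construction

variable {M : Type*} [TopologicalSpace M] [ChartedSpace (EuclideanSpace ℝ (Fin 5)) M]
  {M' : Type*} [TopologicalSpace M'] [ChartedSpace (EuclideanSpace ℝ (Fin 5)) M']
  {N : Type*} [TopologicalSpace N] [ChartedSpace (EuclideanSpace ℝ (Fin 7)) N]
  [IsManifold (𝓡 5) ∞ M] [IsManifold (𝓡 5) ∞ M'] [IsManifold (𝓡 7) ∞ N]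
  {𝓘₀ : EDS (𝓡 5) M} {𝓘₁ : EDS (𝓡 5) M'} {𝓑 : EDS (𝓡 7) N} {π : N → M} {π' : N → M'}
  {χ₁₀ χ₀₁ : (x : N) → Submodule ℝ (TangentSpace (𝓡 7) x [⋀^Fin 1]→L[ℝ] ℝ)}
  {W : Set N} {θ : DForm (𝓡 5) M 1} {θ' : DForm (𝓡 5) M' 1} {γ : DForm (𝓡 7) N 1}
  {α : Fin 4 → DForm (𝓡 7) N 1} {lam : N → ℝ} {p : N}

theorem ContactFrame.exists_arisesFromFamilyOn (hB : IsBacklund 2 𝓘₀ 𝓘₁ 𝓑 π π')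
    (h : ContactFrame 𝓘₀ 𝓘₁ 𝓑 π π' χ₁₀ χ₀₁ W θ θ' (dfun lam) α)
    (hlam : ∀ y ∈ W, ContMDiffAt (𝓡 7) 𝓘(ℝ, ℝ) ∞ lam y) (hp : p ∈ W) :
    ∃ U : Set N, IsOpen U ∧ p ∈ U ∧ ArisesFromFamilyOn 𝓘₀ 𝓘₁ 𝓑 π π' U := by
  have hπ : ContMDiff (𝓡 7) (𝓡 5) ∞ π := hB.1.1.1
  have hπ' : ContMDiff (𝓡 7) (𝓡 5) ∞ π' := hB.2.1.1
  obtain ⟨F, hF, hinj, hpF, hmem, hst⟩ := exists_foliatedBox h.split.isOpen hp hlam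
    fun y hy => (h.split.frame.2 y hy).ne_zero (Sum.inl 2)
  have hbox : FoliatedFrame (Sum.elim ![pullback π θ, pullback π' θ', dfun lam] α) W F :=
    ⟨h.split.frame, hF, hmem, hst⟩
  have hd : ∀ j, pairSort (Fin 2) j = none → ∀ x ∈ W,
      IsCharForm (fun i => Sum.elim ![pullback π θ, pullback π' θ', dfun lam] α i x)
        (pairSort (Fin 3))
        (extd (Sum.elim ![pullback π θ, pullback π' θ', dfun lam] α (sliceIndex j)) x) := by
    rintro (a | i) hj x hx
    · fin_cases a
      · exact h.isCharForm_left hx hπ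
      · exact h.isCharForm_right hx hπ'
    · fin_cases i <;> simp [pairSort] at hj
  have hleft := hbox.isIntegrableExtension_slice (𝓘₀ := 𝓘₀) hd hπ (j := 1) h.generates_left
    fun x hx v hv h1 h2 => h.split.trans_left x hx v (fun a => by
      fin_cases a
      · exact (congrArg (fun u => θ (π x) fun _ => u) hv).trans
          (covec (V := TangentSpace (𝓡 5) (π x)) (θ (π x))).map_zero
      · exact h1
      · exact h2) hv
  have hright := hbox.isIntegrableExtension_slice (𝓘₀ := 𝓘₁) hd hπ' (j := 0) h.generates_right
    fun x hx v hv h1 h2 => h.split.trans_right x hx v (fun a => by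
      fin_cases a
      · exact h1
      · exact (congrArg (fun u => θ' (π' x) fun _ => u) hv).trans
          (covec (V := TangentSpace (𝓡 5) (π' x)) (θ' (π' x))).map_zero
      · exact h2) hv
  have hgen := fun μ => hbox.generates_sliceEDS hd μ
  have hframe := fun μ => hbox.isFrameOn_sliceFrame μ
  refine ⟨Set.range F, hF.isOpen_range, hpF, EuclideanSpace ℝ (Fin 6), inferInstance, inferInstance,
    inferInstance, inferInstance, inferInstance, hbox.sliceEDS hd, F,
    ⟨fun μ => ⟨hleft μ, hright μ⟩, hbox.isSubmersion_comp hB.1.1, hbox.isSubmersion_comp hB.2.1,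
      fun x => ⟨Set.univ, isOpen_univ, trivial, fun μ => sliceFrame _ F μ (Sum.inl 1),
        fun μ => sliceFrame _ F μ (Sum.inl 0), ?_, ?_, fun μ x _ =>
          ⟨((hframe μ).2 x trivial).ne_zero (Sum.inl 1),
            ((hframe μ).2 x trivial).ne_zero (Sum.inl 0)⟩, fun μ => ⟨?_, ?_⟩⟩⟩,
    hF, hinj, rfl, hbox.sameIdeal_familyIdeal h.split.gen hd⟩
  · rw [Set.univ_prod_univ]
    exact hbox.smoothOn_familyForm (Sum.inl 1)
  · rw [Set.univ_prod_univ]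
    exact hbox.smoothOn_familyForm (Sum.inl 0)
  · exact (hgen μ).sameIdeal (hbox.generates_slice_comp hπ (j := 1) h.generates_left μ) isOpen_univ
      FoliatedFrame.card_two_four (hframe μ)
  · exact (hgen μ).sameIdeal (hbox.generates_slice_comp hπ' (j := 0) h.generates_right μ) isOpen_univ
      FoliatedFrame.card_two_four (hframe μ)

theorem IsZeroAdapted.span_eq_degOne {W' : Set N} {w0 w0' : DForm (𝓡 7) N 1}
    {w : Fin 4 → DForm (𝓡 7) N 1}
    (hz : IsZeroAdapted 𝓘₀ 𝓘₁ 𝓑 π π' χ₁₀ χ₀₁ W' w0 w0' γ w) {δ₀ : DForm (𝓡 7) N 1}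
    (h : ContactFrame 𝓘₀ 𝓘₁ 𝓑 π π' χ₁₀ χ₀₁ W θ θ' δ₀ α) {x : N} (hxW : x ∈ W) (hx : x ∈ W')
    {δ : DForm (𝓡 7) N 1} {r : ℝ} (hr : r ≠ 0) (hδ : γ x = r • δ x) :
    Submodule.span ℝ (Set.range fun a =>
      (![pullback π θ, pullback π' θ', δ] : Fin 3 → DForm (𝓡 7) N 1) a x) =
        degOne 𝓑.carrier x := by
  obtain ⟨h1, h2, h3, -, -⟩ := hz.2.1 x hx
  rw [h.degOne_left hxW] at h1
  rw [h.degOne_right hxW] at h2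
  have h4 : (Set.range fun a => (![pullback π θ, pullback π' θ', δ] :
      Fin 3 → DForm (𝓡 7) N 1) a x) = {pullback π θ x, pullback π' θ' x, δ x} := by
    have h5 : (fun a => (![pullback π θ, pullback π' θ', δ] : Fin 3 → DForm (𝓡 7) N 1) a x) =
        ![pullback π θ x, pullback π' θ' x, δ x] := by
      ext1 a; fin_cases a <;> rfl
    rw [h5, Matrix.range_cons, Matrix.range_cons, Matrix.range_cons, Matrix.range_empty,
      Set.union_empty, Set.singleton_union, Set.singleton_union]
  have h5 : Submodule.span ℝ {δ x} = Submodule.span ℝ {γ x} := by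
    rw [hδ, Submodule.span_singleton_smul_eq hr.isUnit]
  rw [h4, ← h3, Submodule.span_insert, Submodule.span_insert, Submodule.span_insert _ {w0' x, γ x},
    Submodule.span_insert (w0' x), h1, h2, h5]

theorem exists_arisesFromFamilyOn (hA : IsTypeA 𝓘₀ 𝓘₁ 𝓑 π π')
    (hχ : IsCharacteristicPair 𝓑 χ₁₀ χ₀₁) (p : N)
    (hint : ∀ (W : Set N) (w0 w0' γ : DForm (𝓡 7) N 1) (w : Fin 4 → DForm (𝓡 7) N 1),
        IsOpen W → p ∈ W → IsZeroAdapted 𝓘₀ 𝓘₁ 𝓑 π π' χ₁₀ χ₀₁ W w0 w0' γ w →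
          IntegrableNear γ p) :
    ∃ U : Set N, IsOpen U ∧ p ∈ U ∧ ArisesFromFamilyOn 𝓘₀ 𝓘₁ 𝓑 π π' U := by
  obtain ⟨W, θ, θ', δ₀, α, hp, hδ₀, h⟩ := exists_contactFrame hA hχ p
  obtain ⟨W', hWW', hW', hp', w0, w0', γ, w, hz⟩ := h.exists_isZeroAdapted hA hδ₀ hp
  obtain ⟨V, hV, hpV, f, lam, -, hlam, hγ⟩ := hint W' w0 w0' γ w hW' hp' hz
  have hlam' : ∀ y ∈ W' ∩ V, ContMDiffAt (𝓡 7) 𝓘(ℝ, ℝ) ∞ lam y := fun y hy =>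
    hlam.contMDiffAt (hV.mem_nhds hy.2)
  exact ((h.mono (hW'.inter hV) fun y hy => hWW' hy.1).replace_third (δ := dfun lam)
    (fun y hy => smoothAt_dfun (hlam' y hy)) fun x hx =>
      hz.span_eq_degOne h (hWW' hx.1) hx.1 (hγ x hx.2).1 (hγ x hx.2).2).exists_arisesFromFamilyOn
    hA.backlund hlam' ⟨hp', hpV⟩

end Construction

end BacklundEDS

end

open BacklundEDS in
theorem lemma4p4
    {M : Type*} [TopologicalSpace M] [T2Space M] [SecondCountableTopology M]
    [ChartedSpace (EuclideanSpace ℝ (Fin 5)) M] [IsManifold (𝓡 5) ∞ M]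
    {M' : Type*} [TopologicalSpace M'] [T2Space M'] [SecondCountableTopology M']
    [ChartedSpace (EuclideanSpace ℝ (Fin 5)) M'] [IsManifold (𝓡 5) ∞ M']
    {N : Type*} [TopologicalSpace N] [T2Space N] [SecondCountableTopology N]
    [ChartedSpace (EuclideanSpace ℝ (Fin 7)) N] [IsManifold (𝓡 7) ∞ N]
    (𝓘₀ : EDS (𝓡 5) M) (𝓘₁ : EDS (𝓡 5) M') (𝓑 : EDS (𝓡 7) N)
    (π : N → M) (π' : N → M') (hA : IsTypeA 𝓘₀ 𝓘₁ 𝓑 π π')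
    (χ₁₀ χ₀₁ : (x : N) → Submodule ℝ (TangentSpace (𝓡 7) x [⋀^Fin 1]→L[ℝ] ℝ))
    (hχ : IsCharacteristicPair 𝓑 χ₁₀ χ₀₁) (p : N) :
    (∃ U : Set N, IsOpen U ∧ p ∈ U ∧ ArisesFromFamilyOn 𝓘₀ 𝓘₁ 𝓑 π π' U) ↔
      ∀ (W : Set N) (w0 w0' γ : DForm (𝓡 7) N 1) (w : Fin 4 → DForm (𝓡 7) N 1),
        IsOpen W → p ∈ W → IsZeroAdapted 𝓘₀ 𝓘₁ 𝓑 π π' χ₁₀ χ₀₁ W w0 w0' γ w →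
          IntegrableNear γ p := by
  constructor
  · rintro ⟨U, -, hpU, hU⟩ W w0 w0' γ w hW hp h
    obtain ⟨V, lam, hV, hpV, hlam, hd⟩ := hU.exists_dfun_mem hA.backlund hχ hpU
    exact h.integrableNear hW hp hV hpV hlam hd
  · exact exists_arisesFromFamilyOn hA hχ p
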